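/- Let $\mathbf{k}$ be a field of characteristic zero. Conventions: for an element $a$ of a morphism space the reduced degree is $|a|-1$, and an operation of (reduced) degree $d$ gets the Koszul sign $(-1)^{d\cdot n}$ when $n$ is the sum of the degrees of all inputs on its right (reduced degrees for morphisms, unreduced degree for bimodule elements). "$\sum$" always means the sum over all ways to insert, with these signs. Let $\mathcal A,\mathcal B$ be $\mathbb{Z}$-graded $A_\infty$-categories over $\mathbf{k}$, with operations $\mu^d$ ($d\ge 1$) of degree $2-d$, and let $P$ be an $\mathcal A$-$\mathcal B$ bimodule: graded vector spaces $P(Y,X)$ with operations $\mu_P^{r|1|s}:\mathcal A(X_0,\dots,X_r)\otimes P(Y_0,X_0)\otimes \mathcal B(Y_s,\dots,Y_0)\to P(Y_s,X_r)$ of degree $1-r-s$ satisfying the $A_\infty$-bimodule equations. Let $b_{\mathcal A}\in CC^1(\mathcal A,\mathcal A)$, $b_{\mathcal B}\in CC^1(\mathcal B,\mathcal B)$ be nc-vector fields (Hochschild cocycles), pure with respect to chosen elements $c_X\in \hom^0_{\mathcal A}(X,X)$, $c_Y\in\hom^0_{\mathcal B}(Y,Y)$; that is, $\mu^1(c_X)=-b^0_{\mathcal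 A,X}$ and the chain map $a\mapsto b_{\mathcal A}^1(a)-c_{X'}\circ a+a\circ c_X$ on $\hom_{\mathcal A}(X,X')$ acts on cohomology in degree $i$ as multiplication by $i$, where $a_2\circ a_1=(-1)^{|a_1|}\mu^2(a_2,a_1)$, and likewise for $\mathcal B$. Let $c_P$ be an equivariant structure on $P$: a pre-endomorphism of degree $0$ with $\partial c_P=\nu_{\mathcal A}(b_{\mathcal A})-\nu_{\mathcal B}(b_{\mathcal B})$, where $\partial f=\sum f\circ\mu_{\mathcal A}+\sum f\circ\mu_P+\sum f\circ \mu_{\mathcal B}-(-1)^{|f|}\sum\mu_P\circ f$ and $\nu_{\mathcal A}(b)=\sum\mu_P(\dots,b(\dots),\dots,\underline m,\dots)$, $\nu_{\mathcal B}(b)=-\sum\mu_P(\dots,\underline m,\dots,b(\dots),\dots)$. Suppose that $c_P$ is pure: the chain map $m\mapsto c_P^{0|1|0}(m)-c_X\circ m+m\circ c_Y$ on $P(Y,X)$, with $x\circ m=(-1)^{|m|+1}\mu_P^{1|1|0}(x,m)$ and $m\circ y=\mu_P^{0|1|1}(m,y)$, acts on $H^i(P(Y,X))$ as multiplication by $i$.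 Then $P$ is formal, compatibly with $c_P$. Let $H(\mathcal A)$, $H(\mathcal B)$, $H(P)$ be the cohomology categories and the cohomology bimodule, with only the products and the module actions induced by $\mu^2$, $\mu_P^{1|1|0}$, $\mu_P^{0|1|1}$ as operations, and let $e$ denote their Euler fields, which multiply degree $i$ by $i$. There are: 1. $A_\infty$-equivalences $F: H(\mathcal A)\to\mathcal A$ and $G: H(\mathcal B)\to\mathcal B$, which are the identity on objects and whose linear parts send each class to a cocycle representing it; 2. pre-natural transformations $T:F\to F$ and $S:G\to G$ of degree $0$ with $T^0=c_X$, $S^0=c_Y$ and $dT=F\circ e-b_{\mathcal A}\circ F$, $dS=G\circ e-b_{\mathcal B}\circ G$ (so that $b_{\mathcal A}$, $b_{\mathcal B}$ correspond to the Euler fields); 3. morphisms (closed pre-morphisms of degree $0$) of $H(\mathcal A)$-$H(\mathcal B)$ bimodules $\psi:H(P)\to F^*PG^*$ and $\phi:F^*PG^*\to H(P)$, where $F^*PG^*$ is the two-sided pullback of $P$ along $F$ and $G$, such that $\psi^{0|1|0}$ sends each class to a cocycle representing it, $\phi\circ\psi=\mathrm{id}$, and $\psi\circ\phi-\mathrm{id}=\partial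 h$ for a pre-endomorphism $h$ of degree $-1$; under which $c_P$ corresponds to the Euler field in the following sense. Let $$c'=\sum c_P(F,\dots,F,\underline m,G,\dots,G)+\sum\mu_P(F,\dots,T,\dots,F,\underline m,G,\dots,G)+\sum\mu_P(F,\dots,F,\underline m,G,\dots,S,\dots,G)$$ be the pre-endomorphism of $F^*PG^*$ induced by $c_P$, $T$ and $S$ (an equivariant structure for the Euler fields of $H(\mathcal A)$ and $H(\mathcal B)$), and let it act on $H(\mathcal A)(X_0,\dots,X_r)\otimes P\otimes H(\mathcal B)(Y_s,\dots,Y_0)$ together with the Euler fields on the outer factors. Then $$\phi\circ c'\circ\psi+\sum \phi(\dots,e(x_i),\dots,\underline{\psi(\dots)},\dots)+\sum\phi(\dots,\underline{\psi(\dots)},\dots,e(y_j),\dots)=\mathrm{Euler}_{H(P)},$$ the pre-endomorphism of $H(P)$ whose only nonzero term is $m\mapsto \deg(m)\,m$. -/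

import Mathlib

universe u u' v w₁ w₂ w₃

/-! ### Graded vector spaces -/

/-- A `ℤ`-graded vector space over `k`. -/
structure GrVect (k : Type u) [Field k] where
  carrier : Type v
  [addCommGroup : AddCommGroup carrier]
  [module : Module k carrier]
  /-- the homogeneous pieces -/
  gr : ℤ → Submodule k carrier
  internal : DirectSum.IsInternal gr

namespace GrVect

attribute [instance] GrVect.addCommGroup GrVect.module

instance {k : Type u} [Field k] : CoeSort (GrVect.{u, v} k) (Type v) := ⟨GrVect.carrier⟩

variable {k : Type u} [Field k]

/-- The linear operator which multiplies the piece of degree `n` by `χ n`. -/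
noncomputable def scale (V : GrVect.{u, v} k) (χ : ℤ → k) : V →ₗ[k] V :=
  DirectSum.coeLinearMap V.gr ∘ₗ DirectSum.lmap (fun n => χ n • LinearMap.id) ∘ₗ
    (LinearEquiv.ofBijective (DirectSum.coeLinearMap V.gr) V.internal).symm.toLinearMap

/-- The Euler operator: multiplication by `n` in degree `n`. -/
noncomputable def euler (V : GrVect.{u, v} k) : V →ₗ[k] V := V.scale fun n => (n : k)

/-- The Koszul sign `a ↦ (-1)^(d * |a|) a` for moving an operation of degree `d` past an
element with its unreduced degree. -/
noncomputable def sgn (V : GrVect.{u, v} k) (d : ℤ) : V →ₗ[k] V :=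
  V.scale fun n => (-1 : k) ^ (d * n)

/-- The Koszul sign `a ↦ (-1)^(d * (|a| - 1)) a` for moving an operation of degree `d` past an
element with its reduced degree. -/
noncomputable def rsgn (V : GrVect.{u, v} k) (d : ℤ) : V →ₗ[k] V :=
  V.scale fun n => (-1 : k) ^ (d * (n - 1))

theorem scale_of_mem (V : GrVect.{u, v} k) (χ : ℤ → k) {n : ℤ} {a : V} (ha : a ∈ V.gr n) :
    V.scale χ a = χ n • a := by
  have h : (LinearEquiv.ofBijective (DirectSum.coeLinearMap V.gr) V.internal).symm a
      = DirectSum.lof k ℤ (fun i => V.gr i) n ⟨a, ha⟩ := by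
    rw [LinearEquiv.symm_apply_eq]
    exact (DirectSum.coeLinearMap_lof V.gr n ⟨a, ha⟩).symm
  simp only [scale, LinearMap.comp_apply, LinearEquiv.coe_coe]
  rw [h, DirectSum.lmap_lof]
  simp

theorem hom_ext {V : GrVect.{u, v} k} {W : Type*} [AddCommGroup W] [Module k W]
    {f g : V →ₗ[k] W} (h : ∀ n, ∀ a ∈ V.gr n, f a = g a) : f = g := by
  ext a
  have ha : a ∈ iSup V.gr := by
    rw [V.internal.submodule_iSup_eq_top]
    trivial
  induction ha using Submodule.iSup_induction' with
  | mem n x hx => exact h n x hx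
  | zero => simp
  | add x y _ _ hx hy => simp [hx, hy]

theorem scale_mem (V : GrVect.{u, v} k) (χ : ℤ → k) {n : ℤ} {a : V} (ha : a ∈ V.gr n) :
    V.scale χ a ∈ V.gr n := by
  rw [scale_of_mem V χ ha]
  exact Submodule.smul_mem _ _ ha

theorem sgn_sgn (V : GrVect.{u, v} k) (d : ℤ) (a : V) : V.sgn d (V.sgn d a) = a := by
  have : V.sgn d ∘ₗ V.sgn d = LinearMap.id := hom_ext fun n a ha => by
    simp only [LinearMap.comp_apply, sgn, LinearMap.id_apply]
    rw [scale_of_mem V _ ha, map_smul, scale_of_mem V _ ha, smul_smul, ← mul_zpow]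
    simp
  exact congrArg (fun f => f a) this

theorem rsgn_rsgn (V : GrVect.{u, v} k) (d : ℤ) (a : V) : V.rsgn d (V.rsgn d a) = a := by
  have : V.rsgn d ∘ₗ V.rsgn d = LinearMap.id := hom_ext fun n a ha => by
    simp only [LinearMap.comp_apply, rsgn, LinearMap.id_apply]
    rw [scale_of_mem V _ ha, map_smul, scale_of_mem V _ ha, smul_smul, ← mul_zpow]
    simp
  exact congrArg (fun f => f a) this

/-! ### Cohomology -/

/-- A linear map of degree one. -/
def DegreeOne (V : GrVect.{u, v} k) (d : V →ₗ[k] V) : Prop :=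
  ∀ n, ∀ a ∈ V.gr n, d a ∈ V.gr (n + 1)

theorem sgn_comm {V : GrVect.{u, v} k} {d : V →ₗ[k] V} (hd : V.DegreeOne d) (a : V) :
    V.sgn 1 (d a) = - d (V.sgn 1 a) := by
  have : V.sgn 1 ∘ₗ d = - (d ∘ₗ V.sgn 1) := hom_ext fun n a ha => by
    simp only [LinearMap.comp_apply, LinearMap.neg_apply, sgn]
    rw [scale_of_mem V _ ha, scale_of_mem V _ (hd n a ha), map_smul, ← neg_smul, one_mul, one_mul,
      zpow_add₀ (by simp)]
    simp
  exact congrArg (fun f => f a) this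

theorem rsgn_comm {V : GrVect.{u, v} k} {d : V →ₗ[k] V} (hd : V.DegreeOne d) (a : V) :
    V.rsgn 1 (d a) = - d (V.rsgn 1 a) := by
  have : V.rsgn 1 ∘ₗ d = - (d ∘ₗ V.rsgn 1) := hom_ext fun n a ha => by
    simp only [LinearMap.comp_apply, LinearMap.neg_apply, rsgn]
    rw [scale_of_mem V _ ha, scale_of_mem V _ (hd n a ha), map_smul, ← neg_smul, one_mul, one_mul,
      show n + 1 - 1 = (n - 1) + 1 by ring, zpow_add₀ (by simp)]
    simp
  exact congrArg (fun f => f a) this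

/-- The cohomology `ker d / im d` as a vector space. -/
abbrev Coh (V : GrVect.{u, v} k) (d : V →ₗ[k] V) : Type v :=
  LinearMap.ker d ⧸ (LinearMap.range d).comap (LinearMap.ker d).subtype

/-- The classes of cocycles of degree `n`. -/
def cohGr (V : GrVect.{u, v} k) (d : V →ₗ[k] V) (n : ℤ) : Submodule k (Coh V d) :=
  ((V.gr n).comap (LinearMap.ker d).subtype).map (Submodule.mkQ _)

/-- The projection to the piece of degree `n`. -/
noncomputable def proj (V : GrVect.{u, v} k) (n : ℤ) : V →ₗ[k] V := V.scale (Pi.single n 1)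

theorem proj_same (V : GrVect.{u, v} k) {n : ℤ} {a : V} (ha : a ∈ V.gr n) :
    V.proj n a = a := by
  simp [proj, scale_of_mem V _ ha]

theorem proj_ne (V : GrVect.{u, v} k) {n m : ℤ} (h : m ≠ n) {a : V} (ha : a ∈ V.gr m) :
    V.proj n a = 0 := by
  simp [proj, scale_of_mem V _ ha, h]

theorem d_proj {V : GrVect.{u, v} k} {d : V →ₗ[k] V} (hd : V.DegreeOne d) (n : ℤ) (a : V) :
    d (V.proj n a) = V.proj (n + 1) (d a) := by
  have : d ∘ₗ V.proj n = V.proj (n + 1) ∘ₗ d := hom_ext fun m a ha => by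
    simp only [LinearMap.comp_apply]
    by_cases h : m = n
    · subst h
      rw [proj_same V ha, proj_same V (hd m a ha)]
    · rw [proj_ne V h ha, proj_ne V (by omega) (hd m a ha), map_zero]
  exact congrArg (fun f => f a) this

theorem proj_mem (V : GrVect.{u, v} k) (n : ℤ) (a : V) : V.proj n a ∈ V.gr n := by
  have : (V.gr n).mkQ ∘ₗ V.proj n = 0 := hom_ext fun m a ha => by
    simp only [LinearMap.comp_apply, LinearMap.zero_apply]
    by_cases h : m = n
    · subst h
      rw [proj_same V ha]
      simpa using ha
    · rw [proj_ne V h ha, map_zero]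
  have := congrArg (fun f => f a) this
  simpa using this

theorem exists_finset_sum_proj (V : GrVect.{u, v} k) (a : V) :
    ∃ s : Finset ℤ, ∀ t : Finset ℤ, s ⊆ t → ∑ n ∈ t, V.proj n a = a := by
  have ha : a ∈ iSup V.gr := by
    rw [V.internal.submodule_iSup_eq_top]
    trivial
  induction ha using Submodule.iSup_induction' with
  | mem n x hx =>
    refine ⟨{n}, fun t ht => ?_⟩
    rw [Finset.sum_eq_single_of_mem n (ht (by simp)), proj_same V hx]
    intro m _ hm
    exact proj_ne V hm.symm hx
  | zero => exact ⟨∅, fun t _ => by simp⟩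
  | add x y _ _ hx hy =>
    obtain ⟨s, hs⟩ := hx
    obtain ⟨t, ht⟩ := hy
    refine ⟨s ∪ t, fun r hr => ?_⟩
    simp only [map_add, Finset.sum_add_distrib]
    rw [hs r (Finset.union_subset_left hr), ht r (Finset.union_subset_right hr)]

/-- The projection induced on cohomology. -/
noncomputable def cohProj {V : GrVect.{u, v} k} {d : V →ₗ[k] V} (hd : V.DegreeOne d) (n : ℤ) :
    Coh V d →ₗ[k] Coh V d :=
  Submodule.mapQ _ _ ((V.proj n).restrict (p := LinearMap.ker d) (q := LinearMap.ker d)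
    (fun a ha => by
      rw [LinearMap.mem_ker] at ha ⊢
      rw [d_proj hd, ha, map_zero])) (by
    rintro ⟨a, ha⟩ ⟨b, hb⟩
    refine ⟨V.proj (n - 1) b, ?_⟩
    rw [d_proj hd, hb]
    simp)

theorem cohGr_internal {V : GrVect.{u, v} k} {d : V →ₗ[k] V} (hd : V.DegreeOne d) :
    DirectSum.IsInternal (cohGr V d) := by
  have same : ∀ n, ∀ x ∈ cohGr V d n, cohProj hd n x = x := by
    rintro n _ ⟨⟨a, ha⟩, han, rfl⟩
    simp only [cohProj, Submodule.mkQ_apply, Submodule.mapQ_apply]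
    congr 1
    exact Subtype.ext (proj_same V han)
  have diff : ∀ n m, m ≠ n → ∀ x ∈ cohGr V d m, cohProj hd n x = 0 := by
    rintro n m h _ ⟨⟨a, ha⟩, han, rfl⟩
    simp only [cohProj, Submodule.mkQ_apply, Submodule.mapQ_apply]
    rw [← Submodule.Quotient.mk_zero]
    congr 1
    exact Subtype.ext (proj_ne V h han)
  have key : ∀ n (y : DirectSum ℤ fun i => cohGr V d i),
      cohProj hd n (DirectSum.coeLinearMap (cohGr V d) y) = y n := by
    intro n y
    induction y using DirectSum.induction_on with
    | zero => simp
    | of m x =>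
      rw [DirectSum.coeLinearMap_of]
      by_cases h : m = n
      · subst h
        rw [same m x x.2, DirectSum.of_eq_same]
      · rw [diff n m h x x.2, DirectSum.of_eq_of_ne _ _ _ (Ne.symm h)]
        rfl
    | add x y hx hy => simp [hx, hy]
  refine ⟨fun y z h => ?_, ?_⟩
  · refine DFinsupp.ext fun n => Subtype.ext ?_
    have h' : DirectSum.coeLinearMap (cohGr V d) y = DirectSum.coeLinearMap (cohGr V d) z := h
    rw [← key n y, ← key n z, h']
  · intro x
    suffices x ∈ LinearMap.range (DirectSum.coeLinearMap (cohGr V d)) from this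
    rw [DirectSum.range_coeLinearMap]
    obtain ⟨⟨a, ha⟩, rfl⟩ := Submodule.mkQ_surjective _ x
    obtain ⟨s, hs⟩ := exists_finset_sum_proj V a
    have hc : ∀ n, V.proj n a ∈ LinearMap.ker d := fun n => by
      rw [LinearMap.mem_ker] at ha ⊢
      rw [d_proj hd, ha, map_zero]
    have : (⟨a, ha⟩ : LinearMap.ker d) = ∑ n ∈ s, ⟨V.proj n a, hc n⟩ := by
      apply Subtype.ext
      rw [AddSubmonoidClass.coe_finsetSum]
      exact (hs s le_rfl).symm
    rw [this, map_sum]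
    exact Submodule.sum_mem _ fun n _ => Submodule.mem_iSup_of_mem n
      (Submodule.mem_map_of_mem (proj_mem V n a))

/-- The cohomology of a differential of degree one, as a graded vector space. -/
def cohomology (V : GrVect.{u, v} k) (d : V →ₗ[k] V) (hd : V.DegreeOne d) : GrVect.{u, v} k where
  carrier := Coh V d
  gr := cohGr V d
  internal := cohGr_internal hd

/-- `a` is a cocycle whose cohomology class is `x`. -/
def Represents {V : GrVect.{u, v} k} {d : V →ₗ[k] V} (a : V) (x : Coh V d) : Prop :=
  ∃ h : d a = 0, Submodule.Quotient.mk ⟨a, LinearMap.mem_ker.2 h⟩ = x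

/-- The product induced on cohomology, `([a], [b]) ↦ [f (a, b)]`, by a bilinear map `f` with
`d (f (a, b)) + f (a, d b) + f (d a, σ b) = 0`, where `σ` is a sign operator. -/
def cohProduct {U : GrVect.{u, w₁} k} {V : GrVect.{u, w₂} k} {W : GrVect.{u, w₃} k}
    {dU : U →ₗ[k] U} {dV : V →ₗ[k] V} {dW : W →ₗ[k] W}
    (f : U → V → W) (σ : V →ₗ[k] V)
    (linl : ∀ b, IsLinearMap k fun a => f a b) (linr : ∀ a, IsLinearMap k (f a))
    (hσ : ∀ b, σ (σ b) = b) (hσd : ∀ b, σ (dV b) = - dV (σ b))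
    (hf : ∀ a b, dW (f a b) + f a (dV b) + f (dU a) (σ b) = 0) :
    Coh U dU → Coh V dV → Coh W dW :=
  Quotient.map₂ (fun a b => ⟨f a.1 b.1, by
      have h := hf a.1 b.1
      rw [LinearMap.mem_ker.1 a.2, LinearMap.mem_ker.1 b.2, (linl _).map_zero,
        (linr _).map_zero] at h
      simpa using h⟩) (by
    rintro ⟨a, ha⟩ ⟨a', ha'⟩ haa ⟨b, hb⟩ ⟨b', hb'⟩ hbb
    obtain ⟨x, hx⟩ := (Submodule.quotientRel_def _).1 haa
    obtain ⟨y, hy⟩ := (Submodule.quotientRel_def _).1 hbb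
    rw [LinearMap.mem_ker] at ha ha' hb hb'
    refine (Submodule.quotientRel_def _).2 ⟨- f x (σ b) - f a' y, ?_⟩
    have e1 := hf x (σ b)
    have e2 := hf a' y
    have hσb : dV (σ b) = 0 := by
      have := hσd b
      rw [hb, map_zero] at this
      exact neg_eq_zero.1 this.symm
    change dU x = a - a' at hx
    change dV y = b - b' at hy
    rw [hσb, (linr x).map_zero, hσ, hx, (linl b).map_sub] at e1
    rw [ha', (linl _).map_zero, hy, (linr a').map_sub] at e2
    change dW (- f x (σ b) - f a' y) = f a b - f a' b'
    rw [map_sub, map_neg]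
    have e1' : dW (f x (σ b)) = -(f a b - f a' b) := by
      rw [add_zero] at e1
      exact eq_neg_of_add_eq_zero_left e1
    have e2' : dW (f a' y) = -(f a' b - f a' b') := by
      rw [add_zero] at e2
      exact eq_neg_of_add_eq_zero_left e2
    rw [e1', e2']
    abel)

end GrVect

/-! ### Composable words -/

/-- Composable words `(a_d, …, a_1)` with `a_i ∈ H X_{i-1} X_i`, from `X = X_0` to `Z = X_d`.
The leftmost letter `a_d` is the one added by `cons`. For `d = 0` the word is empty. -/
inductive Word {Ob : Type u} (H : Ob → Ob → Type v) (X : Ob) : Ob → Type (max u v)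
  | nil : Word H X X
  | cons {Y Z : Ob} (a : H Y Z) (w : Word H X Y) : Word H X Z

namespace Word

variable {Ob : Type u} {H : Ob → Ob → Type v} {H' : Ob → Ob → Type u'}

/-- The word with one letter. -/
def single {X Y : Ob} (a : H X Y) : Word H X Y := cons a nil

/-- Concatenation: `(a_d, …, a_{i+1})` and `(a_i, …, a_1)` give `(a_d, …, a_1)`. -/
def append {X Y : Ob} : {Z : Ob} → Word H Y Z → Word H X Y → Word H X Z
  | _, nil, q => q
  | _, cons a p, q => cons a (append p q)

/-- Applying a map to every letter. -/
def map (f : ∀ X Y, H X Y → H' X Y) {X : Ob} : {Y : Ob} → Word H X Y → Word H' X Y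
  | _, nil => nil
  | _, cons a w => cons (f _ _ a) (map f w)

/-- All ways to write `w` as a concatenation of two, possibly empty, words `p`, `q`. -/
def splits {X : Ob} : {Z : Ob} → (w : Word H X Z) → List (Σ Y : Ob, Word H Y Z × Word H X Y)
  | _, nil => [⟨X, nil, nil⟩]
  | Z, cons a w => ⟨Z, nil, cons a w⟩ :: (splits w).map fun t => ⟨t.1, cons a t.2.1, t.2.2⟩

/-- Given a word of words, the letter `a` is put to the left, either as a new block or, if there
is one, into the leftmost block. -/
def consBlock {X : Ob} : {Y Z : Ob} → H Y Z → Word (Word H) X Y → List (Word (Word H) X Z)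
  | _, _, a, nil => [cons (single a) nil]
  | _, _, a, cons s π => [cons (single a) (cons s π), cons (cons a s) π]

/-- All ways to cut a word into consecutive nonempty blocks, as words of words. -/
def parts {X : Ob} : {Z : Ob} → Word H X Z → List (Word (Word H) X Z)
  | _, nil => [nil]
  | _, cons a w => (parts w).flatMap (consBlock a)

end Word

/-- The spaces of morphisms of a graded category: a graded vector space for every two objects. -/
abbrev Quiv (k : Type u) [Field k] (Ob : Type u') := Ob → Ob → GrVect.{u, v} k

/-- Composable words of morphisms. -/
abbrev Quiv.Wd {k : Type u} [Field k] {Ob : Type u'} (H : Quiv.{u, u', v} k Ob) (X Y : Ob) :=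
  Word (fun X Y => (H X Y).carrier) X Y

/-- A family of maps `H(X_0, …, X_d) → H'(X_0, X_d)`, `d ≥ 0`. -/
abbrev Op {k : Type u} [Field k] {Ob : Type u'} (H H' : Quiv.{u, u', v} k Ob) :=
  ∀ X Y : Ob, H.Wd X Y → H' X Y

section Op

variable {k : Type u} [Field k] {Ob : Type u'} {H H' : Quiv.{u, u', v} k Ob}

/-- `w` consists of homogeneous elements, and the sum of their reduced degrees `|a| - 1`
is `n`. -/
def Quiv.HasRDeg (H : Quiv.{u, u', v} k Ob) {X : Ob} : {Y : Ob} → H.Wd X Y → ℤ → Prop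
  | _, .nil, n => n = 0
  | _, .cons a w, n => ∃ i j, a ∈ (H _ _).gr i ∧ H.HasRDeg w j ∧ n = (i - 1) + j

/-- Koszul signs for an operation of degree `d` that moves past a word of reduced degrees. -/
noncomputable def Quiv.kos (H : Quiv.{u, u', v} k Ob) (d : ℤ) {X Y : Ob} (w : H.Wd X Y) :
    H.Wd X Y :=
  w.map fun X Y => (H X Y).rsgn d

namespace Op

/-- Linearity over `k` in each letter. -/
def IsMultilinear (f : Op H H') : Prop :=
  ∀ (X Y Z W : Ob) (p : H.Wd Z W) (q : H.Wd X Y),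
    IsLinearMap k fun a : H Y Z => f X W (p.append (.cons a q))

/-- `f` is of degree `d` as a map `H[1]^{⊗ s} → H'`: the output has degree
`d + ∑ (|a_i| - 1)`. -/
def HasDegree (d : ℤ) (f : Op H H') : Prop :=
  ∀ (X Y : Ob) (w : H.Wd X Y) (n : ℤ), H.HasRDeg w n → f X Y w ∈ (H' X Y).gr (n + d)

/-- The words `(F(…), …, F(…))` for all ways to cut `w` into nonempty blocks. -/
def bar (F : Op H H') {X Y : Ob} (w : H.Wd X Y) : List (H'.Wd X Y) :=
  w.parts.map (Word.map F)

/-- The words `± (a_d, …, g(a_{i+j}, …, a_{i+1}), a_i, …, a_1)`, where `g` has reduced degree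
`d` and the Koszul sign is `(-1)^(d ∑_{l ≤ i} (|a_l| - 1))`. -/
noncomputable def inserts (d : ℤ) (g : Op H H) {X Y : Ob} (w : H.Wd X Y) : List (H.Wd X Y) :=
  w.splits.flatMap fun t => t.2.2.splits.map fun r =>
    t.2.1.append (.cons (g _ _ r.2.1) (H.kos d r.2.2))

/-- The words `± (F(…), …, F(…), T(…), F(…), …, F(…))`, where `T` has reduced degree `d` and
has the Koszul sign for moving past everything on its right. -/
noncomputable def insertsAlong (d : ℤ) (F T : Op H H') {X Y : Ob} (w : H.Wd X Y) :
    List (H'.Wd X Y) :=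
  w.splits.flatMap fun t => t.2.2.splits.flatMap fun r =>
    (F.bar t.2.1).flatMap fun p => (F.bar r.2.2).map fun q =>
      p.append (.cons (T _ _ r.2.1) (H'.kos d q))

/-- The sum of `± f(a_d, …, g(a_{i+j}, …, a_{i+1}), a_i, …, a_1)`, where `g` has reduced
degree `d`. -/
noncomputable def ins (d : ℤ) (f : Op H H') (g : Op H H) : Op H H' := fun X Y w =>
  ((inserts d g w).map (f X Y)).sum

/-- The sum of `f(F(…), …, F(…))`. -/
def comp (f : Op H' H') (F : Op H H') : Op H H' := fun X Y w => ((F.bar w).map (f X Y)).sum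

end Op

/-- The Euler vector field, as a Hochschild cochain: `a ↦ |a| a`, with no other terms. -/
noncomputable def Quiv.eulerField (H : Quiv.{u, u', v} k Ob) : Op H H := fun _ _ w =>
  match w with
  | .cons a .nil => (H _ _).euler a
  | _ => 0

end Op

/-! ### `A∞`-categories -/

/-- A `ℤ`-graded `A∞`-category over `k` with set of objects `Ob`. The operation
`μ^d(a_d, …, a_1)` is the value of `μ` on the word `(a_d, …, a_1)`. (Cohomological units play
no role in what follows and are not required.) -/
structure AInfCat (k : Type u) [Field k] (Ob : Type u') where
  hom : Quiv.{u, u', v} k Ob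
  μ : Op hom hom
  multilinear : μ.IsMultilinear
  /-- `μ^d` has degree `2 - d` -/
  degree : μ.HasDegree 2
  /-- there is no curvature `μ^0` -/
  nil : ∀ X, μ X X .nil = 0
  /-- `∑ (-1)^† μ(a_d, …, μ(a_{i+j}, …, a_{i+1}), a_i, …, a_1) = 0` with
  `† = ∑_{l ≤ i} (|a_l| - 1)` -/
  rel : ∀ X Y (w : hom.Wd X Y), Op.ins 1 μ μ X Y w = 0

namespace AInfCat

variable {k : Type u} [Field k] {Ob : Type u'} (A : AInfCat.{u, u', v} k Ob)

/-- The differential `μ^1`. -/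
def d (X Y : Ob) : A.hom X Y →ₗ[k] A.hom X Y :=
  IsLinearMap.mk' (fun a => A.μ X Y (.single a)) (A.multilinear X X Y Y .nil .nil)

/-- The operation `μ^2`. -/
def m {X Y Z : Ob} (a₂ : A.hom Y Z) (a₁ : A.hom X Y) : A.hom X Z :=
  A.μ X Z (.cons a₂ (.single a₁))

theorem d_degree (X Y : Ob) : (A.hom X Y).DegreeOne (A.d X Y) := by
  intro n a ha
  have := A.degree X Y (.single a) (n - 1) ⟨n, 0, ha, rfl, by ring⟩
  rwa [show n - 1 + 2 = n + 1 by ring] at this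

theorem μ_zero {X Y Z W : Ob} (p : A.hom.Wd Z W) (q : A.hom.Wd X Y) :
    A.μ X W (p.append (.cons (0 : A.hom Y Z) q)) = 0 :=
  (A.multilinear X Y Z W p q).map_zero

/-- The Leibniz rule. -/
theorem leibniz {X Y Z : Ob} (a₂ : A.hom Y Z) (a₁ : A.hom X Y) :
    A.d X Z (A.m a₂ a₁) + A.m a₂ (A.d X Y a₁)
      + A.m (A.d Y Z a₂) ((A.hom X Y).rsgn 1 a₁) = 0 := by
  have h := A.rel X Z (.cons a₂ (.single a₁))
  simp only [Op.ins, Op.inserts, Word.splits, Word.single, A.nil, Word.append, Quiv.kos, Word.map,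
    List.map_cons, List.map_nil, List.flatMap_cons, List.flatMap_nil, List.cons_append,
    List.nil_append, List.append_nil, List.sum_cons, List.sum_nil, add_zero] at h
  have z₁ := fun q => A.μ_zero (Y := Z) (Z := Z) (X := X) .nil q
  have z₂ := fun q => A.μ_zero (Y := Y) (Z := Y) (X := X) (.cons a₂ .nil) q
  have z₃ := A.μ_zero (Y := X) (Z := X) (X := X) (.cons a₂ (.cons a₁ .nil)) .nil
  simp only [Word.append] at z₁ z₂ z₃
  rw [z₁, z₂, z₃, zero_add, zero_add, add_zero] at h
  rw [← h]
  simp only [d, m, IsLinearMap.mk'_apply, Word.single]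
  abel

/-- The composition `a₂ ∘ a₁ = (-1)^|a₁| μ^2(a₂, a₁)`, which is associative and unital on
cohomology. -/
noncomputable def cmp {X Y Z : Ob} (a₂ : A.hom Y Z) (a₁ : A.hom X Y) : A.hom X Z :=
  A.m a₂ ((A.hom X Y).sgn 1 a₁)

/-- The morphism spaces `H(hom(X, Y), μ^1)` of the cohomology category `H(A)`. -/
def coh : Quiv.{u, u', v} k Ob := fun X Y => (A.hom X Y).cohomology (A.d X Y) (A.d_degree X Y)

/-- The product on cohomology, `([a₂], [a₁]) ↦ [μ^2(a₂, a₁)]`. -/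
noncomputable def cohM {X Y Z : Ob} : A.coh Y Z → A.coh X Y → A.coh X Z :=
  GrVect.cohProduct (A.m (X := X) (Y := Y) (Z := Z)) ((A.hom X Y).rsgn 1)
    (fun a₁ => A.multilinear X Y Z Z .nil (.single a₁))
    (fun a₂ => A.multilinear X X Y Z (.single a₂) .nil)
    (GrVect.rsgn_rsgn _ 1) (GrVect.rsgn_comm (A.d_degree X Y)) A.leibniz

/-- The operations of the `A∞`-category `H(A)`: the only nonzero one is the product. -/
noncomputable def cohμ : Op A.coh A.coh := fun _ _ w =>
  match w with
  | .cons a₂ (.cons a₁ .nil) => A.cohM a₂ a₁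
  | _ => 0

/-- The Hochschild differential of a cochain of degree `n` in `CC^n`. -/
noncomputable def hochschild (n : ℤ) (b : Op A.hom A.hom) : Op A.hom A.hom := fun X Y w =>
  Op.ins (n - 1) A.μ b X Y w + (-1 : k) ^ n • Op.ins 1 b A.μ X Y w

/-- An nc-vector field: a Hochschild cocycle of degree one. The term `b^0` is the value on the
empty words. -/
structure IsNCVectorField (b : Op A.hom A.hom) : Prop where
  multilinear : b.IsMultilinear
  degree : b.HasDegree 1
  cocycle : ∀ X Y w, A.hochschild 1 b X Y w = 0

/-- Purity of an nc-vector field `b`, with respect to equivariant structures `c X` on the objects.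
The sign in `μ^1 (c X) = - b^0` is the one for which `a ↦ b^1(a) - c ∘ a + a ∘ c` is a chain map;
this map has to induce the Euler field on cohomology. -/
structure IsPure (b : Op A.hom A.hom) (c : ∀ X, A.hom X X) : Prop where
  degree : ∀ X, c X ∈ (A.hom X X).gr 0
  bounding : ∀ X, A.d X X (c X) = - b X X .nil
  euler : ∀ X X' n, ∀ a ∈ (A.hom X X').gr n, A.d X X' a = 0 →
    b X X' (.single a) - A.cmp (c X') a + A.cmp a (c X) - (n : k) • a ∈ LinearMap.range (A.d X X')

end AInfCat

/-! ### `A∞`-functors that are the identity on objects -/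

section Functor

variable {k : Type u} [Field k] {Ob : Type u'} {H H' : Quiv.{u, u', v} k Ob}

/-- `F` is an `A∞`-functor, the identity on objects, from `(H, μ)` to `(H', μ')`. -/
structure IsAInfFunctor (μ : Op H H) (μ' : Op H' H') (F : Op H H') : Prop where
  multilinear : F.IsMultilinear
  /-- `F^d` has degree `1 - d` -/
  degree : F.HasDegree 1
  nil : ∀ X, F X X .nil = 0
  eqn : ∀ X Y w, μ'.comp F X Y w = Op.ins 1 F μ X Y w

/-- The differential of a pre-natural transformation of degree `n` from `F` to `F`. -/
noncomputable def natDiff (μ : Op H H) (μ' : Op H' H') (F : Op H H') (n : ℤ) (T : Op H H') :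
    Op H H' := fun X Y w =>
  ((Op.insertsAlong (n - 1) F T w).map (μ' X Y)).sum - (-1 : k) ^ (n - 1) • Op.ins 1 T μ X Y w

/-- An equivalence `H(A) → A`: an `A∞`-functor which is the identity on objects, and whose linear
part sends each class to a cocycle that represents it. So it induces the identity
functor of the cohomology category `H(A)`. -/
structure AInfCat.IsFormalityEquivalence (A : AInfCat.{u, u', v} k Ob)
    (F : Op A.coh A.hom) : Prop where
  functor : IsAInfFunctor A.cohμ A.μ F
  represents : ∀ X Y (x : A.coh X Y), GrVect.Represents (d := A.d X Y) (F X Y (.single x)) x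

/-- `T` is a homotopy which makes `F : H(A) → A` compatible with the Euler field of `H(A)` and the
nc-vector field `b` of `A`, and which is given by the chosen equivariant structures `c X` on the
objects. -/
structure AInfCat.IsEquivariantHomotopy (A : AInfCat.{u, u', v} k Ob) (b : Op A.hom A.hom)
    (c : ∀ X, A.hom X X) (F T : Op A.coh A.hom) : Prop where
  multilinear : T.IsMultilinear
  degree : T.HasDegree 0
  nil : ∀ X, T X X .nil = c X
  eqn : ∀ X Y w, natDiff A.cohμ A.μ F 0 T X Y w
    = Op.ins 0 F A.coh.eulerField X Y w - b.comp F X Y w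

end Functor

/-! ### Bimodules -/

universe u₁ u₂ v₁ v₂ v₃

/-- A family of maps `A(X_0, …, X_r) ⊗ P(Y_0, X_0) ⊗ B(Y_s, …, Y_0) → Q(Y_s, X_r)`. In
`f X X' Y Y' (x_r, …, x_1) m (y_1, …, y_s)` we have `X = X_0`, `X' = X_r`, `Y = Y_0`, `Y' = Y_s`. -/
abbrev BiOp {k : Type u} [Field k] {ObA : Type u₁} {ObB : Type u₂}
    (H : Quiv.{u, u₁, v₁} k ObA) (K : Quiv.{u, u₂, v₂} k ObB)
    (P Q : ObB → ObA → GrVect.{u, v₃} k) :=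
  ∀ (X X' : ObA) (Y Y' : ObB), H.Wd X X' → P Y X → K.Wd Y' Y → Q Y' X'

namespace BiOp

variable {k : Type u} [Field k] {ObA : Type u₁} {ObB : Type u₂}
  {H H' : Quiv.{u, u₁, v₁} k ObA} {K K' : Quiv.{u, u₂, v₂} k ObB}
  {P Q R : ObB → ObA → GrVect.{u, v₃} k}

/-- Linearity over `k` in each argument. -/
structure IsMultilinear (f : BiOp H K P Q) : Prop where
  left : ∀ (X X₁ X₂ X' : ObA) (Y Y' : ObB) (p : H.Wd X₂ X') (q : H.Wd X X₁) (m : P Y X)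
    (v : K.Wd Y' Y), IsLinearMap k fun a : H X₁ X₂ => f X X' Y Y' (p.append (.cons a q)) m v
  mid : ∀ (X X' : ObA) (Y Y' : ObB) (w : H.Wd X X') (v : K.Wd Y' Y),
    IsLinearMap k fun m : P Y X => f X X' Y Y' w m v
  right : ∀ (X X' : ObA) (Y Y₁ Y₂ Y' : ObB) (w : H.Wd X X') (m : P Y X) (p : K.Wd Y₂ Y)
    (q : K.Wd Y' Y₁), IsLinearMap k fun a : K Y₁ Y₂ => f X X' Y Y' w m (p.append (.cons a q))

/-- `f` has degree `d`: the output has degree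
`d + ∑ (|x_i| - 1) + deg m + ∑ (|y_j| - 1)`. -/
def HasDegree (d : ℤ) (f : BiOp H K P Q) : Prop :=
  ∀ (X X' : ObA) (Y Y' : ObB) (w : H.Wd X X') (m : P Y X) (v : K.Wd Y' Y) (i j n : ℤ),
    H.HasRDeg w i → m ∈ (P Y X).gr n → K.HasRDeg v j → f X X' Y Y' w m v ∈ (Q Y' X').gr (i + n + j + d)

/-- The sum of `(-1)^(d ∑_{l > S} (|y_l| - 1))
f(x_r, …, x_{R+1}, g(x_R, …, x_1, m, y_1, …, y_S), y_{S+1}, …, y_s)`, where `g` has degree `d`. -/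
noncomputable def comp (d : ℤ) (f : BiOp H K Q R) (g : BiOp H K P Q) : BiOp H K P R :=
  fun X X' _ Y' w m v =>
    (w.splits.flatMap fun s => v.splits.map fun t =>
      f s.1 X' t.1 Y' s.2.1 (g X s.1 _ t.1 s.2.2 m t.2.1) (K.kos d t.2.2)).sum

/-- The sum of `± f(x_r, …, g(x_R, …, x_S), …, x_1, m, y_1, …, y_s)`, where `g` has reduced
degree `d` and the Koszul sign is the one for moving it past all that is on its right. -/
noncomputable def insL (d : ℤ) (f : BiOp H K P Q) (g : Op H H) : BiOp H K P Q :=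
  fun X X' Y Y' w m v =>
    ((Op.inserts d g w).map fun w' => f X X' Y Y' w' ((P Y X).sgn d m) (K.kos d v)).sum

/-- The sum of `± f(x_r, …, x_1, m, y_1, …, g(y_S, …, y_R), …, y_s)`, where `g` has reduced
degree `d` and the Koszul sign is the one for moving it past all that is on its right. -/
noncomputable def insR (d : ℤ) (f : BiOp H K P Q) (g : Op K K) : BiOp H K P Q :=
  fun X X' Y Y' w m v => ((Op.inserts d g v).map fun v' => f X X' Y Y' w m v').sum

/-- The differential of a pre-morphism `f` of degree `n`, for the `A∞`-structures `μA`, `μB` and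
the bimodule structures `μP`, `μQ`. -/
noncomputable def diff (μA : Op H H) (μB : Op K K) (μP : BiOp H K P P) (μQ : BiOp H K Q Q)
    (n : ℤ) (f : BiOp H K P Q) : BiOp H K P Q := fun X X' Y Y' w m v =>
  insL 1 f μA X X' Y Y' w m v + comp 1 f μP X X' Y Y' w m v + insR 1 f μB X X' Y Y' w m v
    - (-1 : k) ^ n • comp n μQ f X X' Y Y' w m v

/-- The operation which applies linear maps to the elements of `P`, with no other terms. -/
def ofLinear (g : ∀ Y X, P Y X →ₗ[k] P Y X) : BiOp H K P P := fun _ _ _ _ w m v =>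
  match w, v, m with
  | .nil, .nil, m => g _ _ m
  | _, _, _ => 0

/-- The identity morphism. -/
def id : BiOp H K P P := ofLinear fun _ _ => LinearMap.id

/-- The Euler field `m ↦ deg(m) m`, with no other terms. -/
noncomputable def eulerField : BiOp H K P P := ofLinear fun Y X => (P Y X).euler

/-- Two-sided pullback along `F` and `G`: the sum of
`f(F(…), …, F(…), m, G(…), …, G(…))`. -/
def pull (F : Op H H') (G : Op K K') (f : BiOp H' K' P Q) : BiOp H K P Q :=
  fun X X' Y Y' w m v =>
    ((F.bar w).flatMap fun w' => (G.bar v).map fun v' => f X X' Y Y' w' m v').sum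

/-- The sum of `± f(F(…), …, T(…), …, F(…), m, G(…), …, G(…))`, where `T` has reduced
degree `d`. -/
noncomputable def pullInsL (d : ℤ) (F T : Op H H') (G : Op K K') (f : BiOp H' K' P Q) :
    BiOp H K P Q := fun X X' Y Y' w m v =>
  ((Op.insertsAlong d F T w).flatMap fun w' => (G.bar v).map fun v' =>
    f X X' Y Y' w' ((P Y X).sgn d m) (K'.kos d v')).sum

/-- The sum of `± f(F(…), …, F(…), m, G(…), …, T(…), …, G(…))`, where `T` has reduced
degree `d`. -/
noncomputable def pullInsR (d : ℤ) (F : Op H H') (G T : Op K K') (f : BiOp H' K' P Q) :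
    BiOp H K P Q := fun X X' Y Y' w m v =>
  ((F.bar w).flatMap fun w' => (Op.insertsAlong d G T v).map fun v' =>
    f X X' Y Y' w' m v').sum

/-- A morphism of bimodules: a closed pre-morphism of degree zero. -/
structure IsHom (μA : Op H H) (μB : Op K K) (μP : BiOp H K P P) (μQ : BiOp H K Q Q)
    (f : BiOp H K P Q) : Prop where
  multilinear : f.IsMultilinear
  degree : f.HasDegree 0
  closed : ∀ X X' Y Y' w m v, diff μA μB μP μQ 0 f X X' Y Y' w m v = 0

/-- The composition `φ ∘ c ∘ ψ`, where `c` is an equivariant structure for the vector fields `eA`,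
`eB` and acts on `H(X_0, …, X_r) ⊗ P ⊗ K(Y_s, …, Y_0)` through `c` itself and through `eA`, `eB`
on the factors in `H` and `K`. -/
noncomputable def transport (eA : Op H H) (eB : Op K K) (φ : BiOp H K Q P) (c : BiOp H K Q Q)
    (ψ : BiOp H K P Q) : BiOp H K P P := fun X X' Y Y' w m v =>
  comp 0 φ (comp 0 c ψ) X X' Y Y' w m v + comp 0 (insL 0 φ eA) ψ X X' Y Y' w m v
    + comp 0 (insR 0 φ eB) ψ X X' Y Y' w m v

end BiOp

/-- An `A∞`-bimodule over `A` and `B`. -/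
structure AInfBimod {k : Type u} [Field k] {ObA : Type u₁} {ObB : Type u₂}
    (A : AInfCat.{u, u₁, v₁} k ObA) (B : AInfCat.{u, u₂, v₂} k ObB) where
  space : ObB → ObA → GrVect.{u, v₃} k
  /-- the operations `μ^{r|1|s}` -/
  μ : BiOp A.hom B.hom space space
  multilinear : μ.IsMultilinear
  /-- `μ^{r|1|s}` has degree `1 - r - s` -/
  degree : μ.HasDegree 1
  rel : ∀ X X' Y Y' w m v, BiOp.insL 1 μ A.μ X X' Y Y' w m v + BiOp.comp 1 μ μ X X' Y Y' w m v
    + BiOp.insR 1 μ B.μ X X' Y Y' w m v = 0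

namespace AInfBimod

variable {k : Type u} [Field k] {ObA : Type u₁} {ObB : Type u₂}
  {A : AInfCat.{u, u₁, v₁} k ObA} {B : AInfCat.{u, u₂, v₂} k ObB}
  (P : AInfBimod.{u, u₁, u₂, v₁, v₂, v₃} A B)

/-- The differential `μ^{0|1|0}`. -/
def d (Y : ObB) (X : ObA) : P.space Y X →ₗ[k] P.space Y X :=
  IsLinearMap.mk' (fun m => P.μ X X Y Y .nil m .nil) (P.multilinear.mid X X Y Y .nil .nil)

theorem d_degree (Y : ObB) (X : ObA) : (P.space Y X).DegreeOne (P.d Y X) := by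
  intro n m hm
  have := P.degree X X Y Y .nil m .nil 0 0 n rfl hm rfl
  rwa [zero_add, add_zero] at this

/-- The operation `μ^{1|1|0}`. -/
def mL {X X' : ObA} {Y : ObB} (x : A.hom X X') (m : P.space Y X) : P.space Y X' :=
  P.μ X X' Y Y (.single x) m .nil

/-- The operation `μ^{0|1|1}`. -/
def mR {X : ObA} {Y Y' : ObB} (m : P.space Y X) (y : B.hom Y' Y) : P.space Y' X :=
  P.μ X X Y Y' .nil m (.single y)

/-- The composition `x ∘ m = (-1)^(deg m + 1) μ^{1|1|0}(x, m)`. -/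
noncomputable def lact {X X' : ObA} {Y : ObB} (x : A.hom X X') (m : P.space Y X) : P.space Y X' :=
  - P.mL x ((P.space Y X).sgn 1 m)

/-- The composition `m ∘ y = μ^{0|1|1}(m, y)`. -/
def ract {X : ObA} {Y Y' : ObB} (m : P.space Y X) (y : B.hom Y' Y) : P.space Y' X := P.mR m y

theorem leibnizL {X X' : ObA} {Y : ObB} (x : A.hom X X') (m : P.space Y X) :
    P.d Y X' (P.mL x m) + P.mL x (P.d Y X m)
      + P.mL (A.d X X' x) ((P.space Y X).sgn 1 m) = 0 := by
  have h := P.rel X X' Y Y (.single x) m .nil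
  simp only [BiOp.insL, BiOp.insR, BiOp.comp, Op.inserts, Word.splits, Word.single, A.nil, B.nil,
    Word.append, Quiv.kos, Word.map,
    List.map_cons, List.map_nil, List.flatMap_cons, List.flatMap_nil, List.cons_append,
    List.nil_append, List.append_nil, List.sum_cons, List.sum_nil, add_zero] at h
  have z₁ := fun q m v =>
    (P.multilinear.left X X' X' X' Y Y .nil q m v).map_zero
  have z₂ := fun q m v =>
    (P.multilinear.left X X X X' Y Y (.cons x .nil) q m v).map_zero
  have z₃ := fun w m => (P.multilinear.right X X' Y Y Y Y w m .nil .nil).map_zero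
  simp only [Word.append] at z₁ z₂ z₃
  rw [z₁, z₂, z₃, zero_add, add_zero, add_zero] at h
  rw [← h]
  simp only [d, mL, AInfCat.d, IsLinearMap.mk'_apply, Word.single]
  abel

theorem leibnizR {X : ObA} {Y Y' : ObB} (m : P.space Y X) (y : B.hom Y' Y) :
    P.d Y' X (P.mR m y) + P.mR m (B.d Y' Y y)
      + P.mR (P.d Y X m) ((B.hom Y' Y).rsgn 1 y) = 0 := by
  have h := P.rel X X Y Y' .nil m (.single y)
  simp only [BiOp.insL, BiOp.insR, BiOp.comp, Op.inserts, Word.splits, Word.single, A.nil, B.nil,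
    Word.append, Quiv.kos, Word.map,
    List.map_cons, List.map_nil, List.flatMap_cons, List.flatMap_nil, List.cons_append,
    List.nil_append, List.append_nil, List.sum_cons, List.sum_nil, add_zero] at h
  have z₁ := fun m v => (P.multilinear.left X X X X Y Y' .nil .nil m v).map_zero
  have z₂ := fun w m q => (P.multilinear.right X X Y Y Y Y' w m .nil q).map_zero
  have z₃ := fun w m => (P.multilinear.right X X Y Y' Y' Y' w m (.cons y .nil) .nil).map_zero
  simp only [Word.append] at z₁ z₂ z₃
  rw [z₁, z₂, z₃, zero_add, zero_add, add_zero] at h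
  rw [← h]
  simp only [d, mR, AInfCat.d, IsLinearMap.mk'_apply, Word.single]
  abel

/-- The spaces `H(P(Y, X), μ^{0|1|0})` of the cohomology bimodule `H(P)`. -/
def coh : ObB → ObA → GrVect.{u, v₃} k :=
  fun Y X => (P.space Y X).cohomology (P.d Y X) (P.d_degree Y X)

/-- The operation `([x], [m]) ↦ [μ^{1|1|0}(x, m)]` on cohomology. -/
noncomputable def cohL {X X' : ObA} {Y : ObB} : A.coh X X' → P.coh Y X → P.coh Y X' :=
  GrVect.cohProduct (P.mL (X := X) (X' := X') (Y := Y)) ((P.space Y X).sgn 1)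
    (fun m => P.multilinear.left X X X' X' Y Y .nil .nil m .nil)
    (fun x => P.multilinear.mid X X' Y Y (.single x) .nil)
    (GrVect.sgn_sgn _ 1) (GrVect.sgn_comm (P.d_degree Y X)) P.leibnizL

/-- The operation `([m], [y]) ↦ [μ^{0|1|1}(m, y)]` on cohomology. -/
noncomputable def cohR {X : ObA} {Y Y' : ObB} : P.coh Y X → B.coh Y' Y → P.coh Y' X :=
  GrVect.cohProduct (P.mR (X := X) (Y := Y) (Y' := Y')) ((B.hom Y' Y).rsgn 1)
    (fun y => P.multilinear.mid X X Y Y' .nil (.single y))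
    (fun m => P.multilinear.right X X Y Y' Y Y' .nil m .nil .nil)
    (GrVect.rsgn_rsgn _ 1) (GrVect.rsgn_comm (B.d_degree Y' Y)) P.leibnizR

/-- The operations of the bimodule `H(P)` over `H(A)` and `H(B)`: the only nonzero ones are
those with a single element of `H(A)` or of `H(B)`. -/
noncomputable def cohμ : BiOp A.coh B.coh P.coh P.coh := fun _ _ _ _ w m v =>
  match w, v, m with
  | .cons x .nil, .nil, m => P.cohL x m
  | .nil, .cons y .nil, m => P.cohR m y
  | _, _, _ => 0

/-- The differential on pre-endomorphisms of `P` of degree `n`. -/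
noncomputable def endDiff (n : ℤ) (f : BiOp A.hom B.hom P.space P.space) :
    BiOp A.hom B.hom P.space P.space :=
  BiOp.diff A.μ B.μ P.μ P.μ n f

/-- The endomorphism of `P` given by a Hochschild cochain `b` of `A` of degree one, which is applied
to some of the inputs in `A`. -/
noncomputable def νA (b : Op A.hom A.hom) : BiOp A.hom B.hom P.space P.space :=
  BiOp.insL 0 P.μ b

/-- The endomorphism of `P` given by a Hochschild cochain `b` of `B` of degree one, which is applied
to some of the inputs in `B`. With the sign, `νA` and `νB` agree on cohomology for a diagonal
bimodule. -/
noncomputable def νB (b : Op B.hom B.hom) : BiOp A.hom B.hom P.space P.space :=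
  fun X X' Y Y' w m v => - BiOp.insR 0 P.μ b X X' Y Y' w m v

/-- `c` is an equivariant structure on `P`: `∂ c = νA(bA) - νB(bB)`. -/
structure IsEquivariantStructure (bA : Op A.hom A.hom) (bB : Op B.hom B.hom)
    (c : BiOp A.hom B.hom P.space P.space) : Prop where
  multilinear : c.IsMultilinear
  degree : c.HasDegree 0
  eqn : ∀ X X' Y Y' w m v, P.endDiff 0 c X X' Y Y' w m v
    = P.νA bA X X' Y Y' w m v - P.νB bB X X' Y Y' w m v

/-- Purity of an equivariant structure `c`: the chain map `m ↦ c^{0|1|0}(m) - c_X ∘ m + m ∘ c_Y`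
induces the Euler field on cohomology. -/
def IsPure (cA : ∀ X, A.hom X X) (cB : ∀ Y, B.hom Y Y)
    (c : BiOp A.hom B.hom P.space P.space) : Prop :=
  ∀ Y X n, ∀ m ∈ (P.space Y X).gr n, P.d Y X m = 0 →
    c X X Y Y .nil m .nil - P.lact (cA X) m + P.ract m (cB Y) - (n : k) • m
      ∈ LinearMap.range (P.d Y X)

variable (F T : Op A.coh A.hom) (G S : Op B.coh B.hom)

/-- The operations of the pullback of `P` to an `H(A)`-`H(B)`-bimodule along functors
`F : H(A) → A` and `G : H(B) → B`. -/
noncomputable def pullμ : BiOp A.coh B.coh P.space P.space := BiOp.pull F G P.μ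

/-- The equivariant structure induced by `c` on the pullback of `P`, where `T` and `S` are the
homotopies that make `F` and `G` equivariant: the pullback of `c` plus the terms in which `T` or
`S` is applied once to some of the inputs of `μ_P`. -/
noncomputable def pullEquivariant (c : BiOp A.hom B.hom P.space P.space) :
    BiOp A.coh B.coh P.space P.space := fun X X' Y Y' w m v =>
  BiOp.pull F G c X X' Y Y' w m v + BiOp.pullInsL (-1) F T G P.μ X X' Y Y' w m v
    + BiOp.pullInsR (-1) F G S P.μ X X' Y Y' w m v

end AInfBimod

/-!
A pure vector field `b` on an `A∞`-category, and a pure equivariant structure on a bimodule, act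
on cohomology by the degree. They can be moved to the cohomology by homological perturbation.
There, as the characteristic is zero, a change of coordinates turns them into the Euler fields;
and an `A∞`-structure that commutes with the Euler field contains only operations of one arity,
since an operation of arity `l` has a weight that depends on `l`.

*Categories.* `Op.exists_minimalModel` extends a contraction of the morphism complexes onto their
cohomology to a minimal model, and `Op.exists_transferredField` moves `b` to the model. Both solve
an equation by recursion on the length of words, and show that its defect vanishes, also by
recursion. Purity says that the linear part of the transferred field is the Euler field. In
`Op.exists_linearization`, a coordinate change with identity linear part makes it equal to the
Euler field; its terms with `l` inputs are found by dividing by `l - 1`. An operation of the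
`A∞`-structure with `l` inputs has weight `2 - l` for the Euler field, hence only the product is
left (`Op.pb_linearization`). This is `AInfCat.exists_formalityEquivalence`.

*Bimodules.* The bimodule is first pulled back along the functors `F` and `G` just found, so that
the operations of the categories are associative products. The structure `c'` induced by `c`, `T`
and `S` is an equivariant structure for the Euler fields (`AInfBimod.delta_pullEquivariant_add`).
The multilinear operations on the bimodule, with the composition, embed into a ring in which the
differential `delta` coming from the products, and the derivation `eps` coming from the Euler
fields, are (graded) commutators with elements `Δ` and `ε`: see `BiOp.OpRing`. The bimodule
equations say that `Δ + μ` has square zero, and the equation of `c'` that `c' + ε` commutes with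
`Δ + μ`. So the perturbation lemma becomes a computation in a ring (`PerturbationLemma.inclusion`,
`projection`, `homotopy`). It moves the operations and `c'` to the image of the idempotent `i ∘ p`
of a contraction. In `BiOp.exists_gauge`, a coordinate change turns the transferred `c'` into the
Euler field; its terms with `n` inputs from the categories are found by dividing by `n`. An
operation of degree `1` with `n` such inputs has weight `1 - n` (`BiOp.euler_weight`), so only the
operations with one input remain. These are the two actions on the cohomology bimodule
(`AInfBimod.cohμ_eq`).

The proofs use multilinear functionals on words instead of the tensor coalgebra: `Op.barSum`,
`Op.alongSum` and `BiOp.pull` are the effects of a functor, a coderivation along a functor, and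
the two-sided pullback on such functionals.
-/

/-! ### Sums over the splittings of a word -/

theorem List.sum_map_sum_comm {α β M : Type*} [AddCommMonoid M] (l : List α) (l' : List β)
    (f : α → β → M) :
    (l.map fun a => (l'.map fun b => f a b).sum).sum
      = (l'.map fun b => (l.map fun a => f a b).sum).sum := by
  induction l with
  | nil => simp
  | cons a l ih => simp only [List.map_cons, List.sum_cons, ih, List.sum_map_add]

theorem List.sum_map_flatMap {α β M : Type*} [AddCommMonoid M] (l : List α) (g : α → List β)
    (f : β → M) :
    ((l.flatMap g).map f).sum = (l.map fun a => ((g a).map f).sum).sum := by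
  induction l with
  | nil => simp
  | cons a l ih => simp [ih]

namespace Word

variable {Ob : Type u} {H : Ob → Ob → Type v} {V W : Type*}

/-- The number of letters. -/
def length {X : Ob} : {Y : Ob} → Word H X Y → ℕ
  | _, nil => 0
  | _, cons _ w => length w + 1

@[simp] theorem length_nil {X : Ob} : (nil : Word H X X).length = 0 := rfl

@[simp] theorem length_cons {X Y Z : Ob} (a : H Y Z) (w : Word H X Y) :
    (cons a w).length = w.length + 1 := rfl

@[simp] theorem length_single {X Y : Ob} (a : H X Y) : (single a).length = 1 := rfl

@[simp] theorem nil_append {X Y : Ob} (w : Word H X Y) : append nil w = w := rfl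

@[simp] theorem cons_append {X Y Z Z' : Ob} (a : H Z Z') (p : Word H Y Z) (q : Word H X Y) :
    append (cons a p) q = cons a (append p q) := rfl

theorem append_assoc {X Y Z Z' : Ob} (p : Word H Z Z') (q : Word H Y Z) (r : Word H X Y) :
    append (append p q) r = append p (append q r) := by
  induction p with
  | nil => rfl
  | cons a p ih => simp only [cons_append, ih]

@[simp] theorem length_append {X Y Z : Ob} (p : Word H Y Z) (q : Word H X Y) :
    (append p q).length = p.length + q.length := by
  induction p with
  | nil => simp
  | cons a p ih => simp only [cons_append, length_cons, ih]; omega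

@[simp] theorem length_map {H' : Ob → Ob → Type u'} (f : ∀ X Y, H X Y → H' X Y) {X Y : Ob}
    (w : Word H X Y) : (w.map f).length = w.length := by
  induction w with
  | nil => rfl
  | cons a w ih => simp [map, ih]

theorem map_append {H' : Ob → Ob → Type u'} (f : ∀ X Y, H X Y → H' X Y) {X Y Z : Ob}
    (p : Word H Y Z) (q : Word H X Y) : (append p q).map f = append (p.map f) (q.map f) := by
  induction p with
  | nil => rfl
  | cons a p ih => simp only [cons_append, map, ih]

section Split

variable [AddCommMonoid V] [AddCommMonoid W]

/-- The sum of `K p q` over all ways to write `w` as a concatenation of `p` and `q`. -/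
def splitSum {X Z : Ob} (w : Word H X Z) (K : ∀ Y, Word H Y Z → Word H X Y → V) : V :=
  (w.splits.map fun t => K t.1 t.2.1 t.2.2).sum

@[simp] theorem splitSum_nil {X : Ob} (K : ∀ Y, Word H Y X → Word H X Y → V) :
    splitSum nil K = K X nil nil := by
  simp [splitSum, splits]

theorem splitSum_cons {X Y Z : Ob} (a : H Y Z) (w : Word H X Y)
    (K : ∀ Y, Word H Y Z → Word H X Y → V) :
    splitSum (cons a w) K = K Z nil (cons a w) + splitSum w fun Y p q => K Y (cons a p) q := by
  simp [splitSum, splits, Function.comp_def]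

theorem splitSum_add {X Z : Ob} (w : Word H X Z) (K L : ∀ Y, Word H Y Z → Word H X Y → V) :
    splitSum w (fun Y p q => K Y p q + L Y p q) = splitSum w K + splitSum w L :=
  List.sum_map_add

@[simp] theorem splitSum_zero {X Z : Ob} (w : Word H X Z) :
    splitSum w (fun _ _ _ => (0 : V)) = 0 := by
  simp [splitSum]

theorem map_splitSum {G : Type*} [FunLike G V W] [AddMonoidHomClass G V W] (f : G) {X Z : Ob}
    (w : Word H X Z) (K : ∀ Y, Word H Y Z → Word H X Y → V) :
    f (splitSum w K) = splitSum w fun Y p q => f (K Y p q) := by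
  simp [splitSum, map_list_sum, Function.comp_def]

theorem splitSum_smul {k : Type*} [Semiring k] [Module k V] (c : k) {X Z : Ob}
    (w : Word H X Z) (K : ∀ Y, Word H Y Z → Word H X Y → V) :
    splitSum w (fun Y p q => c • K Y p q) = c • splitSum w K :=
  (map_splitSum (DistribSMul.toAddMonoidHom V c) w K).symm

/-- Coassociativity of deconcatenation. -/
theorem splitSum_assoc {X Z : Ob} (w : Word H X Z)
    (K : ∀ Y Y', Word H Y Z → Word H Y' Y → Word H X Y' → V) :
    (splitSum w fun Y' r q => splitSum r fun Y p₁ p₂ => K Y Y' p₁ p₂ q)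
      = splitSum w fun Y p₁ r => splitSum r fun Y' p₂ q => K Y Y' p₁ p₂ q := by
  induction w with
  | nil => simp
  | cons a w ih =>
    simp only [splitSum_cons, splitSum_add, splitSum_nil]
    rw [ih, ← add_assoc]

theorem splitSum_congr {X Z : Ob} (w : Word H X Z) {K L : ∀ Y, Word H Y Z → Word H X Y → V}
    (h : ∀ Y p q, append p q = w → p.length + q.length = w.length → K Y p q = L Y p q) :
    splitSum w K = splitSum w L := by
  induction w with
  | nil => simpa using h _ nil nil rfl rfl
  | cons a w ih =>
    rw [splitSum_cons, splitSum_cons, h _ nil (cons a w) rfl (by simp)]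
    congr 1
    exact ih fun Y p q e hl => h Y (cons a p) q (by rw [cons_append, e]) (by simp; omega)

theorem splitSum_eq_nil_left {X Z : Ob} (w : Word H X Z)
    {K : ∀ Y, Word H Y Z → Word H X Y → V}
    (h : ∀ Y p q, 0 < p.length → K Y p q = 0) : splitSum w K = K Z nil w := by
  cases w with
  | nil => simp
  | cons a w =>
    rw [splitSum_cons, splitSum_congr w fun Y p q _ _ => h Y (cons a p) q (by simp)]
    simp

theorem splitSum_eq_nil_right {X Z : Ob} (w : Word H X Z)
    {K : ∀ Y, Word H Y Z → Word H X Y → V}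
    (h : ∀ Y p q, 0 < q.length → K Y p q = 0) : splitSum w K = K X w nil := by
  induction w with
  | nil => simp
  | cons a w ih => rw [splitSum_cons, h _ nil (cons a w) (by simp), ih fun Y p q => h Y _ q,
      zero_add]

theorem splitSum_append_cons {X Y Y' Z : Ob} (p : Word H Y' Z) (a : H Y Y') (q : Word H X Y)
    (K : ∀ Y, Word H Y Z → Word H X Y → V) :
    splitSum (p.append (cons a q)) K
      = (splitSum p fun T p₁ p₂ => K T p₁ (p₂.append (cons a q)))
        + splitSum q fun T q₁ q₂ => K T (p.append (cons a q₁)) q₂ := by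
  induction p with
  | nil => simp [splitSum_cons]
  | cons b p ih => simp only [cons_append, splitSum_cons, ih, add_assoc]

theorem splitSum_map {H' : Ob → Ob → Type u'} (f : ∀ X Y, H X Y → H' X Y) {X Z : Ob}
    (w : Word H X Z) (K : ∀ Y, Word H' Y Z → Word H' X Y → V) :
    splitSum (w.map f) K = splitSum w fun Y p q => K Y (p.map f) (q.map f) := by
  induction w with
  | nil => simp [map]
  | cons a w ih => simp only [map, splitSum_cons, ih]

theorem splitSum_comm {Ob' : Type*} {H' : Ob' → Ob' → Type*} {X Z : Ob} {X' Z' : Ob'}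
    (w : Word H X Z) (w' : Word H' X' Z')
    (K : ∀ Y, Word H Y Z → Word H X Y → ∀ Y', Word H' Y' Z' → Word H' X' Y' → V) :
    (splitSum w fun Y p q => splitSum w' fun Y' p' q' => K Y p q Y' p' q')
      = splitSum w' fun Y' p' q' => splitSum w fun Y p q => K Y p q Y' p' q' :=
  List.sum_map_sum_comm _ _ _

/-- The sum over all ways to cut a nonempty word into blocks, organized by the first block. -/
theorem sum_parts_cons {X Y Z : Ob} (a : H Y Z) (w : Word H X Y)
    (K : Word (Word H) X Z → V) :
    ((parts (cons a w)).map K).sum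
      = splitSum w fun _ p q => ((parts q).map fun π => K (cons (cons a p) π)).sum := by
  induction w generalizing Z with
  | nil => simp [parts, consBlock, single]
  | @cons Y' Y b w ih =>
    rw [parts, List.sum_map_flatMap, ih b (fun π => ((consBlock a π).map K).sum), splitSum_cons]
    simp only [consBlock, List.map_cons, List.map_nil, List.sum_cons, List.sum_nil, add_zero,
      List.sum_map_add, splitSum_add]
    exact congrArg (· + _) (ih b fun π => K (cons (single a) π)).symm

end Split
end Word

/-! ### Multilinear functionals and the operations of the bar construction -/

section Bar

variable {k : Type u} [Field k] {Ob : Type u'} {H H' H'' : Quiv.{u, u', v} k Ob}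
  {V : Type*} [AddCommGroup V] [Module k V] {W : Type*} [AddCommGroup W] [Module k W]

/-- A functional on words with fixed ends which is linear in each letter. -/
def Quiv.MLin {X Z : Ob} (g : H.Wd X Z → V) : Prop :=
  ∀ ⦃Y Y' : Ob⦄ (p : H.Wd Y' Z) (q : H.Wd X Y),
    IsLinearMap k fun a : H Y Y' => g (p.append (.cons a q))

open Quiv Word

theorem Op.IsMultilinear.mlin {f : Op H H'} (hf : f.IsMultilinear) (X Z : Ob) :
    MLin (k := k) (f X Z) := fun Y Y' p q => hf X Y Y' Z p q

theorem Op.isMultilinear_of_mlin {f : Op H H'} (hf : ∀ X Z, MLin (k := k) (f X Z)) :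
    f.IsMultilinear := fun X _ _ W p q => hf X W p q

namespace Quiv.MLin

variable {X Z : Ob} {g g' : H.Wd X Z → V}

theorem head (hg : MLin (k := k) g) {Y : Ob} (q : H.Wd X Y) :
    IsLinearMap k fun a : H Y Z => g (.cons a q) := hg .nil q

theorem tail (hg : MLin (k := k) g) {Y : Ob} (a : H Y Z) :
    MLin (k := k) fun w : H.Wd X Y => g (.cons a w) := fun _ _ p q => hg (.cons a p) q

theorem append_left (hg : MLin (k := k) g) {Y : Ob} (u : H.Wd Y Z) :
    MLin (k := k) fun w : H.Wd X Y => g (u.append w) := fun _ _ p q => by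
  simpa only [append_assoc] using hg (u.append p) q

theorem append_right (hg : MLin (k := k) g) {Y : Ob} (u : H.Wd X Y) :
    MLin (k := k) fun w : H.Wd Y Z => g (w.append u) := fun _ _ p q => by
  simpa only [append_assoc, cons_append] using hg p (q.append u)

theorem comp_linear {f : V → W} (hf : IsLinearMap k f) (hg : MLin (k := k) g) :
    MLin (k := k) fun w => f (g w) := fun _ _ p q =>
  ⟨fun a b => by beta_reduce; rw [(hg p q).map_add, hf.map_add],
    fun c a => by beta_reduce; rw [(hg p q).map_smul, hf.map_smul]⟩

theorem add (hg : MLin (k := k) g) (hg' : MLin (k := k) g') :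
    MLin (k := k) fun w => g w + g' w := fun _ _ p q =>
  ⟨fun a b => by beta_reduce; rw [(hg p q).map_add, (hg' p q).map_add]; abel,
    fun c a => by beta_reduce; rw [(hg p q).map_smul, (hg' p q).map_smul, smul_add]⟩

theorem neg (hg : MLin (k := k) g) : MLin (k := k) fun w => - g w :=
  comp_linear (IsLinearMap.isLinearMap_neg) hg

theorem sub (hg : MLin (k := k) g) (hg' : MLin (k := k) g') :
    MLin (k := k) fun w => g w - g' w := by
  simpa only [sub_eq_add_neg] using hg.add hg'.neg

theorem cons_zero (hg : MLin (k := k) g) {Y : Ob} (q : H.Wd X Y) : g (.cons 0 q) = 0 :=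
  (hg.head q).map_zero

theorem comp_map (hg : MLin (k := k) g) (f : ∀ X Y, H X Y →ₗ[k] H X Y) :
    MLin (k := k) fun w => g (w.map fun X Y => f X Y) := fun Y Y' p q => by
  simp only [map_append, Word.map]
  exact ⟨fun a b => by rw [map_add, (hg _ _).map_add],
    fun c a => by rw [map_smul, (hg _ _).map_smul]⟩

theorem splitSum {K : ∀ Y, H.Wd Y Z → H.Wd X Y → V}
    (h₁ : ∀ Y q, MLin (k := k) fun p => K Y p q) (h₂ : ∀ Y p, MLin (k := k) fun q => K Y p q) :
    MLin (k := k) fun w => Word.splitSum w K := fun Y Y' p q => by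
  simp only [splitSum_append_cons]
  refine ⟨fun a b => ?_, fun c a => ?_⟩
  · rw [add_add_add_comm, ← splitSum_add, ← splitSum_add]
    congr 1
    · congr 1; funext T p₁ p₂; exact (h₂ T p₁ p₂ q).map_add a b
    · congr 1; funext T q₁ q₂; exact (h₁ T q₂ p q₁).map_add a b
  · rw [smul_add, ← splitSum_smul, ← splitSum_smul]
    congr 1
    · congr 1; funext T p₁ p₂; exact (h₂ T p₁ p₂ q).map_smul c a
    · congr 1; funext T q₁ q₂; exact (h₁ T q₂ p q₁).map_smul c a

theorem splitSum_const {Ob' : Type*} {H' : Ob' → Ob' → Type*} {X' Z' : Ob'} (w' : Word H' X' Z')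
    {K : ∀ Y, Word H' Y Z' → Word H' X' Y → H.Wd X Z → V}
    (h : ∀ Y p q, MLin (k := k) fun w => K Y p q w) :
    MLin (k := k) fun w => Word.splitSum w' fun Y p q => K Y p q w := fun Y Y' p q =>
  ⟨fun a b => by
    beta_reduce; rw [← splitSum_add]; congr 1; funext T p₁ p₂; exact (h T p₁ p₂ p q).map_add a b,
   fun c a => by
    beta_reduce; rw [← splitSum_smul]; congr 1; funext T p₁ p₂; exact (h T p₁ p₂ p q).map_smul c a⟩

end Quiv.MLin

theorem IsLinearMap.splitSum {Ob' : Type*} {H' : Ob' → Ob' → Type*} {X' Z' : Ob'}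
    (w' : Word H' X' Z') {K : ∀ Y, Word H' Y Z' → Word H' X' Y → V → W}
    (h : ∀ Y p q, IsLinearMap k fun a => K Y p q a) :
    IsLinearMap k fun a => Word.splitSum w' fun Y p q => K Y p q a :=
  ⟨fun a b => by rw [← splitSum_add]; congr 1; funext T p₁ p₂; exact (h T p₁ p₂).map_add a b,
   fun c a => by rw [← splitSum_smul]; congr 1; funext T p₁ p₂; exact (h T p₁ p₂).map_smul c a⟩

/-! ### Koszul signs -/

@[simp] theorem Quiv.kos_nil (d : ℤ) {X : Ob} : H.kos d (.nil : H.Wd X X) = .nil := rfl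

@[simp] theorem Quiv.kos_cons (d : ℤ) {X Y Z : Ob} (a : H Y Z) (w : H.Wd X Y) :
    H.kos d (.cons a w) = .cons ((H Y Z).rsgn d a) (H.kos d w) := rfl

theorem Quiv.kos_append (d : ℤ) {X Y Z : Ob} (p : H.Wd Y Z) (q : H.Wd X Y) :
    H.kos d (p.append q) = (H.kos d p).append (H.kos d q) := map_append _ _ _

@[simp] theorem Quiv.length_kos (d : ℤ) {X Y : Ob} (w : H.Wd X Y) :
    (H.kos d w).length = w.length := length_map _ _

theorem GrVect.rsgn_add (U : GrVect.{u, v} k) (d e : ℤ) (a : U) :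
    U.rsgn d (U.rsgn e a) = U.rsgn (d + e) a := by
  have : U.rsgn d ∘ₗ U.rsgn e = U.rsgn (d + e) := GrVect.hom_ext fun n a ha => by
    simp only [LinearMap.comp_apply, GrVect.rsgn]
    rw [GrVect.scale_of_mem U _ ha, map_smul, GrVect.scale_of_mem U _ ha,
      GrVect.scale_of_mem U _ ha, smul_smul, ← zpow_add₀ (by simp)]
    congr 2; ring
  exact congrArg (fun f => f a) this

theorem GrVect.sgn_add (U : GrVect.{u, v} k) (d e : ℤ) (a : U) :
    U.sgn d (U.sgn e a) = U.sgn (d + e) a := by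
  have : U.sgn d ∘ₗ U.sgn e = U.sgn (d + e) := GrVect.hom_ext fun n a ha => by
    simp only [LinearMap.comp_apply, GrVect.sgn]
    rw [GrVect.scale_of_mem U _ ha, map_smul, GrVect.scale_of_mem U _ ha,
      GrVect.scale_of_mem U _ ha, smul_smul, ← zpow_add₀ (by simp)]
    congr 2; ring
  exact congrArg (fun f => f a) this

@[simp] theorem GrVect.rsgn_zero (U : GrVect.{u, v} k) (a : U) : U.rsgn 0 a = a := by
  have : U.rsgn 0 = LinearMap.id := GrVect.hom_ext fun n a ha => by
    simp only [GrVect.rsgn, GrVect.scale_of_mem U _ ha]; simp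
  rw [this]; rfl

@[simp] theorem GrVect.sgn_zero (U : GrVect.{u, v} k) (a : U) : U.sgn 0 a = a := by
  have : U.sgn 0 = LinearMap.id := GrVect.hom_ext fun n a ha => by
    simp only [GrVect.sgn, GrVect.scale_of_mem U _ ha]; simp
  rw [this]; rfl

theorem Quiv.kos_kos (d e : ℤ) {X Y : Ob} (w : H.Wd X Y) :
    H.kos d (H.kos e w) = H.kos (d + e) w := by
  induction w with
  | nil => rfl
  | cons a w ih => simp only [kos_cons, ih, GrVect.rsgn_add]

@[simp] theorem Quiv.kos_zero {X Y : Ob} (w : H.Wd X Y) : H.kos 0 w = w := by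
  induction w with
  | nil => rfl
  | cons a w ih => simp only [kos_cons, ih, GrVect.rsgn_zero]

theorem Quiv.splitSum_kos {M : Type*} [AddCommMonoid M] (d : ℤ) {X Z : Ob} (w : H.Wd X Z)
    (K : ∀ Y, H.Wd Y Z → H.Wd X Y → M) :
    Word.splitSum (H.kos d w) K = Word.splitSum w fun Y p q => K Y (H.kos d p) (H.kos d q) :=
  splitSum_map _ w K

theorem Quiv.MLin.comp_kos {X Z : Ob} {g : H.Wd X Z → V} (hg : MLin (k := k) g) (d : ℤ) :
    MLin (k := k) fun w => g (H.kos d w) := hg.comp_map fun X Y => (H X Y).rsgn d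

/-! ### The bar construction of a functor -/

namespace Op

variable {M : Type*} [AddCommMonoid M]

/-- The pullback of a functional `g` along `F`: the sum of `g(F(…), …, F(…))`. -/
def barSum (F : Op H H') {X Z : Ob} (g : H'.Wd X Z → M) (w : H.Wd X Z) : M :=
  ((F.bar w).map g).sum

/-- The sum of `± g(F(…), …, F(…), T(…), F(…), …, F(…))`, where `T` has reduced degree `d`. -/
noncomputable def alongSum (d : ℤ) (F T : Op H H') {X Z : Ob} (g : H'.Wd X Z → M)
    (w : H.Wd X Z) : M :=
  ((insertsAlong d F T w).map g).sum

/-- The sum of `± g(a_d, …, T(…), …, a_1)`, where `T` has reduced degree `d`. -/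
noncomputable def insSum (d : ℤ) (T : Op H H) {X Z : Ob} (g : H.Wd X Z → M) (w : H.Wd X Z) : M :=
  ((inserts d T w).map g).sum

variable (F G T : Op H H') (d : ℤ) {X Y Z : Ob}

@[simp] theorem barSum_nil (g : H'.Wd X X → M) : barSum F g .nil = g .nil := by
  simp [barSum, bar, parts, Word.map]

theorem barSum_cons (g : H'.Wd X Z → M) (a : H Y Z) (w : H.Wd X Y) :
    barSum F g (.cons a w)
      = splitSum w fun _ p q => barSum F (fun u => g (.cons (F _ _ (.cons a p)) u)) q := by
  simp only [barSum, bar, List.map_map]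
  exact sum_parts_cons a w (g ∘ Word.map F)

theorem barSum_comm {Ob' : Type*} {K K' : Quiv k Ob'} (G : Op K K') {X' Z' : Ob'}
    (f : H'.Wd X Z → K'.Wd X' Z' → M) (w : H.Wd X Z) (w' : K.Wd X' Z') :
    barSum F (fun u => barSum G (fun u' => f u u') w') w
      = barSum G (fun u' => barSum F (fun u => f u u') w) w' :=
  List.sum_map_sum_comm _ _ _

theorem barSum_splitSum {Ob' : Type*} {K : Ob' → Ob' → Type*} {X' Z' : Ob'}
    (w' : Word K X' Z') (f : H'.Wd X Z → ∀ Y', Word K Y' Z' → Word K X' Y' → M) (w : H.Wd X Z) :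
    barSum F (fun u => splitSum w' (f u)) w
      = splitSum w' fun Y p q => barSum F (fun u => f u Y p q) w :=
  List.sum_map_sum_comm _ _ _

theorem barSum_add (g g' : H'.Wd X Z → M) (w : H.Wd X Z) :
    barSum F (fun u => g u + g' u) w = barSum F g w + barSum F g' w :=
  List.sum_map_add

@[simp] theorem barSum_zero (w : H.Wd X Z) : barSum F (fun _ : H'.Wd X Z => (0 : M)) w = 0 := by
  simp [barSum]

theorem map_barSum {M' : Type*} [AddCommMonoid M'] {A : Type*} [FunLike A M M']
    [AddMonoidHomClass A M M'] (f : A) (g : H'.Wd X Z → M) (w : H.Wd X Z) :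
    f (barSum F g w) = barSum F (fun u => f (g u)) w := by
  simp [barSum, map_list_sum, Function.comp_def]

theorem barSum_smul (c : k) (g : H'.Wd X Z → V) (w : H.Wd X Z) :
    barSum F (fun u => c • g u) w = c • barSum F g w :=
  (map_barSum F (DistribSMul.toAddMonoidHom V c) g w).symm

theorem _root_.IsLinearMap.barSum {K : H'.Wd X Z → V → W} (h : ∀ u, IsLinearMap k (K u))
    (w : H.Wd X Z) : IsLinearMap k fun a => Op.barSum F (fun u => K u a) w :=
  ⟨fun a b => by rw [← barSum_add]; congr 1; funext u; exact (h u).map_add a b,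
   fun c a => by rw [← barSum_smul]; congr 1; funext u; exact (h u).map_smul c a⟩

theorem _root_.Quiv.MLin.barSum_const {Ob' : Type*} {K : Quiv k Ob'} {X' Z' : Ob'}
    {f : H'.Wd X Z → K.Wd X' Z' → V}
    (h : ∀ u, MLin (k := k) (f u)) (w : H.Wd X Z) :
    MLin (k := k) fun w' => Op.barSum F (fun u => f u w') w := fun _ _ p q =>
  IsLinearMap.barSum F (fun u => h u p q) w

/-- The pullback along `F` is compatible with deconcatenation. -/
theorem barSum_splitSum_self (K : ∀ Y, H'.Wd Y Z → H'.Wd X Y → M) (w : H.Wd X Z) :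
    barSum F (fun u => splitSum u K) w
      = splitSum w fun Y p q => barSum F (fun p' => barSum F (fun q' => K Y p' q') q) p := by
  induction hn : w.length using Nat.strong_induction_on generalizing Z with
  | _ n ih =>
    cases w with
    | nil => simp
    | cons a w =>
      simp only [barSum_cons, splitSum_cons, barSum_nil, splitSum_add, barSum_add]
      congr 1
      rw [splitSum_congr w fun Y p q _ hl => ih q.length (by simp at hn; omega)
        (fun Y' p' q' => K Y' (.cons (F _ _ (.cons a p)) p') q') q rfl]
      rw [← splitSum_assoc w fun Y Y' p q₁ q₂ => barSum F (fun p' => barSum F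
        (fun q' => K Y' (.cons (F _ _ (.cons a p)) p') q') q₂) q₁]

theorem alongSum_def (g : H'.Wd X Z → M) (w : H.Wd X Z) :
    alongSum d F T g w = splitSum w fun Y p r => splitSum r fun Y' r₁ q =>
      barSum F (fun p' => barSum F (fun q' =>
        g (p'.append (.cons (T Y' Y r₁) (H'.kos d q')))) q) p := by
  simp only [alongSum, insertsAlong, splitSum, barSum, List.sum_map_flatMap, List.map_map,
    Function.comp_def]

theorem alongSum_nil (g : H'.Wd X X → M) :
    alongSum d F T g .nil = g (.single (T X X .nil)) := by
  simp [alongSum_def, single]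

theorem alongSum_cons (g : H'.Wd X Z → M) (a : H Y Z) (w : H.Wd X Y) :
    alongSum d F T g (.cons a w)
      = (splitSum (.cons a w) fun _ p q => barSum F (fun q' => g (.cons (T _ _ p) (H'.kos d q'))) q)
        + splitSum w fun _ p q => alongSum d F T (fun u => g (.cons (F _ _ (.cons a p)) u)) q := by
  rw [alongSum_def, splitSum_cons]
  simp only [barSum_nil, nil_append]
  congr 1
  simp only [alongSum_def, barSum_cons, cons_append]
  rw [← splitSum_assoc w fun Y Y' p r₁ q => splitSum q fun Y'' r₂ q => barSum F (fun p' => barSum F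
    (fun q' => g (.cons (F _ _ (.cons a p)) (p'.append (.cons (T Y'' Y' r₂) (H'.kos d q'))))) q) r₁]
  congr 1
  funext Y p q
  rw [splitSum_comm]

theorem alongSum_add (g g' : H'.Wd X Z → M) (w : H.Wd X Z) :
    alongSum d F T (fun u => g u + g' u) w = alongSum d F T g w + alongSum d F T g' w :=
  List.sum_map_add

@[simp] theorem alongSum_zero (w : H.Wd X Z) :
    alongSum d F T (fun _ : H'.Wd X Z => (0 : M)) w = 0 := by
  simp [alongSum]

theorem map_alongSum {M' : Type*} [AddCommMonoid M'] {A : Type*} [FunLike A M M']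
    [AddMonoidHomClass A M M'] (f : A) (g : H'.Wd X Z → M) (w : H.Wd X Z) :
    f (alongSum d F T g w) = alongSum d F T (fun u => f (g u)) w := by
  simp [alongSum, map_list_sum, Function.comp_def]

theorem alongSum_smul (c : k) (g : H'.Wd X Z → V) (w : H.Wd X Z) :
    alongSum d F T (fun u => c • g u) w = c • alongSum d F T g w :=
  (map_alongSum F T d (DistribSMul.toAddMonoidHom V c) g w).symm

theorem alongSum_splitSum {Ob' : Type*} {K : Ob' → Ob' → Type*} {X' Z' : Ob'}
    (w' : Word K X' Z') (f : H'.Wd X Z → ∀ Y', Word K Y' Z' → Word K X' Y' → M) (w : H.Wd X Z) :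
    alongSum d F T (fun u => splitSum w' (f u)) w
      = splitSum w' fun Y p q => alongSum d F T (fun u => f u Y p q) w :=
  List.sum_map_sum_comm _ _ _

theorem alongSum_barSum {Ob' : Type*} {K K' : Quiv k Ob'} (G : Op K K') {X' Z' : Ob'}
    (f : H'.Wd X Z → K'.Wd X' Z' → M) (w : H.Wd X Z) (w' : K.Wd X' Z') :
    alongSum d F T (fun u => barSum G (fun u' => f u u') w') w
      = barSum G (fun u' => alongSum d F T (fun u => f u u') w) w' :=
  List.sum_map_sum_comm _ _ _

theorem alongSum_comm {Ob' : Type*} {K K' : Quiv k Ob'} (e : ℤ) (G S : Op K K') {X' Z' : Ob'}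
    (f : H'.Wd X Z → K'.Wd X' Z' → M) (w : H.Wd X Z) (w' : K.Wd X' Z') :
    alongSum d F T (fun u => alongSum e G S (fun u' => f u u') w') w
      = alongSum e G S (fun u' => alongSum d F T (fun u => f u u') w) w' :=
  List.sum_map_sum_comm _ _ _

theorem _root_.IsLinearMap.alongSum {K : H'.Wd X Z → V → W} (h : ∀ u, IsLinearMap k (K u))
    (w : H.Wd X Z) : IsLinearMap k fun a => Op.alongSum d F T (fun u => K u a) w :=
  ⟨fun a b => by rw [← alongSum_add]; congr 1; funext u; exact (h u).map_add a b,
   fun c a => by rw [← alongSum_smul]; congr 1; funext u; exact (h u).map_smul c a⟩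

theorem _root_.Quiv.MLin.alongSum_const {Ob' : Type*} {K : Quiv k Ob'} {X' Z' : Ob'}
    {f : H'.Wd X Z → K.Wd X' Z' → V}
    (h : ∀ u, MLin (k := k) (f u)) (w : H.Wd X Z) :
    MLin (k := k) fun w' => Op.alongSum d F T (fun u => f u w') w := fun _ _ p q =>
  IsLinearMap.alongSum F T d (fun u => h u p q) w

/-- Insertion along `F` is a coderivation with respect to deconcatenation. -/
theorem alongSum_splitSum_self (K : ∀ Y, H'.Wd Y Z → H'.Wd X Y → M) (w : H.Wd X Z) :
    alongSum d F T (fun u => splitSum u K) w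
      = splitSum w fun Y p q =>
          alongSum d F T (fun p' => barSum F (fun q' => K Y p' (H'.kos d q')) q) p
          + barSum F (fun p' => alongSum d F T (fun q' => K Y p' q') q) p := by
  induction hn : w.length using Nat.strong_induction_on generalizing Z with
  | _ n ih =>
    cases w with
    | nil => simp [alongSum_nil, single, splitSum_cons, add_comm]
    | cons a w =>
      have e₁ : ∀ Y (p : H.Wd Y Z) (q : H.Wd X Y),
          barSum F (fun q' => splitSum q' fun Y' q₁ q₂ =>
            K Y' (.cons (T _ _ p) (H'.kos d q₁)) (H'.kos d q₂)) q
          = splitSum q fun Y' q₁ q₂ => barSum F (fun p' => barSum F (fun q' =>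
            K Y' (.cons (T _ _ p) (H'.kos d p')) (H'.kos d q')) q₂) q₁ :=
        fun Y p q => barSum_splitSum_self F _ q
      have e₂ := splitSum_assoc (.cons a w : H.Wd X Z) fun Y Y' p q₁ q₂ => barSum F (fun p' =>
        barSum F (fun q' => K Y' (.cons (T _ _ p) (H'.kos d p')) (H'.kos d q')) q₂) q₁
      have e₃ : (splitSum w fun Y p q =>
            alongSum d F T (fun u => splitSum (.cons (F _ _ (.cons a p)) u) K) q)
          = (splitSum w fun Y p q =>
              alongSum d F T (fun u => K Z .nil (.cons (F _ _ (.cons a p)) u)) q)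
            + splitSum w fun Y r q => splitSum r fun Y' p p' =>
              alongSum d F T (fun p' => barSum F (fun q' =>
                K Y (.cons (F _ _ (.cons a p)) p') (H'.kos d q')) q) p'
              + barSum F (fun p' => alongSum d F T (fun q' =>
                K Y (.cons (F _ _ (.cons a p)) p') q') q) p' := by
        rw [splitSum_assoc w fun Y' Y p p' q => alongSum d F T (fun p' => barSum F (fun q' =>
                K Y (.cons (F _ _ (.cons a p)) p') (H'.kos d q')) q) p'
              + barSum F (fun p' => alongSum d F T (fun q' =>
                K Y (.cons (F _ _ (.cons a p)) p') q') q) p', ← splitSum_add]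
        refine splitSum_congr w fun Y p q _ hl => ?_
        simp only [splitSum_cons, alongSum_add]
        exact congrArg (_ + ·) (ih q.length (by simp at hn; omega)
          (fun Y' p' q' => K Y' (.cons (F _ _ (.cons a p)) p') q') q rfl)
      rw [alongSum_cons, e₃]
      simp only [splitSum_cons (H := fun X Y => (H' X Y).carrier), splitSum_kos, barSum_add, e₁]
      rw [splitSum_add, ← e₂]
      simp only [splitSum_cons a w, splitSum_nil, splitSum_add, alongSum_cons, alongSum_nil,
        kos_nil, barSum_cons, barSum_nil, single]
      abel

end Op
end Bar

section Bar

variable {k : Type u} [Field k] {Ob : Type u'} {H H' H'' : Quiv.{u, u', v} k Ob}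
  {V : Type*} [AddCommGroup V] [Module k V] {W : Type*} [AddCommGroup W] [Module k W]
  {M : Type*} [AddCommMonoid M]

open Quiv Word

namespace Op

variable (F T : Op H H') (d : ℤ) {X Z : Ob}

/-- The value of the pullback along `F` on a word with a marked letter, organized by the block that
contains the letter. -/
theorem barSum_append_cons (g : H'.Wd X Z → M) {Y Y' : Ob} (p : H.Wd Y' Z) (a : H Y Y')
    (q : H.Wd X Y) :
    barSum F g (p.append (.cons a q)) = splitSum p fun _ p₁ p₂ => splitSum q fun _ q₁ q₂ =>
      barSum F (fun p' => barSum F (fun q' =>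
        g (p'.append (.cons (F _ _ (p₂.append (.cons a q₁))) q'))) q₂) p₁ := by
  induction hn : p.length using Nat.strong_induction_on generalizing Z with
  | _ n ih =>
    cases p with
    | nil => simp [barSum_cons]
    | cons b p =>
      simp only [cons_append, barSum_cons, splitSum_append_cons, splitSum_cons, barSum_nil,
        nil_append]
      rw [add_comm]
      congr 1
      rw [splitSum_congr p fun Y r p₂ _ hl => ih p₂.length (by simp at hn; omega)
        (fun u => g (.cons (F _ _ (.cons b r)) u)) p₂ rfl]
      rw [← splitSum_assoc p fun Y Y' r p₁ p₂ => splitSum q fun _ q₁ q₂ =>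
        barSum F (fun p' => barSum F (fun q' => g (.cons (F _ _ (.cons b r))
          (p'.append (.cons (F _ _ (p₂.append (.cons a q₁))) q')))) q₂) p₁]
      congr 1
      funext Y p₁ p₂
      rw [splitSum_comm]

end Op

theorem Quiv.MLin.barSum {F : Op H H'} (hF : F.IsMultilinear) {X Z : Ob} {g : H'.Wd X Z → V}
    (hg : MLin (k := k) g) : MLin (k := k) (Op.barSum F g) := fun Y Y' p q => by
  simp only [Op.barSum_append_cons]
  refine IsLinearMap.splitSum p fun _ p₁ p₂ => IsLinearMap.splitSum q fun _ q₁ q₂ =>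
    IsLinearMap.barSum F (fun p' => IsLinearMap.barSum F (fun q' => ?_) q₂) p₁
  exact ⟨fun a b => by rw [(hF.mlin _ _ p₂ q₁).map_add, (hg p' q').map_add],
    fun c a => by rw [(hF.mlin _ _ p₂ q₁).map_smul, (hg p' q').map_smul]⟩

theorem Quiv.MLin.alongSum {F T : Op H H'} (d : ℤ) (hF : F.IsMultilinear) (hT : T.IsMultilinear)
    {X Z : Ob} {g : H'.Wd X Z → V} (hg : MLin (k := k) g) :
    MLin (k := k) (Op.alongSum d F T g) := by
  have e : Op.alongSum d F T g = _ := funext fun w => Op.alongSum_def F T d g w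
  rw [e]
  refine MLin.splitSum (fun Y r => ?_) (fun Y p => ?_)
  · refine MLin.splitSum_const _ fun Y' r₁ q => MLin.barSum hF ?_
    exact MLin.barSum_const _ (fun q' => hg.append_right _) q
  · refine MLin.splitSum (fun Y' q => ?_) (fun Y' r₁ => ?_)
    · refine MLin.barSum_const _ (fun p' => MLin.barSum_const _ (fun q' => ?_) q) p
      exact MLin.comp_linear (f := fun x => g (p'.append (.cons x (H'.kos d q'))))
        ((hg.append_left p').head (H'.kos d q')) (hT.mlin Y' Y)
    · refine MLin.barSum_const _ (fun p' => MLin.barSum hF ?_) p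
      exact ((hg.append_left p').tail _).comp_kos d

namespace Op

/-- The operation with a linear map as its linear part, and no other terms. -/
def linear (f : ∀ X Y, H X Y →ₗ[k] H' X Y) : Op H H' := fun _ _ w =>
  match w with
  | .cons a .nil => f _ _ a
  | _ => 0

@[simp] theorem linear_nil (f : ∀ X Y, H X Y →ₗ[k] H' X Y) (X : Ob) :
    linear f X X .nil = 0 := rfl

@[simp] theorem linear_single (f : ∀ X Y, H X Y →ₗ[k] H' X Y) {X Y : Ob} (a : H X Y) :
    linear f X Y (.cons a .nil) = f X Y a := rfl

theorem linear_of_length (f : ∀ X Y, H X Y →ₗ[k] H' X Y) {X Y : Ob} (w : H.Wd X Y)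
    (hw : w.length ≠ 1) : linear f X Y w = 0 := by
  match w, hw with
  | .nil, _ => rfl
  | .cons a .nil, h => exact absurd rfl h
  | .cons a (.cons b w), _ => rfl

@[simp] theorem linear_cons_cons (f : ∀ X Y, H X Y →ₗ[k] H' X Y) {X Y Y' Z : Ob} (a : H Y' Z)
    (b : H Y Y') (w : H.Wd X Y) : linear f X Z (.cons a (.cons b w)) = 0 := rfl

theorem linear_multilinear (f : ∀ X Y, H X Y →ₗ[k] H' X Y) : (linear f).IsMultilinear := by
  intro X Y Z W p q
  cases p with
  | nil =>
    cases q with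
    | nil => exact (f _ _).isLinear
    | cons b q => exact ⟨fun _ _ => by simp, fun _ _ => by simp⟩
  | cons b p =>
    have : ∀ a : H Y Z, linear f X W ((Word.cons b p).append (.cons a q)) = 0 := fun a =>
      linear_of_length f _ (by simp)
    exact ⟨fun _ _ => by simp only [this, add_zero], fun _ _ => by simp only [this, smul_zero]⟩

variable (H) in
/-- The identity functor. -/
def idOp : Op H H := linear fun _ _ => LinearMap.id

theorem idOp_multilinear : (idOp H).IsMultilinear := linear_multilinear _

variable {F F' T T' : Op H H'} {d : ℤ} {X Z : Ob}

/-- The sum over all cuttings into blocks, organized by the leftmost block. -/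
theorem barSum_eq {g : H'.Wd X Z → V} (hg : MLin (k := k) g) (hF : ∀ X, F X X .nil = 0)
    (w : H.Wd X Z) (hw : 0 < w.length) :
    barSum F g w = splitSum w fun _ p q => barSum F (fun u => g (.cons (F _ _ p) u)) q := by
  cases w with
  | nil => simp at hw
  | cons a w => rw [barSum_cons, splitSum_cons, hF]; simp [hg.cons_zero]

/-- Insertion along `F`, organized by the leftmost block. -/
theorem alongSum_eq {g : H'.Wd X Z → V} (hg : MLin (k := k) g) (hF : ∀ X, F X X .nil = 0)
    (w : H.Wd X Z) :
    alongSum d F T g w = splitSum w fun _ p q =>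
      barSum F (fun q' => g (.cons (T _ _ p) (H'.kos d q'))) q
        + alongSum d F T (fun u => g (.cons (F _ _ p) u)) q := by
  cases w with
  | nil => simp [alongSum_nil, hF, hg.cons_zero, single]
  | cons a w =>
    rw [alongSum_cons, splitSum_add, splitSum_cons a w (fun Y p q => alongSum _ _ _ _ _)]
    simp [hF, hg.cons_zero]

/-- An additive operator on functionals of words, which is determined by what it does to the
leftmost block along `F`. -/
theorem eq_of_recursion (hF : ∀ X, F X X .nil = 0)
    {Λ Λ' : ∀ {Z : Ob}, (H'.Wd X Z → V) → H.Wd X Z → V}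
    {R : ∀ {Z : Ob}, (H'.Wd X Z → V) → ∀ Y, H.Wd Y Z → H.Wd X Y → V}
    (h0 : ∀ {Z : Ob} (w : H.Wd X Z), Λ (fun _ => 0) w = Λ' (fun _ => 0) w)
    (h : ∀ {Z : Ob} (g : H'.Wd X Z → V), MLin (k := k) g → ∀ w : H.Wd X Z,
      Λ g w = splitSum w fun Y p q => R g Y p q + Λ (fun u => g (.cons (F _ _ p) u)) q)
    (h' : ∀ {Z : Ob} (g : H'.Wd X Z → V), MLin (k := k) g → ∀ w : H.Wd X Z,
      Λ' g w = splitSum w fun Y p q => R g Y p q + Λ' (fun u => g (.cons (F _ _ p) u)) q)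
    {g : H'.Wd X Z → V} (hg : MLin (k := k) g) (w : H.Wd X Z) : Λ g w = Λ' g w := by
  induction hn : w.length using Nat.strong_induction_on generalizing Z with
  | _ n ih =>
    rw [h g hg, h' g hg]
    refine splitSum_congr w fun Y p q _ hl => ?_
    cases p with
    | nil => simp only [hF, hg.cons_zero, h0]
    | cons a p => rw [ih q.length (by simp at hl; omega) (hg.tail _) q rfl]

theorem barSum_congr (g : H'.Wd X Z → M) (w : H.Wd X Z)
    (h : ∀ {Y Y' : Ob} (u : H.Wd Y Y'), 0 < u.length → u.length ≤ w.length →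
      F Y Y' u = F' Y Y' u) :
    barSum F g w = barSum F' g w := by
  induction hn : w.length using Nat.strong_induction_on generalizing Z with
  | _ n ih =>
    cases w with
    | nil => simp
    | cons a w =>
      rw [barSum_cons, barSum_cons]
      refine splitSum_congr w fun Y p q _ hl => ?_
      rw [h (.cons a p) (by simp) (by simp; omega)]
      exact ih q.length (by simp at hn; omega) _ q (fun u h₀ hu => h u h₀ (by simp; omega)) rfl

/-- If `g` vanishes on words with one letter, the pullback along `F` only depends on the values of
`F` on shorter words. -/
theorem barSum_congr_of_single {g : H'.Wd X Z → M}
    (hg : ∀ a, g (.cons a .nil) = 0) (w : H.Wd X Z)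
    (h : ∀ {Y Y' : Ob} (u : H.Wd Y Y'), 0 < u.length → u.length < w.length →
      F Y Y' u = F' Y Y' u) :
    barSum F g w = barSum F' g w := by
  cases w with
  | nil => simp
  | cons a w =>
    rw [barSum_cons, barSum_cons]
    refine splitSum_congr w fun Y p q _ hl => ?_
    cases q with
    | nil => simp [hg]
    | cons b q =>
      simp only [length_cons] at hl h
      rw [h (.cons a p) (by simp) (by simp; omega)]
      exact barSum_congr _ _ fun u h₀ hu => h u h₀ (by simp at hu; omega)

/-- If `g` vanishes on words with one letter, insertion of `T` along `F` only depends on the values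
of `T` on shorter words. -/
theorem alongSum_congr_of_single {g : H'.Wd X Z → M}
    (hg : ∀ a, g (.cons a .nil) = 0) (w : H.Wd X Z)
    (h : ∀ {Y Y' : Ob} (u : H.Wd Y Y'), u.length < w.length → T Y Y' u = T' Y Y' u) :
    alongSum d F T g w = alongSum d F T' g w := by
  rw [alongSum_def, alongSum_def]
  refine splitSum_congr w fun Y p r hw hl => splitSum_congr r fun Y' r₁ q hr hl' => ?_
  by_cases hr₁ : r₁.length < w.length
  · rw [h r₁ hr₁]
  · cases p with
    | cons a p => simp only [length_cons] at hl; omega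
    | nil =>
      cases q with
      | cons b q => simp only [length_cons] at hl'; omega
      | nil => simp [hg]

theorem alongSum_congr_right {g g' : H'.Wd X Z → M} (h : ∀ u, 0 < u.length → g u = g' u)
    (w : H.Wd X Z) : alongSum d F T g w = alongSum d F T g' w := by
  have : ∀ Y Y' (p : H'.Wd Y' Z) (a : H' Y Y') (q : H'.Wd X Y),
      g (p.append (.cons a q)) = g' (p.append (.cons a q)) := fun Y Y' p a q => h _ (by simp)
  simp only [alongSum_def, this]

theorem barSum_idOp {g : H.Wd X Z → V} (hg : MLin (k := k) g) (w : H.Wd X Z) :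
    barSum (idOp H) g w = g w := by
  induction w with
  | nil => simp
  | cons a w ih =>
    rw [barSum_cons, splitSum_eq_nil_left]
    · exact ih (hg.tail _)
    · intro Y p q hp
      rw [show idOp H Y _ (.cons a p) = 0 from linear_of_length _ _ (by simp; omega)]
      simp [hg.cons_zero]

theorem insSum_def (T : Op H H) (g : H.Wd X Z → M) (w : H.Wd X Z) :
    insSum d T g w = splitSum w fun _ p r => splitSum r fun _ r₁ q =>
      g (p.append (.cons (T _ _ r₁) (H.kos d q))) := by
  simp only [insSum, inserts, splitSum, List.sum_map_flatMap, List.map_map, Function.comp_def]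

/-- Insertion into a multilinear functional is insertion along the identity. -/
theorem insSum_eq (T : Op H H) {g : H.Wd X Z → V} (hg : MLin (k := k) g) :
    insSum d T g = alongSum d (idOp H) T g := by
  funext w
  rw [insSum_def, alongSum_def]
  congr 1
  funext Y p r
  congr 1
  funext Y' r₁ q
  have h : ∀ p' : H.Wd Y Z, barSum (idOp H) (fun q' =>
      g (p'.append (.cons (T Y' Y r₁) (H.kos d q')))) q
      = g (p'.append (.cons (T Y' Y r₁) (H.kos d q))) := fun p' =>
    barSum_idOp (((hg.append_left p').tail _).comp_kos d) q
  simp only [h]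
  exact (barSum_idOp (hg.append_right (.cons (T Y' Y r₁) (H.kos d q))) p).symm

theorem alongSum_T_add {g : H'.Wd X Z → V} (hg : MLin (k := k) g) (w : H.Wd X Z) :
    alongSum d F (fun X Y w => T X Y w + T' X Y w) g w
      = alongSum d F T g w + alongSum d F T' g w := by
  simp only [alongSum_def, ← splitSum_add, ← barSum_add]
  congr 1; funext Y p r; congr 1; funext Y' r₁ q; congr 1; funext p'; congr 1; funext q'
  exact (hg p' _).map_add _ _

theorem alongSum_T_smul (c : k) {g : H'.Wd X Z → V} (hg : MLin (k := k) g) (w : H.Wd X Z) :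
    alongSum d F (fun X Y w => c • T X Y w) g w = c • alongSum d F T g w := by
  simp only [alongSum_def, ← splitSum_smul, ← barSum_smul]
  congr 1; funext Y p r; congr 1; funext Y' r₁ q; congr 1; funext p'; congr 1; funext q'
  exact (hg p' _).map_smul _ _

theorem alongSum_T_sub {g : H'.Wd X Z → V} (hg : MLin (k := k) g) (w : H.Wd X Z) :
    alongSum d F (fun X Y w => T X Y w - T' X Y w) g w
      = alongSum d F T g w - alongSum d F T' g w := by
  have h := alongSum_T_add (F := F) (T := T) (T' := fun X Y w => (-1 : k) • T' X Y w) (d := d) hg w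
  rw [alongSum_T_smul _ hg] at h
  simpa only [neg_smul, one_smul, ← sub_eq_add_neg] using h

theorem alongSum_T_zero {g : H'.Wd X Z → V} (hg : MLin (k := k) g) (w : H.Wd X Z) :
    alongSum d F (fun _ _ _ => 0) g w = 0 := by
  have h := alongSum_T_smul (F := F) (T := fun _ _ _ => 0) (d := d) (0 : k) hg w
  simpa only [zero_smul] using h

theorem barSum_eq_zero {g : H'.Wd X Z → M} (hg : ∀ u, 0 < u.length → g u = 0) (w : H.Wd X Z)
    (hw : 0 < w.length) : barSum F g w = 0 := by
  cases w with
  | nil => simp at hw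
  | cons a w =>
    have h : ∀ Y (b : H' Y Z) (q : H'.Wd X Y), g (.cons b q) = 0 := fun Y b q => hg _ (by simp)
    simp [barSum_cons, h]

theorem barSum_linear (f : ∀ X Y, H' X Y →ₗ[k] H'' X Y) (hF : ∀ X, F X X .nil = 0)
    (w : H.Wd X Z) : barSum F (linear f X Z) w = f X Z (F X Z w) := by
  cases w with
  | nil => simp [hF]
  | cons a w =>
    rw [barSum_cons, splitSum_eq_nil_right]
    · simp
    · intro Y p q hq
      exact barSum_eq_zero (fun u hu => linear_of_length _ _ (by simp; omega)) q hq

theorem alongSum_linear (f : ∀ X Y, H' X Y →ₗ[k] H'' X Y)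
    (w : H.Wd X Z) : alongSum d F T (linear f X Z) w = f X Z (T X Z w) := by
  rw [alongSum_def, splitSum_eq_nil_left, splitSum_eq_nil_right]
  · simp
  · intro Y p q hq
    simp only [barSum_nil, nil_append]
    exact barSum_eq_zero (fun u hu => linear_of_length _ _ (by simp; omega)) q hq
  · intro Y p r hp
    have : ∀ Y' (r₁ : H.Wd Y' Y) (q : H.Wd X Y'), barSum F (fun p' => barSum F (fun q' =>
        linear f X Z (p'.append (.cons (T Y' Y r₁) (H'.kos d q')))) q) p = 0 := fun Y' r₁ q =>
      barSum_eq_zero (fun u hu => by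
        have : ∀ q', linear f X Z (u.append (.cons (T Y' Y r₁) (H'.kos d q'))) = 0 := fun q' =>
          linear_of_length _ _ (by simp; omega)
        simp [this]) p hp
    simp [this]

/-! ### Identities between pullbacks and insertions -/

theorem barSum_idOp_apply (hF : ∀ X, F X X .nil = 0) (w : H.Wd X Z) :
    barSum F (idOp H' X Z) w = F X Z w := barSum_linear _ hF w

theorem alongSum_idOp_apply (w : H.Wd X Z) : alongSum d F T (idOp H' X Z) w = T X Z w :=
  alongSum_linear _ w

/-- The sum of `f(F(…), …, F(…))`. -/
def pb (F : Op H H') (f : Op H' H'') : Op H H'' := fun X Y => barSum F (f X Y)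

/-- The sum of `± f(F(…), …, F(…), T(…), F(…), …, F(…))`, where `T` has reduced degree `d`. -/
noncomputable def along (d : ℤ) (F T : Op H H') (f : Op H' H'') : Op H H'' :=
  fun X Y => alongSum d F T (f X Y)

theorem pb_nil {f : Op H' H''} (hf : ∀ X, f X X .nil = 0) (F : Op H H') (X : Ob) :
    pb F f X X .nil = 0 := by
  rw [← hf X]; exact barSum_nil F (f X X)

theorem pb_multilinear {f : Op H' H''} (hf : f.IsMultilinear) (hF : F.IsMultilinear) :
    (pb F f).IsMultilinear := isMultilinear_of_mlin fun X Z => (hf.mlin X Z).barSum hF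

theorem along_multilinear {f : Op H' H''} (hf : f.IsMultilinear) (hF : F.IsMultilinear)
    (hT : T.IsMultilinear) : (along d F T f).IsMultilinear :=
  isMultilinear_of_mlin fun X Z => (hf.mlin X Z).alongSum d hF hT

/-- Functoriality of the bar construction. -/
theorem barSum_barSum {G : Op H H'} {F : Op H' H''} (hF : ∀ X, F X X .nil = 0)
    {g : H''.Wd X Z → V} (hg : MLin (k := k) g) (w : H.Wd X Z) :
    barSum G (barSum F g) w = barSum (pb G F) g w := by
  induction hn : w.length using Nat.strong_induction_on generalizing Z with
  | _ n ih =>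
    cases w with
    | nil => simp
    | cons a w =>
      rw [barSum_eq hg (pb_nil hF G) _ (by simp)]
      have : barSum G (barSum F g) (.cons a w) = barSum G (fun u => splitSum u fun _ p q =>
          barSum F (fun u => g (.cons (F _ _ p) u)) q) (.cons a w) := by
        rw [barSum_cons, barSum_cons]
        congr 1; funext Y p q; congr 1; funext u
        rw [barSum_eq hg hF _ (by simp)]
      rw [this, barSum_splitSum_self]
      refine splitSum_congr _ fun Y p q _ hl => ?_
      have e : ∀ q', barSum G (fun p' => barSum F (fun u => g (.cons (F _ _ p') u)) q') p
          = barSum F (fun u => g (.cons (pb G F Y _ p) u)) q' := fun q' =>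
        (map_barSum G (IsLinearMap.mk' _ (IsLinearMap.barSum F (fun u => hg.head u) q'))
          (F Y Z) p).symm
      rw [barSum_comm]
      simp only [e]
      cases p with
      | nil => simp [pb_nil hF G, hg.cons_zero]
      | cons b p => exact ih q.length (by simp at hl hn; omega) (hg.tail _) q rfl

/-- Commutation of the Koszul signs with `F`. -/
def KosComm (F : Op H H') : Prop :=
  ∀ (d : ℤ) (X Y : Ob) (w : H.Wd X Y), F X Y (H.kos d w) = (H' X Y).rsgn d (F X Y w)

theorem barSum_kos (hF : KosComm F) (g : H'.Wd X Z → M) (d : ℤ) (w : H.Wd X Z) :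
    barSum F g (H.kos d w) = barSum F (fun u => g (H'.kos d u)) w := by
  induction hn : w.length using Nat.strong_induction_on generalizing Z with
  | _ n ih =>
    cases w with
    | nil => simp
    | cons a w =>
      rw [kos_cons, barSum_cons, barSum_cons, splitSum_kos]
      refine splitSum_congr w fun Y p q _ hl => ?_
      rw [ih q.length (by simp at hn; omega) _ q rfl]
      simp only [kos_cons, ← hF d]

/-- The pullback of an insertion along `F`. -/
theorem barSum_alongSum {G : Op H H'} {F T : Op H' H''} (hF : ∀ X, F X X .nil = 0)
    {g : H''.Wd X Z → V}
    (hg : MLin (k := k) g) (w : H.Wd X Z) :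
    barSum G (alongSum d F T g) w = alongSum d (pb G F) (pb G T) g w := by
  refine eq_of_recursion (Λ := fun g w => barSum G (alongSum d F T g) w)
    (Λ' := fun g w => alongSum d (pb G F) (pb G T) g w) (F := pb G F) (pb_nil hF G)
    (R := fun g Y p q => barSum (pb G F) (fun q' => g (.cons (pb G T Y _ p) (H''.kos d q'))) q)
    (fun w => ?_) (fun g hg w => ?_) (fun g hg w => alongSum_eq hg (pb_nil hF G) w) hg w
  · simp only [show alongSum d F T (fun _ : H''.Wd X _ => (0 : V)) = fun _ => 0 from
      funext fun u => alongSum_zero F T d u, barSum_zero, alongSum_zero]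
  · have : alongSum d F T g = fun u => splitSum u fun _ p q =>
        barSum F (fun q' => g (.cons (T _ _ p) (H''.kos d q'))) q
          + alongSum d F T (fun u => g (.cons (F _ _ p) u)) q := funext fun u => alongSum_eq hg hF u
    rw [this, barSum_splitSum_self]
    refine splitSum_congr _ fun Y p q _ hl => ?_
    simp only [barSum_add]
    congr 1
    · rw [barSum_comm, ← barSum_barSum hF ((hg.tail _).comp_kos d)]
      congr 1; funext q'
      exact (map_barSum G (IsLinearMap.mk' _ (IsLinearMap.barSum F
        (fun u => hg.head (H''.kos d u)) q')) (T Y _) p).symm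
    · rw [barSum_comm]
      congr 1; funext q'
      exact (map_barSum G (IsLinearMap.mk' _ (IsLinearMap.alongSum F T d
        (fun u => hg.head u) q')) (F Y _) p).symm

/-- Insertion into a pullback along `F`. -/
theorem alongSum_barSum_self {G T : Op H H'} {F : Op H' H''} (hF : ∀ X, F X X .nil = 0)
    (hFd : KosComm F) {g : H''.Wd X Z → V}
    (hg : MLin (k := k) g) (w : H.Wd X Z) :
    alongSum d G T (barSum F g) w
      = alongSum d (pb G F) (along d G T F) g w := by
  refine eq_of_recursion (Λ := fun g w => alongSum d G T (barSum F g) w)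
    (Λ' := fun g w => alongSum d (pb G F) (along d G T F) g w)
    (F := pb G F) (pb_nil hF G)
    (R := fun g Y p q => barSum (pb G F)
      (fun q' => g (.cons (along d G T F Y _ p) (H''.kos d q'))) q)
    (fun w => ?_) (fun g hg w => ?_) (fun g hg w => alongSum_eq hg (pb_nil hF G) w) hg w
  · simp only [show barSum F (fun _ : H''.Wd X _ => (0 : V)) = fun _ => 0 from
      funext fun u => barSum_zero F u, alongSum_zero]
  · have : alongSum d G T (barSum F g) w = alongSum d G T (fun u => splitSum u fun _ p q =>
        barSum F (fun u => g (.cons (F _ _ p) u)) q) w := by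
      exact alongSum_congr_right (fun u hu => barSum_eq hg hF u hu) w
    rw [this, alongSum_splitSum_self]
    refine splitSum_congr _ fun Y p q _ hl => ?_
    congr 1
    · rw [alongSum_barSum]
      have e : ∀ q', alongSum d G T (fun p' => barSum F (fun u => g (.cons (F _ _ p') u))
          (H'.kos d q')) p
          = barSum F (fun u => g (.cons (along d G T F Y _ p) (H''.kos d u))) q' := by
        intro q'
        rw [← barSum_kos hFd (fun u => g (.cons (along d G T F Y _ p) u))]
        exact (map_alongSum G T d (IsLinearMap.mk' _ (IsLinearMap.barSum F
          (fun u => hg.head u) (H'.kos d q'))) (F Y _) p).symm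
      simp only [e]
      exact barSum_barSum hF ((hg.tail _).comp_kos d) q
    · have e : ∀ q', barSum G (fun p' => barSum F (fun u => g (.cons (F _ _ p') u)) q') p
          = barSum F (fun u => g (.cons (pb G F Y _ p) u)) q' := fun q' =>
        (map_barSum G (IsLinearMap.mk' _ (IsLinearMap.barSum F (fun u => hg.head u) q'))
          (F Y _) p).symm
      rw [← alongSum_barSum]
      simp only [e]

end Op
end Bar

section Bar

variable {k : Type u} [Field k] {Ob : Type u'} {H H' H'' : Quiv.{u, u', v} k Ob}
  {V : Type*} [AddCommGroup V] [Module k V] {W : Type*} [AddCommGroup W] [Module k W]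
  {M : Type*} [AddCommMonoid M]

open Quiv Word

theorem Quiv.MLin.comp_linearMap {X Z : Ob} {g : H.Wd X Z → V} (f : V →ₗ[k] W)
    (hg : MLin (k := k) g) : MLin (k := k) fun w => f (g w) := hg.comp_linear f.isLinear

/-- Two multilinear functionals agree if they agree on words of homogeneous letters. -/
theorem Quiv.MLin.ext_homogeneous {X Z : Ob} {g g' : H.Wd X Z → V} (hg : MLin (k := k) g)
    (hg' : MLin (k := k) g') (h : ∀ w n, H.HasRDeg w n → g w = g' w) (w : H.Wd X Z) :
    g w = g' w := by
  induction w with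
  | nil => exact h _ 0 rfl
  | @cons Y Z a w ih =>
    have : IsLinearMap.mk' _ (hg.head w) = IsLinearMap.mk' _ (hg'.head w) :=
      GrVect.hom_ext fun i b hb => by
        exact ih (hg.tail b) (hg'.tail b) fun w n hw => h _ _ ⟨i, n, hb, hw, rfl⟩
    exact congrArg (fun f => f a) this

theorem Quiv.MLin.apply_kos {X Z : Ob} {g : H.Wd X Z → V} (hg : MLin (k := k) g) (d : ℤ)
    (w : H.Wd X Z) (n : ℤ) (hw : H.HasRDeg w n) : g (H.kos d w) = (-1 : k) ^ (d * n) • g w := by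
  induction w generalizing n with
  | nil => simp [show n = 0 from hw]
  | cons a w ih =>
    obtain ⟨i, j, ha, hj, rfl⟩ := hw
    rw [kos_cons, ih (hg.tail _) j hj, GrVect.rsgn, GrVect.scale_of_mem _ _ ha,
      (hg.head w).map_smul, smul_smul, ← zpow_add₀ (by simp)]
    congr 2; ring

namespace Op

variable {F G T T' : Op H H'} {d : ℤ} {X Z : Ob}

/-- The commutation of the Koszul signs with an operation of reduced degree `t`. -/
def KosDeg (t : ℤ) (T : Op H H') : Prop :=
  ∀ (d : ℤ) (X Y : Ob) (w : H.Wd X Y),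
    T X Y (H.kos d w) = (-1 : k) ^ (d * t) • (H' X Y).rsgn d (T X Y w)

theorem HasDegree.kosDeg {e t : ℤ} (hT : T.HasDegree e) (hl : T.IsMultilinear) (he : e = t + 1) :
    KosDeg t T := by
  intro d X Y
  refine MLin.ext_homogeneous ((hl.mlin X Y).comp_kos d)
    (MLin.comp_linearMap ((-1 : k) ^ (d * t) • (H' X Y).rsgn d) (hl.mlin X Y)) ?_
  intro w n hw
  rw [(hl.mlin X Y).apply_kos d w n hw]
  simp only [GrVect.rsgn]
  rw [GrVect.scale_of_mem _ _ (hT X Y w n hw), smul_smul, ← zpow_add₀ (by simp), he,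
    show d * t + d * (n + (t + 1) - 1) = d * n + (d * t + d * t) by ring, zpow_add₀ (by simp),
    zpow_add₀ (by simp) (d * t), ← mul_zpow]
  simp

theorem KosDeg.kosComm (hF : KosDeg 0 F) : KosComm F := fun d X Y w => by
  simpa using hF d X Y w

theorem kosComm_linear (f : ∀ X Y, H X Y →ₗ[k] H X Y)
    (hf : ∀ X Y d a, f X Y ((H X Y).rsgn d a) = (H X Y).rsgn d (f X Y a)) :
    KosComm (linear f) := fun d X Y w => by
  match w with
  | .nil => simp
  | .cons a .nil => simp [hf]
  | .cons a (.cons b w) => simp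

theorem kosComm_idOp : KosComm (idOp H) := kosComm_linear _ fun _ _ _ _ => rfl

theorem idOp_nil (X : Ob) : idOp H X X .nil = 0 := rfl

theorem pb_idOp (hF : ∀ X, F X X .nil = 0) : pb F (idOp H') = F :=
  funext fun _ => funext fun _ => funext fun w => barSum_idOp_apply hF w

theorem idOp_pb {F : Op H H'} (hF : F.IsMultilinear) : pb (idOp H) F = F :=
  funext fun X => funext fun Z => funext fun w => barSum_idOp (hF.mlin X Z) w

theorem KosDeg.pb {t : ℤ} {f : Op H' H''} (hf : KosDeg t f) (hF : KosComm F) :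
    KosDeg t (pb F f) := fun d X Y w => by
  simp only [Op.pb, barSum_kos hF, hf d, barSum_smul, map_barSum]

theorem alongSum_kos {t : ℤ} (hF : KosComm F) (hT : KosDeg t T) {g : H'.Wd X Z → V}
    (hg : MLin (k := k) g) (d e : ℤ) (w : H.Wd X Z) :
    alongSum d F T g (H.kos e w)
      = (-1 : k) ^ (e * t) • alongSum d F T (fun u => g (H'.kos e u)) w := by
  rw [alongSum_def, alongSum_def, splitSum_kos, ← splitSum_smul]
  congr 1; funext Y p r
  rw [splitSum_kos, ← splitSum_smul]
  congr 1; funext Y' r₁ q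
  rw [barSum_kos hF, ← barSum_smul]
  congr 1; funext p'
  rw [barSum_kos hF, ← barSum_smul]
  congr 1; funext q'
  rw [kos_append, kos_cons, kos_kos, kos_kos, hT e, (hg _ _).map_smul, add_comm]

/-- The commutator of the insertion of `T` along `F` with the insertion of `μ`, respectively `ν`,
into words is the insertion of a single operation along `F`, if `F` intertwines `ν` and `μ`. -/
theorem alongSum_commutator {μ : Op H' H'} {ν : Op H H} {t m : ℤ}
    (hF0 : ∀ X, F X X .nil = 0) (hF : F.IsMultilinear) (hFk : KosComm F)
    (hT : T.IsMultilinear) (hTk : KosDeg t T) (hμk : KosDeg m μ)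
    (hFν : pb F μ = along m (idOp H) ν F)
    {g : H'.Wd X Z → V} (hg : MLin (k := k) g) (w : H.Wd X Z) :
    alongSum t F T (alongSum m (idOp H') μ g) w
        - (-1 : k) ^ (t * m) • alongSum m (idOp H) ν (alongSum t F T g) w
      = alongSum (t + m) F (fun X Y w => along t F T μ X Y w
          - (-1 : k) ^ (t * m) • along m (idOp H) ν T X Y w) g w := by
  refine eq_of_recursion
    (Λ := fun g w => alongSum t F T (alongSum m (idOp H') μ g) w
        - (-1 : k) ^ (t * m) • alongSum m (idOp H) ν (alongSum t F T g) w)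
    (Λ' := fun g w => alongSum (t + m) F (fun X Y w => along t F T μ X Y w
          - (-1 : k) ^ (t * m) • along m (idOp H) ν T X Y w) g w) (F := F) hF0
    (R := fun g Y p q => barSum F (fun q' => g (.cons (along t F T μ Y _ p
          - (-1 : k) ^ (t * m) • along m (idOp H) ν T Y _ p) (H'.kos (t + m) q'))) q)
    (fun w => ?_) (fun g hg w => ?_) (fun g hg w => alongSum_eq hg hF0 w) hg w
  · simp only [show alongSum m (idOp H') μ (fun _ : H'.Wd X _ => (0 : V)) = fun _ => 0 from
        funext fun u => alongSum_zero _ _ _ u,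
      show alongSum t F T (fun _ : H'.Wd X _ => (0 : V)) = fun _ => 0 from
        funext fun u => alongSum_zero _ _ _ u, alongSum_zero, smul_zero, sub_zero]
  · have sq : (-1 : k) ^ (t * m) * (-1 : k) ^ (t * m) = 1 := by rw [← mul_zpow]; simp
    have eA : alongSum m (idOp H') μ g = fun u => splitSum u fun _ p q =>
        g (.cons (μ _ _ p) (H'.kos m q))
          + alongSum m (idOp H') μ (fun u => g (.cons (idOp H' _ _ p) u)) q := funext fun u => by
      rw [alongSum_eq hg idOp_nil u]
      congr 1; funext Y p q
      rw [barSum_idOp ((hg.tail _).comp_kos m) q]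
    have eB : alongSum t F T g = fun u => splitSum u fun _ p q =>
        barSum F (fun q' => g (.cons (T _ _ p) (H'.kos t q'))) q
          + alongSum t F T (fun u => g (.cons (F _ _ p) u)) q := funext fun u =>
      alongSum_eq hg hF0 u
    have mK₁ : ∀ Y (p : H.Wd Y _), MLin (k := k) fun q : H.Wd X Y =>
        barSum F (fun q' => g (.cons (T _ _ p) (H'.kos t q'))) q
          + alongSum t F T (fun u => g (.cons (F _ _ p) u)) q := fun Y p =>
      (((hg.tail _).comp_kos t).barSum hF).add ((hg.tail _).alongSum t hF hT)
    have mK₂ : ∀ Y (q : H.Wd X Y), MLin (k := k) fun p : H.Wd Y _ =>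
        barSum F (fun q' => g (.cons (T _ _ p) (H'.kos t q'))) q
          + alongSum t F T (fun u => g (.cons (F _ _ p) u)) q := fun Y q =>
      (MLin.comp_linearMap (IsLinearMap.mk' _ (IsLinearMap.barSum F (fun u => hg.head
        (H'.kos t u)) q))
        (hT.mlin Y _)).add
        (MLin.comp_linearMap (IsLinearMap.mk' _ (IsLinearMap.alongSum F T t (fun u =>
          hg.head u) q)) (hF.mlin Y _))
    rw [eA, eB, alongSum_splitSum_self, alongSum_splitSum_self, ← splitSum_smul,
      sub_eq_add_neg, ← neg_one_smul k (splitSum _ _), ← splitSum_smul, ← splitSum_add]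
    refine splitSum_congr w fun Y p q _ _ => ?_
    simp only [barSum_idOp ((mK₁ _ _).comp_kos m),
      barSum_idOp (MLin.alongSum_const (idOp H) ν m (fun q' => mK₂ _ q') q)]
    simp only [barSum_add, alongSum_add]
    have a₁ : alongSum t F T (fun p' => barSum F (fun q' =>
          g (.cons (μ Y _ p') (H'.kos m (H'.kos t q')))) q) p
        = barSum F (fun q' => g (.cons (along t F T μ Y _ p) (H'.kos (t + m) q'))) q := by
      simp only [kos_kos, add_comm m t]
      exact (map_alongSum F T t (IsLinearMap.mk' _ (IsLinearMap.barSum F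
        (fun u => hg.head (H'.kos (t + m) u)) q)) (μ Y _) p).symm
    have a₂ : alongSum t F T (fun p' => barSum F (fun q' =>
          alongSum m (idOp H') μ (fun u => g (.cons (idOp H' Y _ p') u)) (H'.kos t q')) q) p
        = barSum F (fun q' =>
          alongSum m (idOp H') μ (fun u => g (.cons (T Y _ p) u)) (H'.kos t q')) q := by
      have := (map_alongSum F T t (IsLinearMap.mk' _ (IsLinearMap.barSum F
        (fun q' => IsLinearMap.alongSum (idOp H') μ m (fun u => hg.head u) (H'.kos t q')) q))
          (idOp H' Y _) p).symm
      rw [alongSum_idOp_apply] at this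
      exact this
    have a₃ : barSum F (fun p' => alongSum t F T (fun q' => g (.cons (μ Y _ p') (H'.kos m q'))) q) p
        = alongSum t F T (fun q' => g (.cons (pb F μ Y _ p) (H'.kos m q'))) q :=
      (map_barSum F (IsLinearMap.mk' _ (IsLinearMap.alongSum F T t
        (fun u => hg.head (H'.kos m u)) q)) (μ Y _) p).symm
    have a₄ : barSum F (fun p' => alongSum t F T (fun q' => alongSum m (idOp H') μ
          (fun u => g (.cons (idOp H' Y _ p') u)) q') q) p
        = alongSum t F T (alongSum m (idOp H') μ (fun u => g (.cons (F Y _ p) u))) q := by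
      have := (map_barSum F (IsLinearMap.mk' _ (IsLinearMap.alongSum F T t
        (fun q' => IsLinearMap.alongSum (idOp H') μ m (fun u => hg.head u) q') q))
          (idOp H' Y _) p).symm
      rw [barSum_idOp_apply hF0] at this
      exact this
    have b₁ : alongSum m (idOp H) ν (fun p' => barSum F (fun q' =>
          g (.cons (T Y _ p') (H'.kos t q'))) (H.kos m q)) p
        = barSum F (fun q' => g (.cons (along m (idOp H) ν T Y _ p) (H'.kos (t + m) q'))) q := by
      refine (map_alongSum (idOp H) ν m (IsLinearMap.mk' _ (IsLinearMap.barSum F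
        (fun u => hg.head (H'.kos t u)) (H.kos m q))) (T Y _) p).symm.trans ?_
      simp only [IsLinearMap.mk'_apply, barSum_kos hFk, kos_kos]
      rfl
    have b₂ : alongSum m (idOp H) ν (fun p' => alongSum t F T (fun u =>
          g (.cons (F Y _ p') u)) (H.kos m q)) p
        = (-1 : k) ^ (t * m) • alongSum t F T
            (fun q' => g (.cons (pb F μ Y _ p) (H'.kos m q'))) q := by
      rw [mul_comm t m, ← alongSum_kos hFk hTk (hg.tail _), hFν]
      exact (map_alongSum (idOp H) ν m (IsLinearMap.mk' _ (IsLinearMap.alongSum F T t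
        (fun u => hg.head u) (H.kos m q))) (F Y _) p).symm
    have b₃ : barSum F (fun q' =>
          alongSum m (idOp H') μ (fun u => g (.cons (T Y _ p) u)) (H'.kos t q')) q
        = (-1 : k) ^ (t * m) • alongSum m (idOp H) ν (fun q' => barSum F (fun q'' =>
          g (.cons (T Y _ p) (H'.kos t q''))) q') q := by
      rw [← barSum_kos hFk (alongSum m (idOp H') μ (fun u => g (.cons (T Y _ p) u))),
        barSum_alongSum idOp_nil (hg.tail _),
        alongSum_barSum_self hF0 hFk ((hg.tail _).comp_kos t), hFν, pb_idOp hF0, idOp_pb hF,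
        alongSum_kos hFk (hμk.pb hFk |> (hFν ▸ ·)) (hg.tail _)]
    simp only [a₁, a₂, a₃, a₄, b₁, b₂, b₃, smul_add, smul_smul, sq, one_smul]
    have e : barSum F (fun q' => g (.cons (along t F T μ Y _ p
          - (-1 : k) ^ (t * m) • along m (idOp H) ν T Y _ p) (H'.kos (t + m) q'))) q
        = barSum F (fun q' => g (.cons (along t F T μ Y _ p) (H'.kos (t + m) q'))) q
          - (-1 : k) ^ (t * m) •
            barSum F (fun q' => g (.cons (along m (idOp H) ν T Y _ p) (H'.kos (t + m) q'))) q := by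
      have l := IsLinearMap.barSum F (fun u => hg.head (H'.kos (t + m) u)) q
      rw [l.map_sub, l.map_smul]
    rw [e]
    generalize (-1 : k) ^ (t * m) = s
    module

end Op
end Bar

section Bar

variable {k : Type u} [Field k] {Ob : Type u'} {H H' H'' : Quiv.{u, u', v} k Ob}
  {V : Type*} [AddCommGroup V] [Module k V]

open Quiv Word

/-! ### Degrees -/

theorem Quiv.HasRDeg.append {X Y Z : Ob} {p : H.Wd Y Z} {q : H.Wd X Y} {i j : ℤ}
    (hp : H.HasRDeg p i) (hq : H.HasRDeg q j) : H.HasRDeg (p.append q) (i + j) := by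
  induction p generalizing i with
  | nil =>
    rw [show i = 0 from hp, zero_add]
    exact hq
  | cons a p ih =>
    obtain ⟨r, s, ha, hs, rfl⟩ := hp
    exact ⟨r, s + j, ha, ih hs, by ring⟩

theorem Quiv.HasRDeg.kos {X Y : Ob} {w : H.Wd X Y} {n : ℤ} (hw : H.HasRDeg w n) (d : ℤ) :
    H.HasRDeg (H.kos d w) n := by
  induction w generalizing n with
  | nil => exact hw
  | cons a w ih =>
    obtain ⟨r, s, ha, hs, rfl⟩ := hw
    exact ⟨r, s, GrVect.scale_mem _ _ ha, ih hs, rfl⟩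

theorem Word.splitSum_mem {S : Submodule k V} {X Z : Ob} {w : H.Wd X Z} {n : ℤ}
    (hw : H.HasRDeg w n) {K : ∀ Y, H.Wd Y Z → H.Wd X Y → V}
    (h : ∀ Y p q i j, H.HasRDeg p i → H.HasRDeg q j → i + j = n → K Y p q ∈ S) :
    splitSum w K ∈ S := by
  induction w generalizing n with
  | nil => simpa using h _ .nil .nil 0 0 rfl rfl (by simpa using (show n = 0 from hw).symm)
  | cons a w ih =>
    rw [splitSum_cons]
    refine add_mem (h _ .nil (.cons a w) 0 n rfl hw (by ring)) ?_
    obtain ⟨r, s, ha, hs, rfl⟩ := hw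
    exact ih hs fun Y p q i j hp hq e => h Y (.cons a p) q (r - 1 + i) j ⟨r, i, ha, hp, rfl⟩ hq
      (by rw [← e]; ring)

namespace Op

variable {F G T T' : Op H H'} {d : ℤ} {X Z : Ob}

theorem barSum_mem (hF : F.HasDegree 1) {S : Submodule k V} {w : H.Wd X Z} {n : ℤ}
    (hw : H.HasRDeg w n) {g : H'.Wd X Z → V} (h : ∀ u, H'.HasRDeg u n → g u ∈ S) :
    barSum F g w ∈ S := by
  induction hn : w.length using Nat.strong_induction_on generalizing Z n with
  | _ m ih =>
    cases w with
    | nil => simpa using h .nil hw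
    | cons a w =>
      rw [barSum_cons]
      obtain ⟨r, s, ha, hs, rfl⟩ := hw
      have hl : splitSum w (fun Y p q => barSum F (fun u => g (.cons (F Y Z (.cons a p)) u)) q)
          = splitSum w (fun Y p q => if q.length < m then
            barSum F (fun u => g (.cons (F Y Z (.cons a p)) u)) q else 0) :=
        splitSum_congr w fun Y p q _ hl => by rw [if_pos]; simp at hn; omega
      rw [hl]
      refine splitSum_mem hs fun Y p q i j hp hq e => ?_
      split_ifs with hlt
      · refine ih q.length hlt hq (fun u hu => h _ ⟨r + i, j, ?_, hu, ?_⟩) rfl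
        · have := hF Y Z (.cons a p) (r - 1 + i) ⟨r, i, ha, hp, rfl⟩
          rwa [show r - 1 + i + 1 = r + i by ring] at this
        · rw [← e]; ring
      · exact zero_mem _

theorem alongSum_mem (hF : F.HasDegree 1) {e : ℤ} (hT : T.HasDegree e) (he : e = d + 1)
    {S : Submodule k V} {w : H.Wd X Z} {n : ℤ} (hw : H.HasRDeg w n) {g : H'.Wd X Z → V}
    (h : ∀ u, H'.HasRDeg u (n + d) → g u ∈ S) : alongSum d F T g w ∈ S := by
  rw [alongSum_def]
  refine splitSum_mem hw fun Y p r i j hp hr e₁ => splitSum_mem hr fun Y' r₁ q i' j' hr₁ hq e₂ => ?_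
  refine barSum_mem hF hp fun p' hp' => barSum_mem hF hq fun q' hq' => h _ ?_
  have := hp'.append (q := .cons (T Y' Y r₁) (H'.kos d q')) (j := i' + d + j')
    ⟨i' + e, j', hT _ _ _ _ hr₁, hq'.kos d, by rw [he]; ring⟩
  rwa [show n + d = i + (i' + d + j') by rw [← e₁, ← e₂]; ring]

theorem HasDegree.pb {f : Op H' H''} {e : ℤ} (hf : f.HasDegree e) (hF : F.HasDegree 1) :
    (pb F f).HasDegree e := fun X Y _ n hw => barSum_mem hF hw fun u hu => hf X Y u n hu

theorem HasDegree.along {f : Op H' H''} {e e' e'' : ℤ} (hf : f.HasDegree e) (hF : F.HasDegree 1)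
    (hT : T.HasDegree e') (he : e' = d + 1) (he' : e'' = e + d) :
    (along d F T f).HasDegree e'' := fun X Y w n hw =>
  alongSum_mem hF hT he hw fun u hu => by
    rw [show n + e'' = n + d + e by rw [he']; ring]
    exact hf X Y u _ hu

theorem HasDegree.add (hF : F.HasDegree d) (hG : G.HasDegree d) :
    HasDegree d (fun X Y w => F X Y w + G X Y w) := fun X Y w n hw =>
  add_mem (hF X Y w n hw) (hG X Y w n hw)

theorem HasDegree.sub (hF : F.HasDegree d) (hG : G.HasDegree d) :
    HasDegree d (fun X Y w => F X Y w - G X Y w) := fun X Y w n hw =>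
  sub_mem (hF X Y w n hw) (hG X Y w n hw)

theorem HasDegree.linear {f : ∀ X Y, H X Y →ₗ[k] H' X Y} (e : ℤ)
    (hf : ∀ X Y n, ∀ a ∈ (H X Y).gr n, f X Y a ∈ (H' X Y).gr (n + e)) :
    (linear f).HasDegree (1 + e) := by
  intro X Y w n hw
  match w with
  | .nil => exact zero_mem _
  | .cons a .nil =>
    obtain ⟨i, j, ha, hj, hn⟩ := hw
    have hj : j = 0 := hj
    rw [show n + (1 + e) = i + e by rw [hn, hj]; ring]
    exact hf _ _ _ _ ha
  | .cons a (.cons b w) => exact zero_mem _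

theorem idOp_hasDegree : (idOp H).HasDegree 1 :=
  HasDegree.linear 0 fun _ _ n a ha => by simpa using ha

theorem eulerField_eq : H.eulerField = linear fun X Y => (H X Y).euler := by
  funext X Y w
  match w with
  | .nil => rfl
  | .cons a .nil => rfl
  | .cons a (.cons b w) => rfl

theorem eulerField_multilinear : H.eulerField.IsMultilinear := by
  rw [eulerField_eq]; exact linear_multilinear _

theorem eulerField_hasDegree : H.eulerField.HasDegree 1 := by
  rw [eulerField_eq]
  exact HasDegree.linear 0 fun _ _ n a ha => by rw [add_zero]; exact GrVect.scale_mem _ _ ha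

/-- The Euler field acts on multilinear functionals by the total unreduced degree. -/
theorem alongSum_eulerField {g : H.Wd X Z → V} (hg : MLin (k := k) g) (w : H.Wd X Z) (n : ℤ)
    (hw : H.HasRDeg w n) :
    alongSum 0 (idOp H) H.eulerField g w = ((n : k) + w.length) • g w := by
  rw [eulerField_eq]
  induction w generalizing n with
  | nil =>
    rw [show n = 0 from hw, alongSum_nil]
    simpa [single] using hg.cons_zero _
  | cons a w ih =>
    obtain ⟨r, s, ha, hs, rfl⟩ := hw
    rw [alongSum_cons, splitSum_cons, splitSum_eq_nil_left, splitSum_eq_nil_left]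
    · have e := ih (hg.tail a) s hs
      have e₀ := barSum_idOp (hg.tail ((H _ _).euler a)) w
      simp only [linear_nil, linear_single, kos_zero, hg.cons_zero, barSum_zero, zero_add,
        idOp, LinearMap.id_apply]
      have e' : g (.cons ((H _ _).euler a) w) = (r : k) • g (.cons a w) := by
        rw [GrVect.euler, GrVect.scale_of_mem _ _ ha, (hg.head w).map_smul]
      rw [idOp] at e e₀
      rw [e, e₀, e', ← add_smul]
      congr 1
      push_cast [length_cons]
      ring
    · intro Y p q hp
      rw [show idOp H Y _ (.cons a p) = 0 from linear_of_length _ _ (by simp; omega)]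
      simp [hg.cons_zero]
    · intro Y p q hp
      rw [show linear (fun X Y => (H X Y).euler) Y _ (.cons a p) = 0 from
        linear_of_length _ _ (by simp; omega)]
      simp [hg.cons_zero]

end Op

/-! ### Recursive constructions -/

/-- A self-map of a complete ultrametric family, for which each step improves the precision, has a
fixed point. Here `ag n f g` says that `f` and `g` agree up to precision `n`. -/
theorem exists_fixedPoint_of_agree {E : Type*} (ag : ℕ → E → E → Prop) (S : Set E)
    (h0 : ∀ f g, ag 0 f g) (symm : ∀ n f g, ag n f g → ag n g f)
    (trans : ∀ n f g h, ag n f g → ag n g h → ag n f h)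
    (sep : ∀ f g, (∀ n, ag (n + 1) f g) → f = g)
    (lim : ∀ s : ℕ → E, (∀ n, s n ∈ S) → (∀ n, ag n (s n) (s (n + 1))) →
      ∃ f ∈ S, ∀ n, ag n f (s n))
    (z : E) (hz : z ∈ S) (Φ : E → E) (hΦ : ∀ f ∈ S, Φ f ∈ S)
    (hc : ∀ n, ∀ f ∈ S, ∀ g ∈ S, ag n f g → ag (n + 1) (Φ f) (Φ g)) : ∃ f ∈ S, Φ f = f := by
  have hs : ∀ n, Φ^[n] z ∈ S := fun n => by
    induction n with
    | zero => exact hz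
    | succ n ih => rw [Function.iterate_succ_apply']; exact hΦ _ ih
  have ha : ∀ n, ag n (Φ^[n] z) (Φ^[n + 1] z) := fun n => by
    induction n with
    | zero => exact h0 _ _
    | succ n ih =>
      rw [Function.iterate_succ_apply', Function.iterate_succ_apply' _ (n + 1)]
      exact hc n _ (hs n) _ (hs (n + 1)) ih
  obtain ⟨f, hf, h⟩ := lim _ hs ha
  refine ⟨f, hf, sep _ _ fun n => ?_⟩
  have h₁ := hc n _ hf _ (hs n) (h n)
  rw [← Function.iterate_succ_apply' Φ] at h₁
  exact trans _ _ _ _ h₁ (symm _ _ _ (h (n + 1)))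

/-- Solutions of recursive equations for operations, where the value on a word is expressed through
the values on shorter words. -/
theorem Op.exists_fixedPoint (d : ℤ) (Φ : Op H H' → Op H H')
    (hΦ : ∀ f, f.IsMultilinear → f.HasDegree d → (Φ f).IsMultilinear ∧ (Φ f).HasDegree d)
    (hc : ∀ f g : Op H H', f.IsMultilinear → g.IsMultilinear → ∀ X Y (w : H.Wd X Y),
      (∀ X' Y' (u : H.Wd X' Y'), u.length < w.length → f X' Y' u = g X' Y' u) →
      Φ f X Y w = Φ g X Y w) :
    ∃ f, f.IsMultilinear ∧ f.HasDegree d ∧ Φ f = f := by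
  let ag : ℕ → Op H H' → Op H H' → Prop := fun n f g => ∀ X Y w, w.length < n → f X Y w = g X Y w
  have lim : ∀ s : ℕ → Op H H', (∀ n, (s n).IsMultilinear ∧ (s n).HasDegree d) →
      (∀ n, ag n (s n) (s (n + 1))) →
      ∃ f : Op H H', (f.IsMultilinear ∧ f.HasDegree d) ∧ ∀ n, ag n f (s n) := by
    intro s hs ha
    have key : ∀ m n, m ≤ n → ag m (s m) (s n) := by
      intro m n hmn
      induction n, hmn using Nat.le_induction with
      | base => intro _ _ _ _; rfl
      | succ n hmn ih => exact fun X Y w hw => (ih X Y w hw).trans (ha n X Y w (by omega))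
    refine ⟨fun X Y w => s (w.length + 1) X Y w, ⟨fun X Y Z W p q => ?_, fun X Y w n hw => ?_⟩,
      fun n X Y w hw => key _ _ hw X Y w (by omega)⟩
    · have e : ∀ a : H Y Z, (p.append (.cons a q)).length = p.length + (q.length + 1) := by simp
      simp only [e]
      exact (hs _).1 X Y Z W p q
    · exact (hs _).2 X Y w n hw
  obtain ⟨f, hf, h⟩ := exists_fixedPoint_of_agree ag
    {f | f.IsMultilinear ∧ f.HasDegree d} (fun f g X Y w hw => by simp at hw)
    (fun n f g h X Y w hw => (h X Y w hw).symm)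
    (fun n f g h h₁ h₂ X Y w hw => (h₁ X Y w hw).trans (h₂ X Y w hw))
    (fun f g h => funext fun X => funext fun Y => funext fun w =>
      h w.length X Y w (by simp))
    lim (fun _ _ _ => 0)
    ⟨fun _ _ _ _ _ _ => ⟨fun _ _ => by simp, fun _ _ => by simp⟩, fun _ _ _ _ _ => zero_mem _⟩
    Φ (fun f hf => hΦ f hf.1 hf.2)
    (fun n f hf g hg h X Y w hw => hc f g hf.1 hg.1 X Y w fun X' Y' u hu => h X' Y' u (by omega))
  exact ⟨f, hf.1, hf.2, h⟩

end Bar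

/-! ### Contractions onto cohomology -/

namespace GrVect

variable {k : Type u} [Field k]

theorem ext_of_isInternal {E : Type*} [AddCommGroup E] [Module k E] {gr : ℤ → Submodule k E}
    (hgr : DirectSum.IsInternal gr) {W : Type*} [AddCommGroup W] [Module k W] {f g : E →ₗ[k] W}
    (h : ∀ n, ∀ a ∈ gr n, f a = g a) : f = g := by
  have e := (LinearMap.eqOn_span (s := ⋃ n, (gr n : Set E)) (f := f) (g := g) fun x hx => by
    obtain ⟨n, hn⟩ := Set.mem_iUnion.1 hx
    exact h n x hn)
  ext a
  refine e ?_
  rw [← Submodule.iSup_eq_span, hgr.submodule_iSup_eq_top]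
  trivial

/-- The component of degree `e` of a linear map between graded vector spaces. -/
theorem exists_component {E : Type*} [AddCommGroup E] [Module k E] {gr : ℤ → Submodule k E}
    (hgr : DirectSum.IsInternal gr) {V : GrVect.{u, w₁} k} (f : E →ₗ[k] V) (e : ℤ) :
    ∃ g : E →ₗ[k] V, ∀ n, ∀ a ∈ gr n, g a = V.proj (n + e) (f a) := by
  refine ⟨DirectSum.toModule k ℤ V (fun n => V.proj (n + e) ∘ₗ f ∘ₗ (gr n).subtype) ∘ₗ
    (LinearEquiv.ofBijective (DirectSum.coeLinearMap gr) hgr).symm.toLinearMap,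
    fun n a ha => ?_⟩
  have h : (LinearEquiv.ofBijective (DirectSum.coeLinearMap gr) hgr).symm a
      = DirectSum.lof k ℤ (fun i => gr i) n ⟨a, ha⟩ := by
    rw [LinearEquiv.symm_apply_eq]
    exact (DirectSum.coeLinearMap_lof gr n ⟨a, ha⟩).symm
  simp only [LinearMap.comp_apply, LinearEquiv.coe_coe]
  rw [h, DirectSum.toModule_lof]
  rfl

/-- A contraction of a complex `(V, d)` onto a graded vector space `U` with zero differential: an
inclusion `i`, a projection `p` and a homotopy `h` from `i p` to the identity, with the side
conditions. -/
structure Contraction (U V : GrVect.{u, v} k) (d : V →ₗ[k] V) where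
  i : U →ₗ[k] V
  p : V →ₗ[k] U
  h : V →ₗ[k] V
  i_degree : ∀ n, ∀ x ∈ U.gr n, i x ∈ V.gr n
  p_degree : ∀ n, ∀ a ∈ V.gr n, p a ∈ U.gr n
  h_degree : ∀ n, ∀ a ∈ V.gr n, h a ∈ V.gr (n - 1)
  d_i : ∀ x, d (i x) = 0
  p_d : ∀ a, p (d a) = 0
  p_i : ∀ x, p (i x) = x
  h_i : ∀ x, h (i x) = 0
  p_h : ∀ a, p (h a) = 0
  h_h : ∀ a, h (h a) = 0
  homotopy : ∀ a, i (p a) - a = d (h a) + h (d a)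

theorem exists_contraction {V : GrVect.{u, v} k} {d : V →ₗ[k] V} (hd : V.DegreeOne d)
    (dd : ∀ a, d (d a) = 0) :
    ∃ c : Contraction (V.cohomology d hd) V d,
      (∀ x : Coh V d, Represents (d := d) (c.i x) x) ∧
      ∀ a (ha : d a = 0), c.p a =
        (Submodule.Quotient.mk ⟨a, LinearMap.mem_ker.2 ha⟩ : Coh V d) := by
  -- a pseudo-inverse `s` of `d` of degree `-1`
  obtain ⟨s₀, hs₀⟩ : ∃ s₀ : V →ₗ[k] V, ∀ a, d (s₀ (d a)) = d a := by
    obtain ⟨r, hr⟩ := d.rangeRestrict.exists_rightInverse_of_surjective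
      (LinearMap.range_eq_top.2 d.surjective_rangeRestrict)
    obtain ⟨q, hq⟩ := (LinearMap.range d).subtype.exists_leftInverse_of_injective
      (Submodule.ker_subtype _)
    refine ⟨r ∘ₗ q, fun a => ?_⟩
    have h₁ : q (d a) = d.rangeRestrict a := congrArg (fun f => f (d.rangeRestrict a)) hq
    have h₂ := congrArg (fun f => (f (d.rangeRestrict a) : V)) hr
    rw [LinearMap.comp_apply, h₁]
    exact h₂
  obtain ⟨s, hs⟩ := exists_component V.internal s₀ (-1)
  have s_degree : ∀ n, ∀ a ∈ V.gr n, s a ∈ V.gr (n - 1) := fun n a ha => by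
    rw [hs n a ha]; exact proj_mem V _ _
  have dsd : ∀ a, d (s (d a)) = d a := by
    have : d ∘ₗ s ∘ₗ d = d := hom_ext fun n a ha => by
      simp only [LinearMap.comp_apply]
      rw [hs _ _ (hd n a ha), d_proj hd, hs₀, show n + 1 + -1 + 1 = n + 1 by ring,
        proj_same V (hd n a ha)]
    exact fun a => congrArg (fun f => f a) this
  -- a graded section `i` of the projection from cocycles to cohomology
  obtain ⟨i₀, hi₀⟩ := (Submodule.mkQ ((LinearMap.range d).comap
    (LinearMap.ker d).subtype)).exists_rightInverse_of_surjective
      (LinearMap.range_eq_top.2 (Submodule.mkQ_surjective _))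
  obtain ⟨i, hi⟩ := exists_component (cohGr_internal hd) ((LinearMap.ker d).subtype ∘ₗ i₀) 0
  have d_i : ∀ x, d (i x) = 0 := by
    have : d ∘ₗ i = 0 := ext_of_isInternal (cohGr_internal hd) fun n x hx => by
      rw [LinearMap.comp_apply, hi n x hx, d_proj hd, LinearMap.comp_apply, Submodule.subtype_apply,
        LinearMap.mem_ker.1 (i₀ x).2]
      simp
    exact fun x => congrArg (fun f => f x) this
  have rep : (Submodule.mkQ ((LinearMap.range d).comap (LinearMap.ker d).subtype)) ∘ₗ
      i.codRestrict (LinearMap.ker d) (fun x => LinearMap.mem_ker.2 (d_i x)) = LinearMap.id :=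
    ext_of_isInternal (cohGr_internal hd) fun n x hx => by
      obtain ⟨⟨a, ha⟩, han, rfl⟩ := hx
      have e := congrArg (fun f => f (Submodule.Quotient.mk ⟨a, ha⟩)) hi₀
      obtain ⟨b, hb⟩ := (Submodule.Quotient.eq _).1 e
      refine (Submodule.Quotient.eq _).2 ⟨V.proj (n - 1) b, ?_⟩
      have hm : (Submodule.Quotient.mk ⟨a, ha⟩ : Coh V d) ∈ cohGr V d n := ⟨⟨a, ha⟩, han, rfl⟩
      have h₁ := hi n _ hm
      rw [add_zero] at h₁
      have h₂ : V.proj n a = a := proj_same V han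
      change d (V.proj (n - 1) b) = i (Submodule.Quotient.mk ⟨a, ha⟩) - a
      have h₃ : V.proj n (d b)
          = V.proj n (((LinearMap.ker d).subtype ∘ₗ i₀) (Submodule.Quotient.mk ⟨a, ha⟩))
            - V.proj n a := by
        rw [hb, map_sub, map_sub]
        rfl
      rw [h₁, d_proj hd, sub_add_cancel, h₃, h₂]
  -- the projection to cocycles
  let z : V →ₗ[k] V := LinearMap.id - s ∘ₗ d
  have hz : ∀ a, z a = a - s (d a) := fun a => rfl
  have dz : ∀ a, z a ∈ LinearMap.ker d := fun a => by
    rw [LinearMap.mem_ker, hz, map_sub, dsd, sub_self]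
  let p : V →ₗ[k] Coh V d := Submodule.mkQ _ ∘ₗ z.codRestrict (LinearMap.ker d) dz
  have p_of : ∀ a (ha : d a = 0), p a = Submodule.Quotient.mk ⟨a, LinearMap.mem_ker.2 ha⟩ := by
    intro a ha
    change (Submodule.Quotient.mk (⟨z a, dz a⟩ : LinearMap.ker d) : Coh V d) = _
    congr 2
    rw [hz, ha, map_zero, sub_zero]
  have p_i : ∀ x, p (i x) = x := fun x => by
    rw [p_of _ (d_i x)]
    exact congrArg (fun f => f x) rep
  have p_d : ∀ a, p (d a) = 0 := fun a => by
    rw [p_of _ (dd a)]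
    exact (Submodule.Quotient.mk_eq_zero _).2 ⟨a, rfl⟩
  have z_d : ∀ a, z (d a) = d a := fun a => by rw [hz, dd, map_zero, sub_zero]
  have z_i : ∀ x, z (i x) = i x := fun x => by rw [hz, d_i, map_zero, sub_zero]
  have z_s_d : ∀ a, z (s (d a)) = 0 := fun a => by rw [hz, dsd, sub_self]
  have p_z : ∀ a, z a = 0 → p a = 0 := fun a ha => by
    change (Submodule.Quotient.mk (⟨z a, dz a⟩ : LinearMap.ker d) : Coh V d) = 0
    rw [Submodule.Quotient.mk_eq_zero]
    exact ⟨0, by simp [ha]⟩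
  -- `z - i p` takes values in the image of `d`
  have exact_ : ∀ a, ∃ b, d b = z a - i (p a) := fun a => by
    have e : p a = p (z a) := by
      rw [p_of _ (dz a)]; rfl
    have e' : (Submodule.Quotient.mk ⟨z a, dz a⟩ : Coh V d)
        = Submodule.Quotient.mk ⟨i (p a), LinearMap.mem_ker.2 (d_i _)⟩ :=
      (congrArg (fun f => f (p a)) rep).symm
    obtain ⟨b, hb⟩ := (Submodule.Quotient.eq _).1 e'
    exact ⟨b, hb⟩
  let h : V →ₗ[k] V := - (s ∘ₗ (z - i ∘ₗ p))
  have hh : ∀ a, h a = - s (z a - i (p a)) := fun a => rfl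
  have z_h : ∀ a, z (h a) = 0 := fun a => by
    obtain ⟨b, hb⟩ := exact_ a
    rw [hh, ← hb, map_neg, z_s_d, neg_zero]
  have i_deg : ∀ n, ∀ x ∈ cohGr V d n, i x ∈ V.gr n := fun n x hx => by
    have h₁ := hi n x hx
    rw [add_zero] at h₁
    rw [h₁]
    exact proj_mem V _ _
  have z_deg : ∀ n, ∀ a ∈ V.gr n, z a ∈ V.gr n := fun n a ha =>
    sub_mem ha (by simpa using s_degree _ _ (hd n a ha))
  have p_deg : ∀ n, ∀ a ∈ V.gr n, p a ∈ cohGr V d n := fun n a ha =>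
    ⟨⟨z a, dz a⟩, z_deg n a ha, rfl⟩
  have h_i : ∀ x : Coh V d, h (i x) = 0 := fun x => by
    rw [hh, z_i, p_i, sub_self, map_zero, neg_zero]
  have homotopy : ∀ a, i (p a) - a = d (h a) + h (d a) := fun a => by
    obtain ⟨b, hb⟩ := exact_ a
    rw [hh, hh, z_d, p_d, map_zero, sub_zero, ← hb, map_neg, dsd, hb, hz]
    abel
  refine ⟨⟨i, p, h, i_deg, p_deg, fun n a ha =>
    neg_mem (s_degree n _ (sub_mem (z_deg n a ha) (i_deg n _ (p_deg n a ha)))), d_i, p_d, p_i,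
    h_i, fun a => p_z _ (z_h a), fun a => ?_, homotopy⟩,
    fun x => ⟨d_i x, congrArg (fun f => f x) rep⟩, p_of⟩
  rw [hh, z_h, p_z _ (z_h a), map_zero, sub_zero, map_zero, neg_zero]

end GrVect

/-! ### Minimal models of `A∞`-categories -/

section Bar

variable {k : Type u} [Field k] {Ob : Type u'} {H H' H'' : Quiv.{u, u', v} k Ob}

open Quiv Word

namespace Op

variable {F G T T' : Op H H'} {d : ℤ} {X Y Z : Ob}

/-- The composition of an operation with a linear map. -/
def post (l : ∀ X Y, H' X Y →ₗ[k] H'' X Y) (f : Op H H') : Op H H'' :=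
  fun X Y w => l X Y (f X Y w)

/-- The terms of an operation other than the linear part. -/
def higher (f : Op H H') : Op H H' := fun X Y w => if w.length = 1 then 0 else f X Y w

theorem post_multilinear (l : ∀ X Y, H' X Y →ₗ[k] H'' X Y) {f : Op H H'} (hf : f.IsMultilinear) :
    (post l f).IsMultilinear := isMultilinear_of_mlin fun X Z =>
  MLin.comp_linearMap (l X Z) (hf.mlin X Z)

theorem add_multilinear (hF : F.IsMultilinear) (hG : G.IsMultilinear) :
    IsMultilinear (fun X Y w => F X Y w + G X Y w) := isMultilinear_of_mlin fun X Z =>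
  (hF.mlin X Z).add (hG.mlin X Z)

theorem sub_multilinear (hF : F.IsMultilinear) (hG : G.IsMultilinear) :
    IsMultilinear (fun X Y w => F X Y w - G X Y w) := isMultilinear_of_mlin fun X Z =>
  (hF.mlin X Z).sub (hG.mlin X Z)

/-- Coefficients that only depend on the length of the word. -/
theorem smul_length_multilinear (c : ℕ → k) (hF : F.IsMultilinear) :
    IsMultilinear (fun X Y w => c w.length • F X Y w) := fun X Y Z W p q => by
  have e : ∀ a : H Y Z, (p.append (.cons a q)).length = p.length + (q.length + 1) := by simp
  simp only [e]
  exact ⟨fun a b => by rw [(hF X Y Z W p q).map_add, smul_add],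
    fun s a => by rw [(hF X Y Z W p q).map_smul, smul_comm]⟩

theorem higher_eq (f : Op H H') :
    higher f = fun X Y w => (if w.length = 1 then (0 : k) else 1) • f X Y w := by
  funext X Y w
  simp only [higher, ite_smul, zero_smul, one_smul]

theorem higher_multilinear (hF : F.IsMultilinear) : (higher F).IsMultilinear := by
  rw [higher_eq]
  exact smul_length_multilinear (fun n => if n = 1 then 0 else 1) hF

theorem HasDegree.post {f : Op H H'} {e : ℤ} (hf : f.HasDegree d)
    {l : ∀ X Y, H' X Y →ₗ[k] H'' X Y}
    (hl : ∀ X Y n, ∀ a ∈ (H' X Y).gr n, l X Y a ∈ (H'' X Y).gr (n + e)) :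
    (post l f).HasDegree (d + e) := fun X Y w n hw => by
  rw [← add_assoc]
  exact hl X Y _ _ (hf X Y w n hw)

theorem HasDegree.smul_length (hF : F.HasDegree d) (c : ℕ → k) :
    HasDegree d (fun X Y w => c w.length • F X Y w) := fun X Y w n hw =>
  Submodule.smul_mem _ _ (hF X Y w n hw)

theorem HasDegree.higher (hF : F.HasDegree d) : (higher F).HasDegree d := by
  rw [higher_eq]
  exact hF.smul_length fun n => if n = 1 then 0 else 1

@[simp] theorem higher_single (f : Op H H') (a : H X Y) : higher f X Y (.cons a .nil) = 0 := rfl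

@[simp] theorem higher_nil (f : Op H H') : higher f X X .nil = f X X .nil := rfl

@[simp] theorem higher_cons_cons (f : Op H H') {X' : Ob} (a : H Y Z) (b : H X' Y) (w : H.Wd X X') :
    higher f X Z (.cons a (.cons b w)) = f X Z (.cons a (.cons b w)) := by
  simp [higher]

theorem eq_linear_add_higher {f : Op H H'} {l : ∀ X Y, H X Y →ₗ[k] H' X Y}
    (hl : ∀ X Y a, f X Y (.cons a .nil) = l X Y a) (X Y : Ob) (w : H.Wd X Y) :
    f X Y w = linear l X Y w + higher f X Y w := by
  match w with
  | .nil => simp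
  | .cons a .nil => simp [hl]
  | .cons a (.cons b w) => simp

theorem map_linear_eq_zero {l : ∀ X Y, H X Y →ₗ[k] H' X Y} {l' : ∀ X Y, H' X Y →ₗ[k] H'' X Y}
    (h : ∀ X Y a, l' X Y (l X Y a) = 0) (X Y : Ob) (w : H.Wd X Y) :
    l' X Y (linear l X Y w) = 0 := by
  match w with
  | .nil => simp
  | .cons a .nil => simp [h]
  | .cons a (.cons b w) => simp

theorem pb_eq_linear_add {f : Op H' H''} {l : ∀ X Y, H' X Y →ₗ[k] H'' X Y}
    (hl : ∀ X Y a, f X Y (.cons a .nil) = l X Y a) (hF : ∀ X, F X X .nil = 0) (X Y : Ob)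
    (w : H.Wd X Y) : pb F f X Y w = l X Y (F X Y w) + pb F (higher f) X Y w := by
  rw [pb, funext (eq_linear_add_higher hl X Y), barSum_add, barSum_linear l hF]
  rfl

theorem along_eq_linear_add {f : Op H' H''} {l : ∀ X Y, H' X Y →ₗ[k] H'' X Y}
    (hl : ∀ X Y a, f X Y (.cons a .nil) = l X Y a) (d : ℤ) (F T : Op H H') (X Y : Ob)
    (w : H.Wd X Y) :
    along d F T f X Y w = l X Y (T X Y w) + along d F T (higher f) X Y w := by
  rw [along, funext (eq_linear_add_higher hl X Y), alongSum_add, alongSum_linear]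
  rfl

theorem along_post {H₃ : Quiv.{u, u', v} k Ob} (l : ∀ X Y, H'' X Y →ₗ[k] H₃ X Y) (f : Op H' H'')
    (F T : Op H H') (d : ℤ) (X Y : Ob) (w : H.Wd X Y) :
    along d F T (post l f) X Y w = l X Y (along d F T f X Y w) :=
  (map_alongSum F T d (l X Y) (f X Y) w).symm

theorem ins_eq {f : Op H H'} (hf : f.IsMultilinear) (g : Op H H) (d : ℤ) (X Y : Ob)
    (w : H.Wd X Y) : Op.ins d f g X Y w = along d (idOp H) g f X Y w :=
  congrArg (fun φ => φ w) (insSum_eq g (hf.mlin X Y))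

theorem along_congr_of_single {f : Op H' H''} (hf : ∀ a, f X Y (.cons a .nil) = 0) (w : H.Wd X Y)
    (h : ∀ {Y Y' : Ob} (u : H.Wd Y Y'), u.length < w.length → T Y Y' u = T' Y Y' u) :
    along d F T f X Y w = along d F T' f X Y w := alongSum_congr_of_single hf w h

theorem along_eq_zero_of_single {f : Op H' H''} (hfm : f.IsMultilinear)
    (hf : ∀ X Y a, f X Y (.cons a .nil) = 0) (w : H.Wd X Y)
    (h : ∀ {Y Y' : Ob} (u : H.Wd Y Y'), u.length < w.length → T Y Y' u = 0) :
    along d F T f X Y w = 0 := by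
  rw [along_congr_of_single (T' := fun _ _ _ => 0) (hf X Y) w h]
  exact alongSum_T_zero (hfm.mlin X Y) w

/-- If `g` vanishes on words with at most one letter, then inserting `g` into a functional only
uses the values of the functional on shorter words. -/
theorem along_idOp_congr_of_short {f f' : Op H H'} {g : Op H H} (hfm : f.IsMultilinear)
    (hfm' : f'.IsMultilinear) (h0 : ∀ X, g X X .nil = 0) (h1 : ∀ X Y a, g X Y (.cons a .nil) = 0)
    (w : H.Wd X Y)
    (h : ∀ X Y (u : H.Wd X Y), u.length < w.length → f X Y u = f' X Y u) :
    along d (idOp H) g f X Y w = along d (idOp H) g f' X Y w := by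
  simp only [along, ← insSum_eq _ (hfm.mlin X Y), ← insSum_eq _ (hfm'.mlin X Y), insSum_def]
  refine splitSum_congr w fun Y p r _ hl => splitSum_congr r fun Y' r₁ q _ hl' => ?_
  cases r₁ with
  | nil => rw [h0, (hfm.mlin _ _ _ _).map_zero, (hfm'.mlin _ _ _ _).map_zero]
  | cons a r₁ =>
    cases r₁ with
    | nil => rw [h1, (hfm.mlin _ _ _ _).map_zero, (hfm'.mlin _ _ _ _).map_zero]
    | cons b r₁ => exact h _ _ _ (by simp at hl hl' ⊢; omega)

/-- If `f` vanishes on single letters and `g`, `g'` on empty words, then the insertion of `g` into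
`f` only uses the values of `g` on shorter words. -/
theorem pb_congr_of_single {f : Op H' H''} (hf : ∀ a, f X Y (.cons a .nil) = 0) (w : H.Wd X Y)
    (h : ∀ {Y Y' : Ob} (u : H.Wd Y Y'), 0 < u.length → u.length < w.length →
      F Y Y' u = G Y Y' u) : pb F f X Y w = pb G f X Y w :=
  barSum_congr_of_single hf w h

/-- A minimal model of the `A∞`-structure `μ` on `H'`: an `A∞`-structure `ν` on `H`, with no linear
part, and an `A∞`-functor `F` from it which extends the inclusion of a contraction. -/
structure MinimalModel {dH : ∀ X Y, H' X Y →ₗ[k] H' X Y}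
    (c : ∀ X Y, GrVect.Contraction (H X Y) (H' X Y) (dH X Y)) (μ : Op H' H') where
  F : Op H H'
  ν : Op H H
  F_multilinear : F.IsMultilinear
  F_degree : F.HasDegree 1
  F_nil : ∀ X, F X X .nil = 0
  F_single : ∀ X Y x, F X Y (.cons x .nil) = (c X Y).i x
  p_F : ∀ X Y w, (c X Y).p (F X Y w) = idOp H X Y w
  h_F : ∀ X Y w, (c X Y).h (F X Y w) = 0
  ν_multilinear : ν.IsMultilinear
  ν_degree : ν.HasDegree 2
  ν_nil : ∀ X, ν X X .nil = 0
  ν_single : ∀ X Y x, ν X Y (.cons x .nil) = 0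
  ν_two : ∀ X Y Z (x : H Y Z) (y : H X Y), ν X Z (.cons x (.cons y .nil))
    = (c X Z).p (μ X Z (.cons ((c Y Z).i x) (.cons ((c X Y).i y) .nil)))
  functor : pb F μ = along 1 (idOp H) ν F
  rel : ∀ X Y w, along 1 (idOp H) ν ν X Y w = 0
  d_d : ∀ X Y a, dH X Y (dH X Y a) = 0

/-- The linear part of an `A∞`-structure is a differential. -/
theorem linear_linear_eq_zero {μ : Op H H} (hμ : μ.IsMultilinear) (h0 : ∀ X, μ X X .nil = 0)
    {l : ∀ X Y, H X Y →ₗ[k] H X Y} (h1 : ∀ X Y a, μ X Y (.cons a .nil) = l X Y a)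
    (rel : ∀ X Y w, along 1 (idOp H) μ μ X Y w = 0) (X Y : Ob) (a : H X Y) :
    l X Y (l X Y a) = 0 := by
  have := rel X Y (.cons a .nil)
  rw [along_eq_linear_add h1, h1, along_eq_zero_of_single (higher_multilinear hμ)
    (fun X Y a => higher_single μ a), add_zero] at this
  · exact this
  · intro Y Y' u hu
    cases u with
    | nil => exact h0 _
    | cons a u => simp at hu

/-- Every contraction extends to a minimal model. The functor `F` solves `F = i + h ∘ U` and the
operations on the model are `ν = p ∘ U`, where `U = μ_{≥2}(F, …, F)` is the sum over at least two
blocks; as `U` involves only shorter words, this determines `F`. The defect of the functor equation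
solves the homogeneous linear equation of the same kind, so that it vanishes. -/
theorem exists_minimalModel {dH : ∀ X Y, H' X Y →ₗ[k] H' X Y}
    (c : ∀ X Y, GrVect.Contraction (H X Y) (H' X Y) (dH X Y)) {μ : Op H' H'}
    (hμ : μ.IsMultilinear) (hd : μ.HasDegree 2) (h0 : ∀ X, μ X X .nil = 0)
    (h1 : ∀ X Y a, μ X Y (.cons a .nil) = dH X Y a)
    (rel : ∀ X Y w, along 1 (idOp H') μ μ X Y w = 0) : Nonempty (MinimalModel c μ) := by
  have hm₂ : (higher μ).IsMultilinear := higher_multilinear hμ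
  have dd := linear_linear_eq_zero hμ h0 h1 rel
  -- `F` is defined by recursion on the length: `higher μ` vanishes on words with one letter, so
  -- that `F` enters the right hand side only on shorter words
  obtain ⟨F, hF, hFd, hfix⟩ := Op.exists_fixedPoint 1
    (fun F => fun X Y w => linear (fun X Y => (c X Y).i) X Y w
      + post (fun X Y => (c X Y).h) (pb F (higher μ)) X Y w)
    (fun F hF hFd => ⟨add_multilinear (linear_multilinear _) (post_multilinear _
      (pb_multilinear hm₂ hF)),
      (HasDegree.linear 0 fun X Y n a ha => by simpa using (c X Y).i_degree n a ha).add
        ((hd.higher.pb hFd).post (e := -1) fun X Y n a ha => (c X Y).h_degree n a ha)⟩)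
    (fun f g _ _ X Y w h => by
      simp only [post]
      rw [pb_congr_of_single (fun a => higher_single μ a) w fun u _ hu => h _ _ u hu])
  set U : Op H H' := pb F (higher μ) with hU
  have hF' : ∀ X Y w, F X Y w = linear (fun X Y => (c X Y).i) X Y w + (c X Y).h (U X Y w) :=
    fun X Y w => congrFun (congrFun (congrFun hfix.symm X) Y) w
  have hFe : F = fun X Y w => linear (fun X Y => (c X Y).i) X Y w
      + post (fun X Y => (c X Y).h) U X Y w := hfix.symm
  have hUm : U.IsMultilinear := pb_multilinear hm₂ hF
  have hU0 : ∀ X, U X X .nil = 0 := fun X => by simp [hU, pb, h0]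
  have hU1 : ∀ X Y x, U X Y (.cons x .nil) = 0 := fun X Y x => by simp [hU, pb, barSum_cons]
  have hF0 : ∀ X, F X X .nil = 0 := fun X => by rw [hF', hU0]; simp
  have hF1 : ∀ X Y x, F X Y (.cons x .nil) = (c X Y).i x := fun X Y x => by rw [hF', hU1]; simp
  have hFk : KosComm F := (hFd.kosDeg (t := 0) hF (by ring)).kosComm
  set ν : Op H H := post (fun X Y => (c X Y).p) U with hν
  have hνm : ν.IsMultilinear := post_multilinear _ hUm
  have e₁ : ∀ X Y w, pb F μ X Y w = dH X Y (F X Y w) + U X Y w := pb_eq_linear_add h1 hF0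
  have e₃ : ∀ X Y w, along 1 (idOp H) ν F X Y w
      = (c X Y).i (ν X Y w) + (c X Y).h (along 1 (idOp H) ν U X Y w) := fun X Y w => by
    rw [← along_post (fun X Y => (c X Y).h) U, ← alongSum_linear (F := idOp H) (T := ν) (d := 1)
      (fun X Y => (c X Y).i), along, along, ← alongSum_add]
    exact congrArg (fun f : Op H H' => alongSum 1 (idOp H) ν (f X Y) w) hFe
  -- the defect of the functor equation; `e₄` computes it with the homotopy identity, and `e₅` is
  -- the relation `μ ∘ μ = 0`, pulled back along `F`
  set Φ : Op H H' := fun X Y w => pb F μ X Y w - along 1 (idOp H) ν F X Y w with hΦ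
  have e₄ : ∀ X Y w, Φ X Y w
      = - (c X Y).h (dH X Y (U X Y w) + along 1 (idOp H) ν U X Y w) := fun X Y w => by
    have := (c X Y).homotopy (U X Y w)
    simp only [hΦ, e₁, e₃, hF' X Y w, map_add]
    rw [map_linear_eq_zero (fun X Y => (c X Y).d_i) X Y w,
      eq_sub_of_add_eq this.symm]
    simp only [hν, post]
    abel
  have e₅ : ∀ X Y w, dH X Y (U X Y w) + along 1 (idOp H) ν U X Y w
      + along 1 F Φ (higher μ) X Y w = 0 := fun X Y w => by
    have b := barSum_alongSum (G := F) (T := μ) (d := 1) idOp_nil (hμ.mlin X Y) w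
    rw [pb_idOp hF0, show alongSum 1 (idOp H') μ (μ X Y) = fun _ => 0 from funext (rel X Y),
      barSum_zero, show pb F μ = fun X Y w => Φ X Y w + along 1 (idOp H) ν F X Y w by
        funext X Y w; simp [hΦ], alongSum_T_add (hμ.mlin X Y),
      show alongSum 1 F (along 1 (idOp H) ν F) (μ X Y) w = along 1 (idOp H) ν (pb F μ) X Y w by
        rw [along, pb, alongSum_barSum_self hF0 hFk (hμ.mlin X Y), idOp_pb hF]] at b
    have b₁ := along_eq_linear_add h1 1 F Φ X Y w
    have b₂ : along 1 (idOp H) ν (pb F μ) X Y w = dH X Y (along 1 (idOp H) ν F X Y w)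
        + along 1 (idOp H) ν U X Y w := by
      rw [← along_post]
      simp only [along, ← alongSum_add]
      rw [funext (e₁ X Y)]
      rfl
    have b₃ : dH X Y (Φ X Y w) = dH X Y (U X Y w) - dH X Y (along 1 (idOp H) ν F X Y w) := by
      rw [hΦ, map_sub, e₁, map_add, dd, zero_add]
    rw [b₂, show alongSum 1 F Φ (μ X Y) w = along 1 F Φ μ X Y w from rfl, b₁, b₃] at b
    rw [b]
    abel
  -- the defect on a word is expressed through the defect on shorter words
  have e₆ : ∀ X Y w, Φ X Y w = (c X Y).h (along 1 F Φ (higher μ) X Y w) := fun X Y w => by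
    rw [e₄, ← map_neg, eq_neg_of_add_eq_zero_right (e₅ X Y w)]
  have hΦ0 : ∀ n X Y (w : H.Wd X Y), w.length = n → Φ X Y w = 0 := by
    intro n
    induction n using Nat.strong_induction_on with
    | _ n ih =>
      intro X Y w hw
      rw [e₆, along_eq_zero_of_single hm₂ (fun X Y a => higher_single μ a) w
        fun u hu => ih _ (hw ▸ hu) _ _ u rfl, map_zero]
  have hf : ∀ X Y w, pb F μ X Y w = along 1 (idOp H) ν F X Y w := fun X Y w =>
    sub_eq_zero.1 (hΦ0 _ X Y w rfl)
  refine ⟨{ F := F, ν := ν, F_multilinear := hF, F_degree := hFd, F_nil := hF0, F_single := hF1,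
            ν_multilinear := hνm, p_F := fun X Y w => ?_,
            h_F := fun X Y w => by
              rw [hF', map_add, map_linear_eq_zero (fun X Y => (c X Y).h_i), (c X Y).h_h, add_zero],
            ν_degree := (hd.higher.pb hFd).post (e := 0) fun X Y n a ha => by
              simpa using (c X Y).p_degree n a ha,
            ν_nil := fun X => by simp [hν, post, hU0],
            ν_single := fun X Y x => by simp [hν, post, hU1],
            ν_two := fun X Y Z x y => ?_,
            functor := funext fun X => funext fun Y => funext (hf X Y),
            rel := fun X Y w => ?_, d_d := dd }⟩
  · rw [hF', map_add, (c X Y).p_h, add_zero]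
    match w with
    | .nil => simp [idOp]
    | .cons a .nil => simp [idOp, (c _ _).p_i]
    | .cons a (.cons b w) => simp [idOp]
  · simp [hν, post, hU, pb, barSum_cons, splitSum_cons, hF1]
  · have h := e₅ X Y w
    rw [along_eq_zero_of_single hm₂ (fun X Y a => higher_single μ a) w
        fun u hu => hΦ0 _ _ _ u rfl, add_zero] at h
    have e := along_post (fun X Y => (c X Y).p) U (idOp H) ν 1 X Y w
    rw [eq_neg_of_add_eq_zero_right h, map_neg, (c X Y).p_d, neg_zero] at e
    exact e

end Op
end Bar

/-! ### Transfer of nc-vector fields to minimal models -/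

section Bar

variable {k : Type u} [Field k] {Ob : Type u'} {H H' H'' H₃ : Quiv.{u, u', v} k Ob}

open Quiv Word

namespace Op

variable {F G T T' : Op H H'} {d : ℤ} {X Y Z : Ob}

theorem along_add (f f' : Op H' H'') (w : H.Wd X Y) :
    along d F T (fun X Y w => f X Y w + f' X Y w) X Y w
      = along d F T f X Y w + along d F T f' X Y w := alongSum_add _ _ _ _ _ _

theorem along_smul (s : k) (f : Op H' H'') (w : H.Wd X Y) :
    along d F T (fun X Y w => s • f X Y w) X Y w = s • along d F T f X Y w :=
  alongSum_smul _ _ _ _ _ _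

theorem along_sub (f f' : Op H' H'') (w : H.Wd X Y) :
    along d F T (fun X Y w => f X Y w - f' X Y w) X Y w
      = along d F T f X Y w - along d F T f' X Y w := by
  have := along_add (d := d) (F := F) (T := T) f (fun X Y w => (-1 : k) • f' X Y w) w
  rw [along_smul] at this
  simpa only [neg_smul, one_smul, ← sub_eq_add_neg] using this

theorem along_T_add {f : Op H' H''} (hf : f.IsMultilinear) (w : H.Wd X Y) :
    along d F (fun X Y w => T X Y w + T' X Y w) f X Y w
      = along d F T f X Y w + along d F T' f X Y w := alongSum_T_add (hf.mlin X Y) w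

theorem along_T_sub {f : Op H' H''} (hf : f.IsMultilinear) (w : H.Wd X Y) :
    along d F (fun X Y w => T X Y w - T' X Y w) f X Y w
      = along d F T f X Y w - along d F T' f X Y w := alongSum_T_sub (hf.mlin X Y) w

theorem pb_add (f f' : Op H' H'') (w : H.Wd X Y) :
    pb F (fun X Y w => f X Y w + f' X Y w) X Y w = pb F f X Y w + pb F f' X Y w :=
  barSum_add _ _ _ _

theorem pb_pb {G : Op H H'} {F : Op H' H''} (hF : ∀ X, F X X .nil = 0) {f : Op H'' H₃}
    (hf : f.IsMultilinear) : pb G (pb F f) = pb (pb G F) f :=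
  funext fun X => funext fun Y => funext fun w => barSum_barSum hF (hf.mlin X Y) w

theorem pb_along {G : Op H H'} {F T : Op H' H''} (hF : ∀ X, F X X .nil = 0) {f : Op H'' H₃}
    (hf : f.IsMultilinear) : pb G (along d F T f) = along d (pb G F) (pb G T) f :=
  funext fun X => funext fun Y => funext fun w => barSum_alongSum hF (hf.mlin X Y) w

theorem along_pb {G T : Op H H'} {F : Op H' H''} (hF : ∀ X, F X X .nil = 0) (hk : KosComm F)
    {f : Op H'' H₃} (hf : f.IsMultilinear) :
    along d G T (pb F f) = along d (pb G F) (along d G T F) f :=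
  funext fun X => funext fun Y => funext fun w => alongSum_barSum_self hF hk (hf.mlin X Y) w

theorem along_commutator {μ : Op H' H'} {ν : Op H H} {t m : ℤ}
    (hF0 : ∀ X, F X X .nil = 0) (hF : F.IsMultilinear) (hFk : KosComm F)
    (hT : T.IsMultilinear) (hTk : KosDeg t T) (hμk : KosDeg m μ)
    (hFν : pb F μ = along m (idOp H) ν F) {f : Op H' H''} (hf : f.IsMultilinear) (w : H.Wd X Y) :
    along t F T (along m (idOp H') μ f) X Y w
        - (-1 : k) ^ (t * m) • along m (idOp H) ν (along t F T f) X Y w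
      = along (t + m) F (fun X Y w => along t F T μ X Y w
          - (-1 : k) ^ (t * m) • along m (idOp H) ν T X Y w) f X Y w :=
  alongSum_commutator hF0 hF hFk hT hTk hμk hFν (hf.mlin X Y) w

theorem along_idOp : along d F T (idOp H') = T :=
  funext fun _ => funext fun _ => funext fun w => alongSum_idOp_apply w

theorem along_commutator_idOp {T ν : Op H H} {t m : ℤ} (hT : T.IsMultilinear) (hTk : KosDeg t T)
    (hν : ν.IsMultilinear) (hνk : KosDeg m ν) {f : Op H H''} (hf : f.IsMultilinear)
    (w : H.Wd X Y) :
    along t (idOp H) T (along m (idOp H) ν f) X Y w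
        - (-1 : k) ^ (t * m) • along m (idOp H) ν (along t (idOp H) T f) X Y w
      = along (t + m) (idOp H) (fun X Y w => along t (idOp H) T ν X Y w
          - (-1 : k) ^ (t * m) • along m (idOp H) ν T X Y w) f X Y w :=
  along_commutator idOp_nil idOp_multilinear kosComm_idOp hT hTk hνk
    ((idOp_pb hν).trans along_idOp.symm) hf w

theorem along_eq_zero {f : Op H' H''} (hf : f.IsMultilinear) (hT : ∀ X Y w, T X Y w = 0)
    (w : H.Wd X Y) : along d F T f X Y w = 0 := by
  rw [show T = fun _ _ _ => 0 from funext fun X => funext fun Y => funext fun w => hT X Y w]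
  exact alongSum_T_zero (hf.mlin X Y) w

theorem eq_zero_along {f : Op H' H''} (hf : ∀ X Y w, f X Y w = 0)
    (w : H.Wd X Y) : along d F T f X Y w = 0 := by
  rw [show f = fun _ _ _ => 0 from funext fun X => funext fun Y => funext fun w => hf X Y w]
  exact alongSum_zero _ _ _ w

/-- The bar differential of an `A∞`-structure squares to zero. -/
theorem along_along_eq_zero [CharZero k] {ν : Op H H} (hν : ν.IsMultilinear) (hd : ν.HasDegree 2)
    (rel : ∀ X Y w, along 1 (idOp H) ν ν X Y w = 0) {f : Op H H'} (hf : f.IsMultilinear)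
    (w : H.Wd X Y) : along 1 (idOp H) ν (along 1 (idOp H) ν f) X Y w = 0 := by
  have hk := hd.kosDeg hν (t := 1) (by ring)
  have := along_commutator_idOp hν hk hν hk hf w
  simp only [rel, smul_zero, sub_zero] at this
  rw [along_eq_zero hf fun _ _ _ => rfl, show (-1 : k) ^ ((1 : ℤ) * 1) = -1 by simp, neg_one_smul,
    sub_neg_eq_add, ← two_smul k] at this
  exact (smul_eq_zero.1 this).resolve_left two_ne_zero

/-- The terms of an operation other than the one without inputs. -/
def offNil (f : Op H H') : Op H H' := fun X Y w => if w.length = 0 then 0 else f X Y w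

theorem offNil_eq (f : Op H H') :
    offNil f = fun X Y w => (if w.length = 0 then (0 : k) else 1) • f X Y w := by
  funext X Y w
  simp only [offNil, ite_smul, zero_smul, one_smul]

theorem offNil_multilinear (hF : F.IsMultilinear) : (offNil F).IsMultilinear := by
  rw [offNil_eq]
  exact smul_length_multilinear (fun n => if n = 0 then 0 else 1) hF

theorem HasDegree.offNil (hF : F.HasDegree d) : (offNil F).HasDegree d := by
  rw [offNil_eq]
  exact hF.smul_length fun n => if n = 0 then 0 else 1

@[simp] theorem offNil_nil (f : Op H H') : offNil f X X .nil = 0 := rfl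

@[simp] theorem offNil_cons (f : Op H H') (a : H Y Z) (w : H.Wd X Y) :
    offNil f X Z (.cons a w) = f X Z (.cons a w) := rfl

/-- The operation with the given term without inputs, and no other terms. -/
def ofNil (c : ∀ X, H' X X) : Op H H' := fun _ _ w =>
  match w with
  | .nil => c _
  | .cons _ _ => 0

@[simp] theorem ofNil_nil (c : ∀ X, H' X X) : ofNil (H := H) c X X .nil = c X := rfl

@[simp] theorem ofNil_cons (c : ∀ X, H' X X) (a : H Y Z) (w : H.Wd X Y) :
    ofNil c X Z (.cons a w) = 0 := rfl

theorem ofNil_multilinear (c : ∀ X, H' X X) : (ofNil (H := H) c).IsMultilinear := by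
  intro X Y Z W p q
  cases p with
  | nil => exact ⟨fun _ _ => by simp, fun _ _ => by simp⟩
  | cons a p => exact ⟨fun _ _ => by simp, fun _ _ => by simp⟩

theorem ofNil_hasDegree {c : ∀ X, H' X X} (hc : ∀ X, c X ∈ (H' X X).gr d) :
    (ofNil (H := H) c).HasDegree d := by
  intro X Y w n hw
  cases w with
  | nil => rw [show n = 0 from hw, zero_add]; exact hc X
  | cons a w => exact zero_mem _

/-- The data on a minimal model that corresponds to an nc-vector field `b`: a vector field `bH` and
a homotopy `T`, given by `cc` on objects, between its push-forward and the pullback of `b`. -/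
structure TransferredField (F : Op H H') (ν : Op H H) (b : Op H' H')
    (cc : ∀ X, H' X X) (μ : Op H' H') where
  T : Op H H'
  bH : Op H H
  T_multilinear : T.IsMultilinear
  T_degree : T.HasDegree 0
  T_nil : ∀ X, T X X .nil = cc X
  bH_multilinear : bH.IsMultilinear
  bH_degree : bH.HasDegree 1
  bH_nil : ∀ X, bH X X .nil = 0
  homotopy : ∀ X Y w, along (-1) F T μ X Y w + along 1 (idOp H) ν T X Y w + pb F b X Y w
    = along 0 (idOp H) bH F X Y w
  closed : ∀ X Y w, along 0 (idOp H) bH ν X Y w = along 1 (idOp H) ν bH X Y w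

/-- Every vector field `b` for which `c` bounds the terms without inputs can be transferred to a
minimal model, and the linear part of the transferred field is given on representatives by `b`,
corrected by the commutator with `c`. The sum `V` of all terms of the homotopy equation, except the
linear ones in the unknowns `T` and `bH`, determines both unknowns: `T = c + h ∘ V` and
`bH = p ∘ V`. Since `V` on a word depends on `T` and `bH` on shorter words, this is a recursion.
The defect of the equation vanishes by the same argument as for the minimal model. -/
theorem exists_transferredField [CharZero k] {dH : ∀ X Y, H' X Y →ₗ[k] H' X Y}
    {c : ∀ X Y, GrVect.Contraction (H X Y) (H' X Y) (dH X Y)} {μ : Op H' H'} (M : MinimalModel c μ)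
    (hμ : μ.IsMultilinear) (hd : μ.HasDegree 2)
    (h1 : ∀ X Y a, μ X Y (.cons a .nil) = dH X Y a)
    (rel : ∀ X Y w, along 1 (idOp H') μ μ X Y w = 0)
    {b : Op H' H'} (hb : b.IsMultilinear) (hbd : b.HasDegree 1)
    (closed : ∀ X Y w, along 0 (idOp H') b μ X Y w = along 1 (idOp H') μ b X Y w)
    {cc : ∀ X, H' X X} (hcc : ∀ X, cc X ∈ (H' X X).gr 0)
    (hcb : ∀ X, dH X X (cc X) = - b X X .nil) :
    ∃ R : TransferredField M.F M.ν b cc μ, ∀ X Y x, R.bH X Y (.cons x .nil) = (c X Y).p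
      (μ X Y (.cons (cc Y) (.cons ((H' X Y).rsgn (-1) ((c X Y).i x)) .nil))
        + μ X Y (.cons ((c X Y).i x) (.cons (cc X) .nil)) + b X Y (.cons ((c X Y).i x) .nil)) := by
  have hF := M.F_multilinear
  have hFd := M.F_degree
  have hF0 := M.F_nil
  have hFk : KosComm M.F := (hFd.kosDeg (t := 0) hF (by ring)).kosComm
  have hν := M.ν_multilinear
  have hνk := M.ν_degree.kosDeg hν (t := 1) (by ring)
  have hm₂ : (higher μ).IsMultilinear := higher_multilinear hμ
  set F := M.F with hFdef
  set ν := M.ν with hνdef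
  have ν0 : ∀ X, ν X X .nil = 0 := M.ν_nil
  have ν1 : ∀ X Y x, ν X Y (.cons x .nil) = 0 := M.ν_single
  -- the homotopy and the vector field determined by `V`; the terms without inputs are prescribed
  let τ : Op H H' → Op H H' := fun V X Y w => ofNil cc X Y w + (c X Y).h (offNil V X Y w)
  let β : Op H H' → Op H H := fun V => post (fun X Y => (c X Y).p) (offNil V)
  have τm : ∀ V : Op H H', V.IsMultilinear → (τ V).IsMultilinear := fun V hV =>
    add_multilinear (ofNil_multilinear cc)
      (post_multilinear (fun X Y => (c X Y).h) (offNil_multilinear hV))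
  have βm : ∀ V : Op H H', V.IsMultilinear → (β V).IsMultilinear := fun V hV =>
    post_multilinear (fun X Y => (c X Y).p) (offNil_multilinear hV)
  have τd : ∀ V : Op H H', V.HasDegree 1 → (τ V).HasDegree 0 := fun V hV =>
    (ofNil_hasDegree hcc).add (hV.offNil.post (e := -1) fun X Y n a ha => (c X Y).h_degree n a ha)
  have βd : ∀ V : Op H H', V.HasDegree 1 → (β V).HasDegree 1 := fun V hV =>
    hV.offNil.post (e := 0) fun X Y n a ha => by simpa using (c X Y).p_degree n a ha
  obtain ⟨V, hV, hVd, hfix⟩ := Op.exists_fixedPoint (H := H) (H' := H') 1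
    (fun V X Y w => along (-1) F (τ V) (higher μ) X Y w + along 1 (idOp H) ν (τ V) X Y w
      + pb F b X Y w - along 0 (idOp H) (β V) (higher F) X Y w)
    (fun V hV hVd => ⟨sub_multilinear (add_multilinear (add_multilinear
      (along_multilinear hm₂ hF (τm V hV)) (along_multilinear (τm V hV) idOp_multilinear hν))
      (pb_multilinear hb hF))
      (along_multilinear (higher_multilinear hF) idOp_multilinear (βm V hV)),
      HasDegree.sub (HasDegree.add (HasDegree.add
        (hd.higher.along hFd (τd V hVd) (by ring) (by ring))
        ((τd V hVd).along idOp_hasDegree M.ν_degree (by ring) (by ring)))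
        (hbd.pb hFd)) (hFd.higher.along idOp_hasDegree (βd V hVd) (by ring) (by ring))⟩)
    (fun V V' hV hV' X Y w h => by
      have h₁ : ∀ X Y (u : H.Wd X Y), u.length < w.length → τ V X Y u = τ V' X Y u :=
        fun X Y u hu => by simp only [τ, offNil, h X Y u hu]
      have h₂ : ∀ X Y (u : H.Wd X Y), u.length < w.length → β V X Y u = β V' X Y u :=
        fun X Y u hu => by simp only [β, post, offNil, h X Y u hu]
      rw [along_congr_of_single (fun a => higher_single μ a) w fun u hu => h₁ _ _ u hu,
        along_congr_of_single (fun a => higher_single F a) w fun u hu => h₂ _ _ u hu,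
        along_idOp_congr_of_short (τm V hV) (τm V' hV') M.ν_nil M.ν_single w h₁])
  set T := τ V with hT
  set bH := β V with hbH
  have Tm : T.IsMultilinear := τm V hV
  have Td : T.HasDegree 0 := τd V hVd
  have bm : bH.IsMultilinear := βm V hV
  have bd : bH.HasDegree 1 := βd V hVd
  have Tk : KosDeg (-1) T := Td.kosDeg Tm (by ring)
  have bk : KosDeg 0 bH := bd.kosDeg bm (by ring)
  have eV : ∀ X Y w, V X Y w = along (-1) F T (higher μ) X Y w + along 1 (idOp H) ν T X Y w
      + pb F b X Y w - along 0 (idOp H) bH (higher F) X Y w := fun X Y w =>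
    congrFun (congrFun (congrFun hfix.symm X) Y) w
  have V0 : ∀ X, V X X .nil = b X X .nil := fun X => by
    rw [eV]
    simp only [along, alongSum_nil, single, higher_single, ν0, pb, barSum_nil]
    rw [(Tm.mlin _ _).cons_zero]
    abel
  -- `Ψ` is the defect of the homotopy equation
  set S : Op H H' := fun X Y w => along (-1) F T μ X Y w + along 1 (idOp H) ν T X Y w with hS
  set Ψ : Op H H' := fun X Y w => S X Y w + pb F b X Y w - along 0 (idOp H) bH F X Y w with hΨ
  have Sm : S.IsMultilinear := add_multilinear
      (along_multilinear hμ hF Tm) (along_multilinear Tm idOp_multilinear hν)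
  have Ψm : Ψ.IsMultilinear := sub_multilinear (add_multilinear Sm
      (pb_multilinear hb hF)) (along_multilinear hF idOp_multilinear bm)
  have e₁ : ∀ X Y w, Ψ X Y w = dH X Y (T X Y w) + V X Y w - (c X Y).i (bH X Y w) := fun X Y w => by
    rw [hΨ, eV]
    simp only [hS]
    rw [along_eq_linear_add h1, along_eq_linear_add M.F_single]
    abel
  have b0 : ∀ X, bH X X .nil = 0 := fun X => map_zero _
  have dd : ∀ X Y a, dH X Y (dH X Y a) = 0 := fun X Y a => M.d_d X Y a
  have T0 : ∀ X, T X X .nil = cc X := fun X => by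
    rw [hT]; simp only [τ, ofNil_nil, offNil_nil, map_zero, add_zero]
  have Vc : ∀ {X Y Z} (a : H Y Z) (w : H.Wd X Y),
      T X Z (.cons a w) = (c X Z).h (V X Z (.cons a w)) :=
    fun a w => by rw [hT]; simp only [τ, ofNil_cons, offNil_cons, zero_add]
  have e₂ : ∀ X Y w, dH X Y (Ψ X Y w) = dH X Y (V X Y w) := fun X Y w => by
    rw [e₁, map_sub, map_add, dd, (c X Y).d_i, zero_add, sub_zero]
  have e₃ : ∀ X Y w, Ψ X Y w = - (c X Y).h (dH X Y (Ψ X Y w)) := fun X Y w => by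
    rw [e₂, e₁]
    cases w with
    | nil =>
      have hb0 : dH X X (b X X .nil) = 0 := by rw [← neg_neg (b X X .nil), ← hcb, map_neg, dd,
        neg_zero]
      rw [b0, V0, T0, hcb, hb0, map_zero, map_zero]
      abel
    | cons a w =>
      have := (c X Y).homotopy (V X Y (.cons a w))
      rw [Vc, show bH X Y (.cons a w) = (c X Y).p (V X Y (.cons a w)) from rfl,
        ← sub_eq_zero, show ∀ x y z t : H' X Y, x + y - z - -t = x + t - (z - y) by intros; abel,
        this, sub_self]
  -- `γ` is the defect of the closedness of `bH`; the graded Jacobi identities relate it to `Ψ`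
  set γ : Op H H := fun X Y w => along 0 (idOp H) bH ν X Y w - along 1 (idOp H) ν bH X Y w with hγ
  have γm : γ.IsMultilinear := sub_multilinear (along_multilinear hν idOp_multilinear bm)
    (along_multilinear bm idOp_multilinear hν)
  have e₄ : ∀ X Y w, along 0 F Ψ μ X Y w - along 1 (idOp H) ν Ψ X Y w
      = - along 1 (idOp H) γ F X Y w := fun X Y w => by
    have a₁ := along_commutator hF0 hF hFk Tm Tk (hd.kosDeg hμ (t := 1) (by ring)) M.functor hμ w
    rw [eq_zero_along rel] at a₁
    simp only [show (-1 : k) ^ ((-1 : ℤ) * 1) = -1 by simp, neg_one_smul, sub_neg_eq_add, zero_add,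
      show (-1 : ℤ) + 1 = 0 by ring] at a₁
    have a₂ : along 0 F (pb F b) μ X Y w = along 1 (idOp H) ν (pb F b) X Y w := by
      have h₁ := pb_along (d := 0) (G := F) (T := b) idOp_nil hμ
      have h₂ := pb_along (d := 1) (G := F) (T := μ) idOp_nil hb
      rw [pb_idOp hF0] at h₁ h₂
      rw [← h₁, along_pb hF0 hFk hb, idOp_pb hF, ← M.functor, ← h₂,
        funext fun X => funext fun Y => funext fun w => closed X Y w]
    have a₃ : along 0 F (along 0 (idOp H) bH F) μ X Y w
        = along 0 (idOp H) bH (along 1 (idOp H) ν F) X Y w := by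
      rw [← M.functor, along_pb hF0 hFk hμ, idOp_pb hF]
    have a₄ := along_commutator_idOp bm bk hν hνk hF w
    simp only [zero_mul, zpow_zero, one_smul, zero_add] at a₄
    have a₅ := along_along_eq_zero hν M.ν_degree M.rel Tm w
    rw [hΨ, along_T_sub hμ, along_T_add hμ, along_sub, along_add, ← a₁, a₂, a₃, hS, along_add, a₅,
      ← a₄]
    abel
  have e₅ : ∀ X Y w, dH X Y (Ψ X Y w) = along 1 (idOp H) ν Ψ X Y w - along 1 (idOp H) γ F X Y w
      - along 0 F Ψ (higher μ) X Y w := fun X Y w => by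
    have h := e₄ X Y w
    rw [along_eq_linear_add h1] at h
    rw [eq_sub_iff_add_eq, sub_eq_add_neg, ← h]
    abel
  have pΨ : ∀ X Y w, (c X Y).p (Ψ X Y w) = 0 := fun X Y w => by
    rw [e₃, map_neg, (c X Y).p_h, neg_zero]
  have hΨ' : ∀ X Y w, (c X Y).h (Ψ X Y w) = 0 := fun X Y w => by
    rw [e₃, map_neg, (c X Y).h_h, neg_zero]
  -- the side conditions `h ∘ Ψ = 0` and `h ∘ F = 0` remove all terms without `higher μ`
  have e₆ : ∀ X Y w, Ψ X Y w = (c X Y).h (along 0 F Ψ (higher μ) X Y w) := fun X Y w => by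
    rw [e₃, e₅, map_sub, map_sub, ← along_post (fun X Y => (c X Y).h) Ψ,
      ← along_post (fun X Y => (c X Y).h) F, eq_zero_along (f := post (fun X Y => (c X Y).h) Ψ) hΨ',
      eq_zero_along (f := post (fun X Y => (c X Y).h) F) M.h_F]
    abel
  have Ψ0 : ∀ n X Y (w : H.Wd X Y), w.length = n → Ψ X Y w = 0 := by
    intro n
    induction n using Nat.strong_induction_on with
    | _ n ih =>
      intro X Y w hw
      rw [e₆, along_eq_zero_of_single hm₂ (fun X Y a => higher_single μ a) w
        fun u hu => ih _ (hw ▸ hu) _ _ u rfl, map_zero]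
  -- `p ∘ F` is the identity, so `p` applied to `e₅` isolates `γ`
  have γ0 : ∀ X Y w, γ X Y w = 0 := fun X Y w => by
    have h := congrArg (c X Y).p (e₅ X Y w)
    rw [(c X Y).p_d, map_sub, map_sub, ← along_post (fun X Y => (c X Y).p) Ψ,
      ← along_post (fun X Y => (c X Y).p) F,
      eq_zero_along (f := post (fun X Y => (c X Y).p) Ψ) pΨ, along_eq_zero hm₂ fun X Y w =>
        Ψ0 _ X Y w rfl, map_zero,
      show post (fun X Y => (c X Y).p) F = idOp H from
        funext fun X => funext fun Y => funext fun w => M.p_F X Y w, along_idOp, zero_sub,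
          sub_zero] at h
    exact neg_eq_zero.1 h.symm
  refine ⟨⟨T, bH, Tm, Td, T0, bm, bd, b0, fun X Y w => sub_eq_zero.1 (Ψ0 _ X Y w rfl),
    fun X Y w => sub_eq_zero.1 (γ0 X Y w)⟩, fun X Y x => ?_⟩
  have F1 : ∀ X Y x, F X Y (.cons x .nil) = (c X Y).i x := M.F_single
  change (c X Y).p (V X Y (.cons x .nil)) = _
  rw [eV]
  congr 1
  simp only [along, alongSum_cons, alongSum_nil, splitSum_cons, splitSum_nil, barSum_nil,
    barSum_cons, single, kos_nil, kos_cons, higher_cons_cons, higher_single, pb, F1, T0, ν0, ν1, b0,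
    (Tm.mlin _ _).cons_zero, (hF.mlin _ _).cons_zero, ((Tm.mlin _ _).tail _).cons_zero,
    ((hF.mlin _ _).tail _).cons_zero]
  abel

end Op
end Bar

/-! ### Formality of `A∞`-categories with a pure vector field -/

section Bar

variable {k : Type u} [Field k] {Ob : Type u'} {H H' H'' H₃ : Quiv.{u, u', v} k Ob}

open Quiv Word

namespace Op

variable {F G T T' : Op H H'} {d : ℤ} {X Y Z : Ob}

/-- The terms of an operation with exactly `n` inputs. -/
def ofLength (n : ℕ) (f : Op H H') : Op H H' := fun X Y w => if w.length = n then f X Y w else 0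

theorem ofLength_eq (n : ℕ) (f : Op H H') :
    ofLength n f = fun X Y w => (if w.length = n then (1 : k) else 0) • f X Y w := by
  funext X Y w
  simp only [ofLength, ite_smul, zero_smul, one_smul]

theorem ofLength_multilinear (n : ℕ) (hF : F.IsMultilinear) : (ofLength n F).IsMultilinear := by
  rw [ofLength_eq]
  exact smul_length_multilinear (fun m => if m = n then 1 else 0) hF

theorem HasDegree.ofLength (n : ℕ) (hF : F.HasDegree d) : (ofLength n F).HasDegree d := by
  rw [ofLength_eq]
  exact hF.smul_length fun m => if m = n then 1 else 0

theorem ext_homogeneous (hF : F.IsMultilinear) (hG : G.IsMultilinear)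
    (h : ∀ X Y (w : H.Wd X Y) n, H.HasRDeg w n → F X Y w = G X Y w) (X Y : Ob) (w : H.Wd X Y) :
    F X Y w = G X Y w :=
  MLin.ext_homogeneous (hF.mlin X Y) (hG.mlin X Y) (fun w n hw => h X Y w n hw) w

theorem euler_of_hasDegree (hF : F.HasDegree d) (w : H.Wd X Y) (n : ℤ) (hw : H.HasRDeg w n) :
    (H' X Y).euler (F X Y w) = ((n : k) + d) • F X Y w := by
  rw [GrVect.euler, GrVect.scale_of_mem _ _ (hF X Y w n hw)]
  push_cast
  rfl

/-- If the linear part of a vector field `b` is the Euler field, then a nonlinear change of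
coordinates transforms it into the Euler field. The terms with `l` inputs of the change of
coordinates are found by dividing by `l - 1`. -/
theorem exists_linearization [CharZero k] {b : Op H H} (hb : b.IsMultilinear)
    (hbd : b.HasDegree 1) (b0 : ∀ X, b X X .nil = 0)
    (b1 : ∀ X Y x, b X Y (.cons x .nil) = (H X Y).euler x) :
    ∃ Θ : Op H H, Θ.IsMultilinear ∧ Θ.HasDegree 1 ∧ (∀ X, Θ X X .nil = 0) ∧
      (∀ X Y x, Θ X Y (.cons x .nil) = x) ∧ pb Θ b = along 0 (idOp H) H.eulerField Θ := by
  have hb₂ := higher_multilinear hb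
  obtain ⟨Θ, hΘ, hΘd, hfix⟩ := Op.exists_fixedPoint (H := H) (H' := H) 1
    (fun Θ X Y w => idOp H X Y w + ((w.length : k) - 1)⁻¹ • pb Θ (higher b) X Y w)
    (fun Θ hΘ hΘd => ⟨add_multilinear idOp_multilinear
      (smul_length_multilinear (fun l => ((l : k) - 1)⁻¹) (pb_multilinear hb₂ hΘ)),
      idOp_hasDegree.add ((hbd.higher.pb hΘd).smul_length fun l => ((l : k) - 1)⁻¹)⟩)
    (fun f g _ _ X Y w h => by
      rw [pb_congr_of_single (fun a => higher_single b a) w fun u _ hu => h _ _ u hu])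
  have e : ∀ X Y w, Θ X Y w = idOp H X Y w + ((w.length : k) - 1)⁻¹ • pb Θ (higher b) X Y w :=
    fun X Y w => congrFun (congrFun (congrFun hfix.symm X) Y) w
  have Θ0 : ∀ X, Θ X X .nil = 0 := fun X => by rw [e, pb, barSum_nil, higher_nil, b0]; simp [idOp]
  refine ⟨Θ, hΘ, hΘd, Θ0, fun X Y x => by rw [e]; simp [idOp],
    funext fun X => funext fun Y => funext fun w => ext_homogeneous (pb_multilinear hb hΘ)
      (along_multilinear hΘ idOp_multilinear eulerField_multilinear) (fun X Y w n hw => ?_) X Y w⟩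
  -- on a word with `l` letters and reduced degree `n`, the Euler field of the target acts on `Θ` by
  -- `n + 1`, and the one of the source by `n + l`
  rw [pb_eq_linear_add b1 Θ0, euler_of_hasDegree hΘd w n hw, along,
    alongSum_eulerField (hΘ.mlin X Y) w n hw]
  by_cases hl : w.length = 1
  · have h0 : pb Θ (higher b) X Y w = 0 := by
      match w, hl with
      | .cons a .nil, _ => simp [pb, barSum_cons]
    rw [h0, hl]
    simp
  · have hl' : (w.length : k) - 1 ≠ 0 := fun h => hl (by
      have : (w.length : k) = (1 : ℕ) := by rw [Nat.cast_one]; exact sub_eq_zero.1 h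
      exact Nat.cast_injective this)
    have h : pb Θ (higher b) X Y w = ((w.length : k) - 1) • Θ X Y w := by
      rw [e, idOp, linear_of_length _ _ hl, zero_add, smul_smul, mul_inv_cancel₀ hl', one_smul]
    rw [h, ← add_smul]
    congr 1
    push_cast
    ring

/-- The Euler field is a derivation of the product, as the product preserves the degree: a word of
reduced degree `n` with two letters has degree `n + 2`. -/
theorem along_eulerField_ofLength_two {ν : Op H H} (hν : ν.IsMultilinear) (hνd : ν.HasDegree 2)
    (w : H.Wd X Y) : along 0 (idOp H) H.eulerField (ofLength 2 ν) X Y w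
      = along 1 (idOp H) (ofLength 2 ν) H.eulerField X Y w := by
  have ν₂m := ofLength_multilinear 2 hν
  refine ext_homogeneous (along_multilinear ν₂m idOp_multilinear eulerField_multilinear)
    (along_multilinear eulerField_multilinear idOp_multilinear ν₂m) (fun X Y w n hw => ?_) X Y w
  rw [along, alongSum_eulerField (ν₂m.mlin X Y) w n hw, eulerField_eq, along,
    alongSum_linear, euler_of_hasDegree (hνd.ofLength 2) w n hw]
  by_cases hl : w.length = 2
  · rw [hl]; norm_cast
  · simp [ofLength, hl]

/-- In a minimal `A∞`-structure, the operation with two inputs is associative. -/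
theorem along_ofLength_two {ν : Op H H} (hν : ν.IsMultilinear) (h0 : ∀ X, ν X X .nil = 0)
    (h1 : ∀ X Y x, ν X Y (.cons x .nil) = 0)
    (rel : ∀ X Y w, along 1 (idOp H) ν ν X Y w = 0) (w : H.Wd X Y) :
    along 1 (idOp H) (ofLength 2 ν) (ofLength 2 ν) X Y w = 0 := by
  have ν₂m := ofLength_multilinear 2 hν
  suffices h : along 1 (idOp H) (ofLength 2 ν) (ofLength 2 ν) X Y w
      = (if w.length = 3 then (1 : k) else 0) • along 1 (idOp H) ν ν X Y w by
    rw [h, rel, smul_zero]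
  simp only [along, ← insSum_eq _ (ν₂m.mlin X Y), ← insSum_eq _ (hν.mlin X Y), insSum_def,
    ← splitSum_smul]
  refine splitSum_congr w fun Y p r _ hl => splitSum_congr r fun Y' r₁ q _ hl' => ?_
  have hlen : ∀ a, (p.append (.cons a (H.kos 1 q))).length = p.length + (q.length + 1) := by simp
  cases r₁ with
  | nil => simp [ofLength, h0, (hν.mlin _ _ _ _).map_zero]
  | cons a r₁ =>
  cases r₁ with
  | nil => simp [ofLength, h1, (hν.mlin _ _ _ _).map_zero]
  | cons b r₁ =>
  cases r₁ with
  | nil =>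
    have e : w.length = 3 ↔ p.length + (q.length + 1) = 2 := by
      simp at hl hl'; omega
    by_cases h : w.length = 3
    · simp [ofLength, e.1 h, h]
    · simp [ofLength, mt e.2 h, h]
  | cons c r₁ =>
    rw [show ofLength 2 ν _ _ (.cons a (.cons b (.cons c r₁))) = 0 by simp [ofLength],
      (ν₂m.mlin _ _ _ _).map_zero]
    by_cases h : w.length = 3
    · cases p with
      | cons _ _ => simp at hl hl'; omega
      | nil =>
        cases q with
        | cons _ _ => simp at hl hl'; omega
        | nil => simp [h1]
    · simp [h]

/-- After the vector field has become the Euler field, the `A∞`-structure has no terms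
besides the product, since all terms have to be of weight zero. -/
theorem pb_linearization [CharZero k] {b ν Θ : Op H H} (hb : b.IsMultilinear)
    (b1 : ∀ X Y x, b X Y (.cons x .nil) = (H X Y).euler x)
    (hν : ν.IsMultilinear) (hνd : ν.HasDegree 2) (ν1 : ∀ X Y x, ν X Y (.cons x .nil) = 0)
    (closed : ∀ X Y w, along 0 (idOp H) b ν X Y w = along 1 (idOp H) ν b X Y w)
    (hΘ : Θ.IsMultilinear) (hΘd : Θ.HasDegree 1) (Θ0 : ∀ X, Θ X X .nil = 0)
    (Θ1 : ∀ X Y x, Θ X Y (.cons x .nil) = x)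
    (hΘb : pb Θ b = along 0 (idOp H) H.eulerField Θ) :
    pb Θ ν = along 1 (idOp H) (ofLength 2 ν) Θ := by
  set ν₂ := ofLength 2 ν with hν₂
  have ν₂m : ν₂.IsMultilinear := ofLength_multilinear 2 hν
  have ν₂d : ν₂.HasDegree 2 := hνd.ofLength 2
  have hb₂ := higher_multilinear hb
  have em := eulerField_multilinear (H := H)
  have hΘk : KosComm Θ := (hΘd.kosDeg (t := 0) hΘ (by ring)).kosComm
  -- the defect, which commutes with the vector fields by the Jacobi identities
  set Φ : Op H H := fun X Y w => pb Θ ν X Y w - along 1 (idOp H) ν₂ Θ X Y w with hΦ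
  have Φm : Φ.IsMultilinear := sub_multilinear (pb_multilinear hν hΘ)
    (along_multilinear hΘ idOp_multilinear ν₂m)
  have Φd : Φ.HasDegree 2 := (hνd.pb hΘd).sub (hΘd.along idOp_hasDegree ν₂d (by ring) (by ring))
  have c₁ : ∀ X Y w, along 0 (idOp H) H.eulerField ν₂ X Y w
      = along 1 (idOp H) ν₂ H.eulerField X Y w := fun X Y w =>
    along_eulerField_ofLength_two hν hνd w
  have c₂ : ∀ X Y w, along 1 Θ Φ b X Y w = along 0 (idOp H) H.eulerField Φ X Y w := fun X Y w => by
    have h₁ := pb_along (d := 1) (G := Θ) (T := ν) idOp_nil hb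
    have h₂ := pb_along (d := 0) (G := Θ) (T := b) idOp_nil hν
    rw [pb_idOp Θ0] at h₁ h₂
    have h₃ := along_commutator_idOp em (eulerField_hasDegree.kosDeg em (t := 0) (by ring)) ν₂m
      (ν₂d.kosDeg ν₂m (t := 1) (by ring)) hΘ w
    simp only [zero_mul, zpow_zero, one_smul, zero_add] at h₃
    rw [along_eq_zero hΘ fun X Y w => sub_eq_zero.2 (c₁ X Y w), sub_eq_zero] at h₃
    rw [hΦ, along_T_sub hb, along_sub, ← h₁,
      ← funext fun X => funext fun Y => funext fun w => closed X Y w, h₂, hΘb,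
      along_pb Θ0 hΘk hν, idOp_pb hΘ, h₃, ← hΘb, along_pb Θ0 hΘk hb, idOp_pb hΘ]
  -- on words of length `l`, the commutator of the Euler field with an operation of degree `2` is
  -- multiplication by `2 - l`
  have c₃ : ∀ X Y w, ((w.length : k) - 2) • Φ X Y w = along 1 Θ Φ (higher b) X Y w :=
    ext_homogeneous (smul_length_multilinear (fun l => (l : k) - 2) Φm)
      (along_multilinear hb₂ hΘ Φm) fun X Y w n hw => by
        have h := c₂ X Y w
        have h' : along 0 (idOp H) H.eulerField Φ X Y w = _ :=
          alongSum_eulerField (Φm.mlin X Y) w n hw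
        rw [h', along_eq_linear_add b1, euler_of_hasDegree Φd w n hw, ← eq_sub_iff_add_eq',
          ← sub_smul] at h
        rw [h]
        congr 1
        push_cast
        ring
  have Φ0 : ∀ n X Y (w : H.Wd X Y), w.length = n → Φ X Y w = 0 := by
    intro n
    induction n using Nat.strong_induction_on with
    | _ n ih =>
      intro X Y w hw
      -- `l - 2` is invertible except for `l = 2`, where both sides are the product itself
      by_cases hn : n = 2
      · subst hn
        match w, hw with
        | .cons x (.cons y .nil), _ =>
          simp [hΦ, pb, along, alongSum_cons, alongSum_nil, splitSum_cons, barSum_cons, single,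
            hν₂, ofLength, Θ1, (hΘ.mlin _ _).cons_zero, ((hΘ.mlin _ _).tail _).cons_zero,
            (((hΘ.mlin _ _).tail _).tail _).cons_zero, idOp]
          exact ν1 _ _ _
      · have h := c₃ X Y w
        rw [along_eq_zero_of_single hb₂ (fun X Y a => higher_single b a) w
          fun u hu => ih _ (hw ▸ hu) _ _ u rfl] at h
        refine (smul_eq_zero.1 h).resolve_left fun h => hn ?_
        have : (w.length : k) = (2 : ℕ) := by rw [Nat.cast_ofNat]; exact sub_eq_zero.1 h
        rw [← hw]
        exact Nat.cast_injective this
  exact funext fun X => funext fun Y => funext fun w => sub_eq_zero.1 (Φ0 _ X Y w rfl)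

end Op

namespace AInfCat

variable (A : AInfCat.{u, u', v} k Ob)

open Op

theorem along_μ_μ (X Y : Ob) (w : A.hom.Wd X Y) : along 1 (idOp A.hom) A.μ A.μ X Y w = 0 := by
  rw [← ins_eq A.multilinear, A.rel]

/-- There is a minimal model of `A` on its cohomology, for which the operation with two inputs is
the product of the cohomology category. -/
theorem exists_minimalModel : ∃ (C : ∀ X Y, GrVect.Contraction (A.coh X Y) (A.hom X Y) (A.d X Y))
    (M : MinimalModel (H := A.coh) C A.μ),
    (∀ X Y (x : A.coh X Y), GrVect.Represents (d := A.d X Y) ((C X Y).i x) x) ∧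
      A.cohμ = ofLength 2 M.ν := by
  have dd := linear_linear_eq_zero A.multilinear A.nil (l := A.d) (fun _ _ _ => rfl) A.along_μ_μ
  have contr : ∀ X Y, ∃ C : GrVect.Contraction (A.coh X Y) (A.hom X Y) (A.d X Y),
      (∀ x : A.coh X Y, GrVect.Represents (d := A.d X Y) (C.i x) x) ∧
      ∀ a (ha : A.d X Y a = 0), C.p a
        = (Submodule.Quotient.mk ⟨a, LinearMap.mem_ker.2 ha⟩ : GrVect.Coh (A.hom X Y) (A.d X Y)) :=
    fun X Y => GrVect.exists_contraction (A.d_degree X Y) (dd X Y)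
  choose C rep proj using contr
  obtain ⟨M⟩ := Op.exists_minimalModel (H := A.coh) C A.multilinear A.degree A.nil
    (fun X Y a => rfl) A.along_μ_μ
  refine ⟨C, M, rep, ?_⟩
  funext X Y w
  match w with
  | .nil => rfl
  | .cons x .nil => rfl
  | .cons (Y := W) x (.cons y .nil) =>
    obtain ⟨hx, ex⟩ := rep _ _ x
    obtain ⟨hy, ey⟩ := rep _ _ y
    change A.cohM x y = M.ν _ _ _
    have h := A.leibniz ((C _ _).i x) ((C _ _).i y)
    have z₁ : A.m ((C _ _).i x) (0 : A.hom X W) = 0 :=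
      ((A.multilinear.mlin _ _).tail _).cons_zero _
    have z₂ : ∀ a : A.hom X W, A.m (0 : A.hom W Y) a = 0 := fun a =>
      (A.multilinear.mlin _ _).cons_zero _
    rw [hx, hy, z₁, z₂, add_zero, add_zero] at h
    rw [M.ν_two]
    refine Eq.trans ?_ (proj _ _ _ h).symm
    conv_lhs => rw [← ex, ← ey]
    rfl
  | .cons x (.cons y (.cons z w)) => simp [cohμ, ofLength]

theorem cohμ_multilinear : A.cohμ.IsMultilinear := by
  obtain ⟨C, M, -, hμ⟩ := A.exists_minimalModel
  rw [hμ]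
  exact ofLength_multilinear 2 M.ν_multilinear

theorem cohμ_degree : A.cohμ.HasDegree 2 := by
  obtain ⟨C, M, -, hμ⟩ := A.exists_minimalModel
  rw [hμ]
  exact M.ν_degree.ofLength 2

/-- The product on cohomology is associative. -/
theorem along_cohμ_cohμ : along 1 (idOp A.coh) A.cohμ A.cohμ = fun _ _ _ => 0 := by
  obtain ⟨C, M, -, hμ⟩ := A.exists_minimalModel
  rw [hμ]
  funext X Y w
  exact along_ofLength_two M.ν_multilinear M.ν_nil M.ν_single M.rel w

/-- The Euler field is a derivation of the product on cohomology. -/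
theorem along_eulerField_cohμ : along 0 (idOp A.coh) A.coh.eulerField A.cohμ
    = along 1 (idOp A.coh) A.cohμ A.coh.eulerField := by
  obtain ⟨C, M, -, hμ⟩ := A.exists_minimalModel
  rw [hμ]
  funext X Y w
  exact along_eulerField_ofLength_two M.ν_multilinear M.ν_degree w

/-- An `A∞`-category with a pure vector field is formal, equivariantly: purity says that the vector
field on the minimal model has the Euler field as its linear part. The equivalence `F` and the
homotopy `T` are those of the minimal model, after the change of coordinates which linearizes the
vector field. -/
theorem exists_formalityEquivalence [CharZero k] {b : Op A.hom A.hom} (hb : A.IsNCVectorField b)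
    {c : ∀ X, A.hom X X} (hc : A.IsPure b c) :
    ∃ F T, A.IsFormalityEquivalence F ∧ A.IsEquivariantHomotopy b c F T := by
  obtain ⟨C, M, rep, hμ⟩ := A.exists_minimalModel
  have rel := A.along_μ_μ
  have h1 : ∀ X Y a, A.μ X Y (.cons a .nil) = A.d X Y a := fun X Y a => rfl
  have closed : ∀ X Y w, along 0 (idOp A.hom) b A.μ X Y w = along 1 (idOp A.hom) A.μ b X Y w :=
    fun X Y w => by
      have := hb.cocycle X Y w
      rw [hochschild, ins_eq A.multilinear, ins_eq hb.multilinear] at this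
      simpa [← sub_eq_add_neg, sub_eq_zero] using this
  obtain ⟨R, hR⟩ := exists_transferredField M A.multilinear A.degree h1 rel hb.multilinear
    hb.degree closed hc.degree hc.bounding
  -- purity, in terms of the signs of the bar construction
  have R1 : ∀ X Y x, R.bH X Y (.cons x .nil) = (A.coh X Y).euler x := fun X Y x => by
    refine congrArg (fun f => f x) (GrVect.hom_ext (V := A.coh X Y)
      (f := IsLinearMap.mk' _ ((R.bH_multilinear.mlin X Y).head .nil)) fun n x hx => ?_)
    rw [IsLinearMap.mk'_apply, hR, GrVect.euler, GrVect.scale_of_mem _ _ hx]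
    have ha : (C X Y).i x ∈ (A.hom X Y).gr n := (C X Y).i_degree n x hx
    obtain ⟨y, hy⟩ := hc.euler X Y n _ ha ((C X Y).d_i x)
    have hs : (A.hom X Y).rsgn (-1) ((C X Y).i x) = - (A.hom X Y).sgn 1 ((C X Y).i x) := by
      rw [GrVect.rsgn, GrVect.sgn, GrVect.scale_of_mem _ _ ha, GrVect.scale_of_mem _ _ ha,
        ← neg_smul]
      congr 1
      rw [show (-1 : ℤ) * (n - 1) = 1 * n + 1 - (n + n) by ring, zpow_sub₀ (by simp),
        zpow_add₀ (by simp), zpow_add₀ (by simp : (-1 : k) ≠ 0) n n, ← mul_zpow]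
      simp
    have hs' : (A.hom X X).sgn 1 (c X) = c X := by
      rw [GrVect.sgn, GrVect.scale_of_mem _ _ (hc.degree X)]
      simp
    have h₁ := congrArg (C X Y).p hy
    rw [(C X Y).p_d, map_sub, map_smul, (C X Y).p_i, eq_comm, sub_eq_zero] at h₁
    rw [← h₁, hs]
    congr 1
    have h₂ := ((A.multilinear.mlin X Y).tail (c Y)).head .nil |>.map_neg ((A.hom X Y).sgn 1
      ((C X Y).i x))
    rw [h₂, cmp, cmp, hs', m, m]
    simp only [single]
    abel
  -- everything is pulled back along the linearizing change of coordinates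
  obtain ⟨Θ, hΘ, hΘd, Θ0, Θ1, hΘb⟩ := exists_linearization R.bH_multilinear R.bH_degree R.bH_nil R1
  have hΘν := pb_linearization R.bH_multilinear R1 M.ν_multilinear M.ν_degree M.ν_single R.closed hΘ
    hΘd Θ0 Θ1 hΘb
  have hΘk : KosComm Θ := (hΘd.kosDeg (t := 0) hΘ (by ring)).kosComm
  have hF := pb_multilinear M.F_multilinear hΘ
  have hT := pb_multilinear R.T_multilinear hΘ
  refine ⟨pb Θ M.F, pb Θ R.T, ⟨⟨hF, M.F_degree.pb hΘd, pb_nil M.F_nil Θ, fun X Y w => ?_⟩,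
    fun X Y x => ?_⟩, ⟨hT, R.T_degree.pb hΘd, fun X => ?_, fun X Y w => ?_⟩⟩
  · rw [ins_eq hF, hμ]
    change pb (pb Θ M.F) A.μ X Y w = _
    rw [← pb_pb M.F_nil A.multilinear, M.functor, pb_along idOp_nil M.F_multilinear, pb_idOp Θ0,
      hΘν, along_pb Θ0 hΘk M.F_multilinear, idOp_pb hΘ]
  · have e : pb Θ M.F X Y (.single x) = (C X Y).i x := by
      rw [pb, single, barSum_cons, splitSum_nil, barSum_nil, Θ1, M.F_single]
    exact e ▸ rep _ _ x
  · rw [pb, barSum_nil, R.T_nil]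
  · rw [natDiff, ins_eq hT, ins_eq hF, hμ]
    have h : pb Θ (fun X Y w => along (-1) M.F R.T A.μ X Y w + along 1 (idOp A.coh) M.ν R.T X Y w
        + pb M.F b X Y w) X Y w = pb Θ (along 0 (idOp A.coh) R.bH M.F) X Y w :=
      congrArg (fun f => pb Θ f X Y w) (funext fun X => funext fun Y => funext fun w =>
        R.homotopy X Y w)
    rw [pb_add, pb_add, pb_along M.F_nil A.multilinear, pb_along idOp_nil R.T_multilinear,
      pb_along idOp_nil M.F_multilinear, pb_pb M.F_nil hb.multilinear, pb_idOp Θ0, hΘν, hΘb] at h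
    have h₁ := along_pb (d := 1) (G := idOp A.coh) (T := ofLength 2 M.ν) Θ0 hΘk R.T_multilinear
    have h₂ := along_pb (d := 0) (G := idOp A.coh) (T := A.coh.eulerField) Θ0 hΘk M.F_multilinear
    rw [idOp_pb hΘ] at h₁ h₂
    rw [← h₁, ← h₂] at h
    change along (0 - 1) (pb Θ M.F) (pb Θ R.T) A.μ X Y w - _ = _ - pb (pb Θ M.F) b X Y w
    rw [← h]
    simp

end AInfCat
end Bar

/-! ### Operations on bimodules -/

namespace BiOp

open Quiv Word Op

variable {k : Type u} [Field k] {ObA : Type u₁} {ObB : Type u₂}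
  {H H' H'' : Quiv.{u, u₁, v₁} k ObA} {K K' K'' : Quiv.{u, u₂, v₂} k ObB}
  {P Q R S : ObB → ObA → GrVect.{u, v₃} k}

theorem _root_.List.sum_flatMap_eq {α M : Type*} [AddCommMonoid M] (l : List α) (g : α → List M) :
    (l.flatMap g).sum = (l.map fun a => (g a).sum).sum := by
  simpa using List.sum_map_flatMap l g _root_.id

theorem comp_eq (d : ℤ) (f : BiOp H K Q R) (g : BiOp H K P Q) {X X' : ObA} {Y Y' : ObB}
    (w : H.Wd X X') (m : P Y X) (v : K.Wd Y' Y) :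
    comp d f g X X' Y Y' w m v = splitSum w fun X₁ p q => splitSum v fun Y₁ r s =>
      f X₁ X' Y₁ Y' p (g X X₁ Y Y₁ q m r) (K.kos d s) :=
  List.sum_flatMap_eq _ _

theorem pull_eq (F : Op H H') (G : Op K K') (f : BiOp H' K' P Q) {X X' : ObA} {Y Y' : ObB}
    (w : H.Wd X X') (m : P Y X) (v : K.Wd Y' Y) :
    pull F G f X X' Y Y' w m v = barSum F (fun w' => barSum G (fun v' =>
      f X X' Y Y' w' m v') v) w :=
  List.sum_flatMap_eq _ _

theorem pullInsL_eq (d : ℤ) (F T : Op H H') (G : Op K K') (f : BiOp H' K' P Q) {X X' : ObA}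
    {Y Y' : ObB} (w : H.Wd X X') (m : P Y X) (v : K.Wd Y' Y) :
    pullInsL d F T G f X X' Y Y' w m v = alongSum d F T (fun w' =>
      barSum G (fun v' => f X X' Y Y' w' ((P Y X).sgn d m) (K'.kos d v')) v) w :=
  List.sum_flatMap_eq _ _

theorem pullInsR_eq (d : ℤ) (F : Op H H') (G T : Op K K') (f : BiOp H' K' P Q) {X X' : ObA}
    {Y Y' : ObB} (w : H.Wd X X') (m : P Y X) (v : K.Wd Y' Y) :
    pullInsR d F G T f X X' Y Y' w m v = barSum F (fun w' =>
      alongSum d G T (fun v' => f X X' Y Y' w' m v') v) w :=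
  List.sum_flatMap_eq _ _

namespace IsMultilinear

variable {f g : BiOp H K P Q}

theorem mlinL (hf : f.IsMultilinear) {X X' : ObA} {Y Y' : ObB} (m : P Y X) (v : K.Wd Y' Y) :
    MLin (k := k) fun w : H.Wd X X' => f X X' Y Y' w m v := fun _ _ p q =>
  hf.left _ _ _ _ _ _ p q m v

theorem mlinR (hf : f.IsMultilinear) {X X' : ObA} {Y Y' : ObB} (w : H.Wd X X') (m : P Y X) :
    MLin (k := k) fun v : K.Wd Y' Y => f X X' Y Y' w m v := fun _ _ p q =>
  hf.right _ _ _ _ _ _ w m p q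

theorem of_mlin (hl : ∀ (X X' : ObA) (Y Y' : ObB) (m : P Y X) (v : K.Wd Y' Y),
      MLin (k := k) fun w : H.Wd X X' => f X X' Y Y' w m v)
    (hm : ∀ (X X' : ObA) (Y Y' : ObB) (w : H.Wd X X') (v : K.Wd Y' Y),
      IsLinearMap k fun m : P Y X => f X X' Y Y' w m v)
    (hr : ∀ (X X' : ObA) (Y Y' : ObB) (w : H.Wd X X') (m : P Y X),
      MLin (k := k) fun v : K.Wd Y' Y => f X X' Y Y' w m v) : f.IsMultilinear :=
  ⟨fun X _ _ X' Y Y' p q m v => hl X X' Y Y' m v p q, hm,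
    fun X X' Y _ _ Y' w m p q => hr X X' Y Y' w m p q⟩

theorem comp {f : BiOp H K Q R} (hf : f.IsMultilinear) (hg : g.IsMultilinear) (d : ℤ) :
    (comp d f g).IsMultilinear := by
  refine of_mlin (fun X X' Y Y' m v => ?_) (fun X X' Y Y' w v => ?_) (fun X X' Y Y' w m => ?_)
  · simp only [comp_eq]
    refine MLin.splitSum (fun X₁ q => ?_) (fun X₁ p => ?_)
    · exact MLin.splitSum_const _ fun Y₁ r s => hf.mlinL _ _
    · exact MLin.splitSum_const _ fun Y₁ r s => (hg.mlinL _ _).comp_linear (hf.mid _ _ _ _ _ _)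
  · simp only [comp_eq]
    refine IsLinearMap.splitSum _ fun X₁ p q => IsLinearMap.splitSum _ fun Y₁ r s => ?_
    exact ⟨fun a b => by rw [(hg.mid _ _ _ _ _ _).map_add, (hf.mid _ _ _ _ _ _).map_add],
      fun c a => by rw [(hg.mid _ _ _ _ _ _).map_smul, (hf.mid _ _ _ _ _ _).map_smul]⟩
  · simp only [comp_eq]
    refine MLin.splitSum_const _ fun X₁ p q => MLin.splitSum (fun Y₁ s => ?_) (fun Y₁ r => ?_)
    · exact (hg.mlinR _ _).comp_linear (hf.mid _ _ _ _ _ _)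
    · exact (hf.mlinR _ _).comp_kos d

variable {F T : Op H H'} {G S : Op K K'} {f : BiOp H' K' P Q}

theorem pull (hf : f.IsMultilinear) (hF : F.IsMultilinear) (hG : G.IsMultilinear) :
    (pull F G f).IsMultilinear := by
  refine of_mlin (fun X X' Y Y' m v => ?_) (fun X X' Y Y' w v => ?_) (fun X X' Y Y' w m => ?_)
  · simp only [pull_eq]
    exact MLin.barSum hF (MLin.barSum_const G (fun v' => hf.mlinL _ _) v)
  · simp only [pull_eq]
    exact IsLinearMap.barSum _ (fun w' => IsLinearMap.barSum _ (fun v' => hf.mid _ _ _ _ _ _) _) _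
  · simp only [pull_eq]
    exact MLin.barSum_const F (fun w' => MLin.barSum hG (hf.mlinR _ _)) w

theorem pullInsL (hf : f.IsMultilinear) (hF : F.IsMultilinear) (hT : T.IsMultilinear)
    (hG : G.IsMultilinear) (d : ℤ) : (pullInsL d F T G f).IsMultilinear := by
  refine of_mlin (fun X X' Y Y' m v => ?_) (fun X X' Y Y' w v => ?_) (fun X X' Y Y' w m => ?_)
  · simp only [pullInsL_eq]
    exact MLin.alongSum d hF hT (MLin.barSum_const G (fun v' => hf.mlinL _ _) v)
  · simp only [pullInsL_eq]
    refine IsLinearMap.alongSum _ _ _ (fun w' => IsLinearMap.barSum _ (fun v' => ?_) _) _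
    exact ⟨fun a b => by rw [map_add, (hf.mid _ _ _ _ _ _).map_add],
      fun c a => by rw [map_smul, (hf.mid _ _ _ _ _ _).map_smul]⟩
  · simp only [pullInsL_eq]
    exact MLin.alongSum_const F T d (fun w' => MLin.barSum hG ((hf.mlinR _ _).comp_kos d)) w

theorem pullInsR (hf : f.IsMultilinear) (hF : F.IsMultilinear) (hG : G.IsMultilinear)
    (hS : S.IsMultilinear) (d : ℤ) : (pullInsR d F G S f).IsMultilinear := by
  refine of_mlin (fun X X' Y Y' m v => ?_) (fun X X' Y Y' w v => ?_) (fun X X' Y Y' w m => ?_)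
  · simp only [pullInsR_eq]
    exact MLin.barSum hF (MLin.alongSum_const G S d (fun v' => hf.mlinL _ _) v)
  · simp only [pullInsR_eq]
    exact IsLinearMap.barSum _ (fun w' => IsLinearMap.alongSum _ _ _
      (fun v' => hf.mid _ _ _ _ _ _) _) _
  · simp only [pullInsR_eq]
    exact MLin.barSum_const F (fun w' => MLin.alongSum d hG hS (hf.mlinR _ _)) w

end IsMultilinear

theorem pull_idOp {f : BiOp H K P Q} (hf : f.IsMultilinear) : pull (idOp H) (idOp K) f = f := by
  funext X X' Y Y' w m v
  rw [pull_eq]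
  simp only [barSum_idOp (hf.mlinR _ _)]
  exact barSum_idOp (hf.mlinL m v) w

theorem insL_eq {f : BiOp H K P Q} (hf : f.IsMultilinear) (d : ℤ) (T : Op H H) :
    insL d f T = pullInsL d (idOp H) T (idOp K) f := by
  funext X X' Y Y' w m v
  rw [pullInsL_eq]
  simp only [barSum_idOp ((hf.mlinR _ _).comp_kos d)]
  exact congrArg (fun φ => φ w) (insSum_eq T (hf.mlinL ((P Y X).sgn d m) (K.kos d v)))

theorem insR_eq {f : BiOp H K P Q} (hf : f.IsMultilinear) (d : ℤ) (T : Op K K) :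
    insR d f T = pullInsR d (idOp H) (idOp K) T f := by
  funext X X' Y Y' w m v
  rw [pullInsR_eq]
  rw [barSum_idOp (MLin.alongSum_const (idOp K) T d (fun v' => hf.mlinL m v') v)]
  exact congrArg (fun φ => φ v) (insSum_eq T (hf.mlinR w m))

theorem HasDegree.comp {f : BiOp H K Q R} {g : BiOp H K P Q} {a b c : ℤ} (hf : f.HasDegree a)
    (hg : g.HasDegree b) (e : ℤ) (hc : c = a + b) : (comp e f g).HasDegree c := by
  intro X X' Y Y' w m v i j n hw hm hv
  rw [comp_eq]
  refine splitSum_mem hw fun X₁ p q i₁ i₂ hp hq hi =>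
    splitSum_mem hv fun Y₁ r s j₁ j₂ hr hs hj => ?_
  have := hf X₁ X' Y₁ Y' p _ _ i₁ j₂ _ hp (hg X X₁ Y Y₁ q m r i₂ j₁ n hq hm hr) (hs.kos e)
  rwa [show i + n + j + c = i₁ + (i₂ + n + j₁ + b) + j₂ + a by rw [← hi, ← hj, hc]; ring]

section

variable {F T : Op H H'} {G S : Op K K'} {f : BiOp H' K' P Q} {a c d e : ℤ}

theorem HasDegree.pull (hf : f.HasDegree a) (hF : F.HasDegree 1) (hG : G.HasDegree 1) :
    (pull F G f).HasDegree a := by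
  intro X X' Y Y' w m v i j n hw hm hv
  rw [pull_eq]
  exact barSum_mem hF hw fun w' hw' => barSum_mem hG hv fun v' hv' =>
    hf _ _ _ _ _ _ _ _ _ _ hw' hm hv'

theorem HasDegree.pullInsL (hf : f.HasDegree a) (hF : F.HasDegree 1) (hT : T.HasDegree e)
    (hG : G.HasDegree 1) (he : e = d + 1) (hc : c = a + d) : (pullInsL d F T G f).HasDegree c := by
  intro X X' Y Y' w m v i j n hw hm hv
  rw [pullInsL_eq]
  refine alongSum_mem hF hT he hw fun w' hw' => barSum_mem hG hv fun v' hv' => ?_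
  have := hf X X' Y Y' _ _ _ _ _ _ hw' (GrVect.scale_mem _ (fun n => (-1 : k) ^ (d * n)) hm)
    (hv'.kos d)
  rwa [show i + n + j + c = i + d + n + j + a by rw [hc]; ring]

theorem HasDegree.pullInsR (hf : f.HasDegree a) (hF : F.HasDegree 1) (hG : G.HasDegree 1)
    (hS : S.HasDegree e) (he : e = d + 1) (hc : c = a + d) : (pullInsR d F G S f).HasDegree c := by
  intro X X' Y Y' w m v i j n hw hm hv
  rw [pullInsR_eq]
  refine barSum_mem hF hw fun w' hw' => alongSum_mem hG hS he hv fun v' hv' => ?_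
  have := hf X X' Y Y' _ _ _ _ _ _ hw' hm hv'
  rwa [show i + n + j + c = i + n + (j + d) + a by rw [hc]; ring]

end

/-- The commutation of the Koszul signs with an operation of degree `e`. -/
def SgnDeg (e : ℤ) (g : BiOp H K P Q) : Prop :=
  ∀ (d : ℤ) (X X' : ObA) (Y Y' : ObB) (w : H.Wd X X') (m : P Y X) (v : K.Wd Y' Y),
    g X X' Y Y' (H.kos d w) ((P Y X).sgn d m) (K.kos d v)
      = (-1 : k) ^ (d * e) • (Q Y' X').sgn d (g X X' Y Y' w m v)

/-- Two multilinear operations agree if they agree on homogeneous elements. -/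
theorem ext_homogeneous {f g : BiOp H K P Q} (hf : f.IsMultilinear) (hg : g.IsMultilinear)
    (h : ∀ X X' Y Y' (w : H.Wd X X') m (v : K.Wd Y' Y) i n j, H.HasRDeg w i → m ∈ (P Y X).gr n →
      K.HasRDeg v j → f X X' Y Y' w m v = g X X' Y Y' w m v) : f = g := by
  funext X X' Y Y' w m v
  refine MLin.ext_homogeneous (hf.mlinL m v) (hg.mlinL m v) (fun w i hw => ?_) w
  refine MLin.ext_homogeneous (hf.mlinR w m) (hg.mlinR w m) (fun v j hv => ?_) v
  refine congrArg (fun l => l m) (GrVect.hom_ext (f := IsLinearMap.mk' _ (hf.mid X X' Y Y' w v))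
    (g := IsLinearMap.mk' _ (hg.mid X X' Y Y' w v)) fun n m hm => ?_)
  exact h _ _ _ _ _ _ _ _ _ _ hw hm hv

theorem HasDegree.sgnDeg {g : BiOp H K P Q} {e : ℤ} (hg : g.HasDegree e) (hm : g.IsMultilinear) :
    SgnDeg e g := by
  intro d X X' Y Y' w m v
  refine congrArg (fun φ : BiOp H K P Q => φ X X' Y Y' w m v) (ext_homogeneous
    (f := fun X X' Y Y' w m v => g X X' Y Y' (H.kos d w) ((P Y X).sgn d m) (K.kos d v))
    (g := fun X X' Y Y' w m v => (-1 : k) ^ (d * e) • (Q Y' X').sgn d (g X X' Y Y' w m v))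
    (IsMultilinear.of_mlin (fun X X' Y Y' m v => (hm.mlinL _ _).comp_kos d)
      (fun X X' Y Y' w v => ((hm.mid X X' Y Y' _ _).mk'.comp ((P Y X).sgn d)).isLinear)
      (fun X X' Y Y' w m => (hm.mlinR _ _).comp_kos d))
    (IsMultilinear.of_mlin
      (fun X X' Y Y' m v => MLin.comp_linearMap ((-1 : k) ^ (d * e) • (Q Y' X').sgn d)
        (hm.mlinL _ _))
      (fun X X' Y Y' w v => (((-1 : k) ^ (d * e) • (Q Y' X').sgn d).comp
        (hm.mid X X' Y Y' w v).mk').isLinear)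
      (fun X X' Y Y' w m => MLin.comp_linearMap ((-1 : k) ^ (d * e) • (Q Y' X').sgn d)
        (hm.mlinR _ _))) ?_)
  intro X X' Y Y' w m v i n j hw hn hv
  have h₁ := (hm.mlinL ((P Y X).sgn d m) (K.kos d v)).apply_kos d w i hw
  have h₂ := (hm.mlinR w ((P Y X).sgn d m)).apply_kos d v j hv
  rw [h₁, h₂]
  simp only [GrVect.sgn]
  rw [GrVect.scale_of_mem _ _ hn, (hm.mid _ _ _ _ _ _).map_smul,
    GrVect.scale_of_mem _ _ (hg X X' Y Y' w m v i j n hw hn hv), smul_smul, smul_smul, smul_smul,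
    ← zpow_add₀ (by simp), ← zpow_add₀ (by simp), ← zpow_add₀ (by simp),
    show d * e + d * (i + n + j + e) = d * i + d * j + d * n + (d * e + d * e) by ring,
    zpow_add₀ (by simp) _ (d * e + d * e), zpow_add₀ (by simp) (d * e), ← mul_zpow]
  simp

end BiOp

/-! ### The Leibniz rules and commutators for operations on bimodules -/

namespace BiOp

open Quiv Word Op

variable {k : Type u} [Field k] {ObA : Type u₁} {ObB : Type u₂}
  {H H' H'' : Quiv.{u, u₁, v₁} k ObA} {K K' K'' : Quiv.{u, u₂, v₂} k ObB}
  {P Q R S : ObB → ObA → GrVect.{u, v₃} k}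

theorem _root_.Op.barSum_ext {Ob : Type*} {H H' : Quiv k Ob} {M : Type*} [AddCommMonoid M]
    {F : Op H H'} {X Z : Ob} {g g' : H'.Wd X Z → M} (h : ∀ u, g u = g' u) (w : H.Wd X Z) :
    barSum F g w = barSum F g' w := by
  rw [funext h]

theorem _root_.Op.alongSum_ext {Ob : Type*} {H H' : Quiv k Ob} {M : Type*} [AddCommMonoid M]
    {F T : Op H H'} {d : ℤ} {X Z : Ob} {g g' : H'.Wd X Z → M} (h : ∀ u, g u = g' u)
    (w : H.Wd X Z) : alongSum d F T g w = alongSum d F T g' w := by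
  rw [funext h]

theorem comp_assoc {f : BiOp H K Q R} (hf : f.IsMultilinear) (g : BiOp H K P Q)
    (h : BiOp H K S P) (d e : ℤ) : comp e (comp d f g) h = comp (d + e) f (comp e g h) := by
  funext X X' Y Y' w m v
  simp only [comp_eq]
  have hm : ∀ X X' Y Y' w v, ∃ l : Q Y X →ₗ[k] R Y' X', ∀ m, f X X' Y Y' w m v = l m :=
    fun X X' Y Y' w v => ⟨(hf.mid X X' Y Y' w v).mk', fun m => rfl⟩
  choose l hl using hm
  simp only [hl, map_splitSum, splitSum_kos, kos_kos]
  calc _ = splitSum w fun X₁ p q => splitSum p fun X₂ p₁ p₂ => splitSum v fun Y₁ r s =>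
        splitSum s fun Y₂ s₁ s₂ => l X₂ X' Y₂ Y' p₁ (K.kos (d + e) s₂)
          (g X₁ X₂ Y₁ Y₂ p₂ (h X X₁ Y Y₁ q m r) (K.kos e s₁)) := by
        congr 1; funext X₁ p q
        exact splitSum_comm _ _ _
    _ = splitSum w fun X₂ p₁ t => splitSum t fun X₁ p₂ q => splitSum v fun Y₂ t' s₂ =>
        splitSum t' fun Y₁ r s₁ => l X₂ X' Y₂ Y' p₁ (K.kos (d + e) s₂)
          (g X₁ X₂ Y₁ Y₂ p₂ (h X X₁ Y Y₁ q m r) (K.kos e s₁)) := by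
        rw [splitSum_assoc]
        congr 1; funext X₂ p₁ t; congr 1; funext X₁ p₂ q
        exact (splitSum_assoc v _).symm
    _ = _ := by
        congr 1; funext X₂ p₁ t
        exact splitSum_comm _ _ _

variable {F T : Op H H'} {G U : Op K K'} {d e : ℤ}

/-- Pullback is compatible with composition. -/
theorem pull_comp (hG : KosComm G) {f : BiOp H' K' Q R} (hf : f.IsMultilinear)
    (g : BiOp H' K' P Q) :
    pull F G (comp e f g) = comp e (pull F G f) (pull F G g) := by
  funext X X' Y Y' w m v
  have hm : ∀ X X' Y Y' w v, ∃ l : Q Y X →ₗ[k] R Y' X', ∀ m, f X X' Y Y' w m v = l m :=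
    fun X X' Y Y' w v => ⟨(hf.mid X X' Y Y' w v).mk', fun m => rfl⟩
  choose l hl using hm
  simp only [pull_eq, comp_eq, hl, map_barSum, barSum_splitSum, barSum_splitSum_self,
    barSum_kos hG]
  congr 1; funext X₁ p q; congr 1; funext Y₁ r s
  refine barSum_ext (fun p' => ?_) p
  refine Eq.trans (barSum_ext (fun q' => ?_) q) (barSum_comm F G _ q s)
  exact barSum_comm _ _ _ _ _

/-- The Leibniz rule for insertions on the left. -/
theorem pullInsL_comp (hG : KosComm G) {f : BiOp H' K' Q R} (hf : f.IsMultilinear)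
    {g : BiOp H' K' P Q} (hg : SgnDeg e g) :
    pullInsL d F T G (comp e f g) = comp (d + e) (pull F G f) (pullInsL d F T G g)
      + (-1 : k) ^ (d * e) • comp e (pullInsL d F T G f) (pull F G g) := by
  funext X X' Y Y' w m v
  simp only [Pi.add_apply, Pi.smul_apply]
  have hm : ∀ X X' Y Y' w v, ∃ l : Q Y X →ₗ[k] R Y' X', ∀ m, f X X' Y Y' w m v = l m :=
    fun X X' Y Y' w v => ⟨(hf.mid X X' Y Y' w v).mk', fun m => rfl⟩
  choose l hl using hm
  simp only [pullInsL_eq, pull_eq, comp_eq, hl, map_barSum, map_alongSum, barSum_splitSum,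
    barSum_splitSum_self, barSum_kos hG, splitSum_kos, kos_kos, alongSum_splitSum_self,
    alongSum_splitSum, hg d, map_smul, barSum_smul, alongSum_smul, splitSum_smul, splitSum_add]
  rw [add_comm]
  congr 1
  · congr 1; funext X₁ p q; congr 1; funext Y₁ r s
    refine barSum_ext (fun p' => ?_) p
    refine Eq.trans (alongSum_ext (fun q' => ?_) q) (alongSum_barSum F T d G _ q s)
    rw [add_comm e d]
    exact barSum_comm _ _ _ _ _
  · congr 1
    congr 1; funext X₁ p q; congr 1; funext Y₁ r s
    refine alongSum_ext (fun p' => ?_) p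
    refine Eq.trans (barSum_ext (fun q' => ?_) q) (barSum_comm F G _ q s)
    rw [add_comm e d]
    exact barSum_comm _ _ _ _ _

/-- The Leibniz rule for insertions on the right. -/
theorem pullInsR_comp (hG : KosComm G) (hU : KosDeg d U) {f : BiOp H' K' Q R}
    (hf : f.IsMultilinear) (g : BiOp H' K' P Q) :
    pullInsR d F G U (comp e f g) = comp (d + e) (pull F G f) (pullInsR d F G U g)
      + (-1 : k) ^ (d * e) • comp e (pullInsR d F G U f) (pull F G g) := by
  funext X X' Y Y' w m v
  simp only [Pi.add_apply, Pi.smul_apply]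
  have hm : ∀ X X' Y Y' w v, ∃ l : Q Y X →ₗ[k] R Y' X', ∀ m, f X X' Y Y' w m v = l m :=
    fun X X' Y Y' w v => ⟨(hf.mid X X' Y Y' w v).mk', fun m => rfl⟩
  choose l hl using hm
  have hs : ∀ {X X' : ObA} {Y Y' : ObB} (w : H'.Wd X X') (m : Q Y X) (v : K.Wd Y' Y),
      alongSum d G U (fun v' => l X X' Y Y' w v' m) (K.kos e v)
        = (-1 : k) ^ (d * e) • alongSum d G U (fun v' => l X X' Y Y' w (K'.kos e v') m) v := by
    intro X X' Y Y' w m v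
    simp only [← hl, mul_comm d e]
    exact alongSum_kos hG hU (hf.mlinR w m) d e v
  simp only [pullInsR_eq, pull_eq, comp_eq, hl, barSum_splitSum, alongSum_splitSum,
    barSum_splitSum_self, alongSum_splitSum_self, hs, barSum_kos hG, kos_kos, barSum_smul,
    splitSum_smul, splitSum_add, barSum_add]
  have sq : (-1 : k) ^ (d * e) * (-1 : k) ^ (d * e) = 1 := by rw [← mul_zpow]; simp
  congr 1
  · congr 1; funext X₁ p q; congr 1; funext Y₁ r s
    refine barSum_ext (fun p' => ?_) p
    simp only [map_barSum, map_alongSum]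
    refine Eq.trans (barSum_ext (fun q' => ?_) q) (barSum_comm F G _ q s)
    rw [add_comm e d]
    exact alongSum_barSum _ _ _ _ _ _ _
  · simp only [smul_smul, sq, one_smul, map_barSum]
    congr 1; funext X₁ p q; congr 1; funext Y₁ r s
    refine barSum_ext (fun p' => ?_) p
    rw [alongSum_barSum]
    refine barSum_ext (fun q' => ?_) q
    exact (alongSum_barSum _ _ _ _ _ _ _).symm

theorem insL_apply {f : BiOp H K P Q} (hf : f.IsMultilinear) (d : ℤ) (T : Op H H) {X X' : ObA}
    {Y Y' : ObB} (w : H.Wd X X') (m : P Y X) (v : K.Wd Y' Y) :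
    insL d f T X X' Y Y' w m v = alongSum d (idOp H) T
      (fun w' => f X X' Y Y' w' ((P Y X).sgn d m) (K.kos d v)) w :=
  congrArg (fun φ => φ w) (insSum_eq T (hf.mlinL ((P Y X).sgn d m) (K.kos d v)))

theorem insR_apply {f : BiOp H K P Q} (hf : f.IsMultilinear) (d : ℤ) (T : Op K K) {X X' : ObA}
    {Y Y' : ObB} (w : H.Wd X X') (m : P Y X) (v : K.Wd Y' Y) :
    insR d f T X X' Y Y' w m v = alongSum d (idOp K) T (fun v' => f X X' Y Y' w m v') v :=
  congrArg (fun φ => φ v) (insSum_eq T (hf.mlinR w m))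

theorem isLinearMap_pull (F : Op H H') (G : Op K K') :
    IsLinearMap k (pull F G : BiOp H' K' P Q → BiOp H K P Q) := by
  constructor <;> intros <;> funext X X' Y Y' w m v <;>
    simp only [Pi.add_apply, Pi.smul_apply, pull_eq, barSum_add, barSum_smul]

theorem isLinearMap_pullInsL (d : ℤ) (F T : Op H H') (G : Op K K') :
    IsLinearMap k (pullInsL d F T G : BiOp H' K' P Q → BiOp H K P Q) := by
  constructor <;> intros <;> funext X X' Y Y' w m v <;>
    simp only [Pi.add_apply, Pi.smul_apply, pullInsL_eq, barSum_add, barSum_smul, alongSum_add,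
      alongSum_smul]

theorem isLinearMap_pullInsR (d : ℤ) (F : Op H H') (G U : Op K K') :
    IsLinearMap k (pullInsR d F G U : BiOp H' K' P Q → BiOp H K P Q) := by
  constructor <;> intros <;> funext X X' Y Y' w m v <;>
    simp only [Pi.add_apply, Pi.smul_apply, pullInsR_eq, barSum_add, barSum_smul, alongSum_add,
      alongSum_smul]

theorem isLinearMap_comp_left (g : BiOp H K P Q) :
    IsLinearMap k (fun f : BiOp H K Q R => comp d f g) := by
  constructor <;> intros <;> funext X X' Y Y' w m v <;>
    simp only [Pi.add_apply, Pi.smul_apply, comp_eq, splitSum_add, splitSum_smul]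

theorem isLinearMap_comp_right {f : BiOp H K Q R} (hf : f.IsMultilinear) :
    IsLinearMap k (fun g : BiOp H K P Q => comp d f g) := by
  constructor <;> intros <;> funext X X' Y Y' w m v <;>
    simp only [Pi.add_apply, Pi.smul_apply, comp_eq, (hf.mid _ _ _ _ _ _).map_add,
      (hf.mid _ _ _ _ _ _).map_smul, splitSum_add, splitSum_smul]

theorem pull_insL (hF0 : ∀ X, F X X .nil = 0) {f : BiOp H' K' P Q} (hf : f.IsMultilinear)
    (T : Op H' H') : pull F G (insL d f T) = pullInsL d F (pb F T) G f := by
  funext X X' Y Y' w m v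
  simp only [pull_eq, pullInsL_eq, insL_apply hf, ← alongSum_barSum]
  rw [barSum_alongSum idOp_nil (MLin.barSum_const G (fun v' => hf.mlinL _ _) v), pb_idOp hF0]

theorem pull_insR (hG0 : ∀ X, G X X .nil = 0) {f : BiOp H' K' P Q} (hf : f.IsMultilinear)
    (T : Op K' K') : pull F G (insR d f T) = pullInsR d F G (pb G T) f := by
  funext X X' Y Y' w m v
  simp only [pull_eq, pullInsR_eq, insR_apply hf]
  refine barSum_ext (fun w' => ?_) w
  rw [barSum_alongSum idOp_nil (hf.mlinR w' m), pb_idOp hG0]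

/-- Insertion into a pullback along `F` and `G`, on the left. Together with `pull_insL` it
shows that pullbacks commute with insertions of operations which `F` intertwines. -/
theorem insL_pull (hF0 : ∀ X, F X X .nil = 0) (hF : F.IsMultilinear) (hFk : KosComm F)
    (hG : G.IsMultilinear) (hGk : KosComm G) {f : BiOp H' K' P Q} (hf : f.IsMultilinear)
    (T : Op H H) : insL d (pull F G f) T = pullInsL d F (along d (idOp H) T F) G f := by
  funext X X' Y Y' w m v
  rw [insL_apply (hf.pull hF hG), pullInsL_eq]
  simp only [pull_eq, barSum_kos hGk]
  rw [alongSum_barSum_self hF0 hFk (MLin.barSum_const G (fun v' => hf.mlinL _ _) v), idOp_pb hF]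

theorem insR_pull (hF : F.IsMultilinear) (hG0 : ∀ X, G X X .nil = 0)
    (hG : G.IsMultilinear) (hGk : KosComm G) {f : BiOp H' K' P Q} (hf : f.IsMultilinear)
    (T : Op K K) : insR d (pull F G f) T = pullInsR d F G (along d (idOp K) T G) f := by
  funext X X' Y Y' w m v
  rw [insR_apply (hf.pull hF hG), pullInsR_eq]
  simp only [pull_eq, alongSum_barSum]
  refine barSum_ext (fun w' => ?_) w
  rw [alongSum_barSum_self hG0 hGk (hf.mlinR w' m), idOp_pb hG]

section Commutators

variable {μ : Op H' H'} {ν : Op H H} {μ' : Op K' K'} {ν' : Op K K} {t m : ℤ}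

/-- The graded commutator of inserting `T` along `F` with inserting `μ`, respectively `ν`, on the
left: it inserts the differential of `T`. On different sides the commutators vanish, see
`pullInsL_insR` and `pullInsR_insL`. -/
theorem pullInsL_insL (hF0 : ∀ X, F X X .nil = 0) (hF : F.IsMultilinear) (hFk : KosComm F)
    (hT : T.IsMultilinear) (hTk : KosDeg t T) (hμk : KosDeg m μ)
    (hFν : pb F μ = along m (idOp H) ν F) (hG : G.IsMultilinear) (hGk : KosComm G)
    {f : BiOp H' K' P Q} (hf : f.IsMultilinear) :
    pullInsL t F T G (insL m f μ) - (-1 : k) ^ (t * m) • insL m (pullInsL t F T G f) ν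
      = pullInsL (t + m) F (fun X Y w => along t F T μ X Y w
          - (-1 : k) ^ (t * m) • along m (idOp H) ν T X Y w) G f := by
  funext X X' Y Y' w p v
  simp only [Pi.sub_apply, Pi.smul_apply]
  rw [insL_apply (hf.pullInsL hF hT hG t)]
  simp only [pullInsL_eq, insL_apply hf, barSum_kos hGk, kos_kos, GrVect.sgn_add, ← alongSum_barSum]
  rw [add_comm m t]
  exact alongSum_commutator hF0 hF hFk hT hTk hμk hFν
    (MLin.barSum_const G (fun v' => hf.mlinL _ _) v) w

theorem pullInsL_insR (hF : F.IsMultilinear) (hT : T.IsMultilinear) (hμk : KosDeg m μ')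
    (hG0 : ∀ X, G X X .nil = 0) (hG : G.IsMultilinear) (hGk : KosComm G)
    (hGν : pb G μ' = along m (idOp K) ν' G) {f : BiOp H' K' P Q} (hf : f.IsMultilinear) :
    pullInsL t F T G (insR m f μ') = (-1 : k) ^ (t * m) • insR m (pullInsL t F T G f) ν' := by
  funext X X' Y Y' w p v
  simp only [Pi.smul_apply]
  rw [insR_apply (hf.pullInsL hF hT hG t)]
  simp only [pullInsL_eq, insR_apply hf]
  rw [alongSum_comm, ← alongSum_smul]
  refine alongSum_ext (fun w' => ?_) w
  simp only [alongSum_kos kosComm_idOp hμk (hf.mlinR _ _), barSum_smul]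
  rw [alongSum_barSum_self hG0 hGk ((hf.mlinR _ _).comp_kos t), barSum_alongSum idOp_nil
    ((hf.mlinR _ _).comp_kos t), hGν, idOp_pb hG, pb_idOp hG0]

theorem pullInsR_insL (hF0 : ∀ X, F X X .nil = 0) (hF : F.IsMultilinear) (hFk : KosComm F)
    (hFν : pb F μ = along m (idOp H) ν F) (hG : G.IsMultilinear) (hGk : KosComm G)
    (hU : U.IsMultilinear) (hUk : KosDeg t U)
    {f : BiOp H' K' P Q} (hf : f.IsMultilinear) :
    pullInsR t F G U (insL m f μ) = (-1 : k) ^ (t * m) • insL m (pullInsR t F G U f) ν := by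
  funext X X' Y Y' w p v
  simp only [Pi.smul_apply]
  have sq : (-1 : k) ^ (t * m) * (-1 : k) ^ (t * m) = 1 := by rw [← mul_zpow]; simp
  rw [insL_apply (hf.pullInsR hF hG hU t)]
  simp only [pullInsR_eq, insL_apply hf, alongSum_kos hGk hUk (hf.mlinR _ _), barSum_smul,
    alongSum_smul, smul_smul, mul_comm m t, sq, one_smul]
  simp only [alongSum_comm G U t m (idOp H') μ]
  have hg : MLin (k := k) fun w' : H'.Wd X X' =>
      alongSum t G U (fun v' => f X X' Y Y' w' ((P Y X).sgn m p) (K'.kos m v')) v :=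
    MLin.alongSum_const G U t (fun v' => hf.mlinL _ _) v
  rw [barSum_alongSum idOp_nil hg, alongSum_barSum_self hF0 hFk hg, pb_idOp hF0, idOp_pb hF, hFν]

theorem pullInsR_insR (hF : F.IsMultilinear)
    (hG0 : ∀ X, G X X .nil = 0) (hG : G.IsMultilinear) (hGk : KosComm G)
    (hU : U.IsMultilinear) (hUk : KosDeg t U) (hμk : KosDeg m μ')
    (hGν : pb G μ' = along m (idOp K) ν' G)
    {f : BiOp H' K' P Q} (hf : f.IsMultilinear) :
    pullInsR t F G U (insR m f μ') - (-1 : k) ^ (t * m) • insR m (pullInsR t F G U f) ν'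
      = pullInsR (t + m) F G (fun X Y w => along t G U μ' X Y w
          - (-1 : k) ^ (t * m) • along m (idOp K) ν' U X Y w) f := by
  funext X X' Y Y' w p v
  simp only [Pi.sub_apply, Pi.smul_apply]
  rw [insR_apply (hf.pullInsR hF hG hU t)]
  simp only [pullInsR_eq, insR_apply hf, alongSum_barSum]
  rw [← barSum_smul, sub_eq_add_neg, ← neg_one_smul k (barSum _ _ _), ← barSum_smul, ← barSum_add]
  refine barSum_ext (fun w' => ?_) w
  rw [neg_one_smul, ← sub_eq_add_neg]
  exact alongSum_commutator hG0 hG hGk hU hUk hμk hGν (hf.mlinR _ _) v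

end Commutators

end BiOp

/-! ### Differential and Euler derivation on operations over formal categories -/

section Bar

variable {k : Type u} [Field k] {Ob : Type u'} {H H' : Quiv.{u, u', v} k Ob}

open Quiv Word Op

/-- An associative product, compatible with the grading: the operations of an `A∞`-category which
is formal. -/
structure Op.IsGradedProduct (ν : Op H H) : Prop where
  multilinear : ν.IsMultilinear
  degree : ν.HasDegree 2
  of_length : ∀ X Y (w : H.Wd X Y), w.length ≠ 2 → ν X Y w = 0
  assoc : along 1 (idOp H) ν ν = fun _ _ _ => 0
  euler : along 0 (idOp H) H.eulerField ν = along 1 (idOp H) ν H.eulerField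

theorem AInfCat.isGradedProduct [CharZero k] (A : AInfCat.{u, u', v} k Ob) :
    IsGradedProduct A.cohμ :=
  ⟨A.cohμ_multilinear, A.cohμ_degree, fun X Y w hw => by
    match w, hw with
    | .nil, _ => rfl
    | .cons a .nil, _ => rfl
    | .cons a (.cons b .nil), hw => exact absurd rfl hw
    | .cons a (.cons b (.cons c w)), _ => rfl,
  A.along_cohμ_cohμ, A.along_eulerField_cohμ⟩

theorem Op.IsGradedProduct.kosDeg {ν : Op H H} (hν : IsGradedProduct ν) : KosDeg 1 ν :=
  hν.degree.kosDeg hν.multilinear (by ring)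

theorem Op.kosDeg_eulerField : KosDeg 0 H.eulerField :=
  eulerField_hasDegree.kosDeg eulerField_multilinear (by ring)

theorem IsAInfFunctor.kosComm {ν : Op H H} {μ : Op H' H'} {F : Op H H'}
    (hF : IsAInfFunctor ν μ F) : KosComm F :=
  (hF.degree.kosDeg (t := 0) hF.multilinear (by ring)).kosComm

theorem IsAInfFunctor.pb_eq {ν : Op H H} {μ : Op H' H'} {F : Op H H'}
    (hF : IsAInfFunctor ν μ F) : pb F μ = along 1 (idOp H) ν F := by
  funext X Y w
  rw [← ins_eq hF.multilinear]
  exact hF.eqn X Y w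

end Bar

namespace BiOp

open Quiv Word Op

variable {k : Type u} [Field k] {ObA : Type u₁} {ObB : Type u₂}
  {H H' : Quiv.{u, u₁, v₁} k ObA} {K K' : Quiv.{u, u₂, v₂} k ObB}
  {P Q R S : ObB → ObA → GrVect.{u, v₃} k}

theorem IsMultilinear.insL {f : BiOp H K P Q} (hf : f.IsMultilinear) {T : Op H H}
    (hT : T.IsMultilinear) (d : ℤ) : (insL d f T).IsMultilinear := by
  rw [insL_eq hf]
  exact hf.pullInsL idOp_multilinear hT idOp_multilinear d

theorem IsMultilinear.insR {f : BiOp H K P Q} (hf : f.IsMultilinear) {T : Op K K}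
    (hT : T.IsMultilinear) (d : ℤ) : (insR d f T).IsMultilinear := by
  rw [insR_eq hf]
  exact hf.pullInsR idOp_multilinear idOp_multilinear hT d

theorem HasDegree.insL {f : BiOp H K P Q} (hf : f.IsMultilinear) {a c d e : ℤ}
    (hd : f.HasDegree a) {T : Op H H} (hT : T.HasDegree e) (he : e = d + 1) (hc : c = a + d) :
    (insL d f T).HasDegree c := by
  rw [insL_eq hf]
  exact hd.pullInsL idOp_hasDegree hT idOp_hasDegree he hc

theorem HasDegree.insR {f : BiOp H K P Q} (hf : f.IsMultilinear) {a c d e : ℤ}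
    (hd : f.HasDegree a) {T : Op K K} (hT : T.HasDegree e) (he : e = d + 1) (hc : c = a + d) :
    (insR d f T).HasDegree c := by
  rw [insR_eq hf]
  exact hd.pullInsR idOp_hasDegree idOp_hasDegree hT he hc

theorem IsMultilinear.add {f g : BiOp H K P Q} (hf : f.IsMultilinear) (hg : g.IsMultilinear) :
    (f + g).IsMultilinear :=
  of_mlin (fun _ _ _ _ m v => (hf.mlinL m v).add (hg.mlinL m v))
    (fun _ _ _ _ w v => ((hf.mid _ _ _ _ w v).mk' + (hg.mid _ _ _ _ w v).mk').isLinear)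
    (fun _ _ _ _ w m => (hf.mlinR w m).add (hg.mlinR w m))

theorem IsMultilinear.smul {f : BiOp H K P Q} (s : k) (hf : f.IsMultilinear) :
    (s • f).IsMultilinear :=
  of_mlin (fun _ _ _ _ m v => MLin.comp_linearMap (s • LinearMap.id) (hf.mlinL m v))
    (fun _ _ _ _ w v => (s • (hf.mid _ _ _ _ w v).mk').isLinear)
    (fun _ _ _ _ w m => MLin.comp_linearMap (s • LinearMap.id) (hf.mlinR w m))

theorem HasDegree.add {f g : BiOp H K P Q} {d : ℤ} (hf : f.HasDegree d) (hg : g.HasDegree d) :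
    (f + g).HasDegree d := fun X X' Y Y' w m v i j n hw hm hv =>
  Submodule.add_mem _ (hf X X' Y Y' w m v i j n hw hm hv) (hg X X' Y Y' w m v i j n hw hm hv)

theorem HasDegree.smul {f : BiOp H K P Q} {d : ℤ} (s : k) (hf : f.HasDegree d) :
    (s • f).HasDegree d := fun X X' Y Y' w m v i j n hw hm hv =>
  Submodule.smul_mem _ _ (hf X X' Y Y' w m v i j n hw hm hv)

theorem pullInsL_sub_left {f : BiOp H' K' P Q} (hf : f.IsMultilinear) (d : ℤ) (F T T' : Op H H')
    (G : Op K K') : pullInsL d F (fun X Y w => T X Y w - T' X Y w) G f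
      = pullInsL d F T G f - pullInsL d F T' G f := by
  funext X X' Y Y' w m v
  simp only [Pi.sub_apply, pullInsL_eq]
  exact alongSum_T_sub (MLin.barSum_const G (fun v' => hf.mlinL _ _) v) w

theorem pullInsR_sub_right {f : BiOp H' K' P Q} (hf : f.IsMultilinear) (d : ℤ) (F : Op H H')
    (G U U' : Op K K') : pullInsR d F G (fun X Y w => U X Y w - U' X Y w) f
      = pullInsR d F G U f - pullInsR d F G U' f := by
  funext X X' Y Y' w m v
  simp only [Pi.sub_apply, pullInsR_eq]
  rw [sub_eq_add_neg, ← neg_one_smul k (barSum _ _ _), ← barSum_smul, ← barSum_add]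
  refine barSum_ext (fun w' => ?_) w
  rw [neg_one_smul, ← sub_eq_add_neg]
  exact alongSum_T_sub (hf.mlinR _ _) v

/-- The terms of the differential of a pre-morphism `f` that come from the products `ν` and `ν'`
of the two categories. -/
noncomputable def delta (ν : Op H H) (ν' : Op K K) (f : BiOp H K P Q) : BiOp H K P Q :=
  insL 1 f ν + insR 1 f ν'

/-- The sum of all ways to apply the Euler fields of the two categories to an input of `f`. -/
noncomputable def eps (f : BiOp H K P Q) : BiOp H K P Q :=
  insL 0 f H.eulerField + insR 0 f K.eulerField

section

variable {ν : Op H H} {ν' : Op K K} {f : BiOp H K Q R} {g : BiOp H K P Q} {e : ℤ}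

theorem insL_comp (hf : f.IsMultilinear) (hg : g.IsMultilinear) (hge : g.HasDegree e) (d : ℤ)
    {T : Op H H} : insL d (comp e f g) T
      = comp (d + e) f (insL d g T) + (-1 : k) ^ (d * e) • comp e (insL d f T) g := by
  rw [insL_eq (hf.comp hg e), pullInsL_comp kosComm_idOp hf (hge.sgnDeg hg), pull_idOp hf,
    pull_idOp hg, insL_eq hf, insL_eq hg]

theorem insR_comp (hf : f.IsMultilinear) (hg : g.IsMultilinear) {d : ℤ} {T : Op K K}
    (hT : KosDeg d T) : insR d (comp e f g) T
      = comp (d + e) f (insR d g T) + (-1 : k) ^ (d * e) • comp e (insR d f T) g := by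
  rw [insR_eq (hf.comp hg e), pullInsR_comp kosComm_idOp hT hf, pull_idOp hf,
    pull_idOp hg, insR_eq hf, insR_eq hg]

/-- `delta` is a derivation of the composition, with Koszul signs. -/
theorem delta_comp (hν' : IsGradedProduct ν') (hf : f.IsMultilinear) (hg : g.IsMultilinear)
    (hge : g.HasDegree e) : delta ν ν' (comp e f g)
      = comp (e + 1) f (delta ν ν' g) + (-1 : k) ^ e • comp e (delta ν ν' f) g := by
  rw [delta, insL_comp hf hg hge, insR_comp hf hg hν'.kosDeg, delta, delta, one_mul, add_comm 1 e,
    (isLinearMap_comp_left g).map_add, (isLinearMap_comp_right hf).map_add, smul_add]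
  abel

/-- `eps` is a derivation of the composition. -/
theorem eps_comp (hf : f.IsMultilinear) (hg : g.IsMultilinear)
    (hge : g.HasDegree e) : eps (comp e f g) = comp e f (eps g) + comp e (eps f) g := by
  rw [eps, insL_comp hf hg hge, insR_comp hf hg kosDeg_eulerField, eps, eps, zero_mul, zero_add,
    zpow_zero, one_smul, one_smul, (isLinearMap_comp_left g).map_add,
    (isLinearMap_comp_right hf).map_add]
  abel

theorem IsMultilinear.delta (hν : IsGradedProduct ν) (hν' : IsGradedProduct ν')
    (hf : f.IsMultilinear) : (delta ν ν' f).IsMultilinear :=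
  (hf.insL hν.multilinear 1).add (hf.insR hν'.multilinear 1)

theorem IsMultilinear.eps (hf : f.IsMultilinear) : (eps f).IsMultilinear :=
  (hf.insL eulerField_multilinear 0).add (hf.insR eulerField_multilinear 0)

theorem HasDegree.delta (hν : IsGradedProduct ν) (hν' : IsGradedProduct ν')
    (hf : f.IsMultilinear) (hd : f.HasDegree e) : (delta ν ν' f).HasDegree (e + 1) :=
  (hd.insL hf hν.degree (by ring) rfl).add (hd.insR hf hν'.degree (by ring) rfl)

theorem isLinearMap_insL (d : ℤ) (T : Op H H) :
    IsLinearMap k (fun f : BiOp H K P Q => insL d f T) := by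
  constructor <;> intros <;> funext X X' Y Y' w m v
  · simp only [Pi.add_apply, insL, List.sum_map_add]
  · simp only [Pi.smul_apply, insL, List.smul_sum, List.map_map]
    rfl

theorem isLinearMap_insR (d : ℤ) (T : Op K K) :
    IsLinearMap k (fun f : BiOp H K P Q => insR d f T) := by
  constructor <;> intros <;> funext X X' Y Y' w m v
  · simp only [Pi.add_apply, insR, List.sum_map_add]
  · simp only [Pi.smul_apply, insR, List.smul_sum, List.map_map]
    rfl

theorem isLinearMap_delta (ν : Op H H) (ν' : Op K K) :
    IsLinearMap k (delta ν ν' : BiOp H K P Q → BiOp H K P Q) :=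
  ((isLinearMap_insL 1 ν).mk' + (isLinearMap_insR 1 ν').mk').isLinear

theorem isLinearMap_eps : IsLinearMap k (eps : BiOp H K P Q → BiOp H K P Q) :=
  ((isLinearMap_insL 0 _).mk' + (isLinearMap_insR 0 _).mk').isLinear

theorem pullInsL_zero {F : Op H H'} {G : Op K K'} {f : BiOp H' K' P Q} (hf : f.IsMultilinear)
    (d : ℤ) {T : Op H H'} (hT : ∀ X Y w, T X Y w = 0) : pullInsL d F T G f = 0 := by
  rw [show T = fun _ _ _ => 0 from funext fun X => funext fun Y => funext fun w => hT X Y w]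
  funext X X' Y Y' w m v
  rw [pullInsL_eq]
  exact alongSum_T_zero (MLin.barSum_const G (fun v' => hf.mlinL _ _) v) w

theorem pullInsR_zero {F : Op H H'} {G : Op K K'} {f : BiOp H' K' P Q} (hf : f.IsMultilinear)
    (d : ℤ) {U : Op K K'} (hU : ∀ X Y w, U X Y w = 0) : pullInsR d F G U f = 0 := by
  rw [show U = fun _ _ _ => 0 from funext fun X => funext fun Y => funext fun w => hU X Y w]
  funext X X' Y Y' w m v
  simp only [pullInsR_eq, alongSum_T_zero (hf.mlinR _ _), barSum_zero]
  rfl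

/-- `delta` is a differential, as the products are associative. -/
theorem delta_delta [CharZero k] (hν : IsGradedProduct ν) (hν' : IsGradedProduct ν')
    (hf : f.IsMultilinear) : delta ν ν' (delta ν ν' f) = 0 := by
  have hL := hf.insL hν.multilinear 1
  have hR := hf.insR hν'.multilinear 1
  have two : ∀ x : BiOp H K Q R, x + x = 0 → x = 0 := fun x hx => by
    rw [← two_smul k] at hx
    exact (smul_eq_zero.1 hx).resolve_left two_ne_zero
  have LL := pullInsL_insL idOp_nil idOp_multilinear kosComm_idOp hν.multilinear hν.kosDeg
    hν.kosDeg ((idOp_pb hν.multilinear).trans along_idOp.symm)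
    (idOp_multilinear (H := K)) kosComm_idOp hf
  have RR := pullInsR_insR (idOp_multilinear (H := H)) idOp_nil idOp_multilinear kosComm_idOp
    hν'.multilinear hν'.kosDeg hν'.kosDeg
    ((idOp_pb hν'.multilinear).trans along_idOp.symm) hf
  have LR := pullInsL_insR (t := 1) idOp_multilinear hν.multilinear hν'.kosDeg idOp_nil
    idOp_multilinear kosComm_idOp ((idOp_pb hν'.multilinear).trans along_idOp.symm) hf
  replace LL := LL.trans (pullInsL_zero hf _ fun X Y w => by simp [hν.assoc])
  replace RR := RR.trans (pullInsR_zero hf _ fun X Y w => by simp [hν'.assoc])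
  rw [← insL_eq hL, ← insL_eq hf] at LL
  rw [← insR_eq hR, ← insR_eq hf] at RR
  rw [← insL_eq hR, ← insL_eq hf] at LR
  norm_num at LL RR LR
  rw [delta, delta, (isLinearMap_insL 1 ν).map_add, (isLinearMap_insR 1 ν').map_add, LR,
    two _ LL, two _ RR]
  abel

/-- `delta` commutes with `eps`, as the Euler fields are derivations of the products. -/
theorem delta_eps (hν : IsGradedProduct ν) (hν' : IsGradedProduct ν')
    (hf : f.IsMultilinear) : eps (delta ν ν' f) = delta ν ν' (eps f) := by
  have hL := hf.insL hν.multilinear 1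
  have hR := hf.insR hν'.multilinear 1
  have em := eulerField_multilinear (H := H)
  have em' := eulerField_multilinear (H := K)
  have LL := pullInsL_insL idOp_nil idOp_multilinear kosComm_idOp em kosDeg_eulerField
    hν.kosDeg ((idOp_pb hν.multilinear).trans along_idOp.symm)
    (idOp_multilinear (H := K)) kosComm_idOp hf
  have RR := pullInsR_insR (idOp_multilinear (H := H)) idOp_nil idOp_multilinear kosComm_idOp
    em' kosDeg_eulerField hν'.kosDeg
    ((idOp_pb hν'.multilinear).trans along_idOp.symm) hf
  have LR := pullInsL_insR (t := 0) idOp_multilinear em hν'.kosDeg idOp_nil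
    idOp_multilinear kosComm_idOp ((idOp_pb hν'.multilinear).trans along_idOp.symm) hf
  have RL := pullInsR_insL (t := 0) (m := 1) idOp_nil idOp_multilinear kosComm_idOp
    ((idOp_pb hν.multilinear).trans along_idOp.symm) idOp_multilinear kosComm_idOp
    em' kosDeg_eulerField hf
  replace LL := LL.trans (pullInsL_zero hf _ fun X Y w => by simp [hν.euler])
  replace RR := RR.trans (pullInsR_zero hf _ fun X Y w => by simp [hν'.euler])
  rw [← insL_eq hL, ← insL_eq hf] at LL
  rw [← insR_eq hR, ← insR_eq hf] at RR
  rw [← insL_eq hR, ← insL_eq hf] at LR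
  rw [← insR_eq hL, ← insR_eq hf] at RL
  simp only [zero_mul, zpow_zero, one_smul, sub_eq_zero] at LL RR LR RL
  rw [delta, delta, eps, eps, (isLinearMap_insL 1 ν).map_add, (isLinearMap_insR 1 ν').map_add,
    (isLinearMap_insL 0 _).map_add, (isLinearMap_insR 0 _).map_add, LL, LR, RR, RL]
  abel

end

section

variable {μ : Op H' H'} {μ' : Op K' K'} {ν : Op H H} {ν' : Op K K} {F T : Op H H'}
  {G U : Op K K'} {f : BiOp H' K' P Q}

/-- Pullback along `A∞`-functors is a map of complexes for the differentials `delta`. -/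
theorem pull_delta (hF : IsAInfFunctor ν μ F) (hG : IsAInfFunctor ν' μ' G)
    (hf : f.IsMultilinear) : pull F G (delta μ μ' f) = delta ν ν' (pull F G f) := by
  rw [delta, delta, (isLinearMap_pull F G).map_add, pull_insL hF.nil hf, pull_insR hG.nil hf,
    hF.pb_eq, hG.pb_eq, insL_pull hF.nil hF.multilinear hF.kosComm hG.multilinear hG.kosComm hf,
    insR_pull hF.multilinear hG.nil hG.multilinear hG.kosComm hf]

/-- Inserting `T` along `F` is a homotopy, whose differential inserts the differential of `T`. -/
theorem pullInsL_delta (hμ : μ.IsMultilinear) (hμd : μ.HasDegree 2) (hμ' : μ'.IsMultilinear)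
    (hμ'd : μ'.HasDegree 2) (hF : IsAInfFunctor ν μ F) (hG : IsAInfFunctor ν' μ' G)
    (hT : T.IsMultilinear) (hTd : T.HasDegree 0) (hf : f.IsMultilinear) :
    pullInsL (-1) F T G (delta μ μ' f) + delta ν ν' (pullInsL (-1) F T G f)
      = pullInsL 0 F (natDiff ν μ F 0 T) G f := by
  have LL := pullInsL_insL hF.nil hF.multilinear hF.kosComm hT
    (hTd.kosDeg (t := -1) hT (by ring)) (hμd.kosDeg (t := 1) hμ (by ring)) hF.pb_eq
    hG.multilinear hG.kosComm hf
  have LR := pullInsL_insR (t := -1) hF.multilinear hT (hμ'd.kosDeg (t := 1) hμ' (by ring)) hG.nil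
    hG.multilinear hG.kosComm hG.pb_eq hf
  rw [delta, (isLinearMap_pullInsL _ _ _ _).map_add, LR, eq_add_of_sub_eq LL, delta]
  have e : natDiff ν μ F 0 T = fun X Y w => along (-1) F T μ X Y w
      - (-1 : k) ^ ((-1 : ℤ) * 1) • along 1 (idOp H) ν T X Y w := by
    funext X Y w
    rw [natDiff, ins_eq hT]
    rfl
  rw [e, show (-1 : ℤ) + 1 = 0 by ring, show (-1 : k) ^ ((-1 : ℤ) * 1) = -1 by simp, neg_one_smul,
    neg_one_smul]
  abel

theorem pullInsR_delta (hμ' : μ'.IsMultilinear)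
    (hμ'd : μ'.HasDegree 2) (hF : IsAInfFunctor ν μ F) (hG : IsAInfFunctor ν' μ' G)
    (hU : U.IsMultilinear) (hUd : U.HasDegree 0) (hf : f.IsMultilinear) :
    pullInsR (-1) F G U (delta μ μ' f) + delta ν ν' (pullInsR (-1) F G U f)
      = pullInsR 0 F G (natDiff ν' μ' G 0 U) f := by
  have RR := pullInsR_insR hF.multilinear hG.nil hG.multilinear hG.kosComm hU
    (hUd.kosDeg (t := -1) hU (by ring)) (hμ'd.kosDeg (t := 1) hμ' (by ring)) hG.pb_eq hf
  have RL := pullInsR_insL (m := 1) (t := -1) hF.nil hF.multilinear hF.kosComm hF.pb_eq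
    hG.multilinear hG.kosComm hU (hUd.kosDeg (t := -1) hU (by ring)) hf
  rw [delta, (isLinearMap_pullInsR _ _ _ _).map_add, RL, eq_add_of_sub_eq RR, delta]
  have e : natDiff ν' μ' G 0 U = fun X Y w => along (-1) G U μ' X Y w
      - (-1 : k) ^ ((-1 : ℤ) * 1) • along 1 (idOp K) ν' U X Y w := by
    funext X Y w
    rw [natDiff, ins_eq hU]
    rfl
  rw [e, show (-1 : ℤ) + 1 = 0 by ring, show (-1 : k) ^ ((-1 : ℤ) * 1) = -1 by simp, neg_one_smul,
    neg_one_smul]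
  abel

end

end BiOp

/-! ### The pullback bimodule and its equivariant structure -/

namespace AInfBimod

open Op BiOp

variable {k : Type u} [Field k] {ObA : Type u₁} {ObB : Type u₂}
  {A : AInfCat.{u, u₁, v₁} k ObA} {B : AInfCat.{u, u₂, v₂} k ObB}
  (P : AInfBimod.{u, u₁, u₂, v₁, v₂, v₃} A B) {F T : Op A.coh A.hom} {G S : Op B.coh B.hom}

/-- The `A∞`-bimodule equations, as a Maurer-Cartan equation. -/
theorem delta_μ_add : delta A.μ B.μ P.μ + comp 1 P.μ P.μ = 0 := by
  funext X X' Y Y' w m v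
  have := P.rel X X' Y Y' w m v
  simp only [delta, Pi.add_apply, Pi.zero_apply]
  rw [← this]
  abel

theorem pullμ_multilinear (hF : IsAInfFunctor A.cohμ A.μ F) (hG : IsAInfFunctor B.cohμ B.μ G) :
    (P.pullμ F G).IsMultilinear := P.multilinear.pull hF.multilinear hG.multilinear

theorem pullμ_degree (hF : IsAInfFunctor A.cohμ A.μ F) (hG : IsAInfFunctor B.cohμ B.μ G) :
    (P.pullμ F G).HasDegree 1 := P.degree.pull hF.degree hG.degree

/-- The pullback of a bimodule along `A∞`-functors satisfies the bimodule equations. -/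
theorem delta_pullμ_add (hF : IsAInfFunctor A.cohμ A.μ F) (hG : IsAInfFunctor B.cohμ B.μ G) :
    delta A.cohμ B.cohμ (P.pullμ F G) + comp 1 (P.pullμ F G) (P.pullμ F G) = 0 := by
  have h := congrArg (pull F G) P.delta_μ_add
  rwa [(isLinearMap_pull F G).map_add, (isLinearMap_pull F G).map_zero, pull_delta hF hG
    P.multilinear, pull_comp hG.kosComm P.multilinear] at h

variable {bA : Op A.hom A.hom} {bB : Op B.hom B.hom} {cA : ∀ X, A.hom X X} {cB : ∀ Y, B.hom Y Y}
  {c : BiOp A.hom B.hom P.space P.space}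

theorem pullEquivariant_eq : P.pullEquivariant F T G S c = pull F G c
    + pullInsL (-1) F T G P.μ + pullInsR (-1) F G S P.μ := rfl

theorem pullEquivariant_multilinear (hF : IsAInfFunctor A.cohμ A.μ F)
    (hG : IsAInfFunctor B.cohμ B.μ G) (hT : A.IsEquivariantHomotopy bA cA F T)
    (hS : B.IsEquivariantHomotopy bB cB G S) (hc : P.IsEquivariantStructure bA bB c) :
    (P.pullEquivariant F T G S c).IsMultilinear :=
  ((hc.multilinear.pull hF.multilinear hG.multilinear).add
    (P.multilinear.pullInsL hF.multilinear hT.multilinear hG.multilinear _)).add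
    (P.multilinear.pullInsR hF.multilinear hG.multilinear hS.multilinear _)

theorem pullEquivariant_degree (hF : IsAInfFunctor A.cohμ A.μ F)
    (hG : IsAInfFunctor B.cohμ B.μ G) (hT : A.IsEquivariantHomotopy bA cA F T)
    (hS : B.IsEquivariantHomotopy bB cB G S) (hc : P.IsEquivariantStructure bA bB c) :
    (P.pullEquivariant F T G S c).HasDegree 0 :=
  ((hc.degree.pull hF.degree hG.degree).add
    (P.degree.pullInsL hF.degree hT.degree hG.degree (by ring) (by ring))).add
    (P.degree.pullInsR hF.degree hG.degree hS.degree (by ring) (by ring))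

/-- The induced equivariant structure is an equivariant structure for the Euler fields. -/
theorem delta_pullEquivariant_add (hF : IsAInfFunctor A.cohμ A.μ F)
    (hG : IsAInfFunctor B.cohμ B.μ G) (hT : A.IsEquivariantHomotopy bA cA F T)
    (hS : B.IsEquivariantHomotopy bB cB G S) (hc : P.IsEquivariantStructure bA bB c) :
    delta A.cohμ B.cohμ (P.pullEquivariant F T G S c)
      + comp 1 (P.pullEquivariant F T G S c) (P.pullμ F G)
      - comp 0 (P.pullμ F G) (P.pullEquivariant F T G S c) = eps (P.pullμ F G) := by
  have hQ := P.pullμ_multilinear hF hG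
  have ec : delta A.μ B.μ c + comp 1 c P.μ - comp 0 P.μ c = insL 0 P.μ bA + insR 0 P.μ bB := by
    funext X X' Y Y' w m v
    have := hc.eqn X X' Y Y' w m v
    simp only [endDiff, diff, νA, νB, zpow_zero, one_smul, sub_neg_eq_add] at this
    simp only [delta, Pi.add_apply, Pi.sub_apply]
    rw [← this]
    abel
  -- the equation of `c` is pulled back, and `T` and `S` are inserted into the bimodule equation
  have h₁ := congrArg (pull F G) ec
  rw [(isLinearMap_pull F G).map_sub, (isLinearMap_pull F G).map_add,
    (isLinearMap_pull F G).map_add,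
    pull_delta hF hG hc.multilinear, pull_comp hG.kosComm hc.multilinear,
    pull_comp hG.kosComm P.multilinear, pull_insL hF.nil P.multilinear,
    pull_insR hG.nil P.multilinear] at h₁
  have h₂ := congrArg (pullInsL (-1) F T G) P.delta_μ_add
  rw [(isLinearMap_pullInsL _ _ _ _).map_add, (isLinearMap_pullInsL _ _ _ _).map_zero,
    eq_sub_of_add_eq (pullInsL_delta A.multilinear A.degree B.multilinear B.degree hF hG
      hT.multilinear hT.degree P.multilinear),
    pullInsL_comp hG.kosComm P.multilinear (P.degree.sgnDeg P.multilinear)] at h₂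
  have h₃ := congrArg (pullInsR (-1) F G S) P.delta_μ_add
  rw [(isLinearMap_pullInsR _ _ _ _).map_add, (isLinearMap_pullInsR _ _ _ _).map_zero,
    eq_sub_of_add_eq (pullInsR_delta B.multilinear B.degree hF hG
      hS.multilinear hS.degree P.multilinear),
    pullInsR_comp hG.kosComm (hS.degree.kosDeg hS.multilinear (by ring)) P.multilinear] at h₃
  -- the vector fields of `A` and `B` in the first equation cancel against the other two
  have dT : natDiff A.cohμ A.μ F 0 T = fun X Y w => along 0 (idOp A.coh) A.coh.eulerField F X Y w
      - pb F bA X Y w := by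
    funext X Y w
    rw [hT.eqn, ins_eq hF.multilinear]
    rfl
  have dS : natDiff B.cohμ B.μ G 0 S = fun X Y w => along 0 (idOp B.coh) B.coh.eulerField G X Y w
      - pb G bB X Y w := by
    funext X Y w
    rw [hS.eqn, ins_eq hG.multilinear]
    rfl
  rw [dT, pullInsL_sub_left P.multilinear, ← insL_pull hF.nil hF.multilinear hF.kosComm
    hG.multilinear hG.kosComm P.multilinear] at h₂
  rw [dS, pullInsR_sub_right P.multilinear, ← insR_pull hF.multilinear hG.nil
    hG.multilinear hG.kosComm P.multilinear] at h₃
  change _ + comp 1 _ (P.pullμ F G) - comp 0 (P.pullμ F G) _ = _ at h₁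
  change insL 0 (P.pullμ F G) _ - _ - _
    + (comp _ (P.pullμ F G) _ + _ • comp _ _ (P.pullμ F G)) = 0 at h₂
  change insR 0 (P.pullμ F G) _ - _ - _
    + (comp _ (P.pullμ F G) _ + _ • comp _ _ (P.pullμ F G)) = 0 at h₃
  rw [show (-1 : ℤ) + 1 = 0 by ring, show (-1 : k) ^ ((-1 : ℤ) * 1) = -1 by simp,
    neg_one_smul] at h₂ h₃
  rw [pullEquivariant_eq, (isLinearMap_delta _ _).map_add, (isLinearMap_delta _ _).map_add,
    (isLinearMap_comp_left _).map_add, (isLinearMap_comp_left _).map_add,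
    (isLinearMap_comp_right hQ).map_add, (isLinearMap_comp_right hQ).map_add, eps]
  linear_combination (norm := abel) h₁ - h₂ - h₃

end AInfBimod

/-! ### Linear terms and the length filtration of operations on bimodules -/

namespace BiOp

open Quiv Word Op

variable {k : Type u} [Field k] {ObA : Type u₁} {ObB : Type u₂}
  {H : Quiv.{u, u₁, v₁} k ObA} {K : Quiv.{u, u₂, v₂} k ObB}
  {P Q R S : ObB → ObA → GrVect.{u, v₃} k}

/-- The operation which applies linear maps to the elements of the bimodule, with no other
terms. -/
def linear (l : ∀ Y X, P Y X →ₗ[k] Q Y X) : BiOp H K P Q := fun _ _ _ _ w m v =>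
  match w, v, m with
  | .nil, .nil, m => l _ _ m
  | _, _, _ => 0

theorem ofLinear_eq (l : ∀ Y X, P Y X →ₗ[k] P Y X) :
    (ofLinear l : BiOp H K P P) = linear l := by
  funext X X' Y Y' w m v
  cases w <;> cases v <;> rfl

section Linear

variable (l : ∀ Y X, P Y X →ₗ[k] Q Y X) {X X' : ObA} {Y Y' : ObB} {d e : ℤ}

@[simp] theorem linear_nil (m : P Y X) : (linear l : BiOp H K P Q) X X Y Y .nil m .nil = l Y X m :=
  rfl

theorem linear_of_length_left {w : H.Wd X X'} (hw : 0 < w.length) (m : P Y X) (v : K.Wd Y' Y) :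
    (linear l : BiOp H K P Q) X X' Y Y' w m v = 0 := by
  cases w with
  | nil => simp at hw
  | cons a w => rfl

theorem linear_of_length_right (w : H.Wd X X') (m : P Y X) {v : K.Wd Y' Y} (hv : 0 < v.length) :
    (linear l : BiOp H K P Q) X X' Y Y' w m v = 0 := by
  cases v with
  | nil => simp at hv
  | cons a v => cases w <;> rfl

theorem linear_multilinear : (linear l : BiOp H K P Q).IsMultilinear := by
  refine ⟨fun X X₁ X₂ X' Y Y' p q m v => ?_, fun X X' Y Y' w v => ?_,
    fun X X' Y Y₁ Y₂ Y' w m p q => ?_⟩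
  · have h : ∀ a : H X₁ X₂, (linear l : BiOp H K P Q) X X' Y Y' (p.append (.cons a q)) m v = 0 :=
      fun a => linear_of_length_left l (by simp) m v
    exact ⟨fun a b => by simp only [h, add_zero], fun c a => by simp only [h, smul_zero]⟩
  · cases w with
    | nil =>
      cases v with
      | nil => exact (l _ _).isLinear
      | cons a v => exact ⟨fun _ _ => (add_zero _).symm, fun _ _ => (smul_zero _).symm⟩
    | cons a w => exact ⟨fun _ _ => (add_zero _).symm, fun _ _ => (smul_zero _).symm⟩
  · have h : ∀ a : K Y₁ Y₂, (linear l : BiOp H K P Q) X X' Y Y' w m (p.append (.cons a q)) = 0 :=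
      fun a => linear_of_length_right l w m (by simp)
    exact ⟨fun a b => by simp only [h, add_zero], fun c a => by simp only [h, smul_zero]⟩

theorem linear_hasDegree (hl : ∀ Y X n, ∀ m ∈ (P Y X).gr n, l Y X m ∈ (Q Y X).gr (n + d)) :
    (linear l : BiOp H K P Q).HasDegree d := by
  intro X X' Y Y' w m v i j n hw hm hv
  cases w with
  | cons a w => exact zero_mem _
  | nil =>
    cases v with
    | cons a v => exact zero_mem _
    | nil =>
      rw [show i = 0 from hw, show j = 0 from hv, zero_add, add_zero]
      exact hl Y X n m hm

theorem linear_comp (f : BiOp H K R P) (w : H.Wd X X') (m : R Y X) (v : K.Wd Y' Y) :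
    comp e (linear l) f X X' Y Y' w m v = l Y' X' (f X X' Y Y' w m v) := by
  rw [comp_eq, splitSum_eq_nil_left, splitSum_eq_nil_right]
  · rfl
  · exact fun Y p q hq => linear_of_length_right l _ _ (by simpa using hq)
  · intro Y p q hp
    simp only [linear_of_length_left l hp, splitSum_zero]

theorem comp_linear {f : BiOp H K Q R} (hf : f.IsMultilinear) (w : H.Wd X X') (m : P Y X)
    (v : K.Wd Y' Y) :
    comp e f (linear l) X X' Y Y' w m v = f X X' Y Y' w (l Y X m) (K.kos e v) := by
  rw [comp_eq, splitSum_eq_nil_right, splitSum_eq_nil_left]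
  · rfl
  · exact fun Y p q hp => by rw [linear_of_length_right l _ _ hp, (hf.mid _ _ _ _ _ _).map_zero]
  · intro Y p q hq
    simp only [linear_of_length_left l hq, (hf.mid _ _ _ _ _ _).map_zero, splitSum_zero]

theorem linear_comp_linear (l' : ∀ Y X, Q Y X →ₗ[k] R Y X) :
    comp e (linear l' : BiOp H K Q R) (linear l) = linear fun Y X => l' Y X ∘ₗ l Y X := by
  funext X X' Y Y' w m v
  rw [linear_comp]
  cases w <;> cases v <;> first | rfl | exact map_zero _

theorem insL_linear (T : Op H H) : insL d (linear l : BiOp H K P Q) T = 0 := by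
  funext X X' Y Y' w m v
  rw [insL_apply (linear_multilinear l), alongSum_congr_right
    (fun u hu => linear_of_length_left l hu _ _), alongSum_zero]
  rfl

theorem insR_linear (T : Op K K) : insR d (linear l : BiOp H K P Q) T = 0 := by
  funext X X' Y Y' w m v
  rw [insR_apply (linear_multilinear l), alongSum_congr_right
    (fun u hu => linear_of_length_right l _ _ hu), alongSum_zero]
  rfl

theorem delta_linear (ν : Op H H) (ν' : Op K K) : delta ν ν' (linear l : BiOp H K P Q) = 0 := by
  rw [delta, insL_linear, insR_linear, add_zero]

theorem eps_linear : eps (linear l : BiOp H K P Q) = 0 := by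
  rw [eps, insL_linear, insR_linear, add_zero]

theorem id_eq : (BiOp.id : BiOp H K P P) = linear fun _ _ => LinearMap.id := ofLinear_eq _

theorem id_multilinear : (BiOp.id : BiOp H K P P).IsMultilinear := by
  rw [id_eq]; exact linear_multilinear _

theorem id_hasDegree : (BiOp.id : BiOp H K P P).HasDegree 0 := by
  rw [id_eq]
  exact linear_hasDegree _ fun Y X n m hm => by simpa using hm

theorem id_comp (f : BiOp H K P Q) : comp e BiOp.id f = f := by
  funext X X' Y Y' w m v
  rw [id_eq, linear_comp]
  rfl

theorem comp_id {f : BiOp H K P Q} (hf : f.IsMultilinear) : comp 0 f BiOp.id = f := by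
  funext X X' Y Y' w m v
  rw [id_eq, comp_linear _ hf]
  simp

end Linear

/-- The operation `f` vanishes if there are fewer than `N` inputs besides the element of the
bimodule. -/
def VanishesBelow (N : ℕ) (f : BiOp H K P Q) : Prop :=
  ∀ (X X' : ObA) (Y Y' : ObB) (w : H.Wd X X') (m : P Y X) (v : K.Wd Y' Y),
    w.length + v.length < N → f X X' Y Y' w m v = 0

/-- Multiplication by a coefficient that depends on the number of inputs. -/
def smulLength (c : ℕ → k) (f : BiOp H K P Q) : BiOp H K P Q := fun X X' Y Y' w m v =>
  c (w.length + v.length) • f X X' Y Y' w m v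

section Length

variable {f g : BiOp H K P Q} {N M : ℕ} {e d : ℤ} (c : ℕ → k)

theorem IsMultilinear.smulLength (hf : f.IsMultilinear) : (smulLength c f).IsMultilinear := by
  refine ⟨fun X X₁ X₂ X' Y Y' p q m v => ?_, fun X X' Y Y' w v => ?_,
    fun X X' Y Y₁ Y₂ Y' w m p q => ?_⟩
  · simp only [BiOp.smulLength, length_append, length_cons]
    exact ⟨fun a b => by rw [(hf.left _ _ _ _ _ _ p q m v).map_add, smul_add],
      fun s a => by rw [(hf.left _ _ _ _ _ _ p q m v).map_smul, smul_comm]⟩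
  · simp only [BiOp.smulLength]
    exact ⟨fun a b => by rw [(hf.mid _ _ _ _ w v).map_add, smul_add],
      fun s a => by rw [(hf.mid _ _ _ _ w v).map_smul, smul_comm]⟩
  · simp only [BiOp.smulLength, length_append, length_cons]
    exact ⟨fun a b => by rw [(hf.right _ _ _ _ _ _ w m p q).map_add, smul_add],
      fun s a => by rw [(hf.right _ _ _ _ _ _ w m p q).map_smul, smul_comm]⟩

theorem HasDegree.smulLength (hf : f.HasDegree e) : (smulLength c f).HasDegree e :=
  fun X X' Y Y' w m v i j n hw hm hv => Submodule.smul_mem _ _ (hf X X' Y Y' w m v i j n hw hm hv)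

theorem VanishesBelow.smulLength (hf : VanishesBelow N f) : VanishesBelow N (smulLength c f) :=
  fun X X' Y Y' w m v h => by rw [BiOp.smulLength, hf X X' Y Y' w m v h, smul_zero]

theorem smulLength_sub : smulLength c (f - g) = smulLength c f - smulLength c g := by
  funext X X' Y Y' w m v
  exact smul_sub _ _ _

theorem VanishesBelow.zero (f : BiOp H K P Q) : VanishesBelow 0 f :=
  fun _ _ _ _ _ _ _ h => absurd h (Nat.not_lt_zero _)

theorem VanishesBelow.add (hf : VanishesBelow N f) (hg : VanishesBelow N g) :
    VanishesBelow N (f + g) := fun X X' Y Y' w m v h => by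
  rw [Pi.add_apply, Pi.add_apply, Pi.add_apply, Pi.add_apply, Pi.add_apply, Pi.add_apply,
    Pi.add_apply, hf X X' Y Y' w m v h, hg X X' Y Y' w m v h, add_zero]

theorem VanishesBelow.neg (hf : VanishesBelow N f) : VanishesBelow N (-f) :=
  fun X X' Y Y' w m v h => neg_eq_zero.2 (hf X X' Y Y' w m v h)

theorem VanishesBelow.sub (hf : VanishesBelow N f) (hg : VanishesBelow N g) :
    VanishesBelow N (f - g) := by
  rw [sub_eq_add_neg]; exact hf.add hg.neg

theorem VanishesBelow.mono (hf : VanishesBelow N f) (h : M ≤ N) : VanishesBelow M f :=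
  fun X X' Y Y' w m v hw => hf X X' Y Y' w m v (hw.trans_le h)

theorem eq_zero_of_vanishesBelow (hf : ∀ N, VanishesBelow N f) : f = 0 := by
  funext X X' Y Y' w m v
  exact hf _ X X' Y Y' w m v (Nat.lt_succ_self _)

theorem VanishesBelow.comp {f : BiOp H K Q R} (hfm : f.IsMultilinear) (hf : VanishesBelow M f)
    (hg : VanishesBelow N g) (e : ℤ) : VanishesBelow (M + N) (comp e f g) := by
  intro X X' Y Y' w m v h
  rw [comp_eq, splitSum_congr w (L := fun _ _ _ => 0), splitSum_zero]
  intro X₁ p q _ hl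
  rw [splitSum_congr v (L := fun _ _ _ => 0), splitSum_zero]
  intro Y₁ r s _ hl'
  by_cases hq : q.length + r.length < N
  · rw [hg _ _ _ _ _ _ _ hq, (hfm.mid _ _ _ _ _ _).map_zero]
  · exact hf _ _ _ _ _ _ _ (by rw [length_kos]; omega)

/-- Inserting a product shortens a word by one letter. -/
theorem insSum_eq_zero_of_short {Ob : Type*} {H : Quiv.{u, _, v} k Ob} {V : Type*} [AddCommGroup V]
    [Module k V] {ν : Op H H} (hν : ∀ X Y (w : H.Wd X Y), w.length ≠ 2 → ν X Y w = 0)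
    {X Z : Ob} {g : H.Wd X Z → V} (hg : MLin (k := k) g) (w : H.Wd X Z)
    (h : ∀ u, u.length + 1 = w.length → g u = 0) : insSum d ν g w = 0 := by
  rw [insSum_def, splitSum_congr w (L := fun _ _ _ => 0), splitSum_zero]
  intro Y p r _ hl
  rw [splitSum_congr r (L := fun _ _ _ => 0), splitSum_zero]
  intro Y' r₁ q _ hl'
  by_cases h₁ : r₁.length = 2
  · exact h _ (by simp; omega)
  · rw [hν _ _ _ h₁, (hg _ _).map_zero]

theorem VanishesBelow.delta {ν : Op H H} {ν' : Op K K} (hν : IsGradedProduct ν)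
    (hν' : IsGradedProduct ν') (hfm : f.IsMultilinear) (hf : VanishesBelow N f) :
    VanishesBelow (N + 1) (delta ν ν' f) := by
  intro X X' Y Y' w m v h
  have hL : insL 1 f ν X X' Y Y' w m v = 0 :=
    insSum_eq_zero_of_short hν.of_length (hfm.mlinL ((P Y X).sgn 1 m) (K.kos 1 v)) w
      fun u hu => hf _ _ _ _ _ _ _ (by simp; omega)
  have hR : insR 1 f ν' X X' Y Y' w m v = 0 :=
    insSum_eq_zero_of_short hν'.of_length (hfm.mlinR w m) v
      fun u hu => hf _ _ _ _ _ _ _ (by omega)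
  simp [BiOp.delta, hL, hR]

/-- The commutator with the Euler fields determines the degree and the number of inputs. -/
theorem euler_weight {f : BiOp H K P Q} (hf : f.IsMultilinear) (hd : f.HasDegree e) :
    comp e (linear fun Y X => (Q Y X).euler) f - comp 0 f (linear fun Y X => (P Y X).euler) - eps f
      = smulLength (fun l => (e : k) - l) f := by
  have lin : ∀ V : ObB → ObA → GrVect.{u, v₃} k,
      (linear fun Y X => (V Y X).euler : BiOp H K V V).IsMultilinear := fun V =>
        linear_multilinear _
  have sub : ∀ {f g : BiOp H K P Q}, f.IsMultilinear → g.IsMultilinear → (f - g).IsMultilinear :=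
    fun hf hg => by
      rw [sub_eq_add_neg, ← neg_one_smul k]
      exact hf.add (hg.smul _)
  refine ext_homogeneous (sub (sub ((lin Q).comp hf e) (hf.comp (lin P) 0)) hf.eps)
    (hf.smulLength _) fun X X' Y Y' w m v i n j hw hm hv => ?_
  have h₁ : eps f X X' Y Y' w m v = ((i : k) + w.length) • f X X' Y Y' w m v
      + ((j : k) + v.length) • f X X' Y Y' w m v := by
    rw [eps, ← alongSum_eulerField (hf.mlinL m v) w i hw,
      ← alongSum_eulerField (hf.mlinR w m) v j hv]
    simp only [Pi.add_apply, insL_apply hf, insR_apply hf, GrVect.sgn_zero, kos_zero]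
  have h₂ := GrVect.scale_of_mem _ (fun n => (n : k)) hm
  have h₃ := GrVect.scale_of_mem _ (fun n => (n : k)) (hd X X' Y Y' w m v i j n hw hm hv)
  simp only [Pi.sub_apply, linear_comp, comp_linear _ hf, smulLength, kos_zero, h₁, h₂,
    GrVect.euler,
    h₃, (hf.mid _ _ _ _ _ _).map_smul]
  rw [← add_smul, ← sub_smul, ← sub_smul]
  congr 1
  push_cast
  ring

/-- Solutions of recursive equations for operations, where each step improves the precision. -/
theorem exists_fixedPoint (e : ℤ) (Φ : BiOp H K P Q → BiOp H K P Q)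
    (hΦ : ∀ f, f.IsMultilinear → f.HasDegree e → (Φ f).IsMultilinear ∧ (Φ f).HasDegree e)
    (hc : ∀ N, ∀ f g : BiOp H K P Q, f.IsMultilinear → g.IsMultilinear → VanishesBelow N (f - g) →
      VanishesBelow (N + 1) (Φ f - Φ g)) :
    ∃ f, f.IsMultilinear ∧ f.HasDegree e ∧ Φ f = f := by
  let ag : ℕ → BiOp H K P Q → BiOp H K P Q → Prop := fun N f g => VanishesBelow N (f - g)
  have lim : ∀ s : ℕ → BiOp H K P Q, (∀ n, (s n).IsMultilinear ∧ (s n).HasDegree e) →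
      (∀ n, ag n (s n) (s (n + 1))) →
      ∃ f : BiOp H K P Q, (f.IsMultilinear ∧ f.HasDegree e) ∧ ∀ n, ag n f (s n) := by
    intro s hs ha
    have key : ∀ m n, m ≤ n → ag m (s m) (s n) := by
      intro m n hmn
      induction n, hmn using Nat.le_induction with
      | base => intro _ _ _ _ _ _ _ _; exact sub_self _
      | succ n hmn ih =>
        have := ih.add ((ha n).mono hmn)
        rwa [sub_add_sub_cancel] at this
    refine ⟨fun X X' Y Y' w m v => s (w.length + v.length + 1) X X' Y Y' w m v,
      ⟨⟨fun X X₁ X₂ X' Y Y' p q m v => ?_, fun X X' Y Y' w v => ?_,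
        fun X X' Y Y₁ Y₂ Y' w m p q => ?_⟩, fun X X' Y Y' w m v i j n hw hm hv => ?_⟩,
      fun n X X' Y Y' w m v h => key _ _ h X X' Y Y' w m v (by omega)⟩
    · simp only [length_append, length_cons]
      exact (hs _).1.left _ _ _ _ _ _ p q m v
    · exact (hs _).1.mid _ _ _ _ w v
    · simp only [length_append, length_cons]
      exact (hs _).1.right _ _ _ _ _ _ w m p q
    · exact (hs _).2 _ _ _ _ w m v i j n hw hm hv
  obtain ⟨f, hf, h⟩ := exists_fixedPoint_of_agree ag
    {f | f.IsMultilinear ∧ f.HasDegree e} (fun f g => VanishesBelow.zero _)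
    (fun n f g h => by have := VanishesBelow.neg h; rwa [neg_sub] at this)
    (fun n f g h h₁ h₂ => by
      have := VanishesBelow.add h₁ h₂
      rwa [sub_add_sub_cancel] at this)
    (fun f g h => sub_eq_zero.1 (eq_zero_of_vanishesBelow fun N => (h N).mono (Nat.le_succ N)))
    lim (fun _ _ _ _ _ _ _ => 0)
    ⟨⟨fun _ _ _ _ _ _ _ _ _ _ => ⟨fun _ _ => by simp, fun _ _ => by simp⟩,
      fun _ _ _ _ _ _ => ⟨fun _ _ => by simp, fun _ _ => by simp⟩,
      fun _ _ _ _ _ _ _ _ _ _ => ⟨fun _ _ => by simp, fun _ _ => by simp⟩⟩,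
      fun _ _ _ _ _ _ _ _ _ _ _ _ _ => zero_mem _⟩
    Φ (fun f hf => hΦ f hf.1 hf.2)
    (fun n f hf g hg h => hc n f g hf.1 hg.1 h)
  exact ⟨f, hf.1, hf.2, h⟩

end Length

end BiOp

/-! ### Homological perturbation in a ring -/

namespace PerturbationLemma

variable {R : Type*} [Ring R] {D h n A π : R}

/-- Both one-sided geometric series compute the same element. -/
theorem left_eq_right {B : R} (h₁ : A = n + n * h * A) (h₂ : B = n + B * h * n) : A = B := by
  have e₁ : n * h * A = A - n := by rw [eq_sub_iff_add_eq']; exact h₁.symm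
  have e₂ : B * h * n = B - n := by rw [eq_sub_iff_add_eq']; exact h₂.symm
  have : B * h * A = B - n + (B * h * A - (A - n)) := by
    conv_lhs => rw [h₁]
    rw [mul_add, e₂, show B * h * (n * h * A) = B * h * n * (h * A) by noncomm_ring, e₂, ← e₁]
    noncomm_ring
  have h₃ : B - A = 0 := by
    have := sub_eq_zero.2 this
    rw [← neg_eq_zero, ← this]
    noncomm_ring
  exact (sub_eq_zero.1 h₃).symm

/-- The transferred perturbation `A = n + n * h * n + …` is a Maurer-Cartan element with respect to
the product `x * π * y`. Here `D` is the unperturbed differential, `h` a homotopy from `π` to the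
identity, and `D + n` the perturbed differential. -/
theorem maurerCartan (h₁ : A = n + n * h * A) (h₂ : A = n + A * h * n)
    (hπ : π - 1 = D * h + h * D) (hD : D * D = 0) (hDn : (D + n) * (D + n) = 0) :
    A * π * A + A * D + D * A = 0 := by
  have e₁ : (1 - n * h) * A = n := by
    linear_combination (norm := noncomm_ring) h₁
  have e₂ : A * (1 - h * n) = n := by
    linear_combination (norm := noncomm_ring) h₂
  have e₃ : (1 + A * h) * (1 - n * h) = 1 := by
    linear_combination (norm := noncomm_ring) h₂ * h
  have e₄ : (1 - h * n) * (1 + h * A) = 1 := by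
    linear_combination (norm := noncomm_ring) h * h₁
  have mc : D * n + n * D + n * n = 0 := by
    linear_combination (norm := noncomm_ring) hDn - hD
  have key : (1 - n * h) * (A * π * A + A * D + D * A) * (1 - h * n) = 0 := by
    calc _ = ((1 - n * h) * A) * π * (A * (1 - h * n)) + ((1 - n * h) * A) * D * (1 - h * n)
          + (1 - n * h) * D * (A * (1 - h * n)) := by noncomm_ring
      _ = n * (π - 1) * n + n * n + n * D * (1 - h * n) + (1 - n * h) * D * n := by
          rw [e₁, e₂]; noncomm_ring
      _ = 0 := by
          rw [hπ]; linear_combination (norm := noncomm_ring) mc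
  calc _ = ((1 + A * h) * (1 - n * h)) * (A * π * A + A * D + D * A)
        * ((1 - h * n) * (1 + h * A)) := by rw [e₃, e₄, one_mul, mul_one]
    _ = (1 + A * h) * ((1 - n * h) * (A * π * A + A * D + D * A) * (1 - h * n))
        * (1 + h * A) := by noncomm_ring
    _ = 0 := by rw [key]; noncomm_ring

/-- `1 + h * A` intertwines the transferred differential with the perturbed one. On the image of `π`
it is the perturbed inclusion. -/
theorem inclusion (h₁ : A = n + n * h * A) (h₂ : A = n + A * h * n)
    (hπ : π - 1 = D * h + h * D) (hD : D * D = 0) (hDn : (D + n) * (D + n) = 0) :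
    (D + n) * (1 + h * A) = (1 + h * A) * (D + π * A) := by
  have mc := maurerCartan h₁ h₂ hπ hD hDn
  linear_combination (norm := noncomm_ring) -h₁ - hπ * A - h * mc

/-- `1 + A * h` intertwines the perturbed differential with the transferred one. Followed by `π`
it is the perturbed projection. -/
theorem projection (h₁ : A = n + n * h * A) (h₂ : A = n + A * h * n)
    (hπ : π - 1 = D * h + h * D) (hD : D * D = 0) (hDn : (D + n) * (D + n) = 0) :
    (1 + A * h) * (D + n) = (D + A * π) * (1 + A * h) := by
  have mc := maurerCartan h₁ h₂ hπ hD hDn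
  linear_combination (norm := noncomm_ring) -h₂ - A * hπ - mc * h

/-- The perturbed inclusion and projection are inverse to each other up to the perturbed
homotopy `h + h * A * h`. -/
theorem homotopy (h₁ : A = n + n * h * A) (h₂ : A = n + A * h * n)
    (hπ : π - 1 = D * h + h * D) (hD : D * D = 0) (hDn : (D + n) * (D + n) = 0) :
    (1 + h * A) * π * (1 + A * h) - 1
      = (D + n) * (h + h * A * h) + (h + h * A * h) * (D + n) := by
  have i₁ := inclusion h₁ h₂ hπ hD hDn
  have i₂ := projection h₁ h₂ hπ hD hDn
  have mc := maurerCartan h₁ h₂ hπ hD hDn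
  linear_combination (norm := noncomm_ring) hπ - i₁ * h - h * i₂ - h * mc * h

end PerturbationLemma

/-! ### Operations on a bimodule as elements of a ring -/

namespace BiOp

open Quiv Op

variable {k : Type u} [Field k] {ObA : Type u₁} {ObB : Type u₂}

/-- The vector space of multilinear operations on the spaces `P`. -/
def multilinearOps (H : Quiv.{u, u₁, v₁} k ObA) (K : Quiv.{u, u₂, v₂} k ObB)
    (P : ObB → ObA → GrVect.{u, v₃} k) : Submodule k (BiOp H K P P) where
  carrier := {f | f.IsMultilinear}
  add_mem' := IsMultilinear.add
  zero_mem' := by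
    have := (linear_multilinear (fun Y X => (0 : P Y X →ₗ[k] P Y X)) (H := H) (K := K)).smul (0 : k)
    rwa [zero_smul] at this
  smul_mem' := fun s _ hf => hf.smul s

/-- The ring which contains the operations on `P`, with the composition as product, and in which
the differential and the Euler derivation are commutators. The ring acts on operations from the
right; this is why the opposite ring of the endomorphisms appears. -/
def OpRing (H : Quiv.{u, u₁, v₁} k ObA) (K : Quiv.{u, u₂, v₂} k ObB)
    (P : ObB → ObA → GrVect.{u, v₃} k) := (Module.End k (multilinearOps H K P))ᵐᵒᵖ

noncomputable instance (H : Quiv.{u, u₁, v₁} k ObA) (K : Quiv.{u, u₂, v₂} k ObB)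
    (P : ObB → ObA → GrVect.{u, v₃} k) : Ring (OpRing H K P) :=
  inferInstanceAs (Ring (Module.End k (multilinearOps H K P))ᵐᵒᵖ)

noncomputable instance (H : Quiv.{u, u₁, v₁} k ObA) (K : Quiv.{u, u₂, v₂} k ObB)
    (P : ObB → ObA → GrVect.{u, v₃} k) : Module k (OpRing H K P) :=
  inferInstanceAs (Module k (Module.End k (multilinearOps H K P))ᵐᵒᵖ)

variable {H : Quiv.{u, u₁, v₁} k ObA} {K : Quiv.{u, u₂, v₂} k ObB}
  {P : ObB → ObA → GrVect.{u, v₃} k} {ν : Op H H} {ν' : Op K K} {f g : BiOp H K P P}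
  {a b c e : ℤ}

/-- The operation `f`, composed with the sign rule for degree `e`, as an element of the ring. -/
noncomputable def toRing (e : ℤ) (f : BiOp H K P P) (hf : f.IsMultilinear) : OpRing H K P :=
  MulOpposite.op
    { toFun := fun g => ⟨comp e g.1 f, IsMultilinear.comp g.2 hf e⟩
      map_add' := fun g g' => Subtype.ext ((isLinearMap_comp_left f).map_add g.1 g'.1)
      map_smul' := fun s g => Subtype.ext ((isLinearMap_comp_left f).map_smul s g.1) }

/-- The differential on operations, as an element of the ring. -/
noncomputable def ringDelta (P : ObB → ObA → GrVect.{u, v₃} k) (hν : IsGradedProduct ν)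
    (hν' : IsGradedProduct ν') : OpRing H K P :=
  MulOpposite.op
    { toFun := fun g => ⟨delta ν ν' g.1, IsMultilinear.delta hν hν' g.2⟩
      map_add' := fun g g' => Subtype.ext ((isLinearMap_delta ν ν').map_add g.1 g'.1)
      map_smul' := fun s g => Subtype.ext ((isLinearMap_delta ν ν').map_smul s g.1) }

/-- The Euler derivation on operations, as an element of the ring. -/
noncomputable def ringEps (H : Quiv.{u, u₁, v₁} k ObA) (K : Quiv.{u, u₂, v₂} k ObB)
    (P : ObB → ObA → GrVect.{u, v₃} k) : OpRing H K P :=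
  MulOpposite.op
    { toFun := fun g => ⟨eps g.1, IsMultilinear.eps g.2⟩
      map_add' := fun g g' => Subtype.ext (isLinearMap_eps.map_add g.1 g'.1)
      map_smul' := fun s g => Subtype.ext (isLinearMap_eps.map_smul s g.1) }

theorem ring_ext {x y : OpRing H K P}
    (h : ∀ g, (MulOpposite.unop x g).1 = (MulOpposite.unop y g).1) : x = y :=
  MulOpposite.unop_injective (LinearMap.ext fun g => Subtype.ext (h g))

theorem toRing_injective {hf : f.IsMultilinear} {hg : g.IsMultilinear}
    (h : toRing e f hf = toRing e g hg) : f = g := by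
  have := congrArg (fun x : OpRing H K P => (MulOpposite.unop x ⟨BiOp.id, id_multilinear⟩).1) h
  change comp e BiOp.id f = comp e BiOp.id g at this
  rwa [id_comp, id_comp] at this

theorem toRing_congr (h : f = g) (hf : f.IsMultilinear) :
    toRing e f hf = toRing e g (h ▸ hf) := by
  subst h; rfl

theorem toRing_mul (hf : f.IsMultilinear) (hg : g.IsMultilinear) (hc : c = a + b) :
    toRing c (comp b f g) (hf.comp hg b) = toRing a f hf * toRing b g hg := by
  subst hc
  exact ring_ext fun x => (comp_assoc x.2 f g a b).symm

theorem toRing_id : toRing 0 (BiOp.id : BiOp H K P P) id_multilinear = 1 :=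
  ring_ext fun x => comp_id x.2

theorem toRing_add (hf : f.IsMultilinear) (hg : g.IsMultilinear) :
    toRing e (f + g) (hf.add hg) = toRing e f hf + toRing e g hg :=
  ring_ext fun x => (isLinearMap_comp_right x.2).map_add f g

theorem toRing_smul (s : k) (hf : f.IsMultilinear) :
    toRing e (s • f) (hf.smul s) = s • toRing e f hf :=
  ring_ext fun x => (isLinearMap_comp_right x.2).map_smul s f

theorem IsMultilinear.neg (hf : f.IsMultilinear) : (-f).IsMultilinear := by
  rw [← neg_one_smul k]; exact hf.smul _

theorem IsMultilinear.sub (hf : f.IsMultilinear) (hg : g.IsMultilinear) :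
    (f - g).IsMultilinear := by
  rw [sub_eq_add_neg]; exact hf.add hg.neg

theorem HasDegree.neg (hf : f.HasDegree e) : (-f).HasDegree e := by
  rw [← neg_one_smul k]; exact hf.smul _

theorem HasDegree.sub (hf : f.HasDegree e) (hg : g.HasDegree e) : (f - g).HasDegree e := by
  rw [sub_eq_add_neg]; exact hf.add hg.neg

theorem toRing_sub (hf : f.IsMultilinear) (hg : g.IsMultilinear) :
    toRing e (f - g) (hf.sub hg) = toRing e f hf - toRing e g hg :=
  ring_ext fun x => (isLinearMap_comp_right x.2).map_sub f g

theorem toRing_eq_zero (hf : f.IsMultilinear) (h : f = 0) : toRing e f hf = 0 := by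
  subst h
  exact ring_ext fun x => (isLinearMap_comp_right x.2).map_zero

theorem eq_zero_of_toRing {hf : f.IsMultilinear} (h : toRing e f hf = 0) : f = 0 := by
  have h0 : (0 : BiOp H K P P).IsMultilinear := (multilinearOps H K P).zero_mem
  refine toRing_injective (hg := h0) (h.trans (toRing_eq_zero h0 rfl).symm)

/-- In the ring, `delta` is the graded commutator with `ringDelta`. -/
theorem toRing_delta (hν : IsGradedProduct ν) (hν' : IsGradedProduct ν') (hf : f.IsMultilinear)
    (hd : f.HasDegree e) (hc : c = e + 1) : toRing c (delta ν ν' f) (hf.delta hν hν')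
      = toRing e f hf * ringDelta P hν hν' - (-1 : k) ^ e •
        (ringDelta P hν hν' * toRing e f hf) := by
  subst hc
  refine ring_ext fun x => ?_
  change comp (e + 1) x.1 (delta ν ν' f) = delta ν ν' (comp e x.1 f)
    - (-1 : k) ^ e • comp e (delta ν ν' x.1) f
  rw [delta_comp hν' x.2 hf hd, add_sub_cancel_right]

/-- In the ring, `eps` is the commutator with `ringEps`. -/
theorem toRing_eps (hf : f.IsMultilinear) (hd : f.HasDegree e) : toRing e (eps f) hf.eps
    = toRing e f hf * ringEps H K P - ringEps H K P * toRing e f hf := by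
  refine ring_ext fun x => ?_
  change comp e x.1 (eps f) = eps (comp e x.1 f) - comp e (eps x.1) f
  rw [eps_comp x.2 hf hd, add_sub_cancel_right]

theorem ringDelta_mul_self [CharZero k] (hν : IsGradedProduct ν) (hν' : IsGradedProduct ν') :
    ringDelta P hν hν' * ringDelta P hν hν' = 0 := ring_ext fun x => delta_delta hν hν' x.2

theorem ringDelta_mul_ringEps (hν : IsGradedProduct ν) (hν' : IsGradedProduct ν') :
    ringDelta P hν hν' * ringEps H K P = ringEps H K P * ringDelta P hν hν' :=
  ring_ext fun x => delta_eps hν hν' x.2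

/-- The commutator with the Euler fields determines the degree and the number of inputs. -/
theorem toRing_euler_weight {E : OpRing H K P}
    (hE : E = toRing 0 (linear fun Y X => (P Y X).euler) (linear_multilinear _))
    (hf : f.IsMultilinear) (hd : f.HasDegree e) :
    (E + ringEps H K P) * toRing e f hf - toRing e f hf * (E + ringEps H K P)
      = toRing e (smulLength (fun l => (e : k) - l) f) (hf.smulLength _) := by
  have h := toRing_congr (e := e) (euler_weight hf hd).symm (hf.smulLength _)
  have h₁ := (linear_multilinear (fun Y X => (P Y X).euler) (H := H) (K := K)).comp hf e
  have h₂ := hf.comp (linear_multilinear (fun Y X => (P Y X).euler) (H := H) (K := K)) 0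
  rw [h, toRing_sub (h₁.sub h₂) hf.eps, toRing_sub h₁ h₂, toRing_mul (linear_multilinear _) hf
    (zero_add e).symm,
    toRing_mul hf (linear_multilinear _) (add_zero e).symm, ← hE, toRing_eps hf hd]
  noncomm_ring

/-- A perturbation of the identity is invertible. -/
theorem exists_inverse {θ : BiOp H K P P} (hθ : θ.IsMultilinear) (hd : θ.HasDegree 0)
    (h1 : VanishesBelow 1 θ) : ∃ (z : BiOp H K P P) (hz : z.IsMultilinear), z.HasDegree 0 ∧
      toRing 0 z hz * (1 + toRing 0 θ hθ) = 1 ∧ (1 + toRing 0 θ hθ) * toRing 0 z hz = 1 := by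
  obtain ⟨z, hz, hzd, ez⟩ := exists_fixedPoint (H := H) (K := K) (P := P) (Q := P) 0
    (fun z => BiOp.id - comp 0 z θ)
    (fun z hz hzd => ⟨id_multilinear.sub (hz.comp hθ 0),
      id_hasDegree.sub (hzd.comp hd 0 (by ring))⟩)
    (fun N f g hf hg h => by
      have := VanishesBelow.comp (hf.sub hg) h h1 0
      rw [(isLinearMap_comp_left θ).map_sub] at this
      have := this.neg
      rwa [sub_sub_sub_cancel_left, ← neg_sub])
  obtain ⟨z', hz', -, ez'⟩ := exists_fixedPoint (H := H) (K := K) (P := P) (Q := P) 0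
    (fun z => BiOp.id - comp 0 θ z)
    (fun z hz hzd => ⟨id_multilinear.sub (hθ.comp hz 0),
      id_hasDegree.sub (hd.comp hzd 0 (by ring))⟩)
    (fun N f g hf hg h => by
      have := VanishesBelow.comp hθ h1 h 0
      rw [(isLinearMap_comp_right hθ).map_sub, add_comm] at this
      have := this.neg
      rwa [sub_sub_sub_cancel_left, ← neg_sub])
  have e₁ : toRing 0 z hz = 1 - toRing 0 z hz * toRing 0 θ hθ := by
    rw [← toRing_mul hz hθ (c := 0) (by ring), ← toRing_id, ← toRing_sub]
    exact toRing_congr ez.symm hz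
  have e₂ : toRing 0 z' hz' = 1 - toRing 0 θ hθ * toRing 0 z' hz' := by
    rw [← toRing_mul hθ hz' (c := 0) (by ring), ← toRing_id, ← toRing_sub]
    exact toRing_congr ez'.symm hz'
  have e₃ : toRing 0 z hz * (1 + toRing 0 θ hθ) = 1 := by
    rw [mul_add, mul_one, ← eq_sub_iff_add_eq]; exact e₁
  have e₄ : (1 + toRing 0 θ hθ) * toRing 0 z' hz' = 1 := by
    rw [add_mul, one_mul, ← eq_sub_iff_add_eq]; exact e₂
  refine ⟨z, hz, hzd, e₃, ?_⟩
  rw [show toRing 0 z hz = toRing 0 z' hz' from left_inv_eq_right_inv e₃ e₄, e₄]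

end BiOp

/-! ### Linearization of equivariant structures -/

namespace PerturbationLemma

variable {R : Type*} [Ring R] {D h n A π Δ ε E C M M₁ Θ Λ X : R}

/-- If `Θ` carries `E` to `C`, then the defect of `Θ` as a morphism from the differential `Δ + M₁`
to `Δ + M` commutes with `E`, respectively `C`, and the Euler derivation `ε`. -/
theorem gauge_commutator (hK : (C + ε * π) * (Δ + M) = (Δ + M) * (C + ε * π))
    (hΔ : π * Δ = Δ * π) (hM : π * M = M) (hΘ : π * Θ = Θ)
    (hC : (C + ε) * Θ = Θ * (E + ε)) (hM₁ : (E + ε) * M₁ = M₁ * (E + ε))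
    (hε : Δ * ε = ε * Δ) (hE : Δ * E = E * Δ) :
    (C + ε) * ((Δ + M) * Θ - Θ * (Δ + M₁)) = ((Δ + M) * Θ - Θ * (Δ + M₁)) * (E + ε) := by
  linear_combination (norm := noncomm_ring) hK * Θ + (Δ + M) * hC - hC * (Δ + M₁)
    + (Δ + M) * ε * hΘ - ε * hM * Θ - ε * hΔ * Θ - ε * Δ * hΘ + Θ * hε + Θ * hE - Θ * hM₁

end PerturbationLemma

namespace BiOp

open Quiv Op Word

variable {k : Type u} [Field k] {ObA : Type u₁} {ObB : Type u₂}
  {H : Quiv.{u, u₁, v₁} k ObA} {K : Quiv.{u, u₂, v₂} k ObB}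
  {P Q R : ObB → ObA → GrVect.{u, v₃} k} {ν : Op H H} {ν' : Op K K} {f g : BiOp H K P P}
  {a b c e : ℤ}

theorem linear_comp_smulLength (l : ∀ Y X, Q Y X →ₗ[k] R Y X) (s : ℕ → k) (f : BiOp H K P Q) :
    comp e (linear l) (smulLength s f) = smulLength s (comp e (linear l) f) := by
  funext X X' Y Y' w m v
  simp only [linear_comp, smulLength, map_smul]

theorem smulLength_smulLength (s t : ℕ → k) (f : BiOp H K P Q) :
    smulLength s (smulLength t f) = smulLength (fun l => s l * t l) f := by
  funext X X' Y Y' w m v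
  exact smul_smul _ _ _

theorem smulLength_add (s : ℕ → k) (f g : BiOp H K P Q) :
    smulLength s (f + g) = smulLength s f + smulLength s g := by
  funext X X' Y Y' w m v
  exact smul_add _ _ _

theorem smulLength_linear {s : ℕ → k} (hs : s 0 = 0) (l : ∀ Y X, P Y X →ₗ[k] Q Y X) :
    smulLength s (linear l : BiOp H K P Q) = 0 := by
  funext X X' Y Y' w m v
  cases w with
  | cons a w => exact smul_zero _
  | nil =>
    cases v with
    | cons a v => exact smul_zero _
    | nil => simp [smulLength, hs]

theorem toRing_linear_mul (l l' : ∀ Y X, P Y X →ₗ[k] P Y X) (hc : c = a + b) :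
    toRing a (linear l : BiOp H K P P) (linear_multilinear _) * toRing b (linear l')
      (linear_multilinear _) = toRing c (linear fun Y X => l Y X ∘ₗ l' Y X)
        (linear_multilinear _) := by
  rw [← toRing_mul _ _ hc]
  exact toRing_congr (linear_comp_linear l' l) _

/-- Let `C` be an endomorphism of degree zero, with linear part the Euler field on the image of an
idempotent `l`, which together with the Euler fields of the categories commutes with the
differential `M`. Then `C` can be transformed into the Euler field, and this makes `M` equal
to its part `M₁` with one input. -/
theorem exists_gauge [CharZero k] (hν : IsGradedProduct ν) (hν' : IsGradedProduct ν')
    {l : ∀ Y X, P Y X →ₗ[k] P Y X} (l_l : ∀ Y X m, l Y X (l Y X m) = l Y X m)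
    (l_degree : ∀ Y X n, ∀ m ∈ (P Y X).gr n, l Y X m ∈ (P Y X).gr n)
    {M M₁ C : BiOp H K P P} (hM : M.IsMultilinear) (hMd : M.HasDegree 1) (hM₁ : M₁.IsMultilinear)
    (hM₁d : M₁.HasDegree 1) (hC : C.IsMultilinear) (hCd : C.HasDegree 0)
    (M₁v : VanishesBelow 1 M₁) (M₁len : smulLength (fun n => 1 - (n : k)) M₁ = 0)
    (Mv : VanishesBelow 2 (M - M₁))
    (Cv : VanishesBelow 1 (C - linear fun Y X => l Y X ∘ₗ (P Y X).euler))
    (M₁_l : comp 0 M₁ (linear l) = M₁) (l_M₁ : comp 1 (linear l) M₁ = M₁)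
    (l_M : comp 1 (linear l) M = M) (l_C : comp 0 (linear l) C = C) {π Δ ε E : OpRing H K P}
    (hπ : π = toRing 0 (linear l) (linear_multilinear l)) (hΔ : Δ = ringDelta P hν hν')
    (hε : ε = ringEps H K P)
    (hE : E = toRing 0 (linear fun Y X => (P Y X).euler) (linear_multilinear _))
    (hK : (toRing 0 C hC + ε * π) * (Δ + toRing 1 M hM)
      = (Δ + toRing 1 M hM) * (toRing 0 C hC + ε * π)) :
    ∃ (Θ Λ : BiOp H K P P) (hΘ : Θ.IsMultilinear) (hΛ : Λ.IsMultilinear),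
      Θ.HasDegree 0 ∧ Λ.HasDegree 0 ∧ VanishesBelow 1 (Θ - linear l) ∧
      π * toRing 0 Θ hΘ = toRing 0 Θ hΘ ∧ toRing 0 Θ hΘ * π = toRing 0 Θ hΘ ∧
      (toRing 0 C hC + ε) * toRing 0 Θ hΘ = toRing 0 Θ hΘ * (E + ε) ∧
      (Δ + toRing 1 M hM) * toRing 0 Θ hΘ = toRing 0 Θ hΘ * (Δ + toRing 1 M₁ hM₁) ∧
      toRing 0 Λ hΛ * π = toRing 0 Λ hΛ ∧ π * toRing 0 Λ hΛ = toRing 0 Λ hΛ ∧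
      toRing 0 Λ hΛ * toRing 0 Θ hΘ = π ∧ toRing 0 Θ hΘ * toRing 0 Λ hΛ = π := by
  have lm := linear_multilinear l (H := H) (K := K)
  have ld : (linear l : BiOp H K P P).HasDegree 0 :=
    linear_hasDegree l fun Y X n m hm => by simpa using l_degree Y X n m hm
  have lE : ∀ Y X m, l Y X ((P Y X).euler m) = (P Y X).euler (l Y X m) := fun Y X m =>
    congrArg (fun f => f m) (GrVect.hom_ext (f := l Y X ∘ₗ (P Y X).euler)
      (g := (P Y X).euler ∘ₗ l Y X) fun n m hm => by
        simp only [LinearMap.comp_apply, GrVect.euler, GrVect.scale_of_mem _ _ hm,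
          GrVect.scale_of_mem _ _ (l_degree Y X n m hm), map_smul])
  have ll : comp 0 (linear l) (linear l) = (linear l : BiOp H K P P) := by
    rw [linear_comp_linear]
    congr; funext Y X; exact LinearMap.ext (l_l Y X)
  set Em := linear_multilinear (fun Y X => (P Y X).euler) (H := H) (K := K)
  have Ed : (linear fun Y X => (P Y X).euler : BiOp H K P P).HasDegree 0 :=
    linear_hasDegree _ fun Y X n m hm => by rw [add_zero]; exact GrVect.scale_mem _ _ hm
  set C₀ : BiOp H K P P := linear fun Y X => l Y X ∘ₗ (P Y X).euler with hC₀
  have C₀m : C₀.IsMultilinear := linear_multilinear _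
  have C₀d : C₀.HasDegree 0 := linear_hasDegree _ fun Y X n m hm => by
    rw [add_zero]; exact l_degree Y X n _ (GrVect.scale_mem _ _ hm)
  have l_C₀ : comp 0 (linear l) C₀ = C₀ := by
    rw [hC₀, linear_comp_linear]
    congr; funext Y X; exact LinearMap.ext fun m => l_l Y X _
  set C₁ := C - C₀ with hC₁
  have C₁m : C₁.IsMultilinear := hC.sub C₀m
  have C₁d : C₁.HasDegree 0 := hCd.sub C₀d
  have l_C₁ : comp 0 (linear l) C₁ = C₁ := by
    rw [hC₁, (isLinearMap_comp_right lm).map_sub, l_C, l_C₀]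
  -- As the commutator of `Θ` with the Euler fields multiplies its terms with `n` inputs by `-n`,
  -- the condition on `Θ` is that `n` times these terms are those of `C₁ ∘ Θ`. The terms of `C₁`
  -- have at least one input, so that this is a recursion. Composition with `l` keeps `Θ` on the
  -- image of `l`.
  set s : ℕ → k := fun n => (n : k)⁻¹ with hs
  obtain ⟨Θ, hΘ, hΘd, hfix⟩ := exists_fixedPoint (H := H) (K := K) (P := P) (Q := P) 0
    (fun Θ => comp 0 (linear l + smulLength s (comp 0 C₁ Θ)) (linear l))
    (fun Θ hΘ hΘd => ⟨(lm.add ((C₁m.comp hΘ 0).smulLength s)).comp lm 0,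
      (ld.add ((C₁d.comp hΘd 0 (by ring)).smulLength s)).comp ld 0 (by ring)⟩)
    (fun N f g hf hg h => by
      have h₁ := (VanishesBelow.comp C₁m Cv h 0).smulLength s
      rw [(isLinearMap_comp_right C₁m).map_sub, smulLength_sub] at h₁
      have h₂ := VanishesBelow.comp (((C₁m.comp hf 0).smulLength s).sub
        ((C₁m.comp hg 0).smulLength s)) h₁ (VanishesBelow.zero (linear l)) 0
      rw [← (isLinearMap_comp_left _).map_sub, add_sub_add_left_eq_sub]
      exact h₂.mono (by omega))
  have Θ_l : comp 0 Θ (linear l) = Θ := by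
    conv_lhs => rw [← hfix]
    rw [comp_assoc (lm.add ((C₁m.comp hΘ 0).smulLength s)), ll, add_zero]
    exact hfix
  have eΘ : Θ = linear l + smulLength s (comp 0 C₁ Θ) := by
    conv_lhs => rw [← hfix]
    rw [(isLinearMap_comp_left _).map_add, ll]
    congr 1
    have : comp 0 (comp 0 C₁ Θ) (linear l) = comp 0 C₁ Θ := by
      rw [comp_assoc C₁m, Θ_l, add_zero]
    funext X X' Y Y' w m v
    rw [comp_linear _ ((C₁m.comp hΘ 0).smulLength s), kos_zero]
    conv_rhs => rw [← this]
    simp only [smulLength, comp_linear _ (C₁m.comp hΘ 0), kos_zero]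
  have l_Θ : comp 0 (linear l) Θ = Θ := by
    conv_lhs => rw [eΘ]
    rw [(isLinearMap_comp_right lm).map_add, ll, linear_comp_smulLength]
    have := comp_assoc lm C₁ Θ 0 0
    rw [l_C₁, add_zero] at this
    rw [← this]
    exact eΘ.symm
  have Θv : VanishesBelow 1 (Θ - linear l) := by
    have h₁ := (VanishesBelow.comp C₁m Cv (VanishesBelow.zero Θ) 0).smulLength s
    have h₂ := sub_eq_of_eq_add' eΘ
    rw [h₂]
    exact h₁
  have eΘ' : smulLength (fun n => (n : k)) Θ = comp 0 C₁ Θ := by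
    conv_lhs => rw [eΘ]
    rw [smulLength_add, smulLength_linear (by simp), zero_add, smulLength_smulLength]
    funext X X' Y Y' w m v
    rw [smulLength]
    by_cases h : w.length + v.length = 0
    · have := VanishesBelow.comp C₁m Cv (VanishesBelow.zero Θ) 0 X X' Y Y' w m v (by omega)
      rw [this, smul_zero]
    · rw [hs]
      dsimp only
      rw [mul_inv_cancel₀ (Nat.cast_ne_zero.2 h), one_smul]
  -- passing to the ring
  set θ := toRing 0 Θ hΘ with hθ
  have πΘ : π * θ = θ := by
    rw [hπ, ← toRing_mul lm hΘ (c := 0) (by ring)]; exact toRing_congr l_Θ _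
  have Θπ : θ * π = θ := by
    rw [hπ, ← toRing_mul hΘ lm (c := 0) (by ring)]; exact toRing_congr Θ_l _
  have ππ : π * π = π := by
    rw [hπ, ← toRing_mul lm lm (c := 0) (by ring)]; exact toRing_congr ll _
  have πE : π * E = E * π := by
    rw [hπ, hE, toRing_linear_mul _ _ (add_zero 0).symm, toRing_linear_mul _ _ (add_zero 0).symm]
    refine toRing_congr ?_ _
    congr; funext Y X; exact LinearMap.ext (lE Y X)
  have cC : toRing 0 C hC = toRing 0 C₁ C₁m + π * E := by
    rw [hπ, hE, toRing_linear_mul _ _ (add_zero 0).symm, ← toRing_add]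
    exact toRing_congr (by rw [hC₁, sub_add_cancel]) _
  have hCΘ : (toRing 0 C hC + ε) * θ = θ * (E + ε) := by
    have h₁ := toRing_euler_weight hE hΘ hΘd
    have h₂ : toRing 0 (smulLength (fun n => ((0 : ℤ) : k) - n) Θ) (hΘ.smulLength _)
        = - (toRing 0 C₁ C₁m * θ) := by
      rw [← toRing_mul C₁m hΘ (c := 0) (by ring), ← neg_one_smul k, ← toRing_smul]
      refine toRing_congr ?_ _
      rw [← eΘ']
      funext X X' Y Y' w m v
      simp only [smulLength, Pi.smul_apply, Int.cast_zero, zero_sub, neg_smul, one_smul]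
    rw [h₂, ← hε] at h₁
    rw [cC]
    have h₃ : π * E * θ = E * θ := by rw [πE, mul_assoc, πΘ]
    linear_combination (norm := noncomm_ring) h₁ + h₃
  -- the compatibility with the differentials
  have lΔ : π * Δ = Δ * π := by
    have := toRing_delta hν hν' lm ld (zero_add 1).symm
    rw [toRing_eq_zero _ (delta_linear l ν ν'), zpow_zero, one_smul, ← hπ, ← hΔ] at this
    exact sub_eq_zero.1 this.symm
  have EΔ : Δ * E = E * Δ := by
    have := toRing_delta hν hν' Em Ed (zero_add 1).symm
    rw [toRing_eq_zero _ (delta_linear _ ν ν'), zpow_zero, one_smul, ← hE, ← hΔ] at this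
    exact (sub_eq_zero.1 this.symm).symm
  have hΔε : Δ * ε = ε * Δ := by rw [hΔ, hε]; exact ringDelta_mul_ringEps hν hν'
  have πM : π * toRing 1 M hM = toRing 1 M hM := by
    rw [hπ, ← toRing_mul lm hM (c := 1) (by ring)]; exact toRing_congr l_M _
  have EM₁ : (E + ε) * toRing 1 M₁ hM₁ = toRing 1 M₁ hM₁ * (E + ε) := by
    have h₁ := toRing_euler_weight hE hM₁ hM₁d
    rw [toRing_eq_zero _ (show smulLength (fun n => ((1 : ℤ) : k) - n) M₁ = 0 by
      rw [Int.cast_one]; exact M₁len), sub_eq_zero] at h₁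
    rw [hε]
    exact h₁
  -- the defect, which has no terms with less than two inputs
  set Φ : BiOp H K P P := comp 0 M Θ - comp 1 Θ M₁ - delta ν ν' Θ with hΦ
  have Φm : Φ.IsMultilinear := ((hM.comp hΘ 0).sub (hΘ.comp hM₁ 1)).sub (hΘ.delta hν hν')
  have Φd : Φ.HasDegree 1 := ((hMd.comp hΘd 0 (by ring)).sub (hΘd.comp hM₁d 1 (by ring))).sub
    (hΘd.delta hν hν' hΘ)
  have rΦ : toRing 1 Φ Φm = (Δ + toRing 1 M hM) * θ - θ * (Δ + toRing 1 M₁ hM₁) := by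
    refine (toRing_congr hΦ Φm).trans ?_
    rw [toRing_sub ((hM.comp hΘ 0).sub (hΘ.comp hM₁ 1)) (hΘ.delta hν hν'),
      toRing_sub (hM.comp hΘ 0) (hΘ.comp hM₁ 1), toRing_mul hM hΘ (add_zero 1).symm,
      toRing_mul hΘ hM₁ (zero_add 1).symm, toRing_delta hν hν' hΘ hΘd (zero_add 1).symm, zpow_zero,
      one_smul, ← hΔ]
    noncomm_ring
  have Φv : VanishesBelow 2 Φ := by
    have θm : (Θ - linear l).IsMultilinear := hΘ.sub lm
    have e : Φ = comp 0 (M - M₁) Θ + comp 0 M₁ (Θ - linear l) - comp 1 (Θ - linear l) M₁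
        - delta ν ν' (Θ - linear l) := by
      rw [hΦ, (isLinearMap_comp_left Θ).map_sub, (isLinearMap_comp_right hM₁).map_sub,
        (isLinearMap_comp_left M₁).map_sub, (isLinearMap_delta ν ν').map_sub, delta_linear, M₁_l,
        l_M₁]
      abel
    rw [e]
    exact (((VanishesBelow.comp (hM.sub hM₁) Mv (VanishesBelow.zero Θ) 0).add
      (VanishesBelow.comp hM₁ M₁v Θv 0)).sub (VanishesBelow.comp θm Θv M₁v 1)).sub
      (VanishesBelow.delta hν hν' θm Θv)
  -- the terms with `n` inputs of the defect, which has degree `1`, are of weight `1 - n`; for `n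
  -- ≥ 2` this is not zero, and the terms vanish by induction on `n`
  have eΦ : smulLength (fun n => ((1 : ℤ) : k) - n) Φ + comp 1 C₁ Φ = 0 := by
    have hC₁Φ := C₁m.comp Φm 1
    have h₁ := toRing_euler_weight hE Φm Φd
    have h₂ := PerturbationLemma.gauge_commutator hK lΔ πM πΘ hCΘ EM₁ hΔε EΔ
    have πΦ : π * toRing 1 Φ Φm = toRing 1 Φ Φm := by
      rw [rΦ]
      linear_combination (norm := noncomm_ring) lΔ * θ + Δ * πΘ + πM * θ
        - πΘ * (Δ + toRing 1 M₁ hM₁)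
    rw [← rΦ, cC] at h₂
    refine eq_zero_of_toRing (e := 1) (hf := (Φm.smulLength _).add hC₁Φ) ?_
    rw [toRing_add (Φm.smulLength _) hC₁Φ, ← h₁, toRing_mul C₁m Φm (zero_add 1).symm, ← hε]
    linear_combination (norm := noncomm_ring) h₂ - πE * toRing 1 Φ Φm - E * πΦ
  have Φ0 : ∀ N, VanishesBelow N Φ := fun N => by
    induction N with
    | zero => exact VanishesBelow.zero Φ
    | succ N ih =>
      intro X X' Y Y' w m v h
      by_cases h₂ : w.length + v.length < 2
      · exact Φv X X' Y Y' w m v h₂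
      · have h₃ := (VanishesBelow.comp C₁m Cv ih 1) X X' Y Y' w m v (by omega)
        have h₄ := congrFun (congrFun (congrFun (congrFun (congrFun (congrFun (congrFun
          eΦ X) X') Y) Y') w) m) v
        simp only [Pi.add_apply, h₃, add_zero, smulLength] at h₄
        refine (smul_eq_zero.1 h₄).resolve_left fun h₅ => h₂ ?_
        have h₆ : ((w.length + v.length : ℕ) : k) = (1 : ℕ) := by
          rw [Nat.cast_one]
          rw [Int.cast_one] at h₅
          exact (sub_eq_zero.1 h₅).symm
        rw [Nat.cast_injective h₆]
        norm_num
  have closed : (Δ + toRing 1 M hM) * θ = θ * (Δ + toRing 1 M₁ hM₁) := by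
    rw [← sub_eq_zero, ← rΦ]
    exact toRing_eq_zero _ (eq_zero_of_vanishesBelow Φ0)
  -- the inverse of the coordinate change, which is the identity on the kernel of `l`
  obtain ⟨z, hz, hzd, z₁, z₂⟩ := exists_inverse (hΘ.sub lm) (hΘd.sub ld) Θv
  rw [toRing_sub hΘ lm, ← hπ, ← hθ] at z₁ z₂
  set ζ := toRing 0 z hz with hζ
  have c₁ : (1 + (θ - π)) * π = θ := by
    linear_combination (norm := noncomm_ring) Θπ - ππ
  have c₂ : π * (1 + (θ - π)) = θ := by
    linear_combination (norm := noncomm_ring) πΘ - ππ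
  have πζ : ζ * π = π * ζ := by
    calc ζ * π = ζ * (π * (1 + (θ - π))) * ζ := by rw [mul_assoc, mul_assoc π, z₂, mul_one]
      _ = ζ * (1 + (θ - π)) * π * ζ := by rw [c₂.trans c₁.symm]; noncomm_ring
      _ = π * ζ := by rw [z₁, one_mul]
  have hΛ : toRing 0 (comp 0 (linear l) z) (lm.comp hz 0) = π * ζ := by
    rw [hπ, hζ, ← toRing_mul lm hz (add_zero 0).symm]
  refine ⟨Θ, comp 0 (linear l) z, hΘ, lm.comp hz 0, hΘd, ld.comp hzd 0 (by ring), Θv, πΘ, Θπ, hCΘ,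
    closed, ?_, ?_, ?_, ?_⟩
  · rw [hΛ, mul_assoc, πζ, ← mul_assoc, ππ]
  · rw [hΛ, ← mul_assoc, ππ]
  · rw [hΛ]
    change π * ζ * θ = π
    rw [← c₁, mul_assoc, ← mul_assoc ζ, z₁, one_mul, ππ]
  · rw [hΛ, ← mul_assoc]
    change θ * π * ζ = π
    rw [Θπ, ← c₂, mul_assoc, z₂, mul_one]

end BiOp

/-! ### Homological perturbation of equivariant bimodules -/

namespace PerturbationLemma

variable {R : Type*} [Ring R] {h A π Δ m d c x y M M₁ Θ Λ ε E : R}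

/-- The transferred inclusion `x * π` is a morphism for the transferred differential. -/
theorem inclusion_transfer (hx : (Δ + m) * x = x * (Δ + d + π * A)) (dπ : d * π = 0)
    (πΔ : π * Δ = Δ * π) (ππ : π * π = π) (hM : M = π * A * π) :
    (Δ + m) * (x * π) = x * π * (Δ + M) := by
  rw [hM]
  linear_combination (norm := noncomm_ring) hx * π + x * dπ - x * πΔ - x * ππ * A * π

/-- The transferred projection `π * y` is a morphism for the transferred differential. -/
theorem projection_transfer (hy : y * (Δ + m) = (Δ + d + A * π) * y) (πd : π * d = 0)
    (πΔ : π * Δ = Δ * π) (ππ : π * π = π) (hM : M = π * A * π) :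
    π * y * (Δ + m) = (Δ + M) * (π * y) := by
  rw [hM]
  linear_combination (norm := noncomm_ring) π * hy + πd * y + πΔ * y - π * A * ππ * y

/-- The transferred projection and inclusion are inverse to each other on the image of `π`, up to
an element which commutes with the contraction. -/
theorem projection_mul_inclusion (hε : h * ε = ε * h) (πε : π * ε = ε * π) (ππ : π * π = π)
    (hπ : h * π = 0) (πh : π * h = 0) (hh : h * h = 0) :
    π * (1 + A * h) * ε * ((1 + h * A) * π) = ε * π := by
  linear_combination (norm := noncomm_ring) πε * π + ε * ππ + π * A * hε * π + π * A * ε * hπ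
    + πε * h * A * π + ε * πh * A * π + π * A * hε * h * A * π + π * A * ε * hh * A * π

/-- The compression `C` of `c` to the image of `π`, together with the Euler derivation, commutes
with the transferred differential if `c + ε` commutes with the original one. -/
theorem transfer_commutator (hc : (c + ε) * (Δ + m) = (Δ + m) * (c + ε))
    (i : (Δ + m) * (x * π) = x * π * (Δ + M)) (p : π * y * (Δ + m) = (Δ + M) * (π * y))
    (hε : π * y * ε * (x * π) = ε * π) (hC : C = π * y * c * (x * π)) :
    (C + ε * π) * (Δ + M) = (Δ + M) * (C + ε * π) := by
  rw [hC, ← hε]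
  linear_combination (norm := noncomm_ring) -π * y * (c + ε) * i + π * y * hc * (x * π)
    + p * (c + ε) * (x * π)

/-- The inclusion `x * Θ` for the coordinates given by `Θ`, with differential `Δ + M₁`. -/
theorem inclusion_gauge (i : (Δ + m) * (x * π) = x * π * (Δ + M)) (πΘ : π * Θ = Θ)
    (hΘ : (Δ + M) * Θ = Θ * (Δ + M₁)) : (Δ + m) * (x * Θ) = x * Θ * (Δ + M₁) := by
  linear_combination (norm := noncomm_ring) i * Θ - (Δ + m) * x * πΘ + x * π * hΘ
    + x * πΘ * (Δ + M₁)

/-- The inverse `Λ` of `Θ` on the image of `π` is a morphism in the other direction. -/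
theorem inverse_gauge (hΘ : (Δ + M) * Θ = Θ * (Δ + M₁)) (πΔ : π * Δ = Δ * π) (Mπ : M * π = M)
    (πM₁ : π * M₁ = M₁) (Λπ : Λ * π = Λ) (πΛ : π * Λ = Λ) (ΛΘ : Λ * Θ = π) (ΘΛ : Θ * Λ = π) :
    Λ * (Δ + M) = (Δ + M₁) * Λ := by
  linear_combination (norm := noncomm_ring) Λ * hΘ * Λ - Λ * (Δ + M) * ΘΛ + ΛΘ * (Δ + M₁) * Λ
    - Λπ * Δ + Λ * πΔ - Λ * Mπ + πΔ * Λ + Δ * πΛ + πM₁ * Λ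

/-- The projection `Λ * y` for the coordinates given by `Θ`. -/
theorem projection_gauge (p : π * y * (Δ + m) = (Δ + M) * (π * y))
    (hΛ : Λ * (Δ + M) = (Δ + M₁) * Λ) (Λπ : Λ * π = Λ) :
    Λ * y * (Δ + m) = (Δ + M₁) * (Λ * y) := by
  linear_combination (norm := noncomm_ring) Λ * p - Λπ * y * (Δ + m) + hΛ * π * y
    + (Δ + M₁) * Λπ * y

/-- The projection is left inverse to the inclusion also in the new coordinates. -/
theorem gauge_retraction (yx : π * y * (x * π) = π) (πΘ : π * Θ = Θ) (Λπ : Λ * π = Λ)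
    (ΛΘ : Λ * Θ = π) : Λ * y * (x * Θ) = π := by
  linear_combination (norm := noncomm_ring) Λ * yx * Θ - Λπ * y * x * Θ - Λ * π * y * x * πΘ
    + Λ * πΘ + ΛΘ

/-- The transport of `c` along the new inclusion and projection, with the terms for the Euler
fields on the outer factors, is the Euler field on the image of `π`. -/
theorem gauge_transport (hC : C = π * y * c * (x * π)) (hε : π * y * ε * (x * π) = ε * π)
    (πΘ : π * Θ = Θ) (Λπ : Λ * π = Λ) (ΛΘ : Λ * Θ = π) (yx : Λ * y * (x * Θ) = π)
    (πε : π * ε = ε * π) (hΘ : (C + ε) * Θ = Θ * (E + ε)) :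
    Λ * y * (c * (x * Θ)) + (Λ * y * ε - ε * (Λ * y)) * (x * Θ) = π * E := by
  have h₁ : Λ * y * (c + ε) * (x * Θ) = Λ * (C + ε * π) * Θ := by
    rw [hC, ← hε]
    linear_combination (norm := noncomm_ring) -Λπ * y * (c + ε) * x * Θ
      - Λ * π * y * (c + ε) * x * πΘ
  linear_combination (norm := noncomm_ring) h₁ - ε * yx + Λ * hΘ + Λ * ε * πΘ + ΛΘ * (E + ε) + πε

end PerturbationLemma

namespace BiOp

open Quiv Op Word

variable {k : Type u} [Field k] {ObA : Type u₁} {ObB : Type u₂}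
  {H : Quiv.{u, u₁, v₁} k ObA} {K : Quiv.{u, u₂, v₂} k ObB}
  {P : ObB → ObA → GrVect.{u, v₃} k} {ν : Op H H} {ν' : Op K K}

section LinearRing

variable {a b c e : ℤ}

theorem toRing_linear_mul_eq_zero {l l' : ∀ Y X, P Y X →ₗ[k] P Y X}
    (h : ∀ Y X m, l Y X (l' Y X m) = 0) : toRing a (linear l : BiOp H K P P) (linear_multilinear _)
      * toRing b (linear l') (linear_multilinear _) = 0 := by
  rw [toRing_linear_mul _ _ rfl]
  refine toRing_eq_zero _ ?_
  funext X X' Y Y' w m v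
  rw [show (fun Y X => l Y X ∘ₗ l' Y X) = fun Y X => 0 from
    funext fun Y => funext fun X => LinearMap.ext (h Y X)]
  cases w <;> cases v <;> rfl

theorem toRing_linear_mul_ringDelta (hν : IsGradedProduct ν) (hν' : IsGradedProduct ν')
    {l : ∀ Y X, P Y X →ₗ[k] P Y X} (hl : (linear l : BiOp H K P P).HasDegree e) :
    toRing e (linear l : BiOp H K P P) (linear_multilinear l) * ringDelta P hν hν'
      = (-1 : k) ^ e • (ringDelta P hν hν' * toRing e (linear l) (linear_multilinear l)) := by
  have := toRing_delta hν hν' (linear_multilinear l) hl rfl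
  rw [toRing_eq_zero _ (delta_linear l ν ν')] at this
  exact sub_eq_zero.1 this.symm

theorem toRing_linear_mul_ringEps {l : ∀ Y X, P Y X →ₗ[k] P Y X}
    (hl : (linear l : BiOp H K P P).HasDegree e) :
    toRing e (linear l : BiOp H K P P) (linear_multilinear l) * ringEps H K P
      = ringEps H K P * toRing e (linear l) (linear_multilinear l) := by
  have := toRing_eps (linear_multilinear l) hl
  rw [toRing_eq_zero _ (eps_linear l)] at this
  exact sub_eq_zero.1 this.symm

end LinearRing

/-- Homological perturbation, followed by a coordinate change which makes the transferred
equivariant structure equal to the Euler field on the image of the idempotent `i ∘ p` of the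
contraction. Then the transferred operations reduce to their part `M₁` with one input. -/
theorem exists_linearized_transfer [CharZero k] (hν : IsGradedProduct ν)
    (hν' : IsGradedProduct ν') {V : ObB → ObA → GrVect.{u, v₃} k} {d : ∀ Y X, P Y X →ₗ[k] P Y X}
    (dd : ∀ Y X m, d Y X (d Y X m) = 0) (d_degree : ∀ Y X, (P Y X).DegreeOne (d Y X))
    (C : ∀ Y X, GrVect.Contraction (V Y X) (P Y X) (d Y X)) {l : ∀ Y X, P Y X →ₗ[k] P Y X}
    (hl : l = fun Y X => (C Y X).i ∘ₗ (C Y X).p)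
    {μ c M₁ : BiOp H K P P} (hμ : μ.IsMultilinear) (hμd : μ.HasDegree 1)
    (μ_d : ∀ X Y m, μ X X Y Y .nil m .nil = d Y X m) (eμ : delta ν ν' μ + comp 1 μ μ = 0)
    (hc : c.IsMultilinear) (hcd : c.HasDegree 0)
    (ec : delta ν ν' c + comp 1 c μ - comp 0 μ c = eps μ)
    (hM₁ : M₁.IsMultilinear) (hM₁d : M₁.HasDegree 1) (M₁v : VanishesBelow 1 M₁)
    (M₁len : smulLength (fun n => 1 - (n : k)) M₁ = 0)
    (M₁_l : comp 0 M₁ (linear l) = M₁) (l_M₁ : comp 1 (linear l) M₁ = M₁)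
    (μM₁ : VanishesBelow 2 (comp 1 (linear l) (comp 0 μ (linear l)) - M₁))
    (cE : VanishesBelow 1 (comp 0 (linear l) (comp 0 c (linear l))
      - linear fun Y X => l Y X ∘ₗ (P Y X).euler)) :
    ∃ (ψ φ η : BiOp H K P P), ψ.IsMultilinear ∧ φ.IsMultilinear ∧ η.IsMultilinear ∧
      ψ.HasDegree 0 ∧ φ.HasDegree 0 ∧ η.HasDegree (-1) ∧ VanishesBelow 1 (ψ - linear l) ∧
      comp 0 ψ (linear l) = ψ ∧ comp 0 (linear l) φ = φ ∧
      delta ν ν' ψ + comp 1 ψ M₁ - comp 0 μ ψ = 0 ∧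
      delta ν ν' φ + comp 1 φ μ - comp 0 M₁ φ = 0 ∧
      comp 0 φ ψ = linear l ∧
      comp 0 ψ φ - BiOp.id = delta ν ν' η + comp 1 η μ + comp (-1) μ η ∧
      comp 0 φ (comp 0 c ψ) + comp 0 (eps φ) ψ = linear fun Y X => l Y X ∘ₗ (P Y X).euler := by
  have Ld := linear_multilinear d (H := H) (K := K)
  have Ll := linear_multilinear l (H := H) (K := K)
  have Lh := linear_multilinear (fun Y X => (C Y X).h) (H := H) (K := K)
  have LE := linear_multilinear (fun Y X => (P Y X).euler) (H := H) (K := K)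
  have l_degree : ∀ Y X n, ∀ m ∈ (P Y X).gr n, l Y X m ∈ (P Y X).gr n := fun Y X n m hm => by
    rw [hl]; exact (C Y X).i_degree _ _ ((C Y X).p_degree _ _ hm)
  have l_l : ∀ Y X m, l Y X (l Y X m) = l Y X m := fun Y X m => by
    rw [hl]; simp only [LinearMap.comp_apply, (C Y X).p_i]
  have Ldd : (linear d : BiOp H K P P).HasDegree 1 := linear_hasDegree d fun Y X n m hm =>
    d_degree Y X n m hm
  have Lld : (linear l : BiOp H K P P).HasDegree 0 := linear_hasDegree l fun Y X n m hm => by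
    simpa using l_degree Y X n m hm
  have Lhd : (linear fun Y X => (C Y X).h : BiOp H K P P).HasDegree (-1) :=
    linear_hasDegree _ fun Y X n m hm => (C Y X).h_degree n m hm
  -- the perturbation `n` consists of the terms with inputs, so the two recursions for the geometric
  -- series `n + n h n + …` can be solved
  set n := μ - linear d with hn
  have nm : n.IsMultilinear := hμ.sub Ld
  have nd : n.HasDegree 1 := hμd.sub Ldd
  have nv : VanishesBelow 1 n := by
    intro X X' Y Y' w m v h
    cases w with
    | cons a w => simp [Word.length] at h
    | nil =>
      cases v with
      | cons a v => simp [Word.length] at h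
      | nil =>
        change μ _ _ _ _ _ _ _ - linear d _ _ _ _ _ _ _ = 0
        rw [μ_d, linear_nil, sub_self]
  obtain ⟨A, hA, hAd, eA⟩ := exists_fixedPoint (H := H) (K := K) (P := P) (Q := P) 1
    (fun A => n + comp 0 n (comp 1 (linear fun Y X => (C Y X).h) A))
    (fun A hA hAd => ⟨nm.add (nm.comp (Lh.comp hA 1) 0),
      nd.add (nd.comp (Lhd.comp hAd 1 (c := 0) (by ring)) 0 (by ring))⟩)
    (fun N f g hf hg h => by
      have h₁ := VanishesBelow.comp Lh (VanishesBelow.zero (linear fun Y X => (C Y X).h)) h 1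
      have h₂ := VanishesBelow.comp nm nv h₁ 0
      rw [(isLinearMap_comp_right Lh).map_sub, (isLinearMap_comp_right nm).map_sub] at h₂
      rw [add_sub_add_left_eq_sub]
      exact h₂.mono (by omega))
  obtain ⟨B, hB, hBd, eB⟩ := exists_fixedPoint (H := H) (K := K) (P := P) (Q := P) 1
    (fun B => n + comp 1 (comp (-1) B (linear fun Y X => (C Y X).h)) n)
    (fun B hB hBd => ⟨nm.add ((hB.comp Lh (-1)).comp nm 1),
      nd.add ((hBd.comp Lhd (-1) (c := 0) (by ring)).comp nd 1 (by ring))⟩)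
    (fun N f g hf hg h => by
      have h₁ := VanishesBelow.comp (hf.sub hg) h
        (VanishesBelow.zero (linear fun Y X => (C Y X).h)) (-1)
      have h₂ := VanishesBelow.comp ((hf.sub hg).comp Lh (-1)) h₁ nv 1
      rw [(isLinearMap_comp_left _).map_sub, (isLinearMap_comp_left _).map_sub] at h₂
      rw [add_sub_add_left_eq_sub]
      exact h₂.mono (by omega))
  -- the operations of the perturbation lemma
  have hAm := Lh.comp hA 1
  have hAhd := Lhd.comp hAd 1 (c := 0) (by ring)
  have Ahm := hA.comp Lh (-1)
  have Ahd := hAd.comp Lhd (-1) (c := 0) (by ring)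
  set x := BiOp.id + comp 1 (linear fun Y X => (C Y X).h) A with hx
  have xm : x.IsMultilinear := id_multilinear.add hAm
  have xd : x.HasDegree 0 := id_hasDegree.add hAhd
  set y := BiOp.id + comp (-1) A (linear fun Y X => (C Y X).h) with hy
  have ym : y.IsMultilinear := id_multilinear.add Ahm
  have yd : y.HasDegree 0 := id_hasDegree.add Ahd
  set M := comp 1 (linear l) (comp 0 A (linear l)) with hM
  have Mm : M.IsMultilinear := Ll.comp (hA.comp Ll 0) 1
  have Md : M.HasDegree 1 := Lld.comp (hAd.comp Lld 0 (c := 1) (by ring)) 1 (by ring)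
  have ylm := Ll.comp ym 0
  have xlm := xm.comp Ll 0
  set c' := comp 0 (comp 0 (linear l) y) (comp 0 c (comp 0 x (linear l))) with hc'
  have cm : c'.IsMultilinear := ylm.comp (hc.comp xlm 0) 0
  have cd : c'.HasDegree 0 := (Lld.comp yd 0 (c := 0) (by ring)).comp
    (hcd.comp (xd.comp Lld 0 (c := 0) (by ring)) 0 (c := 0) (by ring)) 0 (by ring)
  have Av : VanishesBelow 1 A := by
    rw [← eA]
    exact nv.add ((VanishesBelow.comp nm nv (VanishesBelow.zero _) 0).mono (by omega))
  have hAv := VanishesBelow.comp Lh (VanishesBelow.zero (linear fun Y X => (C Y X).h)) Av 1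
  have Ahv := VanishesBelow.comp hA Av (VanishesBelow.zero (linear fun Y X => (C Y X).h)) (-1)
  -- up to one input, the transferred operations are the compression of `μ`: the further terms of
  -- the series contain `n` twice
  have Mv : VanishesBelow 2 (M - M₁) := by
    have h₁ : A - μ = comp 0 n (comp 1 (linear fun Y X => (C Y X).h) A) - linear d := by
      conv_lhs => rw [← eA]
      rw [hn]; abel
    have h₂ : comp 1 (linear l) (comp 0 (linear d) (linear l)) = (0 : BiOp H K P P) := by
      rw [linear_comp_linear, linear_comp_linear]
      funext X X' Y Y' w m v
      rw [show (fun Y X => l Y X ∘ₗ d Y X ∘ₗ l Y X) = fun Y X => 0 from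
        funext fun Y => funext fun X => LinearMap.ext fun m => by
          rw [hl]; simp [(C Y X).d_i]]
      cases w <;> cases v <;> rfl
    have h₃ := VanishesBelow.comp Ll (VanishesBelow.zero _) (VanishesBelow.comp (nm.comp hAm 0)
      (VanishesBelow.comp nm nv hAv 0) (VanishesBelow.zero (linear l)) 0) 1
    have h₄ : M - M₁ = (comp 1 (linear l) (comp 0 μ (linear l)) - M₁) + comp 1 (linear l)
        (comp 0 (comp 0 n (comp 1 (linear fun Y X => (C Y X).h) A)) (linear l)) := by
      have h₅ : comp 0 A (linear l) = comp 0 μ (linear l) + comp 0 (comp 0 n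
          (comp 1 (linear fun Y X => (C Y X).h) A)) (linear l) - comp 0 (linear d) (linear l) := by
        rw [← (isLinearMap_comp_left (linear l)).map_add,
          ← (isLinearMap_comp_left (linear l)).map_sub, add_sub_assoc, ← h₁, add_sub_cancel]
      rw [hM, h₅, (isLinearMap_comp_right Ll).map_sub, (isLinearMap_comp_right Ll).map_add, h₂]
      abel
    rw [h₄]
    exact μM₁.add (h₃.mono (by omega))
  -- without inputs, the transferred equivariant structure is the compression of `c`
  have Cv : VanishesBelow 1 (c' - linear fun Y X => l Y X ∘ₗ (P Y X).euler) := by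
    have h₁ := VanishesBelow.comp (Ll.comp Ahm 0) (VanishesBelow.comp Ll
      (VanishesBelow.zero _) Ahv 0)
      (VanishesBelow.zero (comp 0 c (comp 0 x (linear l)))) 0
    have h₂ := VanishesBelow.comp Ll (VanishesBelow.zero _) (VanishesBelow.comp hc
      (VanishesBelow.zero c) (VanishesBelow.comp hAm hAv (VanishesBelow.zero (linear l)) 0) 0) 0
    have h₃ := (cE.add (h₂.mono (by omega))).add (h₁.mono (by omega))
    convert h₃ using 1
    rw [hc', hy, (isLinearMap_comp_right Ll).map_add, comp_id Ll,
      (isLinearMap_comp_left (comp 0 c (comp 0 x (linear l)))).map_add]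
    conv_lhs => rw [hx, (isLinearMap_comp_left (linear l)).map_add, id_comp,
      (isLinearMap_comp_right hc).map_add, (isLinearMap_comp_right Ll).map_add,
      (isLinearMap_comp_right (Ll.comp Ahm 0)).map_add]
    conv_rhs => rw [hx, (isLinearMap_comp_left (linear l)).map_add, id_comp,
      (isLinearMap_comp_right hc).map_add, (isLinearMap_comp_right (Ll.comp Ahm 0)).map_add]
    abel
  have l_c' : comp 0 (linear l) c' = c' := by
    rw [hc', comp_assoc Ll]
    funext X X' Y Y' w m v
    rw [linear_comp, linear_comp, l_l]
  have l_M : comp 1 (linear l) M = M := by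
    funext X X' Y Y' w m v
    rw [hM, linear_comp, linear_comp, l_l]
  -- the relations between these operations in the ring
  set Δ := ringDelta P hν hν' with hΔ
  set ε := ringEps H K P with hε
  set π := toRing 0 (linear l) Ll with hπ
  set δ := toRing 1 (linear d) Ld with hδ
  set τ := toRing (-1) (linear fun Y X => (C Y X).h) Lh with hτ
  set E := toRing 0 (linear fun Y X => (P Y X).euler) LE with hE
  set α := toRing 1 A hA with hα
  set m := toRing 1 μ hμ with hm
  set γ := toRing 0 c hc with hγ
  have ππ : π * π = π := by
    rw [hπ, toRing_linear_mul _ _ (add_zero 0).symm]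
    refine toRing_congr ?_ _
    congr; funext Y X; exact LinearMap.ext (l_l Y X)
  have δπ : δ * π = 0 := toRing_linear_mul_eq_zero fun Y X m => by
    rw [hl]; simp only [LinearMap.comp_apply, (C Y X).d_i]
  have πδ : π * δ = 0 := toRing_linear_mul_eq_zero fun Y X m => by
    rw [hl]; simp only [LinearMap.comp_apply, (C Y X).p_d, map_zero]
  have δδ : δ * δ = 0 := toRing_linear_mul_eq_zero dd
  have τπ : τ * π = 0 := toRing_linear_mul_eq_zero fun Y X m => by
    rw [hl]; simp only [LinearMap.comp_apply, (C Y X).h_i]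
  have πτ : π * τ = 0 := toRing_linear_mul_eq_zero fun Y X m => by
    rw [hl]; simp only [LinearMap.comp_apply, (C Y X).p_h, map_zero]
  have ττ : τ * τ = 0 := toRing_linear_mul_eq_zero fun Y X m => (C Y X).h_h m
  have hom : π - 1 = δ * τ + τ * δ := by
    rw [hδ, hτ, toRing_linear_mul _ _ (c := 0) (by ring), toRing_linear_mul _ _ (c := 0) (by ring),
      ← toRing_add, ← toRing_id, hπ, ← toRing_sub]
    refine toRing_congr ?_ _
    funext X X' Y Y' w m v
    cases w with
    | cons a w => exact (sub_zero 0).trans (add_zero 0).symm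
    | nil =>
      cases v with
      | cons a v => exact (sub_zero 0).trans (add_zero 0).symm
      | nil =>
        rw [hl]
        exact (C Y X).homotopy m
  have πΔ : π * Δ = Δ * π := by
    have := toRing_linear_mul_ringDelta hν hν' Lld
    rwa [zpow_zero, one_smul] at this
  have τΔ : τ * Δ = -(Δ * τ) := by
    have := toRing_linear_mul_ringDelta hν hν' Lhd
    rwa [show (-1 : k) ^ (-1 : ℤ) = -1 by norm_num, neg_one_smul] at this
  have δΔ : δ * Δ = -(Δ * δ) := by
    have := toRing_linear_mul_ringDelta hν hν' Ldd
    rwa [zpow_one, neg_one_smul] at this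
  have πε : π * ε = ε * π := toRing_linear_mul_ringEps Lld
  have τε : τ * ε = ε * τ := toRing_linear_mul_ringEps Lhd
  have Δε : Δ * ε = ε * Δ := ringDelta_mul_ringEps hν hν'
  have ΔΔ : Δ * Δ = 0 := ringDelta_mul_self hν hν'
  have rn : toRing 1 n nm = m - δ := toRing_sub hμ Ld
  have mm : (Δ + δ + (m - δ)) * (Δ + δ + (m - δ)) = 0 := by
    have := toRing_eq_zero (e := 2) ((hμ.delta hν hν').add (hμ.comp hμ 1)) eμ
    rw [toRing_add (hμ.delta hν hν') (hμ.comp hμ 1), toRing_delta hν hν' hμ hμd (by ring),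
      toRing_mul hμ hμ (a := 1) (by ring), zpow_one, neg_one_smul] at this
    linear_combination (norm := noncomm_ring) this + ΔΔ
  have DD : (Δ + δ) * (Δ + δ) = 0 := by
    linear_combination (norm := noncomm_ring) ΔΔ + δΔ + δδ
  have hom' : π - 1 = (Δ + δ) * τ + τ * (Δ + δ) := by
    linear_combination (norm := noncomm_ring) hom - τΔ
  have γm : (γ + ε) * (Δ + m) = (Δ + m) * (γ + ε) := by
    have := toRing_congr (e := 1) ec (((hc.delta hν hν').add (hc.comp hμ 1)).sub (hμ.comp hc 0))
    rw [toRing_sub ((hc.delta hν hν').add (hc.comp hμ 1)) (hμ.comp hc 0),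
      toRing_add (hc.delta hν hν') (hc.comp hμ 1), toRing_delta hν hν' hc hcd (by ring),
      toRing_mul hc hμ (a := 0) (by ring), toRing_mul hμ hc (a := 1) (by ring),
        toRing_eps hμ hμd, zpow_zero,
      one_smul] at this
    linear_combination (norm := noncomm_ring) this - Δε
  have hα₁ : α = (m - δ) + (m - δ) * τ * α := by
    have := toRing_congr (e := 1) eA.symm hA
    rwa [toRing_add nm (nm.comp hAm 0), toRing_mul nm hAm (a := 1) (by ring),
      toRing_mul Lh hA (a := -1) (by ring), rn, ← mul_assoc] at this
  have hα₂ : α = (m - δ) + α * τ * (m - δ) := by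
    have := toRing_congr (e := 1) eB.symm hB
    rw [toRing_add nm ((hB.comp Lh (-1)).comp nm 1), toRing_mul (hB.comp Lh (-1)) nm (a := 0)
      (by ring), toRing_mul hB Lh (a := 1) (by ring), rn] at this
    rw [PerturbationLemma.left_eq_right hα₁ this]
    exact this
  have rx : toRing 0 x xm = 1 + τ * α := by
    rw [← toRing_id, ← toRing_mul Lh hA (c := 0) (by ring)]
    exact toRing_add id_multilinear hAm
  have ry : toRing 0 y ym = 1 + α * τ := by
    rw [← toRing_id, ← toRing_mul hA Lh (c := 0) (by ring)]
    exact toRing_add id_multilinear Ahm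
  have rM : toRing 1 M Mm = π * α * π := by
    rw [mul_assoc, ← toRing_mul hA Ll (add_zero 1).symm, ← toRing_mul Ll (hA.comp Ll 0)
      (zero_add 1).symm]
  have rc' : toRing 0 c' cm = π * (1 + α * τ) * γ * ((1 + τ * α) * π) := by
    rw [← rx, ← ry, mul_assoc, ← toRing_mul xm Ll (add_zero 0).symm, ← toRing_mul Ll ym
      (add_zero 0).symm, ← toRing_mul hc xlm (add_zero 0).symm, ← toRing_mul ylm (hc.comp xlm 0)
      (add_zero 0).symm]
  -- homological perturbation, and then the change of coordinates on the image of `π`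
  have ix := PerturbationLemma.inclusion hα₁ hα₂ hom' DD mm
  have py := PerturbationLemma.projection hα₁ hα₂ hom' DD mm
  have ht := PerturbationLemma.homotopy hα₁ hα₂ hom' DD mm
  have em : Δ + δ + (m - δ) = Δ + m := by abel
  rw [em] at ix py ht
  have ix' := PerturbationLemma.inclusion_transfer ix δπ πΔ ππ rM
  have py' := PerturbationLemma.projection_transfer py πδ πΔ ππ rM
  have hε' := PerturbationLemma.projection_mul_inclusion (A := α) τε πε ππ τπ πτ ττ
  have hK := PerturbationLemma.transfer_commutator γm ix' py' hε' rc'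
  obtain ⟨Θ, Λ, hΘ, hΛ, Θd, Λd, Θv, πΘ, Θπ, cΘ, MΘ, Λπ, πΛ, ΛΘ, ΘΛ⟩ :=
    exists_gauge hν hν' l_l l_degree Mm Md hM₁ hM₁d cm cd M₁v M₁len Mv Cv M₁_l l_M₁ l_M l_c' hπ hΔ
      hε hE hK
  have MΛ := PerturbationLemma.inverse_gauge MΘ πΔ (show toRing 1 M Mm * π = toRing 1 M Mm by
    rw [rM, mul_assoc, ππ]) (by
    rw [hπ, ← toRing_mul Ll hM₁ (zero_add 1).symm]; exact toRing_congr l_M₁ _) Λπ πΛ ΛΘ ΘΛ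
  have hi := PerturbationLemma.inclusion_gauge ix' πΘ MΘ
  have hp := PerturbationLemma.projection_gauge py' MΛ Λπ
  have yx : Λ.toRing 0 hΛ * (1 + α * τ) * ((1 + τ * α) * Θ.toRing 0 hΘ) = π :=
    PerturbationLemma.gauge_retraction (by
      linear_combination (norm := noncomm_ring) (π * α * ττ * α * π + ππ + π * α * τπ
        + πτ * α * π)) πΘ Λπ ΛΘ
  have tr := PerturbationLemma.gauge_transport rc' hε' πΘ Λπ ΛΘ yx πε cΘ
  have ψm := xm.comp hΘ 0
  have φm := hΛ.comp ym 0
  have ηm := Lh.add (hAm.comp Lh (-1))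
  have ψd := xd.comp Θd 0 (c := 0) (by ring)
  have φd := Λd.comp yd 0 (c := 0) (by ring)
  have rψ : toRing 0 (comp 0 x Θ) ψm = (1 + τ * α) * toRing 0 Θ hΘ := by
    rw [← rx, ← toRing_mul xm hΘ (add_zero 0).symm]
  have rφ : toRing 0 (comp 0 Λ y) φm = toRing 0 Λ hΛ * (1 + α * τ) := by
    rw [← ry, ← toRing_mul hΛ ym (add_zero 0).symm]
  have rη : toRing (-1) _ ηm = τ + τ * α * τ := by
    rw [toRing_add Lh (hAm.comp Lh (-1)), toRing_mul hAm Lh (a := 0) (by ring),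
      toRing_mul Lh hA (a := -1) (by ring)]
  have ηd := Lhd.add (hAhd.comp Lhd (-1) (c := -1) (by ring))
  refine ⟨comp 0 x Θ, comp 0 Λ y, _, ψm, φm, ηm, ψd, φd, ηd, ?_, ?_, ?_, ?_, ?_, ?_, ?_, ?_⟩
  · rw [hx, (isLinearMap_comp_left Θ).map_add, id_comp, add_sub_right_comm]
    exact Θv.add ((VanishesBelow.comp hAm hAv (VanishesBelow.zero Θ) 0).mono (by omega))
  · refine toRing_injective (e := 0) (hf := ψm.comp Ll 0) (hg := ψm) ?_
    rw [toRing_mul ψm Ll (add_zero 0).symm, rψ, ← hπ, mul_assoc, Θπ]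
  · refine toRing_injective (e := 0) (hf := Ll.comp φm 0) (hg := φm) ?_
    rw [toRing_mul Ll φm (add_zero 0).symm, rφ, ← hπ, ← mul_assoc, πΛ]
  · refine eq_zero_of_toRing (e := 1)
      (hf := ((ψm.delta hν hν').add (ψm.comp hM₁ 1)).sub (hμ.comp ψm 0)) ?_
    rw [toRing_sub ((ψm.delta hν hν').add (ψm.comp hM₁ 1)) (hμ.comp ψm 0),
      toRing_add (ψm.delta hν hν') (ψm.comp hM₁ 1), toRing_delta hν hν' ψm ψd (zero_add 1).symm,
      toRing_mul ψm hM₁ (zero_add 1).symm, toRing_mul hμ ψm (add_zero 1).symm, zpow_zero, one_smul,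
      rψ]
    linear_combination (norm := noncomm_ring) -hi
  · refine eq_zero_of_toRing (e := 1)
      (hf := ((φm.delta hν hν').add (φm.comp hμ 1)).sub (hM₁.comp φm 0)) ?_
    rw [toRing_sub ((φm.delta hν hν').add (φm.comp hμ 1)) (hM₁.comp φm 0),
      toRing_add (φm.delta hν hν') (φm.comp hμ 1), toRing_delta hν hν' φm φd (zero_add 1).symm,
      toRing_mul φm hμ (zero_add 1).symm, toRing_mul hM₁ φm (add_zero 1).symm, zpow_zero, one_smul,
      rφ]
    linear_combination (norm := noncomm_ring) hp
  · refine toRing_injective (e := 0) (hf := φm.comp ψm 0) (hg := Ll) ?_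
    rw [toRing_mul φm ψm (add_zero 0).symm, rφ, rψ, yx]
  · have e₁ := (ψm.comp φm 0).sub (id_multilinear (H := H) (K := K) (P := P))
    have e₂ := (ηm.delta hν hν').add (ηm.comp hμ 1)
    have e₃ := hμ.comp ηm (-1)
    refine toRing_injective (e := 0) (hf := e₁) (hg := e₂.add e₃) ?_
    rw [toRing_sub (ψm.comp φm 0) id_multilinear, toRing_id, toRing_mul ψm φm (add_zero 0).symm,
      toRing_add e₂ e₃, toRing_add (ηm.delta hν hν') (ηm.comp hμ 1),
      toRing_delta hν hν' ηm ηd (by ring), toRing_mul ηm hμ (a := -1) (by ring),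
      toRing_mul hμ ηm (a := 1) (by ring), rψ, rφ, rη,
      show (-1 : k) ^ (-1 : ℤ) = -1 by norm_num, neg_one_smul]
    have h₁ : (1 + τ * α) * toRing 0 Θ hΘ * (toRing 0 Λ hΛ * (1 + α * τ))
        = (1 + τ * α) * π * (1 + α * τ) := by
      rw [← ΘΛ]; noncomm_ring
    rw [h₁]
    linear_combination (norm := noncomm_ring) ht
  · have e₁ := φm.comp (hc.comp ψm 0) 0
    have e₂ := φm.eps.comp ψm 0
    refine toRing_injective (e := 0) (hf := e₁.add e₂) (hg := linear_multilinear _) ?_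
    rw [toRing_add e₁ e₂, toRing_mul φm (hc.comp ψm 0) (add_zero 0).symm,
      toRing_mul hc ψm (add_zero 0).symm, toRing_mul φm.eps ψm (add_zero 0).symm,
      toRing_eps φm φd, rφ, rψ, ← toRing_linear_mul l _ (add_zero 0).symm]
    exact tr

end BiOp

/-! ### Formality of equivariant bimodules -/

namespace BiOp

open Quiv Op Word

variable {k : Type u} [Field k] {ObA : Type u₁} {ObB : Type u₂}
  {H : Quiv.{u, u₁, v₁} k ObA} {K : Quiv.{u, u₂, v₂} k ObB}
  {P Q V : ObB → ObA → GrVect.{u, v₃} k} {ν : Op H H} {ν' : Op K K}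

/-- Associativity of the composition, with the degree of the inner composite as a variable. -/
theorem comp_comp {R S : ObB → ObA → GrVect.{u, v₃} k} {f : BiOp H K Q R} (hf : f.IsMultilinear)
    {g : BiOp H K P Q} {h : BiOp H K S P} {c d e : ℤ} (hc : c = d + e) :
    comp e (comp d f g) h = comp c f (comp e g h) := by
  rw [hc, comp_assoc hf]

/-- The differential of pre-morphisms, in terms of `delta` and compositions. -/
theorem diff_eq (μP : BiOp H K P P) (μQ : BiOp H K Q Q) (n : ℤ) (f : BiOp H K P Q) :
    diff ν ν' μP μQ n f = delta ν ν' f + comp 1 f μP - (-1 : k) ^ n • comp n μQ f := by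
  funext X X' Y Y' w m v
  simp only [diff, delta, Pi.add_apply, Pi.sub_apply, Pi.smul_apply]
  abel

/-- The transported equivariant structure: the Euler fields on the outer factors act through
`eps`. -/
theorem transport_eq (φ : BiOp H K Q P) (c : BiOp H K Q Q) (ψ : BiOp H K P Q) :
    transport H.eulerField K.eulerField φ c ψ
      = comp 0 φ (comp 0 c ψ) + comp 0 (eps φ) ψ := by
  rw [eps, (isLinearMap_comp_left ψ).map_add, ← add_assoc]
  rfl

/-- A bimodule over graded categories with a pure equivariant structure `c` for the Euler fields is
formal, compatibly with `c`: for a contraction of the underlying complexes to `V`, the operations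
`μ` reduce to the operations `κ` on `V` which are induced by those with one input. -/
theorem exists_formality [CharZero k] (hν : IsGradedProduct ν) (hν' : IsGradedProduct ν')
    {d : ∀ Y X, P Y X →ₗ[k] P Y X}
    (dd : ∀ Y X m, d Y X (d Y X m) = 0) (d_degree : ∀ Y X, (P Y X).DegreeOne (d Y X))
    (C : ∀ Y X, GrVect.Contraction (V Y X) (P Y X) (d Y X)) {μ c : BiOp H K P P}
    {κ : BiOp H K V V} (hμ : μ.IsMultilinear) (hμd : μ.HasDegree 1)
    (μ_d : ∀ X Y m, μ X X Y Y .nil m .nil = d Y X m) (eμ : delta ν ν' μ + comp 1 μ μ = 0)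
    (hc : c.IsMultilinear) (hcd : c.HasDegree 0)
    (ec : delta ν ν' c + comp 1 c μ - comp 0 μ c = eps μ)
    (hκ : κ.IsMultilinear) (hκd : κ.HasDegree 1) (κv : VanishesBelow 1 κ)
    (κlen : smulLength (fun n => 1 - (n : k)) κ = 0)
    (μκ : VanishesBelow 2 (comp 1 (linear fun Y X => (C Y X).p)
      (comp 0 μ (linear fun Y X => (C Y X).i)) - κ))
    (cE : ∀ X Y x, (C Y X).p (c X X Y Y .nil ((C Y X).i x) .nil) = (V Y X).euler x) :
    ∃ (ψ : BiOp H K V P) (φ : BiOp H K P V) (η : BiOp H K P P), IsHom ν ν' κ μ ψ ∧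
      IsHom ν ν' μ κ φ ∧ (∀ X Y x, ψ X X Y Y .nil x .nil = (C Y X).i x) ∧
      comp 0 φ ψ = BiOp.id ∧ η.IsMultilinear ∧ η.HasDegree (-1) ∧
      comp 0 ψ φ - BiOp.id = diff ν ν' μ μ (-1) η ∧
      transport H.eulerField K.eulerField φ c ψ = eulerField := by
  have Li := linear_multilinear (fun Y X => (C Y X).i) (H := H) (K := K)
  have Lp := linear_multilinear (fun Y X => (C Y X).p) (H := H) (K := K)
  have Lid : (linear fun Y X => (C Y X).i : BiOp H K V P).HasDegree 0 :=
    linear_hasDegree _ fun Y X n m hm => by simpa using (C Y X).i_degree n m hm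
  have Lpd : (linear fun Y X => (C Y X).p : BiOp H K P V).HasDegree 0 :=
    linear_hasDegree _ fun Y X n m hm => by simpa using (C Y X).p_degree n m hm
  have pE : ∀ Y X m, (C Y X).p ((P Y X).euler m) = (V Y X).euler ((C Y X).p m) := fun Y X m =>
    congrArg (fun f => f m) (GrVect.hom_ext (f := (C Y X).p ∘ₗ (P Y X).euler)
      (g := (V Y X).euler ∘ₗ (C Y X).p) fun n m hm => by
        simp only [LinearMap.comp_apply, GrVect.euler, GrVect.scale_of_mem _ _ hm,
          GrVect.scale_of_mem _ _ ((C Y X).p_degree n m hm), map_smul])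
  -- `κ`, carried over to the image of the idempotent `i ∘ p`
  set M₁ : BiOp H K P P := comp 1 (linear fun Y X => (C Y X).i)
    (comp 0 κ (linear fun Y X => (C Y X).p)) with hM
  have hM₁ : M₁.IsMultilinear := Li.comp (hκ.comp Lp 0) 1
  have hM₁d : M₁.HasDegree 1 := Lid.comp (hκd.comp Lpd 0 (c := 1) (by ring)) 1 (by ring)
  have M₁_eq : ∀ X X' Y Y' w m v, M₁ X X' Y Y' w m v
      = (C Y' X').i (κ X X' Y Y' w ((C Y X).p m) v) := fun X X' Y Y' w m v => by
    rw [hM, linear_comp, comp_linear _ hκ, kos_zero]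
  have i_κ : comp 1 (linear fun Y X => (C Y X).i) κ = comp 0 M₁ (linear fun Y X => (C Y X).i) := by
    funext X X' Y Y' w m v
    rw [linear_comp, comp_linear _ hM₁, kos_zero, M₁_eq, (C Y X).p_i]
  have κ_p : comp 0 κ (linear fun Y X => (C Y X).p) = comp 1 (linear fun Y X => (C Y X).p) M₁ := by
    funext X X' Y Y' w m v
    rw [linear_comp, comp_linear _ hκ, kos_zero, M₁_eq, (C Y' X').p_i]
  obtain ⟨ψ, φ, η, hψ, hφ, hη, ψd, φd, ηd, ψv, ψ_l, l_φ, eψ, eφ, φψ, ψφ, tr⟩ :=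
    exists_linearized_transfer (M₁ := M₁) hν hν' dd d_degree C rfl hμ hμd μ_d eμ hc hcd ec hM₁ hM₁d
      (fun X X' Y Y' w m v h => by rw [M₁_eq, κv _ _ _ _ _ _ _ h, map_zero])
      (by
        funext X X' Y Y' w m v
        have := congrFun (congrFun (congrFun (congrFun (congrFun (congrFun (congrFun
          κlen X) X') Y) Y') w) ((C Y X).p m)) v
        rw [smulLength] at this
        rw [smulLength, M₁_eq, ← map_smul, this]
        exact map_zero _)
      (by
        funext X X' Y Y' w m v
        rw [comp_linear _ hM₁, kos_zero, M₁_eq, M₁_eq, LinearMap.comp_apply, (C Y X).p_i])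
      (by
        funext X X' Y Y' w m v
        rw [linear_comp, M₁_eq, LinearMap.comp_apply, (C Y' X').p_i])
      (fun X X' Y Y' w m v h => by
        have := μκ X X' Y Y' w ((C Y X).p m) v h
        simp only [Pi.sub_apply, linear_comp, comp_linear _ hμ, kos_zero] at this
        simp only [Pi.sub_apply, linear_comp, comp_linear _ hμ, kos_zero, M₁_eq,
          LinearMap.comp_apply]
        rw [← map_sub, this, map_zero])
      (fun X X' Y Y' w m v h => by
        cases w with
        | cons a w => simp [Word.length] at h
        | nil =>
          cases v with
          | cons a v => simp [Word.length] at h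
          | nil =>
            simp only [Pi.sub_apply, linear_comp, comp_linear _ hc, kos_zero, LinearMap.comp_apply,
              linear_nil, cE, pE, sub_self])
  have h₀ := (add_zero (0 : ℤ)).symm
  have h₁ := (zero_add (1 : ℤ)).symm
  have h₁' := (add_zero (1 : ℤ)).symm
  have hψi := hψ.comp Li 0
  have hpφ := Lp.comp hφ 0
  refine ⟨comp 0 ψ (linear fun Y X => (C Y X).i), comp 0 (linear fun Y X => (C Y X).p) φ, η,
    ⟨hψi, ψd.comp Lid 0 (by ring), fun X X' Y Y' w m v => ?_⟩,
    ⟨hpφ, Lpd.comp φd 0 (by ring), fun X X' Y Y' w m v => ?_⟩, fun X Y x => ?_, ?_, hη, ηd, ?_, ?_⟩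
  · rw [diff_eq, delta_comp hν' hψ Li Lid, delta_linear, (isLinearMap_comp_right hψ).map_zero,
      zero_add, zpow_zero, one_smul, one_smul, comp_comp hψ h₁, i_κ, ← comp_comp hμ h₀,
      ← comp_comp hψ h₁', ← (isLinearMap_comp_left _).map_add,
      ← (isLinearMap_comp_left _).map_sub, eψ, (isLinearMap_comp_left _).map_zero]
    rfl
  · rw [diff_eq, delta_comp hν' Lp hφ φd, delta_linear, (isLinearMap_comp_left φ).map_zero,
      smul_zero, add_zero, zpow_zero, one_smul, comp_comp Lp h₁, ← comp_comp hκ h₀, κ_p,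
      comp_comp Lp h₁', zero_add, ← (isLinearMap_comp_right Lp).map_add,
      ← (isLinearMap_comp_right Lp).map_sub, eφ, (isLinearMap_comp_right Lp).map_zero]
    rfl
  · have := ψv X X Y Y .nil ((C Y X).i x) .nil Nat.one_pos
    simp only [Pi.sub_apply, linear_nil, LinearMap.comp_apply, (C Y X).p_i, sub_eq_zero] at this
    rw [comp_linear _ hψ, kos_zero, this]
  · rw [comp_comp Lp h₀, ← comp_comp hφ h₀, φψ, linear_comp_linear, linear_comp_linear, id_eq]
    congr; funext Y X; ext x
    simp [(C Y X).p_i]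
  · rw [comp_comp hψ h₀, ← comp_comp Li h₀, linear_comp_linear, l_φ, diff_eq, ψφ,
      show (-1 : k) ^ (-1 : ℤ) = -1 by norm_num, neg_one_smul, sub_neg_eq_add]
  · rw [transport_eq, eps_comp Lp hφ φd, eps_linear, (isLinearMap_comp_left φ).map_zero, add_zero,
      comp_comp Lp h₀, comp_comp Lp h₀, ← (isLinearMap_comp_right Lp).map_add,
      ← comp_comp hc h₀, ← comp_comp hφ h₀, ← comp_comp hφ.eps h₀,
      ← (isLinearMap_comp_left _).map_add, tr, linear_comp_linear, linear_comp_linear, eulerField,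
      ofLinear_eq]
    congr; funext Y X; ext x
    simp [(C Y X).p_i, pE]

end BiOp

namespace AInfBimod

open Quiv Op Word BiOp

variable {k : Type u} [Field k] {ObA : Type u₁} {ObB : Type u₂}
  {A : AInfCat.{u, u₁, v₁} k ObA} {B : AInfCat.{u, u₂, v₂} k ObB}
  (P : AInfBimod.{u, u₁, u₂, v₁, v₂, v₃} A B)
  {F T : Op A.coh A.hom} {G S : Op B.coh B.hom}

theorem d_d (Y : ObB) (X : ObA) (m : P.space Y X) : P.d Y X (P.d Y X m) = 0 := by
  have h := P.rel X X Y Y .nil m .nil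
  have z₁ := fun m v => (P.multilinear.left X X X X Y Y .nil .nil m v).map_zero
  have z₂ := fun w m => (P.multilinear.right X X Y Y Y Y w m .nil .nil).map_zero
  simp only [Word.append] at z₁ z₂
  simp only [BiOp.insL, BiOp.insR, BiOp.comp, Op.inserts, Word.splits, A.nil, B.nil, Word.append,
    Quiv.kos, Word.map, List.map_cons, List.map_nil, List.flatMap_cons, List.flatMap_nil,
    List.append_nil, List.sum_cons, List.sum_nil, add_zero, z₁, z₂, zero_add] at h
  exact h

theorem pullμ_nil (X : ObA) (Y : ObB) (m : P.space Y X) :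
    P.pullμ F G X X Y Y .nil m .nil = P.d Y X m := by
  simp [pullμ, BiOp.pull, Op.bar, Word.parts, Word.map, d]

theorem pullμ_single_left {X X' : ObA} {Y : ObB} (x : A.coh X X') (m : P.space Y X) :
    P.pullμ F G X X' Y Y (.single x) m .nil = P.mL (F X X' (.single x)) m := by
  simp [pullμ, BiOp.pull, Op.bar, Word.parts, Word.map, mL, Word.single, Word.consBlock]

theorem pullμ_single_right {X : ObA} {Y Y' : ObB} (m : P.space Y X) (y : B.coh Y' Y) :
    P.pullμ F G X X Y Y' .nil m (.single y) = P.mR m (G Y' Y (.single y)) := by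
  simp [pullμ, BiOp.pull, Op.bar, Word.parts, Word.map, mR, Word.single, Word.consBlock]

/-- The linear part of the induced equivariant structure is the map which purity is about. -/
theorem pullEquivariant_nil (c : BiOp A.hom B.hom P.space P.space) (X : ObA) (Y : ObB)
    (m : P.space Y X) : P.pullEquivariant F T G S c X X Y Y .nil m .nil
      = c X X Y Y .nil m .nil - P.lact (T X X .nil) m + P.ract m (S Y Y .nil) := by
  have h : (P.space Y X).sgn (-1) m = (P.space Y X).sgn 1 m := by
    rw [GrVect.sgn, GrVect.sgn]
    congr 2
    funext n
    rw [neg_one_mul, one_mul, zpow_neg, ← inv_zpow]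
    norm_num
  simp [pullEquivariant, BiOp.pull, BiOp.pullInsL, BiOp.pullInsR, Op.insertsAlong, Op.bar,
    Word.parts, Word.map, Word.splits, Word.append, Quiv.kos, lact, ract, mL, mR, Word.single, h]

theorem mL_zero {X X' : ObA} {Y : ObB} (x : A.hom X X') : P.mL x (0 : P.space Y X) = 0 :=
  (P.multilinear.mid _ _ _ _ _ _).map_zero

theorem zero_mL {X X' : ObA} {Y : ObB} (m : P.space Y X) : P.mL (0 : A.hom X X') m = 0 :=
  (P.multilinear.left X X X' X' Y Y .nil .nil m .nil).map_zero

theorem mR_zero {X : ObA} {Y Y' : ObB} (m : P.space Y X) : P.mR m (0 : B.hom Y' Y) = 0 :=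
  (P.multilinear.right X X Y Y' Y Y' .nil m .nil .nil).map_zero

theorem zero_mR {X : ObA} {Y Y' : ObB} (y : B.hom Y' Y) : P.mR (0 : P.space Y X) y = 0 :=
  (P.multilinear.mid _ _ _ _ _ _).map_zero

/-- The cohomology bimodule consists of the operations with one input that are induced by those
of the pullback. -/
theorem cohμ_eq (hF : A.IsFormalityEquivalence F) (hG : B.IsFormalityEquivalence G)
    {C : ∀ Y X, GrVect.Contraction (P.coh Y X) (P.space Y X) (P.d Y X)}
    (rep : ∀ Y X (z : P.coh Y X), GrVect.Represents (d := P.d Y X) ((C Y X).i z) z)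
    (proj : ∀ Y X m (hm : P.d Y X m = 0), (C Y X).p m
      = (Submodule.Quotient.mk ⟨m, LinearMap.mem_ker.2 hm⟩ : GrVect.Coh (P.space Y X) (P.d Y X))) :
    P.cohμ = smulLength (fun n => if n = 1 then 1 else 0) (comp 1 (linear fun Y X => (C Y X).p)
      (comp 0 (P.pullμ F G) (linear fun Y X => (C Y X).i))) := by
  have ml := P.pullμ_multilinear hF.functor hG.functor
  funext X X' Y Y' w z v
  rw [smulLength, linear_comp, comp_linear _ ml, kos_zero]
  cases w with
  | nil =>
    cases v with
    | nil => simp [cohμ]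
    | cons y v =>
      cases v with
      | cons y' v => simp [cohμ]
      | nil =>
        obtain ⟨hz, ez⟩ := rep _ _ z
        obtain ⟨hy, ey⟩ := hG.represents _ _ y
        have h := P.leibnizR ((C _ _).i z) (G _ _ (.single y))
        rw [hy, hz, mR_zero, zero_mR, add_zero, add_zero] at h
        change P.cohR z y = (1 : k) • (C Y' X).p (P.pullμ F G X X Y Y' .nil _ (.single y))
        rw [one_smul, pullμ_single_right, proj _ _ _ h]
        conv_lhs => rw [← ez, ← ey]
        rfl
  | cons x w =>
    cases w with
    | cons x' w =>
      have : w.length + 1 + 1 + v.length ≠ 1 := by omega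
      simp [cohμ, this]
    | nil =>
      cases v with
      | cons y v => simp [cohμ]
      | nil =>
        obtain ⟨hz, ez⟩ := rep _ _ z
        obtain ⟨hx, ex⟩ := hF.represents _ _ x
        have h := P.leibnizL (F _ _ (.single x)) ((C _ _).i z)
        rw [hx, hz, mL_zero, zero_mL, add_zero, add_zero] at h
        change P.cohL x z = (1 : k) • (C Y X').p (P.pullμ F G X X' Y Y (.single x) _ .nil)
        rw [one_smul, pullμ_single_left, proj _ _ _ h]
        conv_lhs => rw [← ez, ← ex]
        rfl

/-- Formality of the pullback of `P` to cohomology along equivariant formality equivalences. -/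
theorem exists_formality [CharZero k] {bA : Op A.hom A.hom} {bB : Op B.hom B.hom}
    {cA : ∀ X, A.hom X X} {cB : ∀ Y, B.hom Y Y} {c : BiOp A.hom B.hom P.space P.space}
    (hF : A.IsFormalityEquivalence F) (hG : B.IsFormalityEquivalence G)
    (hT : A.IsEquivariantHomotopy bA cA F T) (hS : B.IsEquivariantHomotopy bB cB G S)
    (hc : P.IsEquivariantStructure bA bB c) (hpure : P.IsPure cA cB c) :
    ∃ (ψ : BiOp A.coh B.coh P.coh P.space) (φ : BiOp A.coh B.coh P.space P.coh)
      (η : BiOp A.coh B.coh P.space P.space),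
      IsHom A.cohμ B.cohμ P.cohμ (P.pullμ F G) ψ ∧ IsHom A.cohμ B.cohμ (P.pullμ F G) P.cohμ φ ∧
      (∀ Y X (x : P.coh Y X), GrVect.Represents (d := P.d Y X) (ψ X X Y Y .nil x .nil) x) ∧
      comp 0 φ ψ = BiOp.id ∧ η.IsMultilinear ∧ η.HasDegree (-1) ∧
      comp 0 ψ φ - BiOp.id = diff A.cohμ B.cohμ (P.pullμ F G) (P.pullμ F G) (-1) η ∧
      transport A.coh.eulerField B.coh.eulerField φ (P.pullEquivariant F T G S c) ψ
        = BiOp.eulerField := by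
  have contr : ∀ Y X, ∃ C : GrVect.Contraction (P.coh Y X) (P.space Y X) (P.d Y X),
      (∀ z : P.coh Y X, GrVect.Represents (d := P.d Y X) (C.i z) z) ∧
      ∀ m (hm : P.d Y X m = 0), C.p m = (Submodule.Quotient.mk ⟨m, LinearMap.mem_ker.2 hm⟩ :
        GrVect.Coh (P.space Y X) (P.d Y X)) :=
    fun Y X => GrVect.exists_contraction (P.d_degree Y X) (P.d_d Y X)
  choose C rep proj using contr
  have hμ := P.pullμ_multilinear hF.functor hG.functor
  have hμd := P.pullμ_degree hF.functor hG.functor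
  have Lp := linear_multilinear (fun Y X => (C Y X).p) (H := A.coh) (K := B.coh)
  have Li := linear_multilinear (fun Y X => (C Y X).i) (H := A.coh) (K := B.coh)
  have Lid : (linear fun Y X => (C Y X).i : BiOp A.coh B.coh _ _).HasDegree 0 :=
    linear_hasDegree _ fun Y X n m hm => by simpa using (C Y X).i_degree n m hm
  have Lpd : (linear fun Y X => (C Y X).p : BiOp A.coh B.coh _ _).HasDegree 0 :=
    linear_hasDegree _ fun Y X n m hm => by simpa using (C Y X).p_degree n m hm
  have eκ := P.cohμ_eq hF hG rep proj
  have κm : P.cohμ.IsMultilinear := by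
    rw [eκ]; exact (Lp.comp (hμ.comp Li 0) 1).smulLength _
  have κd : P.cohμ.HasDegree 1 := by
    rw [eκ]; exact (Lpd.comp (hμd.comp Lid 0 (c := 1) (by ring)) 1 (c := 1) (by ring)).smulLength _
  obtain ⟨ψ, φ, η, hψ, hφ, ψ0, φψ, hη, ηd, ψφ, tr⟩ := BiOp.exists_formality A.isGradedProduct
    B.isGradedProduct P.d_d P.d_degree C hμ hμd (fun X Y m => P.pullμ_nil X Y m)
    (P.delta_pullμ_add hF.functor hG.functor)
    (P.pullEquivariant_multilinear hF.functor hG.functor hT hS hc)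
    (P.pullEquivariant_degree hF.functor hG.functor hT hS hc)
    (P.delta_pullEquivariant_add hF.functor hG.functor hT hS hc) κm κd
    (fun X X' Y Y' w z v h => by
      rw [eκ, smulLength, if_neg (by omega), zero_smul])
    (by
      rw [eκ, smulLength_smulLength]
      funext X X' Y Y' w z v
      rw [smulLength]
      split_ifs with h
      · rw [h]; simp
      · simp)
    (fun X X' Y Y' w z v h => by
      rw [eκ]
      simp only [Pi.sub_apply, smulLength]
      split_ifs with h₁
      · simp
      · cases w with
        | cons x w => simp at h h₁; omega
        | nil =>
          cases v with
          | cons y v => simp at h h₁; omega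
          | nil =>
            rw [linear_comp, comp_linear _ hμ, kos_zero, pullμ_nil, (C Y X).d_i, map_zero,
              zero_smul,
              sub_zero])
    (fun X Y x => by
      refine congrArg (fun f => f x) (GrVect.hom_ext (V := P.coh Y X)
        (f := (C Y X).p ∘ₗ (IsLinearMap.mk' _ ((P.pullEquivariant_multilinear hF.functor hG.functor
          hT hS hc).mid X X Y Y .nil .nil)) ∘ₗ (C Y X).i) (g := (P.coh Y X).euler)
        fun n x hx => ?_)
      simp only [LinearMap.comp_apply, IsLinearMap.mk'_apply]
      rw [pullEquivariant_nil, hT.nil, hS.nil, GrVect.euler, GrVect.scale_of_mem _ _ hx]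
      obtain ⟨y, hy⟩ := hpure Y X n _ ((C Y X).i_degree n x hx) ((C Y X).d_i x)
      have h₁ := congrArg (C Y X).p hy
      rwa [(C Y X).p_d, map_sub, map_smul, (C Y X).p_i, eq_comm, sub_eq_zero] at h₁)
  exact ⟨ψ, φ, η, hψ, hφ, fun Y X x => ψ0 X Y x ▸ rep Y X x, φψ, hη, ηd, ψφ, tr⟩

end AInfBimod

theorem mainTheorem7 {k : Type*} [Field k] [CharZero k] {ObA ObB : Type*}
    (A : AInfCat k ObA) (B : AInfCat k ObB) (P : AInfBimod A B)
    (bA : Op A.hom A.hom) (bB : Op B.hom B.hom)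
    (hbA : A.IsNCVectorField bA) (hbB : B.IsNCVectorField bB)
    (cA : ∀ X, A.hom X X) (cB : ∀ Y, B.hom Y Y)
    (hcA : A.IsPure bA cA) (hcB : B.IsPure bB cB)
    (c : BiOp A.hom B.hom P.space P.space)
    (hc : P.IsEquivariantStructure bA bB c) (hpure : P.IsPure cA cB c) :
    ∃ (F T : Op A.coh A.hom) (G S : Op B.coh B.hom)
      (ψ : BiOp A.coh B.coh P.coh P.space) (φ : BiOp A.coh B.coh P.space P.coh)
      (h : BiOp A.coh B.coh P.space P.space),
      A.IsFormalityEquivalence F ∧ B.IsFormalityEquivalence G ∧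
      A.IsEquivariantHomotopy bA cA F T ∧ B.IsEquivariantHomotopy bB cB G S ∧
      BiOp.IsHom A.cohμ B.cohμ P.cohμ (P.pullμ F G) ψ ∧
      BiOp.IsHom A.cohμ B.cohμ (P.pullμ F G) P.cohμ φ ∧
      (∀ Y X (x : P.coh Y X), GrVect.Represents (d := P.d Y X) (ψ X X Y Y .nil x .nil) x) ∧
      (∀ X X' Y Y' w m v, BiOp.comp 0 φ ψ X X' Y Y' w m v = BiOp.id X X' Y Y' w m v) ∧
      (h.IsMultilinear ∧ h.HasDegree (-1) ∧
        ∀ X X' Y Y' w m v, BiOp.comp 0 ψ φ X X' Y Y' w m v - BiOp.id X X' Y Y' w m v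
          = BiOp.diff A.cohμ B.cohμ (P.pullμ F G) (P.pullμ F G) (-1) h X X' Y Y' w m v) ∧
      (∀ X X' Y Y' w m v,
        BiOp.transport A.coh.eulerField B.coh.eulerField φ (P.pullEquivariant F T G S c) ψ
          X X' Y Y' w m v = BiOp.eulerField X X' Y Y' w m v) := by
  obtain ⟨F, T, hF, hT⟩ := A.exists_formalityEquivalence hbA hcA
  obtain ⟨G, S, hG, hS⟩ := B.exists_formalityEquivalence hbB hcB
  obtain ⟨ψ, φ, η, hψ, hφ, ψ₀, φψ, hη, ηd, ψφ, tr⟩ := P.exists_formality hF hG hT hS hc hpure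
  refine ⟨F, T, G, S, ψ, φ, η, hF, hG, hT, hS, hψ, hφ, ψ₀, fun X X' Y Y' w m v => ?_,
    ⟨hη, ηd, fun X X' Y Y' w m v => ?_⟩, fun X X' Y Y' w m v => ?_⟩
  · rw [φψ]
  · rw [← ψφ]
    rfl
  · rw [tr]
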